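/- Work over $\mathbb C$. Let $Y\subset\mathbb P^2\times\mathbb P^3$, with homogeneous coordinates $(\lambda_0:\lambda_1:\lambda_2)$ and $(x_2:x_3:x_4:x_5)$, be the hypersurface $$\lambda_1\lambda_2x_2^2+\lambda_0\lambda_2x_3^2+\lambda_0\lambda_1x_4^2+F(\lambda_0,\lambda_1,\lambda_2)x_5^2=0,$$ $$F=\lambda_0^2+\lambda_1^2+\lambda_2^2-2\lambda_0\lambda_1-2\lambda_0\lambda_2-2\lambda_1\lambda_2,$$ and let $Q\subset\mathbb P^2\times\mathbb P^5$, with homogeneous coordinates $(\lambda_0:\lambda_1:\lambda_2)$ and $(x_2:\dots:x_7)$, be defined by $$(\lambda_0-\lambda_1)x_5=\lambda_2x_7,\qquad \lambda_1x_4=\lambda_2x_6,$$ $$\lambda_1x_2^2+\lambda_0x_3^2+\lambda_0x_4x_6+(\lambda_2-2\lambda_0-2\lambda_1)x_5^2+\lambda_2x_7^2=0.$$ Let $$Y_1=\{\lambda_2=0,\ x_4=x_5=0\},\quad Y_2=\{\lambda_1=\lambda_2=0,\ x_5=0\},\quad Y_3=\{\lambda_0-\lambda_1=\lambda_2=0,\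 x_4=0\}$$ be the indicated closed subsets of $Y$, with their reduced structures. The formula $$(\lambda,\ x_2:\dots:x_5)\mapsto(\lambda,\ \lambda_2x_2:\lambda_2x_3:\lambda_2x_4:\lambda_2x_5:\lambda_1x_4:(\lambda_0-\lambda_1)x_5)$$ defines a morphism from $Y\setminus(Y_1\cup Y_2\cup Y_3)$ to $Q$, and this is a birational map $\varphi:Y\dashrightarrow Q$. Let $\psi:\tilde Y\to Y$ be the composition of the blowup of $Y$ along $Y_1$, the blowup of the result along the proper transform of $Y_2$, and the blowup of the result of that along the proper transform of $Y_3$. Then $\varphi$ extends to a morphism $\tilde\varphi:\tilde Y\to Q$ over $\mathbb C$, that is, $\tilde\varphi=\varphi\circ\psi$ on $\psi^{-1}(Y\setminus(Y_1\cup Y_2\cup Y_3))$, and both morphisms $\psi:\tilde Y\to Y$ and $\tilde\varphi:\tilde Y\to Q$ are birational and universally $\mathrm{CH}_0$-trivial. Here a proper morphism $f:X'\to X$ of schemes of finite type over a field $k$ is called universally $\mathrm{CH}_0$-trivial if for every field extension $K/k$ the push-forward $f_*:\mathrm{CH}_0(X'_K)\to\mathrm{CH}_0(X_K)$ on Chow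 groups of zero-cycles is an isomorphism. -/

import Mathlib

open CategoryTheory CategoryTheory.Limits AlgebraicGeometry TopologicalSpace

universe u

noncomputable section

/-! ### Zero-cycles, rational equivalence and the Chow group of zero-cycles -/

namespace ZeroCycle

/-- The closed points of a scheme. -/
abbrev ClosedPt (X : Scheme.{u}) : Type u := {x : X // IsClosed ({x} : Set X)}

/-- The group of zero-cycles: the free abelian group on the closed points. -/
abbrev Z0 (X : Scheme.{u}) : Type u := ClosedPt X →₀ ℤ

/-- The image of a closed point under a proper morphism is a closed point. -/
def mapPt {X Y : Scheme.{u}} (f : X ⟶ Y) [IsProper f] (x : ClosedPt X) : ClosedPt Y :=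
  ⟨f x.1, by simpa using f.isClosedMap _ x.2⟩

/-- Push-forward of zero-cycles along a proper morphism: `[x] ↦ [κ(x) : κ(f x)] [f x]`. -/
def push {X Y : Scheme.{u}} (f : X ⟶ Y) [IsProper f] : Z0 X →+ Z0 Y :=
  Finsupp.liftAddHom fun x =>
    (f.residueDegree x.1 : ℤ) • Finsupp.singleAddHom (mapPt f x)

/-- A scheme is a normal integral curve: it is integral, normal, locally noetherian and
of dimension one. -/
structure IsNormalCurve (C : Scheme.{u}) : Prop where
  integral : IsIntegral C
  noetherian : IsLocallyNoetherian C
  normal : ∀ x : C, IsIntegrallyClosed (C.presheaf.stalk x)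
  dim : topologicalKrullDim C = 1

/-- `D` is the divisor of the rational function `g` on the curve `C`. -/
def IsDivisorOf (C : Scheme.{u}) [IsIntegral C] [IsLocallyNoetherian C] (D : Z0 C)
    (g : C.functionField) : Prop :=
  ∀ x : ClosedPt C, D x = Scheme.ord g x.1

/-- The zero-cycles `π_* (div g)`, where `π : C ⟶ X` is a proper morphism from a normal integral
curve and `g` is a nonzero rational function on `C`. -/
def principal (X : Scheme.{u}) : Set (Z0 X) :=
  {z | ∃ (C : Scheme.{u}) (hC : IsNormalCurve C) (π : C ⟶ X) (_ : IsProper π)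
      (g : haveI := hC.integral; C.functionField) (D : Z0 C),
      g ≠ 0 ∧ (haveI := hC.integral; haveI := hC.noetherian; IsDivisorOf C D g) ∧
      z = push π D}

/-- The subgroup of zero-cycles that are rationally equivalent to zero. -/
def rat (X : Scheme.{u}) : AddSubgroup (Z0 X) := AddSubgroup.closure (principal X)

/-- The Chow group of zero-cycles of a scheme of finite type over a field. -/
abbrev CH0 (X : Scheme.{u}) : Type u := Z0 X ⧸ rat X

theorem residueDegree_comp {X Y Z : Scheme.{u}} (f : X ⟶ Y) (g : Y ⟶ Z) (x : X) :
    (f ≫ g).residueDegree x = g.residueDegree (f x) * f.residueDegree x := by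
  let := (f.residueFieldMap x).hom.toAlgebra
  let := (g.residueFieldMap (f x)).hom.toAlgebra
  let : Algebra (Z.residueField (g (f x))) (X.residueField x) :=
    ((f ≫ g).residueFieldMap x).hom.toAlgebra
  have : IsScalarTower (Z.residueField (g (f x))) (Y.residueField (f x)) (X.residueField x) := by
    refine IsScalarTower.of_algebraMap_eq' ?_
    change ((f ≫ g).residueFieldMap x).hom = _
    rw [Scheme.residueFieldMap_comp]
    rfl
  exact (Module.finrank_mul_finrank (Z.residueField (g (f x))) (Y.residueField (f x))
    (X.residueField x)).symm

theorem push_comp {X Y Z : Scheme.{u}} (f : X ⟶ Y) (g : Y ⟶ Z) [IsProper f] [IsProper g]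
    (z : Z0 X) : push (f ≫ g) z = push g (push f z) := by
  suffices h : push (f ≫ g) = (push g).comp (push f) from DFunLike.congr_fun h z
  refine Finsupp.addHom_ext fun x n => ?_
  have hp : mapPt (f ≫ g) x = mapPt g (mapPt f x) := Subtype.ext (by simp [mapPt])
  simp only [push, Finsupp.liftAddHom_apply_single, AddMonoidHom.comp_apply,
    AddMonoidHom.smul_apply, Finsupp.singleAddHom_apply, Finsupp.smul_single, smul_eq_mul,
    residueDegree_comp, hp, Nat.cast_mul]
  congr 1
  simp only [mapPt]
  ring

theorem rat_le_comap {X Y : Scheme.{u}} (f : X ⟶ Y) [IsProper f] :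
    rat X ≤ (rat Y).comap (push f) := by
  refine (AddSubgroup.closure_le _).2 ?_
  rintro _ ⟨C, hC, π, hπ, g, D, hg, hD, rfl⟩
  refine AddSubgroup.subset_closure ⟨C, hC, π ≫ f, inferInstance, g, D, hg, hD, ?_⟩
  exact (push_comp π f D).symm

/-- Proper push-forward `f_* : CH₀(X) → CH₀(Y)`. -/
def CH0.push {X Y : Scheme.{u}} (f : X ⟶ Y) [IsProper f] : CH0 X →+ CH0 Y :=
  QuotientAddGroup.map (rat X) (rat Y) (ZeroCycle.push f) (rat_le_comap f)

/-- The morphism `Spec K ⟶ Spec k` of a field extension `K / k`. -/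
abbrev specExt (k K : Type u) [Field k] [Field K] [Algebra k K] :
    Spec (CommRingCat.of K) ⟶ Spec (CommRingCat.of k) :=
  Spec.map (CommRingCat.ofHom (algebraMap k K))

/-- The base change `f_K : X_K ⟶ Y_K` of a morphism `f : X ⟶ Y` of `k`-schemes, where `Y` is a
`k`-scheme through `s` and `X` through `f ≫ s`. -/
def baseChange {k : Type u} [Field k] {X Y : Scheme.{u}} (s : Y ⟶ Spec (CommRingCat.of k))
    (f : X ⟶ Y) (K : Type u) [Field K] [Algebra k K] :
    pullback (f ≫ s) (specExt k K) ⟶ pullback s (specExt k K) :=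
  pullback.lift (pullback.fst (f ≫ s) (specExt k K) ≫ f) (pullback.snd (f ≫ s) (specExt k K))
    (by simp [pullback.condition])

instance {k : Type u} [Field k] {X Y : Scheme.{u}} (s : Y ⟶ Spec (CommRingCat.of k))
    (f : X ⟶ Y) [hf : IsProper f] (K : Type u) [Field K] [Algebra k K] :
    IsProper (baseChange s f K) :=
  MorphismProperty.pullbackLift_fst_snd (P := @IsProper) (specExt k K) rfl hf

/-- A morphism `f : X ⟶ Y` of `k`-schemes is universally `CH₀`-trivial: it is proper, and for
every field extension `K / k` the push-forward `CH₀(X_K) → CH₀(Y_K)` is an isomorphism. -/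
def IsUniversallyCH0Trivial {k : Type u} [Field k] {X Y : Scheme.{u}}
    (s : Y ⟶ Spec (CommRingCat.of k)) (f : X ⟶ Y) : Prop :=
  ∃ _ : IsProper f, ∀ (K : Type u) [Field K] [Algebra k K],
    Function.Bijective (CH0.push (baseChange s f K))

end ZeroCycle

/-! ### Birational maps and blowups -/

namespace Blow

/-- A rational map is birational if it is represented by an isomorphism between dense open
subschemes. -/
def IsBirational {X Y : Scheme.{u}} (f : X.RationalMap Y) : Prop :=
  ∃ e : X.PartialIso Y, e.toRationalMap = f

/-- The ideal sheaf of an effective Cartier divisor: it is locally generated by a single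
nonzerodivisor. -/
def IsEffectiveCartier {X : Scheme.{u}} (I : X.IdealSheafData) : Prop :=
  ∀ x : X, ∃ U : X.affineOpens, x ∈ U.1 ∧
    ∃ f ∈ nonZeroDivisors Γ(X, U), I.ideal U = Ideal.span {f}

/-- `b : B ⟶ X` is the blowup of `X` along the closed subscheme with ideal sheaf `I`: the inverse
image of `I` is the ideal of an effective Cartier divisor, and `b` is universal with this
property. -/
structure IsBlowup {B X : Scheme.{u}} (b : B ⟶ X) (I : X.IdealSheafData) : Prop where
  cartier : IsEffectiveCartier (I.comap b)
  universal : ∀ (T : Scheme.{u}) (g : T ⟶ X), IsEffectiveCartier (I.comap g) →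
    ∃! h : T ⟶ B, h ≫ b = g

/-- `b` is the blowup along a closed subset with its reduced structure. -/
def IsBlowupAlong {B X : Scheme.{u}} (b : B ⟶ X) (Z : Closeds X) : Prop :=
  IsBlowup b (Scheme.IdealSheafData.vanishingIdeal Z)

/-- The proper transform of `W` under a morphism `b` that is an isomorphism outside `Z`:
the closure of the preimage of `W \ Z`. -/
def properTransform {B X : Scheme.{u}} (b : B ⟶ X) (Z W : Closeds X) : Closeds B :=
  ⟨closure (b ⁻¹' ((W : Set X) \ Z)), isClosed_closure⟩

end Blow

/-! ### Subschemes of `ℙᵐ × ℙⁿ` over the complex numbers -/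

namespace BiProj

attribute [local instance] MvPolynomial.gradedAlgebra

/-- The standard grading of `ℂ[X₀, …, Xₙ]`. -/
abbrev gr (n : ℕ) : ℕ → Submodule ℂ (MvPolynomial (Fin (n + 1)) ℂ) :=
  MvPolynomial.homogeneousSubmodule (Fin (n + 1)) ℂ

/-- Complex projective space. -/
abbrev PP (n : ℕ) : Scheme.{0} := Proj (gr n)

/-- The structure morphism of complex projective space. -/
def PP.str (n : ℕ) : PP n ⟶ Spec (CommRingCat.of ℂ) :=
  Proj.toSpecZero (gr n) ≫ Spec.map (CommRingCat.ofHom (algebraMap ℂ (gr n 0)))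

/-- The product `ℙᵐ × ℙⁿ` over `ℂ`. -/
abbrev PPP (m n : ℕ) : Scheme.{0} := pullback (PP.str m) (PP.str n)

/-- The structure morphism of `ℙᵐ × ℙⁿ`. -/
def PPP.str (m n : ℕ) : PPP m n ⟶ Spec (CommRingCat.of ℂ) :=
  pullback.fst (PP.str m) (PP.str n) ≫ PP.str m

/-- The ring homomorphism `ℂ[X₀, …, Xₙ] → Γ(Spec A)` with `Xᵢ ↦ vᵢ`. -/
def evalHom {n : ℕ} {A : Type} [CommRing A] [Algebra ℂ A] (v : Fin (n + 1) → A) :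
    MvPolynomial (Fin (n + 1)) ℂ →+* Γ(Spec (CommRingCat.of A), ⊤) :=
  (Scheme.ΓSpecIso (CommRingCat.of A)).inv.hom.comp (MvPolynomial.aeval v).toRingHom

theorem map_irrelevant {n : ℕ} {A : Type} [CommRing A] [Algebra ℂ A] (v : Fin (n + 1) → A)
    (hv : Ideal.span (Set.range v) = ⊤) :
    (HomogeneousIdeal.irrelevant (gr n)).toIdeal.map (evalHom v) = ⊤ := by
  have h : Ideal.span (Set.range v) ≤
      (HomogeneousIdeal.irrelevant (gr n)).toIdeal.map
        (MvPolynomial.aeval (R := ℂ) v).toRingHom := by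
    rw [Ideal.span_le]
    rintro _ ⟨i, rfl⟩
    have hi : (MvPolynomial.X i : MvPolynomial (Fin (n + 1)) ℂ) ∈
        (HomogeneousIdeal.irrelevant (gr n)).toIdeal := by
      have hX : (MvPolynomial.X i : MvPolynomial (Fin (n + 1)) ℂ) ∈ gr n 1 :=
        MvPolynomial.isHomogeneous_X ℂ i
      change _ ∈ HomogeneousIdeal.irrelevant (gr n)
      rw [HomogeneousIdeal.mem_irrelevant_iff]
      exact DirectSum.decompose_of_mem_ne (gr n) hX one_ne_zero
    simpa using Ideal.mem_map_of_mem (MvPolynomial.aeval (R := ℂ) v).toRingHom hi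
  rw [hv, top_le_iff] at h
  rw [evalHom, ← Ideal.map_map, h, Ideal.map_top]

/-- The `A`-valued point `[v₀ : … : vₙ]` of `ℙⁿ`, for `vᵢ ∈ A` generating the unit ideal. -/
def pt {n : ℕ} {A : Type} [CommRing A] [Algebra ℂ A] (v : Fin (n + 1) → A)
    (hv : Ideal.span (Set.range v) = ⊤) : Spec (CommRingCat.of A) ⟶ PP n :=
  Proj.fromOfGlobalSections (gr n) (evalHom v) (map_irrelevant v hv)

theorem pt_str {n : ℕ} {A : Type} [CommRing A] [Algebra ℂ A] (v : Fin (n + 1) → A)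
    (hv : Ideal.span (Set.range v) = ⊤) :
    pt v hv ≫ PP.str n = Spec.map (CommRingCat.ofHom (algebraMap ℂ A)) := by
  rw [pt, PP.str, Proj.fromOfGlobalSections_toSpecZero_assoc, ← Spec.map_comp,
    ← CommRingCat.ofHom_comp]
  have h : ((evalHom v).comp (algebraMap (gr n 0) (MvPolynomial (Fin (n + 1)) ℂ))).comp
      (algebraMap ℂ (gr n 0)) =
      (Scheme.ΓSpecIso (CommRingCat.of A)).inv.hom.comp (algebraMap ℂ A) := by
    ext c
    simp only [evalHom, RingHom.comp_apply]
    congr 1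
    exact (MvPolynomial.aeval (R := ℂ) v).commutes c
  rw [h, CommRingCat.ofHom_comp, Spec.map_comp]
  simp

/-- The `A`-valued point `([l₀ : … : lₘ], [x₀ : … : xₙ])` of `ℙᵐ × ℙⁿ`. -/
def bipt {m n : ℕ} {A : Type} [CommRing A] [Algebra ℂ A]
    (l : Fin (m + 1) → A) (x : Fin (n + 1) → A)
    (hl : Ideal.span (Set.range l) = ⊤) (hx : Ideal.span (Set.range x) = ⊤) :
    Spec (CommRingCat.of A) ⟶ PPP m n :=
  pullback.lift (pt l hl) (pt x hx) (by rw [pt_str, pt_str])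

/-- Polynomials in the homogeneous coordinates of `ℙᵐ × ℙⁿ`. -/
abbrev BiPoly (m n : ℕ) : Type := MvPolynomial (Fin (m + 1) ⊕ Fin (n + 1)) ℂ

/-- The ideal of the equations `S = 0` together with `lᵢ = 1` and `xⱼ = 1`. -/
def chartIdeal {m n : ℕ} (S : Set (BiPoly m n)) (i : Fin (m + 1)) (j : Fin (n + 1)) :
    Ideal (BiPoly m n) :=
  Ideal.span (S ∪ {MvPolynomial.X (Sum.inl i) - 1, MvPolynomial.X (Sum.inr j) - 1})

theorem span_eq_top_of_one {n : ℕ} {A : Type} [CommRing A] (v : Fin (n + 1) → A)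
    (i : Fin (n + 1)) (h : v i = 1) : Ideal.span (Set.range v) = ⊤ :=
  (Ideal.eq_top_iff_one _).2 (h ▸ Ideal.subset_span ⟨i, rfl⟩)

/-- The affine scheme `S = 0` in the chart `lᵢ = 1`, `xⱼ = 1`, mapped to `ℙᵐ × ℙⁿ`. -/
def chart {m n : ℕ} (S : Set (BiPoly m n)) (i : Fin (m + 1)) (j : Fin (n + 1)) :
    Spec (CommRingCat.of (BiPoly m n ⧸ chartIdeal S i j)) ⟶ PPP m n :=
  bipt (fun a => Ideal.Quotient.mk (chartIdeal S i j) (MvPolynomial.X (Sum.inl a)))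
    (fun b => Ideal.Quotient.mk (chartIdeal S i j) (MvPolynomial.X (Sum.inr b)))
    (span_eq_top_of_one _ i ((Ideal.Quotient.mk_eq_mk_iff_sub_mem _ _).2
      (Ideal.subset_span (by simp))))
    (span_eq_top_of_one _ j ((Ideal.Quotient.mk_eq_mk_iff_sub_mem _ _).2
      (Ideal.subset_span (by simp))))

/-- The ideal sheaf of the closed subscheme of `ℙᵐ × ℙⁿ` cut out by a set `S` of bihomogeneous
polynomials: a function belongs to it if it vanishes on `S = 0` in each standard chart. On
the chart `lᵢ = 1`, `xⱼ = 1` it is generated by the dehomogenizations of the elements of `S`. -/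
def zeroIdeal {m n : ℕ} (S : Set (BiPoly m n)) : (PPP m n).IdealSheafData :=
  ⨅ (i : Fin (m + 1)) (j : Fin (n + 1)), (chart S i j).ker

/-- The closed subscheme of `ℙᵐ × ℙⁿ` cut out by a set of bihomogeneous polynomials. -/
abbrev zeroScheme {m n : ℕ} (S : Set (BiPoly m n)) : Scheme.{0} := (zeroIdeal S).subscheme

/-- The inclusion of a closed subscheme in `ℙᵐ × ℙⁿ`. -/
abbrev incl {m n : ℕ} (S : Set (BiPoly m n)) : zeroScheme S ⟶ PPP m n :=
  (zeroIdeal S).subschemeι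

/-- The structure morphism of a closed subscheme of `ℙᵐ × ℙⁿ`. -/
def str {m n : ℕ} (S : Set (BiPoly m n)) : zeroScheme S ⟶ Spec (CommRingCat.of ℂ) :=
  incl S ≫ PPP.str m n

/-- The closed subset of `zeroScheme S` where a form in the coordinates of `ℙᵐ` vanishes. -/
def vanL {m n : ℕ} (S : Set (BiPoly m n)) (f : MvPolynomial (Fin (m + 1)) ℂ) :
    Closeds (zeroScheme S) :=
  ((incl S ≫ pullback.fst (PP.str m) (PP.str n)) ⁻¹ᵁ Proj.basicOpen (gr m) f).compl

/-- The closed subset of `zeroScheme S` where a form in the coordinates of `ℙⁿ` vanishes. -/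
def vanX {m n : ℕ} (S : Set (BiPoly m n)) (f : MvPolynomial (Fin (n + 1)) ℂ) :
    Closeds (zeroScheme S) :=
  ((incl S ≫ pullback.snd (PP.str m) (PP.str n)) ⁻¹ᵁ Proj.basicOpen (gr n) f).compl

end BiProj

/-! ### The two fourfolds and the map between them

The coordinates of `ℙ²` are `λ₀, λ₁, λ₂`; those of `ℙ³` are `x₂, …, x₅` and those of `ℙ⁵` are
`x₂, …, x₇`, so that `x₂` has index `0`. -/

namespace Example

open BiProj MvPolynomial

/-- The coordinate `λᵢ`. -/
abbrev lam {n : ℕ} (i : Fin 3) : BiPoly 2 n := X (Sum.inl i)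

/-- The coordinate `x_{j+2}`. -/
abbrev xx {n : ℕ} (j : Fin (n + 1)) : BiPoly 2 n := X (Sum.inr j)

/-- `F(λ₀, λ₁, λ₂)`. -/
def F : BiPoly 2 3 :=
  lam 0 ^ 2 + lam 1 ^ 2 + lam 2 ^ 2 - 2 * lam 0 * lam 1 - 2 * lam 0 * lam 2 - 2 * lam 1 * lam 2

/-- The equation of `Y` in `ℙ² × ℙ³`. -/
def eqY : Set (BiPoly 2 3) :=
  {lam 1 * lam 2 * xx 0 ^ 2 + lam 0 * lam 2 * xx 1 ^ 2 + lam 0 * lam 1 * xx 2 ^ 2 + F * xx 3 ^ 2}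

/-- The equations of `Q` in `ℙ² × ℙ⁵`. -/
def eqQ : Set (BiPoly 2 5) :=
  {(lam 0 - lam 1) * xx 3 - lam 2 * xx 5,
   lam 1 * xx 2 - lam 2 * xx 4,
   lam 1 * xx 0 ^ 2 + lam 0 * xx 1 ^ 2 + lam 0 * xx 2 * xx 4 +
     (lam 2 - 2 * lam 0 - 2 * lam 1) * xx 3 ^ 2 + lam 2 * xx 5 ^ 2}

/-- The hypersurface `Y` of bidegree `(2, 2)` in `ℙ² × ℙ³`. -/
abbrev Y : Scheme.{0} := zeroScheme eqY

/-- The quadric bundle `Q` in `ℙ² × ℙ⁵`. -/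
abbrev Q : Scheme.{0} := zeroScheme eqQ

/-- `λ₂ = 0`, `x₄ = x₅ = 0`. -/
def Y₁ : Closeds Y := vanL eqY (X 2) ⊓ vanX eqY (X 2) ⊓ vanX eqY (X 3)

/-- `λ₁ = λ₂ = 0`, `x₅ = 0`. -/
def Y₂ : Closeds Y := vanL eqY (X 1) ⊓ vanL eqY (X 2) ⊓ vanX eqY (X 3)

/-- `λ₀ - λ₁ = 0`, `λ₂ = 0`, `x₄ = 0`. -/
def Y₃ : Closeds Y := vanL eqY (X 0 - X 1) ⊓ vanL eqY (X 2) ⊓ vanX eqY (X 2)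

/-- The coordinates `(λ₂x₂, λ₂x₃, λ₂x₄, λ₂x₅, λ₁x₄, (λ₀ - λ₁)x₅)`. -/
def phiCoord {A : Type} [CommRing A] (l : Fin 3 → A) (x : Fin 4 → A) : Fin 6 → A :=
  ![l 2 * x 0, l 2 * x 1, l 2 * x 2, l 2 * x 3, l 1 * x 2, (l 0 - l 1) * x 3]

/-- `φ` is the rational map `Y ⇢ Q` given by
`(λ, x) ↦ (λ, (λ₂x₂ : λ₂x₃ : λ₂x₄ : λ₂x₅ : λ₁x₄ : (λ₀ - λ₁)x₅))`, with domain the open set where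
the six coordinates do not vanish simultaneously, the complement of `Y₁ ∪ Y₂ ∪ Y₃`. The formula is
required for points with values in all `ℂ`-algebras. -/
def IsPhi (φ : Y.PartialMap Q) : Prop :=
  φ.domain = (Y₁ ⊔ Y₂ ⊔ Y₃).compl ∧
  ∀ (A : Type) [CommRing A] [Algebra ℂ A] (l : Fin 3 → A) (x : Fin 4 → A)
    (hl : Ideal.span (Set.range l) = ⊤) (hx : Ideal.span (Set.range x) = ⊤)
    (p : Spec (CommRingCat.of A) ⟶ φ.domain.toScheme),
    p ≫ φ.domain.ι ≫ incl eqY = bipt (m := 2) (n := 3) l x hl hx →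
    ∃ hy : Ideal.span (Set.range (phiCoord l x)) = ⊤,
      p ≫ φ.hom ≫ incl eqQ = bipt (m := 2) (n := 5) l (phiCoord l x) hl hy

end Example

end

noncomputable section

/-! ### Gluing morphisms -/

/-- Two morphisms agree if they agree in a neighbourhood of each point. -/
theorem hom_ext_of_locally {T Z : Scheme.{u}} {f g : T ⟶ Z}
    (h : ∀ t : T, ∃ U : T.Opens, t ∈ U ∧ U.ι ≫ f = U.ι ≫ g) : f = g := by
  choose U hU e using h
  refine Scheme.Cover.hom_ext (T.openCoverOfIsOpenCover U ?_) _ _ e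
  rw [IsOpenCover, eq_top_iff]
  exact fun t _ => Opens.mem_iSup.2 ⟨t, hU t⟩

/-- Locally defined morphisms that agree on overlaps glue. -/
theorem exists_glue {T Z : Scheme.{u}} (P : ∀ U : T.Opens, (U.toScheme ⟶ Z) → Prop)
    (hex : ∀ t : T, ∃ U : T.Opens, t ∈ U ∧ ∃ h, P U h)
    (huniq : ∀ U V h k, P U h → P V k →
      T.homOfLE (inf_le_left : U ⊓ V ≤ U) ≫ h = T.homOfLE (inf_le_right : U ⊓ V ≤ V) ≫ k) :
    ∃ h : T ⟶ Z, ∀ U k, P U k → U.ι ≫ h = k := by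
  choose U hU f hf using hex
  have hc : IsOpenCover U := by
    rw [IsOpenCover, eq_top_iff]
    exact fun t _ => Opens.mem_iSup.2 ⟨t, hU t⟩
  let 𝒰 := T.openCoverOfIsOpenCover U hc
  have key : ∀ x y : T, pullback.fst (U x).ι (U y).ι ≫ f x = pullback.snd (U x).ι (U y).ι ≫ f y := by
    intro x y
    rw [← cancel_epi (isPullback_opens_inf (U x) (U y)).isoPullback.hom]
    simpa using huniq _ _ _ _ (hf x) (hf y)
  let h : T ⟶ Z := Scheme.Cover.glueMorphisms 𝒰 f key
  have hh : ∀ t : T, (U t).ι ≫ h = f t := Scheme.Cover.ι_glueMorphisms 𝒰 f key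
  refine ⟨h, fun V k hk => hom_ext_of_locally fun v => ?_⟩
  refine ⟨V.ι ⁻¹ᵁ U v.1, hU v.1, ?_⟩
  have e := huniq _ _ _ _ hk (hf v.1)
  rw [← hh, Scheme.homOfLE_ι_assoc] at e
  have : (V.ι ⁻¹ᵁ U v.1).ι ≫ V.ι = (V.ι ⁻¹ᵁ U v.1).ι ≫ V.ι := rfl
  let j : (V.ι ⁻¹ᵁ U v.1).toScheme ⟶ (V ⊓ U v.1 : T.Opens) :=
    IsOpenImmersion.lift (V ⊓ U v.1).ι ((V.ι ⁻¹ᵁ U v.1).ι ≫ V.ι) (by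
      rintro _ ⟨w, rfl⟩
      simp only [Scheme.Opens.range_ι, Scheme.Hom.comp_apply, SetLike.mem_coe]
      exact ⟨((V.ι ⁻¹ᵁ U v.1).ι w).2, w.2⟩)
  have hj : j ≫ (V ⊓ U v.1).ι = (V.ι ⁻¹ᵁ U v.1).ι ≫ V.ι := IsOpenImmersion.lift_fac _ _ _
  have hj' : j ≫ T.homOfLE inf_le_left = (V.ι ⁻¹ᵁ U v.1).ι := by
    rw [← cancel_mono V.ι, Category.assoc, Scheme.homOfLE_ι, hj]
  rw [← Category.assoc, ← hj, Category.assoc, ← e, ← hj', Category.assoc]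

/-! ### Extending morphisms from the generic point of a normal curve -/

namespace ZeroCycle

theorem IsNormalCurve.coheight_le {C : Scheme.{u}} (hC : IsNormalCurve C) (c : C) :
    Order.coheight c ≤ 1 := by
  have h1 : Order.krullDim C = 1 := by
    rw [← hC.dim, topologicalKrullDim]
    exact (Order.krullDim_eq_of_orderIso irreducibleSetEquivPoints).symm
  have := Order.coheight_le_krullDim c
  rw [h1] at this
  exact_mod_cast this

theorem IsNormalCurve.valuationRing_stalk {C : Scheme.{u}} (hC : IsNormalCurve C) (c : C) :
    haveI := hC.integral
    ValuationRing (C.presheaf.stalk c) := by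
  have := hC.integral
  have := hC.noetherian
  have hk : Ring.KrullDimLE 1 (C.presheaf.stalk c) := krullDimLE_of_coheight_le (hC.coheight_le c)
  have hbot : (⊥ : Ideal (C.presheaf.stalk c)).IsPrime := Ideal.isPrime_bot
  rw [Ring.krullDimLE_one_iff_of_isPrime_bot] at hk
  have h := (tfae_of_isNoetherianRing_of_isLocalRing_of_isDomain (C.presheaf.stalk c)).out 3 1
  exact h.1 ⟨hC.normal c, fun P hP hp => IsLocalRing.eq_maximalIdeal (hk P hP hp)⟩

theorem exists_lift_of_valuationRing {X Y : Scheme.{u}} (f : X ⟶ Y) [hf : IsProper f]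
    {R K : CommRingCat.{u}} [IsDomain R] [ValuationRing R] (hK : IsField K) (φ : R ⟶ K)
    (hφ : @IsFractionRing R _ K _ φ.hom.toAlgebra) (i₁ : Spec K ⟶ X) (i₂ : Spec R ⟶ Y)
    (w : i₁ ≫ f = Spec.map φ ≫ i₂) :
    ∃ l : Spec R ⟶ X, Spec.map φ ≫ l = i₁ ∧ l ≫ f = i₂ := by
  rw [IsProper.eq_valuativeCriterion] at hf
  let _ := hK.toField
  let _ := φ.hom.toAlgebra
  obtain ⟨l, hl₁, hl₂⟩ := (hf.1.1.1.existence
    { R := R, K := K, i₁ := i₁, i₂ := i₂, commSq := ⟨w⟩ }).exists_lift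
  exact ⟨l, hl₁, hl₂⟩

/-- A lift of the generic point of a normal curve along a proper morphism extends to the curve. -/
theorem IsNormalCurve.exists_lift {C X Y : Scheme.{u}} (hC : IsNormalCurve C) (f : X ⟶ Y)
    [IsProper f] (π : C ⟶ Y)
    (g : haveI := hC.integral; Spec (C.functionField) ⟶ X)
    (hg : haveI := hC.integral; g ≫ f = C.fromSpecStalk (genericPoint C) ≫ π) :
    ∃ p : C ⟶ X, p ≫ f = π ∧
      (haveI := hC.integral; C.fromSpecStalk (genericPoint C) ≫ p = g) := by
  have := hC.integral
  have hη (U : C.Opens) (x : C) (hx : x ∈ U) : genericPoint C ∈ U :=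
    (genericPoint_specializes x).mem_open U.2 hx
  let P : ∀ U : C.Opens, (U.toScheme ⟶ X) → Prop := fun U h =>
    h ≫ f = U.ι ≫ π ∧ ∃ hU : genericPoint C ∈ U, U.fromSpecStalkOfMem _ hU ≫ h = g
  have hloc : ∀ c : C, ∃ U : C.Opens, c ∈ U ∧ ∃ h, P U h := by
    intro c
    have := hC.valuationRing_stalk c
    let sp := C.presheaf.stalkSpecializes (genericPoint_specializes c)
    have sq : g ≫ f = Spec.map sp ≫ C.fromSpecStalk c ≫ π := by
      rw [hg, ← Scheme.SpecMap_stalkSpecializes_fromSpecStalk (genericPoint_specializes c),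
        Category.assoc]
    obtain ⟨l, hl₁, hl₂⟩ := exists_lift_of_valuationRing f (Field.toIsField C.functionField) sp
      (inferInstanceAs (IsFractionRing (C.presheaf.stalk c) C.functionField)) g _ sq
    obtain ⟨U, hcU, h, h₁, h₂⟩ := spread_out_of_isGermInjective' π f l hl₂
    refine ⟨U, hcU, h, h₂, hη U c hcU, ?_⟩
    rw [← hl₁, h₁, ← Category.assoc]
    congr 1
    rw [← cancel_mono U.ι, Category.assoc]
    simp only [Scheme.Opens.fromSpecStalkOfMem_ι]
    exact (Scheme.SpecMap_stalkSpecializes_fromSpecStalk (genericPoint_specializes c)).symm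
  obtain ⟨p, hp⟩ := exists_glue P hloc (by
    rintro U V h k ⟨h₁, hU, h₂⟩ ⟨k₁, hV, k₂⟩
    have hUV : genericPoint C ∈ U ⊓ V := ⟨hU, hV⟩
    have : IsDominant ((U ⊓ V).fromSpecStalkOfMem _ hUV) := by
      constructor
      have : IsIntegral (U ⊓ V : C.Opens).toScheme := by
        have : Nonempty (U ⊓ V : C.Opens).toScheme := ⟨⟨_, hUV⟩⟩
        exact isIntegral_of_isOpenImmersion (U ⊓ V).ι
      have hgen : IsGenericPoint (⟨genericPoint C, hUV⟩ : (U ⊓ V : C.Opens).toScheme) ⊤ := by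
        rw [isGenericPoint_iff_specializes]
        intro y
        simp only [Set.top_eq_univ, Set.mem_univ, iff_true]
        exact Topology.IsInducing.subtypeVal.specializes_iff.1 (genericPoint_specializes _)
      have hmem : (⟨genericPoint C, hUV⟩ : (U ⊓ V : C.Opens).toScheme) ∈
          Set.range ((U ⊓ V).fromSpecStalkOfMem _ hUV) := by
        have e₀ : ((U ⊓ V).fromSpecStalkOfMem _ hUV ≫ (U ⊓ V).ι)
            (IsLocalRing.closedPoint (C.presheaf.stalk (genericPoint C))) = genericPoint C := by
          rw [Scheme.Opens.fromSpecStalkOfMem_ι]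
          exact Scheme.fromSpecStalk_closedPoint
        exact ⟨IsLocalRing.closedPoint _, Subtype.ext e₀⟩
      have h3 : Dense ({⟨genericPoint C, hUV⟩} : Set (U ⊓ V : C.Opens).toScheme) := by
        rw [dense_iff_closure_eq]; exact hgen
      exact h3.mono (Set.singleton_subset_iff.2 hmem)
    refine ext_of_isDominant_of_isSeparated f ?_ ((U ⊓ V).fromSpecStalkOfMem _ hUV) ?_
    · simp [h₁, k₁]
    · have e₁ : (U ⊓ V).fromSpecStalkOfMem _ hUV ≫ C.homOfLE inf_le_left =
          U.fromSpecStalkOfMem _ hU := by rw [← cancel_mono U.ι]; simp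
      have e₂ : (U ⊓ V).fromSpecStalkOfMem _ hUV ≫ C.homOfLE inf_le_right =
          V.fromSpecStalkOfMem _ hV := by rw [← cancel_mono V.ι]; simp
      rw [← Category.assoc, e₁, h₂, ← Category.assoc, e₂, k₂])
  refine ⟨p, hom_ext_of_locally fun c => ?_, ?_⟩
  · obtain ⟨U, hcU, h, hP⟩ := hloc c
    exact ⟨U, hcU, by rw [← Category.assoc, hp U h hP, hP.1]⟩
  · obtain ⟨U, hcU, h, hP⟩ := hloc (genericPoint C)
    obtain ⟨hU, e⟩ := hP.2
    rw [← Scheme.Opens.fromSpecStalkOfMem_ι U _ hU, Category.assoc, hp U h hP, e]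

end ZeroCycle

/-! ### Points of `Proj` with values in rings -/

namespace ProjPt

open HomogeneousLocalization

variable {σ A : Type u} [CommRing A] [SetLike σ A] [AddSubgroupClass σ A] (𝒜 : ℕ → σ)
  [GradedRing 𝒜]

/-- The homomorphism from the degree zero part of `A[1/r]` induced by a homomorphism that sends `r`
to a unit. -/
def awayEval {R : Type*} [CommRing R] (e : A →+* R) (r : A) (h : IsUnit (e r)) :
    Away 𝒜 r →+* R :=
  (IsLocalization.Away.lift (S := Localization.Away r) r h).comp
    (algebraMap (Away 𝒜 r) (Localization.Away r))

theorem awayEval_mk {R : Type*} [CommRing R] (e : A →+* R) (r : A) (h : IsUnit (e r)) {d : ℕ}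
    (hd : r ∈ 𝒜 d) (n : ℕ) (a : A) (ha : a ∈ 𝒜 (n • d)) :
    awayEval 𝒜 e r h (Away.mk 𝒜 hd n a ha) * e r ^ n = e a := by
  simp only [awayEval, RingHom.comp_apply, HomogeneousLocalization.algebraMap_apply, Away.val_mk]
  rw [Localization.mk_eq_mk', ← IsLocalization.Away.lift_eq (S := Localization.Away r) r h a,
    ← IsLocalization.Away.lift_eq (S := Localization.Away r) r h r, ← map_pow, ← map_mul]
  congr 1
  rw [← map_pow]
  exact IsLocalization.mk'_spec (Localization.Away r) a (⟨r ^ n, n, rfl⟩ : Submonoid.powers r)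

/-- Homomorphisms from the degree zero part of `A[1/r]` are determined by the images of the
fractions. -/
theorem away_hom_ext {R : Type*} [CommRing R] {r : A} {d : ℕ} (hd : r ∈ 𝒜 d) {φ ψ : Away 𝒜 r →+* R}
    (h : ∀ n a (ha : a ∈ 𝒜 (n • d)), φ (Away.mk 𝒜 hd n a ha) = ψ (Away.mk 𝒜 hd n a ha)) :
    φ = ψ := by
  ext x
  obtain ⟨n, a, ha, rfl⟩ := Away.mk_surjective 𝒜 hd x
  exact h n a ha

variable {R : Type u} [CommRing R] (e : A →+* R)

/-- The `R`-valued point of `Proj` given by a homomorphism `A → R`. -/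
def projPt (he : (HomogeneousIdeal.irrelevant 𝒜).toIdeal.map e = ⊤) :
    Spec (CommRingCat.of R) ⟶ Proj 𝒜 :=
  Proj.fromOfGlobalSections 𝒜 ((Scheme.ΓSpecIso (CommRingCat.of R)).inv.hom.comp e)
    (by rw [← Ideal.map_map, he, Ideal.map_top])

theorem map_irrelevant_eq_top {r : A} {n : ℕ} (hn : 0 < n) (hr : r ∈ 𝒜 n) (h : IsUnit (e r)) :
    (HomogeneousIdeal.irrelevant 𝒜).toIdeal.map e = ⊤ := by
  refine Ideal.eq_top_of_isUnit_mem _ (Ideal.mem_map_of_mem e ?_) h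
  change r ∈ HomogeneousIdeal.irrelevant 𝒜
  rw [HomogeneousIdeal.mem_irrelevant_iff]
  exact DirectSum.decompose_of_mem_ne 𝒜 hr hn.ne'

theorem comp_fromOfGlobalSections {X T : Scheme.{u}} (k : T ⟶ X) (f : A →+* Γ(X, ⊤))
    (hf : (HomogeneousIdeal.irrelevant 𝒜).toIdeal.map f = ⊤) {r : A} {n : ℕ}
    (hn : 0 < n) (hr : r ∈ 𝒜 n) (h : IsUnit (k.appTop.hom.comp f r)) :
    k ≫ Proj.fromOfGlobalSections 𝒜 f hf =
      T.toSpecΓ ≫ Spec.map (CommRingCat.ofHom (awayEval 𝒜 (k.appTop.hom.comp f) r h)) ≫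
        Proj.awayι 𝒜 r hr hn := by
  have hb : Set.range k ⊆ Set.range (X.basicOpen (f r)).ι := by
    have : k ⁻¹ᵁ X.basicOpen (f r) = ⊤ := by
      rw [Scheme.preimage_basicOpen]
      exact Scheme.basicOpen_of_isUnit T h
    rw [Scheme.Opens.range_ι]
    rintro _ ⟨x, rfl⟩
    have hx : x ∈ k ⁻¹ᵁ X.basicOpen (f r) := this ▸ trivial
    exact hx
  obtain ⟨k', rfl⟩ : ∃ k' : T ⟶ _, k = k' ≫ (X.basicOpen (f r)).ι :=
    ⟨IsOpenImmersion.lift _ k hb, (IsOpenImmersion.lift_fac _ k hb).symm⟩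
  have key : (X.basicOpen (f r)).ι ≫ Proj.fromOfGlobalSections 𝒜 f hf =
      Proj.toBasicOpenOfGlobalSections 𝒜 f rfl hn hr ≫ (Proj.basicOpen 𝒜 r).ι :=
    (Proj.openCoverOfMapIrrelevantEqTop 𝒜 f hf).ι_glueMorphisms _ _ ⟨_, _, hn, hr⟩
  rw [Category.assoc, key]
  generalize hk : k' ≫ (X.basicOpen (f r)).ι = k at h
  simp only [Proj.toBasicOpenOfGlobalSections, Category.assoc, Proj.basicOpenIsoSpec_inv_ι]
  simp only [← Category.assoc]
  congr 1
  simp only [Category.assoc]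
  have hle : Submonoid.powers r ≤ (Submonoid.powers (f r)).comap f := by
    rw [← Submonoid.map_le_iff_le_comap, Submonoid.map_powers]
  have h1 : awayEval 𝒜 (k.appTop.hom.comp f) r h =
      (IsLocalization.Away.lift (S := Localization.Away (f r)) (f r) (g := k.appTop.hom) h).comp
      ((IsLocalization.map (M := .powers r) (T := .powers (f r)) (Localization.Away (f r)) f
        hle).comp (algebraMap (Away 𝒜 r) (Localization.Away r))) := by
    rw [← RingHom.comp_assoc, awayEval]
    congr 1
    apply IsLocalization.ringHom_ext (M := .powers r)
    ext i
    simp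
  have h2 : (IsLocalization.Away.lift (S := Localization.Away (f r)) (f r)
      (g := k.appTop.hom) h).comp
      (algebraMap Γ(X, ⊤) (Localization.Away (f r))) = k.appTop.hom := by
    ext x; simp
  have hid : T.toSpecΓ ≫ Spec.map (CommRingCat.ofHom
      (IsLocalization.Away.lift (S := Localization.Away (f r)) (f r)
      (g := k.appTop.hom) h)) ≫ Spec.map (CommRingCat.ofHom (algebraMap Γ(X, ⊤)
      (Localization.Away (f r)))) = k ≫ X.toSpecΓ := by
    rw [← Spec.map_comp, ← CommRingCat.ofHom_comp, h2, Scheme.toSpecΓ_naturality]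
    rfl
  have hfac : (basicOpenIsoSpecAway (f r)).hom ≫ Spec.map (CommRingCat.ofHom
      (algebraMap Γ(X, ⊤) (Localization.Away (f r)))) =
      Scheme.Opens.ι (X := Spec Γ(X, ⊤)) (PrimeSpectrum.basicOpen (f r)) := by
    rw [basicOpenIsoSpecAway, IsOpenImmersion.isoOfRangeEq_hom_fac]
  have h3 : T.toSpecΓ ≫ Spec.map (CommRingCat.ofHom
      (IsLocalization.Away.lift (S := Localization.Away (f r)) (f r)
      (g := k.appTop.hom) h)) = k' ≫ (X.isoOfEq (X.toSpecΓ_preimage_basicOpen (f r))).inv ≫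
      X.toSpecΓ ∣_ (PrimeSpectrum.basicOpen (f r)) ≫ (basicOpenIsoSpecAway (f r)).hom := by
    rw [← cancel_mono (Spec.map (CommRingCat.ofHom (algebraMap Γ(X, ⊤)
      (Localization.Away (f r)))))]
    simp only [Category.assoc]
    rw [hid, hfac, ← hk, Category.assoc]
    have := morphismRestrict_ι X.toSpecΓ (PrimeSpectrum.basicOpen (f r))
    exact congrArg (k' ≫ ·) ((Scheme.isoOfEq_inv_ι_assoc X _ _).symm.trans
      (congrArg ((X.isoOfEq (X.toSpecΓ_preimage_basicOpen (f r))).inv ≫ ·) this.symm))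
  have h4 : Spec.map (CommRingCat.ofHom (awayEval 𝒜 (k.appTop.hom.comp f) r h)) = _ :=
    (congrArg (fun φ => Spec.map (CommRingCat.ofHom φ)) h1).trans
      ((congrArg Spec.map (CommRingCat.ofHom_comp _ _)).trans (Spec.map_comp _ _))
  rw [h4]
  have h5 := congrArg (· ≫ Spec.map (CommRingCat.ofHom ((IsLocalization.map (M := .powers r)
    (T := .powers (f r)) (Localization.Away (f r)) f
        hle).comp (algebraMap (Away 𝒜 r) (Localization.Away r))))) h3
  simp only [Category.assoc] at h5
  refine Eq.trans ?_ h5.symm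
  simp only [CommRingCat.ofHom_comp, Spec.map_comp]

theorem awayEval_comp {R R' : Type*} [CommRing R] [CommRing R'] (e : A →+* R) (φ : R →+* R') {r : A}
    (h : IsUnit (e r)) (h' : IsUnit (φ.comp e r)) {n : ℕ} (hr : r ∈ 𝒜 n) :
    awayEval 𝒜 (φ.comp e) r h' = φ.comp (awayEval 𝒜 e r h) := by
  refine away_hom_ext 𝒜 hr fun m a ha => ?_
  have h1 := awayEval_mk 𝒜 e r h hr m a ha
  have h2 := awayEval_mk 𝒜 (φ.comp e) r (h.map φ) hr m a ha
  apply_fun φ at h1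
  rw [map_mul, map_pow] at h1
  exact ((h.map φ).pow m).mul_right_cancel (h2.trans h1.symm)

/-- The pull-back of `projPt` under a homomorphism that makes the image of `r` a unit. -/
theorem specMap_projPt_eq {R' : Type u} [CommRing R'] (φ : R →+* R')
    (he : (HomogeneousIdeal.irrelevant 𝒜).toIdeal.map e = ⊤) {r : A} {n : ℕ}
    (hn : 0 < n) (hr : r ∈ 𝒜 n) (h : IsUnit (φ.comp e r)) :
    Spec.map (CommRingCat.ofHom φ) ≫ projPt 𝒜 e he =
      Spec.map (CommRingCat.ofHom (awayEval 𝒜 (φ.comp e) r h)) ≫ Proj.awayι 𝒜 r hr hn := by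
  have hcomp : (Spec.map (CommRingCat.ofHom φ)).appTop.hom.comp
      ((Scheme.ΓSpecIso (CommRingCat.of R)).inv.hom.comp e) =
      (Scheme.ΓSpecIso (CommRingCat.of R')).inv.hom.comp (φ.comp e) := by
    rw [← RingHom.comp_assoc, ← RingHom.comp_assoc, ← CommRingCat.hom_comp,
      ← Scheme.ΓSpecIso_inv_naturality]
    rfl
  have hu := h.map (Scheme.ΓSpecIso (CommRingCat.of R')).inv.hom
  rw [projPt, comp_fromOfGlobalSections 𝒜 _ _ _ hn hr (by rw [hcomp]; exact hu), ← Category.assoc]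
  congr 1
  rw [← SpecMap_ΓSpecIso_hom, ← Spec.map_comp, ← CommRingCat.ofHom_hom
    (Scheme.ΓSpecIso (CommRingCat.of R')).hom, ← CommRingCat.ofHom_comp]
  congr 2
  have h3 : (Scheme.ΓSpecIso (CommRingCat.of R')).hom.hom.comp
      ((Spec.map (CommRingCat.ofHom φ)).appTop.hom.comp
      ((Scheme.ΓSpecIso (CommRingCat.of R)).inv.hom.comp e)) = φ.comp e := by
    rw [hcomp, ← RingHom.comp_assoc, ← CommRingCat.hom_comp, Iso.inv_hom_id]
    rfl
  have h4 := awayEval_comp 𝒜 ((Spec.map (CommRingCat.ofHom φ)).appTop.hom.comp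
      ((Scheme.ΓSpecIso (CommRingCat.of R)).inv.hom.comp e))
      (Scheme.ΓSpecIso (CommRingCat.of R')).hom.hom (by rw [hcomp]; exact hu)
      (by rw [h3]; exact h) hr
  rw [← h4]
  simp only [h3]

theorem projPt_eq (he : (HomogeneousIdeal.irrelevant 𝒜).toIdeal.map e = ⊤) {r : A} {n : ℕ}
    (hn : 0 < n) (hr : r ∈ 𝒜 n) (h : IsUnit (e r)) :
    projPt 𝒜 e he = Spec.map (CommRingCat.ofHom (awayEval 𝒜 e r h)) ≫ Proj.awayι 𝒜 r hr hn := by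
  have := specMap_projPt_eq 𝒜 e (RingHom.id R) he hn hr h
  rwa [CommRingCat.ofHom_id, Spec.map_id, Category.id_comp] at this

/-- Two morphisms from the spectrum of a ring agree if they agree on basic open sets covering it. -/
theorem spec_hom_ext_of_span {R : Type u} [CommRing R] {Z : Scheme.{u}}
    {f g : Spec (CommRingCat.of R) ⟶ Z} (s : Set R) (hs : Ideal.span s = ⊤)
    (h : ∀ a ∈ s, Spec.map (CommRingCat.ofHom (algebraMap R (Localization.Away a))) ≫ f =
      Spec.map (CommRingCat.ofHom (algebraMap R (Localization.Away a))) ≫ g) : f = g :=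
  Scheme.Cover.hom_ext (Scheme.affineOpenCoverOfSpanRangeEqTop (R := CommRingCat.of R)
    (fun a : s => a.1) (by simpa using hs)).openCover _ _ fun a => h a.1 a.2

theorem specMap_projPt {R' : Type u} [CommRing R'] (φ : R →+* R')
    (he : (HomogeneousIdeal.irrelevant 𝒜).toIdeal.map e = ⊤)
    (he' : (HomogeneousIdeal.irrelevant 𝒜).toIdeal.map (φ.comp e) = ⊤) :
    Spec.map (CommRingCat.ofHom φ) ≫ projPt 𝒜 e he = projPt 𝒜 (φ.comp e) he' := by
  let s : Set R' := {a | ∃ r n, 0 < n ∧ r ∈ 𝒜 n ∧ φ.comp e r = a}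
  have hs : Ideal.span s = ⊤ := by
    rw [eq_top_iff, ← he', Ideal.map_le_iff_le_comap]
    intro r hr
    classical
    rw [Ideal.mem_comap, ← DirectSum.sum_support_decompose 𝒜 r, map_sum]
    refine Ideal.sum_mem _ fun i hi => Ideal.subset_span ⟨_, i, ?_, SetLike.coe_mem _, rfl⟩
    rw [Nat.pos_iff_ne_zero]
    rintro rfl
    have h0 : GradedRing.proj 𝒜 0 r = 0 := (HomogeneousIdeal.mem_irrelevant_iff 𝒜 r).1 hr
    exact (DFinsupp.mem_support_iff.1 hi) (Subtype.ext h0)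
  refine spec_hom_ext_of_span s hs ?_
  rintro _ ⟨r, n, hn, hr, rfl⟩
  rw [← Category.assoc, ← Spec.map_comp, ← CommRingCat.ofHom_comp,
    specMap_projPt_eq 𝒜 e ((algebraMap R' (Localization.Away (φ.comp e r))).comp φ) he hn hr
      (IsLocalization.Away.algebraMap_isUnit (φ.comp e r)),
    specMap_projPt_eq 𝒜 (φ.comp e) _ he' hn hr
      (IsLocalization.Away.algebraMap_isUnit (φ.comp e r))]

end ProjPt

/-! ### Points of projective space and of products of projective spaces -/

namespace BiProj

attribute [local instance] MvPolynomial.gradedAlgebra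

open ProjPt MvPolynomial

theorem aeval_mul_of_isHomogeneous {k σ A : Type*} [CommRing k] [CommRing A] [Algebra k A] {d : ℕ}
    {f : MvPolynomial σ k} (hf : f.IsHomogeneous d) (c : A) (v : σ → A) :
    aeval (fun i => c * v i) f = c ^ d * aeval v f := by
  rw [aeval_def, aeval_def, eval₂_eq, eval₂_eq, Finset.mul_sum]
  refine Finset.sum_congr rfl fun m hm => ?_
  have h : ∑ i ∈ m.support, m i = d := by
    have := hf (mem_support_iff.1 hm)
    rw [Finsupp.weight_apply] at this
    simpa [Finsupp.sum] using this
  simp only [mul_pow, Finset.prod_mul_distrib, Finset.prod_pow_eq_pow_sum, h]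
  ring

theorem eq_zero_of_span {A : Type*} [CommRing A] {s : Set A} (hs : Ideal.span s = ⊤) {x : A}
    (h : ∀ a ∈ s, algebraMap A (Localization.Away a) x = 0) : x = 0 := by
  have : (Ideal.span {x}).annihilator.radical = ⊤ := by
    rw [eq_top_iff, ← hs, Ideal.span_le]
    intro a ha
    obtain ⟨⟨_, m, rfl⟩, hm⟩ := (IsLocalization.map_eq_zero_iff (Submonoid.powers a) _ x).1 (h a ha)
    refine ⟨m, ?_⟩
    rw [Ideal.span, Submodule.mem_annihilator_span_singleton]
    exact hm
  rw [Ideal.radical_eq_top, Ideal.eq_top_iff_one, Ideal.span,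
    Submodule.mem_annihilator_span_singleton, one_smul] at this
  exact this

variable {n : ℕ} {A B : Type} [CommRing A] [Algebra ℂ A] [CommRing B] [Algebra ℂ B]

theorem X_mem (i : Fin (n + 1)) : (X i : MvPolynomial (Fin (n + 1)) ℂ) ∈ gr n 1 :=
  isHomogeneous_X ℂ i

theorem map_aeval_irrelevant (v : Fin (n + 1) → A) (hv : Ideal.span (Set.range v) = ⊤) :
    (HomogeneousIdeal.irrelevant (gr n)).toIdeal.map (aeval (R := ℂ) v).toRingHom = ⊤ := by
  have h := congrArg (Ideal.map (Scheme.ΓSpecIso (CommRingCat.of A)).hom.hom) (map_irrelevant v hv)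
  rw [Ideal.map_map, Ideal.map_top, evalHom, ← RingHom.comp_assoc, ← CommRingCat.hom_comp,
    Iso.inv_hom_id] at h
  exact h

theorem span_range_map (φ : A →ₐ[ℂ] B) {v : Fin (n + 1) → A}
    (hv : Ideal.span (Set.range v) = ⊤) : Ideal.span (Set.range (φ ∘ v)) = ⊤ := by
  have := congrArg (Ideal.map φ.toRingHom) hv
  rw [Ideal.map_span, Ideal.map_top, ← Set.range_comp] at this
  exact this

theorem specMap_pt (φ : A →ₐ[ℂ] B) (v : Fin (n + 1) → A) (hv : Ideal.span (Set.range v) = ⊤)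
    (hv' : Ideal.span (Set.range (φ ∘ v)) = ⊤) :
    Spec.map (CommRingCat.ofHom φ.toRingHom) ≫ pt v hv = pt (φ ∘ v) hv' := by
  have h : φ.toRingHom.comp (aeval (R := ℂ) v).toRingHom = (aeval (R := ℂ) (φ ∘ v)).toRingHom := by
    ext i <;> simp
  have := specMap_projPt (gr n) (aeval (R := ℂ) v).toRingHom φ.toRingHom
    (map_aeval_irrelevant v hv) (by rw [h]; exact map_aeval_irrelevant _ hv')
  simp only [h] at this
  exact this

theorem pt_eq (v : Fin (n + 1) → A) (hv : Ideal.span (Set.range v) = ⊤) {i : Fin (n + 1)}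
    (hi : IsUnit ((aeval (R := ℂ) v).toRingHom (X i))) :
    pt v hv = Spec.map (CommRingCat.ofHom (awayEval (gr n) (aeval (R := ℂ) v).toRingHom (X i) hi)) ≫
      Proj.awayι (gr n) (X i) (X_mem i) one_pos :=
  projPt_eq (gr n) _ (map_aeval_irrelevant v hv) one_pos (X_mem i) hi

theorem isUnit_of_minors {A : Type*} [CommRing A] {v w : Fin (n + 1) → A} (hw : Ideal.span (Set.range w) = ⊤)
    (h : ∀ i j, v i * w j = v j * w i) {i : Fin (n + 1)} (hi : IsUnit (v i)) : IsUnit (w i) := by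
  rw [← Ideal.span_singleton_eq_top, ← top_le_iff, ← hw, Ideal.span_le]
  rintro _ ⟨j, rfl⟩
  rw [SetLike.mem_coe, Ideal.mem_span_singleton, ← hi.dvd_mul_left, h]
  exact dvd_mul_left _ _

theorem pt_eq_pt_of_isUnit {v w : Fin (n + 1) → A} {hv : Ideal.span (Set.range v) = ⊤}
    {hw : Ideal.span (Set.range w) = ⊤} (h : ∀ i j, v i * w j = v j * w i) {i : Fin (n + 1)}
    (hi : IsUnit (v i)) : pt v hv = pt w hw := by
  have hi' := isUnit_of_minors hw h hi
  rw [pt_eq v hv (i := i) (by simpa using hi), pt_eq w hw (i := i) (by simpa using hi')]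
  congr 3
  refine away_hom_ext (gr n) (X_mem i) fun m a ha => ?_
  have h1 := awayEval_mk (gr n) (aeval (R := ℂ) v).toRingHom (X i) (by simpa using hi) (X_mem i)
    m a ha
  have h2 := awayEval_mk (gr n) (aeval (R := ℂ) w).toRingHom (X i) (by simpa using hi') (X_mem i)
    m a ha
  refine ((hi.mul hi').pow m).mul_right_cancel ?_
  have hm : a.IsHomogeneous m := by simpa using (mem_homogeneousSubmodule _ _).1 ha
  have e1 := aeval_mul_of_isHomogeneous hm (v i) w
  have e2 := aeval_mul_of_isHomogeneous hm (w i) v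
  have e3 : (fun j => v i * w j) = fun j => w i * v j := funext fun j => by rw [h, mul_comm]
  rw [e3, e2] at e1
  change _ * (aeval v (X i : MvPolynomial (Fin (n + 1)) ℂ)) ^ m = aeval v a at h1
  change _ * (aeval w (X i : MvPolynomial (Fin (n + 1)) ℂ)) ^ m = aeval w a at h2
  rw [aeval_X] at h1 h2
  rw [mul_pow, ← mul_assoc, h1, mul_comm (v i ^ m), ← mul_assoc, h2, mul_comm, e1, mul_comm]

/-- The localization map as a homomorphism of `ℂ`-algebras. -/
abbrev locHom (a : A) : A →ₐ[ℂ] Localization.Away a := IsScalarTower.toAlgHom ℂ A _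

theorem pt_eq_pt {v w : Fin (n + 1) → A} {hv : Ideal.span (Set.range v) = ⊤}
    {hw : Ideal.span (Set.range w) = ⊤} (h : ∀ i j, v i * w j = v j * w i) :
    pt v hv = pt w hw := by
  refine spec_hom_ext_of_span _ hv ?_
  rintro _ ⟨i, rfl⟩
  have e1 := specMap_pt (locHom (v i)) v hv (span_range_map _ hv)
  have e2 := specMap_pt (locHom (v i)) w hw (span_range_map _ hw)
  refine e1.trans (Eq.trans ?_ e2.symm)
  refine pt_eq_pt_of_isUnit (i := i) (fun j k => ?_)
    (IsLocalization.Away.algebraMap_isUnit (v i))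
  simp only [Function.comp, ← map_mul, h]

theorem pt_preimage_basicOpen (v : Fin (n + 1) → A) (hv : Ideal.span (Set.range v) = ⊤)
    {f : MvPolynomial (Fin (n + 1)) ℂ} {d : ℕ} (hd : 0 < d) (hf : f.IsHomogeneous d) :
    pt v hv ⁻¹ᵁ Proj.basicOpen (gr n) f = PrimeSpectrum.basicOpen (aeval v f) := by
  rw [pt, Proj.fromOfGlobalSections_preimage_basicOpen (gr n) _ _ hd hf, evalHom,
    RingHom.comp_apply]
  exact basicOpen_eq_of_affine (R := CommRingCat.of A) (aeval v f)

theorem mem_pt_preimage_basicOpen (v : Fin (n + 1) → A) (hv : Ideal.span (Set.range v) = ⊤)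
    {f : MvPolynomial (Fin (n + 1)) ℂ} {d : ℕ} (hd : 0 < d) (hf : f.IsHomogeneous d)
    (y : Spec (CommRingCat.of A)) :
    pt v hv y ∈ Proj.basicOpen (gr n) f ↔ aeval v f ∉ PrimeSpectrum.asIdeal y := by
  change y ∈ pt v hv ⁻¹ᵁ Proj.basicOpen (gr n) f ↔ _
  rw [pt_preimage_basicOpen v hv hd hf]
  rfl

theorem isUnit_of_forall_notMem {A : Type*} [CommRing A] {a : A}
    (h : ∀ y : PrimeSpectrum A, a ∉ y.asIdeal) : IsUnit a := by
  by_contra ha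
  obtain ⟨m, hm, ham⟩ := exists_max_ideal_of_mem_nonunits ha
  exact h ⟨m, hm.isPrime⟩ ham

theorem minors_of_pt_eq_pt {v w : Fin (n + 1) → A} {hv : Ideal.span (Set.range v) = ⊤}
    {hw : Ideal.span (Set.range w) = ⊤} (h : pt v hv = pt w hw) (i j : Fin (n + 1)) :
    v i * w j = v j * w i := by
  have main : ∀ (B : Type) [CommRing B] [Algebra ℂ B] (v w : Fin (n + 1) → B)
      (hv : Ideal.span (Set.range v) = ⊤) (hw : Ideal.span (Set.range w) = ⊤) (k : Fin (n + 1)),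
      IsUnit (v k) → pt v hv = pt w hw → v i * w j = v j * w i := by
    intro B _ _ v w hv hw k hk h
    have hk' : IsUnit (w k) := by
      refine isUnit_of_forall_notMem fun y => ?_
      have h1 := mem_pt_preimage_basicOpen v hv one_pos (isHomogeneous_X ℂ k) y
      have h2 := mem_pt_preimage_basicOpen w hw one_pos (isHomogeneous_X ℂ k) y
      rw [h, h2, aeval_X, aeval_X] at h1
      rw [h1]
      exact fun hm => y.2.ne_top (Ideal.eq_top_of_isUnit_mem _ hm hk)
    have hku : IsUnit ((aeval (R := ℂ) v).toRingHom (X k)) := by simpa using hk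
    have hku' : IsUnit ((aeval (R := ℂ) w).toRingHom (X k)) := by simpa using hk'
    rw [pt_eq v hv hku, pt_eq w hw hku', cancel_mono] at h
    have h3 : awayEval (gr n) (aeval (R := ℂ) v).toRingHom (X k) hku =
        awayEval (gr n) (aeval (R := ℂ) w).toRingHom (X k) hku' :=
      congrArg CommRingCat.Hom.hom (Spec.map_injective h)
    have h4 : ∀ j, v j * w k = w j * v k := fun j => by
      have hj : (X j : MvPolynomial (Fin (n + 1)) ℂ) ∈ gr n (1 • 1) := X_mem j
      have h1 := awayEval_mk (gr n) (aeval (R := ℂ) v).toRingHom (X k) hku (X_mem k) 1 (X j) hj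
      have h2 := awayEval_mk (gr n) (aeval (R := ℂ) w).toRingHom (X k) hku' (X_mem k) 1 (X j) hj
      simp only [AlgHom.toRingHom_eq_coe, RingHom.coe_coe, aeval_X, pow_one] at h1 h2 h3
      rw [← h1, ← h2, h3]
      ring
    refine (hk.mul hk').mul_right_cancel ?_
    linear_combination w j * v k * h4 i - w i * v k * h4 j
  have hz : ∀ k, algebraMap A (Localization.Away (v k)) (v i * w j - v j * w i) = 0 := fun k => by
    have e1 := specMap_pt (locHom (v k)) v hv (span_range_map _ hv)
    have e2 := specMap_pt (locHom (v k)) w hw (span_range_map _ hw)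
    have := main _ _ _ (span_range_map (locHom (v k)) hv) (span_range_map (locHom (v k)) hw) k
      (IsLocalization.Away.algebraMap_isUnit (v k)) (e1.symm.trans ((congrArg _ h).trans e2))
    simp only [Function.comp] at this
    rw [map_sub, map_mul, map_mul, sub_eq_zero]
    exact this
  rw [← sub_eq_zero]
  refine eq_zero_of_span hv ?_
  rintro _ ⟨k, rfl⟩
  exact hz k

/-- A morphism into a standard affine open subset is given by coordinates. -/
theorem exists_eq_pt (p : Spec (CommRingCat.of A) ⟶ PP n)
    (hp : p ≫ PP.str n = Spec.map (CommRingCat.ofHom (algebraMap ℂ A))) (i : Fin (n + 1))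
    (hi : ∀ y, p y ∈ Proj.basicOpen (gr n) (X i)) :
    ∃ (v : Fin (n + 1) → A) (hv : Ideal.span (Set.range v) = ⊤), v i = 1 ∧ p = pt v hv := by
  have hr : Set.range p ⊆ Set.range (Proj.awayι (gr n) (X i) (X_mem i) one_pos) := by
    have := Proj.opensRange_awayι (gr n) (X i) (X_mem i) one_pos
    rintro _ ⟨y, rfl⟩
    have h2 := hi y
    rw [← this] at h2
    exact h2
  obtain ⟨g, rfl⟩ : ∃ g, p = g ≫ Proj.awayι (gr n) (X i) (X_mem i) one_pos :=
    ⟨IsOpenImmersion.lift _ p hr, (IsOpenImmersion.lift_fac _ p hr).symm⟩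
  obtain ⟨γ, rfl⟩ := Spec.map_surjective g
  have hj : ∀ j, (X j : MvPolynomial (Fin (n + 1)) ℂ) ∈ gr n (1 • 1) := fun j => X_mem j
  let v : Fin (n + 1) → A := fun j => γ.hom (HomogeneousLocalization.Away.mk (gr n) (X_mem i) 1 (X j) (hj j))
  have hvi : v i = 1 := by
    have h1 : HomogeneousLocalization.Away.mk (gr n) (X_mem i) 1 (X i) (hj i) = 1 := ?_
    · change γ.hom (HomogeneousLocalization.Away.mk (gr n) (X_mem i) 1 (X i) (hj i)) = 1
      rw [h1, map_one]
    apply HomogeneousLocalization.val_injective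
    rw [HomogeneousLocalization.Away.val_mk, HomogeneousLocalization.val_one]
    simp only [pow_one]
    exact Localization.mk_self (⟨X i, _⟩ : Submonoid.powers (X i : MvPolynomial (Fin (n + 1)) ℂ))
  refine ⟨v, span_eq_top_of_one v i hvi, hvi, ?_⟩
  rw [pt_eq v _ (i := i) (by simp [hvi])]
  congr 2
  ext1
  refine away_hom_ext (gr n) (X_mem i) fun m a ha => ?_
  have h1 := awayEval_mk (gr n) (aeval (R := ℂ) v).toRingHom (X i) (by simp [hvi]) (X_mem i)
    m a ha
  change _ * (aeval v (X i : MvPolynomial (Fin (n + 1)) ℂ)) ^ m = aeval v a at h1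
  have e : (aeval v (X i : MvPolynomial (Fin (n + 1)) ℂ)) ^ m = 1 := by
    rw [aeval_X, hvi, one_pow]
  refine Eq.trans ?_ (((mul_one _).symm.trans ((congrArg (_ * ·) e.symm).trans h1)).symm)
  let S := Localization.Away (X i : MvPolynomial (Fin (n + 1)) ℂ)
  let c : ℂ →+* HomogeneousLocalization.Away (gr n) (X i) :=
    (HomogeneousLocalization.fromZeroRingHom (gr n) _).comp (algebraMap ℂ (gr n 0))
  have hc : γ.hom.comp c = algebraMap ℂ A := by
    rw [PP.str, Category.assoc, Proj.awayι_toSpecZero_assoc, ← Spec.map_comp, ← Spec.map_comp] at hp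
    exact congrArg CommRingCat.Hom.hom (Spec.map_injective hp)
  have hm : a.IsHomogeneous m := by simpa using (mem_homogeneousSubmodule _ _).1 ha
  let w : Fin (n + 1) → HomogeneousLocalization.Away (gr n) (X i) := fun j =>
    HomogeneousLocalization.Away.mk (gr n) (X_mem i) 1 (X j) (hj j)
  have hu : IsUnit (algebraMap (MvPolynomial (Fin (n + 1)) ℂ) S (X i)) :=
    IsLocalization.Away.algebraMap_isUnit (X i)
  have hval : ∀ (k : ℕ) (b : MvPolynomial (Fin (n + 1)) ℂ) (hb : b ∈ gr n (k • 1)),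
      algebraMap (MvPolynomial (Fin (n + 1)) ℂ) S (X i) ^ k * algebraMap (HomogeneousLocalization.Away (gr n) (X i)) S
        (HomogeneousLocalization.Away.mk (gr n) (X_mem i) k b hb) = algebraMap (MvPolynomial (Fin (n + 1)) ℂ) S b := by
    intro k b hb
    rw [HomogeneousLocalization.algebraMap_apply, HomogeneousLocalization.Away.val_mk,
      Localization.mk_eq_mk', ← map_pow, mul_comm]
    exact IsLocalization.mk'_spec S b (⟨X i ^ k, k, rfl⟩ : Submonoid.powers _)
  have key : HomogeneousLocalization.Away.mk (gr n) (X_mem i) m a ha = eval₂ c w a := by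
    have hinj : Function.Injective (algebraMap (HomogeneousLocalization.Away (gr n) (X i)) S) :=
      fun x y h => HomogeneousLocalization.val_injective _ h
    apply hinj
    refine (hu.pow m).mul_left_cancel ?_
    rw [hval, ← RingHom.coe_coe, hom_eval₂]
    have h2 : (algebraMap (HomogeneousLocalization.Away (gr n) (X i)) S).comp c =
        algebraMap ℂ S := rfl
    have h3 := aeval_mul_of_isHomogeneous hm (algebraMap (MvPolynomial (Fin (n + 1)) ℂ) S (X i))
      (fun j => algebraMap (HomogeneousLocalization.Away (gr n) (X i)) S (w j))
    have h4 : (fun j => algebraMap (MvPolynomial (Fin (n + 1)) ℂ) S (X i) *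
        algebraMap (HomogeneousLocalization.Away (gr n) (X i)) S (w j)) =
        fun j => algebraMap (MvPolynomial (Fin (n + 1)) ℂ) S (X j) := funext fun j => by
      have := hval 1 (X j) (hj j)
      rwa [pow_one] at this
    rw [h4, aeval_def] at h3
    rw [RingHom.coe_coe, h2]
    refine Eq.trans ?_ h3
    have h5 := comp_aeval (R := ℂ) (X : Fin (n + 1) → MvPolynomial (Fin (n + 1)) ℂ)
      (IsScalarTower.toAlgHom ℂ (MvPolynomial (Fin (n + 1)) ℂ) S)
    have h6 := DFunLike.congr_fun h5 a
    rw [AlgHom.comp_apply, aeval_X_left, AlgHom.id_apply, aeval_def] at h6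
    exact h6
  rw [key, hom_eval₂, hc]
  rfl

variable {m : ℕ}

theorem bipt_str (l : Fin (m + 1) → A) (x : Fin (n + 1) → A)
    (hl : Ideal.span (Set.range l) = ⊤) (hx : Ideal.span (Set.range x) = ⊤) :
    bipt l x hl hx ≫ PPP.str m n = Spec.map (CommRingCat.ofHom (algebraMap ℂ A)) := by
  rw [bipt, PPP.str, pullback.lift_fst_assoc, pt_str]

theorem specMap_bipt (φ : A →ₐ[ℂ] B) (l : Fin (m + 1) → A) (x : Fin (n + 1) → A)
    (hl : Ideal.span (Set.range l) = ⊤) (hx : Ideal.span (Set.range x) = ⊤)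
    (hl' : Ideal.span (Set.range (φ ∘ l)) = ⊤) (hx' : Ideal.span (Set.range (φ ∘ x)) = ⊤) :
    Spec.map (CommRingCat.ofHom φ.toRingHom) ≫ bipt l x hl hx = bipt (φ ∘ l) (φ ∘ x) hl' hx' := by
  apply pullback.hom_ext
  · rw [bipt, bipt, Category.assoc, pullback.lift_fst, pullback.lift_fst, specMap_pt]
  · rw [bipt, bipt, Category.assoc, pullback.lift_snd, pullback.lift_snd, specMap_pt]

theorem bipt_eq_bipt {l l' : Fin (m + 1) → A} {x x' : Fin (n + 1) → A}
    {hl : Ideal.span (Set.range l) = ⊤} {hx : Ideal.span (Set.range x) = ⊤}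
    {hl' : Ideal.span (Set.range l') = ⊤} {hx' : Ideal.span (Set.range x') = ⊤}
    (h : ∀ i j, l i * l' j = l j * l' i) (h' : ∀ i j, x i * x' j = x j * x' i) :
    bipt l x hl hx = bipt l' x' hl' hx' := by
  apply pullback.hom_ext
  · rw [bipt, bipt, pullback.lift_fst, pullback.lift_fst, pt_eq_pt h]
  · rw [bipt, bipt, pullback.lift_snd, pullback.lift_snd, pt_eq_pt h']

theorem minors_of_bipt_eq_bipt {l l' : Fin (m + 1) → A} {x x' : Fin (n + 1) → A}
    {hl : Ideal.span (Set.range l) = ⊤} {hx : Ideal.span (Set.range x) = ⊤}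
    {hl' : Ideal.span (Set.range l') = ⊤} {hx' : Ideal.span (Set.range x') = ⊤}
    (h : bipt l x hl hx = bipt l' x' hl' hx') :
    (∀ i j, l i * l' j = l j * l' i) ∧ ∀ i j, x i * x' j = x j * x' i := by
  constructor
  · have := congrArg (· ≫ pullback.fst _ _) h
    simp only [bipt, pullback.lift_fst] at this
    exact minors_of_pt_eq_pt this
  · have := congrArg (· ≫ pullback.snd _ _) h
    simp only [bipt, pullback.lift_snd] at this
    exact minors_of_pt_eq_pt this

/-- The standard open subset `lᵢ ≠ 0`, `xⱼ ≠ 0` of `ℙᵐ × ℙⁿ`. -/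
def stdOpen (i : Fin (m + 1)) (j : Fin (n + 1)) : (PPP m n).Opens :=
  pullback.fst (PP.str m) (PP.str n) ⁻¹ᵁ Proj.basicOpen (gr m) (X i) ⊓
    pullback.snd (PP.str m) (PP.str n) ⁻¹ᵁ Proj.basicOpen (gr n) (X j)

theorem exists_eq_bipt (p : Spec (CommRingCat.of A) ⟶ PPP m n)
    (hp : p ≫ PPP.str m n = Spec.map (CommRingCat.ofHom (algebraMap ℂ A)))
    (i : Fin (m + 1)) (j : Fin (n + 1)) (h : ∀ y, p y ∈ stdOpen i j) :
    ∃ (l : Fin (m + 1) → A) (x : Fin (n + 1) → A) (hl : Ideal.span (Set.range l) = ⊤)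
      (hx : Ideal.span (Set.range x) = ⊤), l i = 1 ∧ x j = 1 ∧ p = bipt l x hl hx := by
  obtain ⟨l, hl, hli, h1⟩ := exists_eq_pt (p ≫ pullback.fst _ _)
    (by rw [Category.assoc]; exact hp) i (fun y => by
      rw [Scheme.Hom.comp_apply]; exact (h y).1)
  obtain ⟨x, hx, hxj, h2⟩ := exists_eq_pt (p ≫ pullback.snd _ _)
    (by rw [Category.assoc, ← pullback.condition]; exact hp) j (fun y => by
      rw [Scheme.Hom.comp_apply]; exact (h y).2)
  refine ⟨l, x, hl, hx, hli, hxj, ?_⟩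
  apply pullback.hom_ext
  · rw [bipt, pullback.lift_fst, h1]
  · rw [bipt, pullback.lift_snd, h2]

theorem bipt_mem_stdOpen_iff (l : Fin (m + 1) → A) (x : Fin (n + 1) → A)
    (hl : Ideal.span (Set.range l) = ⊤) (hx : Ideal.span (Set.range x) = ⊤) (i : Fin (m + 1))
    (j : Fin (n + 1)) (y : Spec (CommRingCat.of A)) :
    bipt l x hl hx y ∈ stdOpen i j ↔
      l i ∉ PrimeSpectrum.asIdeal y ∧ x j ∉ PrimeSpectrum.asIdeal y := by
  have h1 := mem_pt_preimage_basicOpen l hl one_pos (isHomogeneous_X ℂ i) y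
  have h2 := mem_pt_preimage_basicOpen x hx one_pos (isHomogeneous_X ℂ j) y
  rw [aeval_X] at h1 h2
  rw [← h1, ← h2]
  have e1 : pullback.fst (PP.str m) (PP.str n) (bipt l x hl hx y) = pt l hl y := by
    rw [← Scheme.Hom.comp_apply, bipt, pullback.lift_fst]
  have e2 : pullback.snd (PP.str m) (PP.str n) (bipt l x hl hx y) = pt x hx y := by
    rw [← Scheme.Hom.comp_apply, bipt, pullback.lift_snd]
  rw [← e1, ← e2]
  rfl

theorem exists_notMem_of_span_eq_top {A : Type*} [CommRing A] {ι : Type*} {v : ι → A}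
    (hv : Ideal.span (Set.range v) = ⊤) (y : PrimeSpectrum A) : ∃ i, v i ∉ y.asIdeal := by
  by_contra! h
  refine y.2.ne_top (top_le_iff.1 ?_)
  rw [← hv, Ideal.span_le]
  rintro _ ⟨i, rfl⟩
  exact h i

theorem adjoin_gr_zero_range_X (n : ℕ) : Algebra.adjoin (gr n 0)
    (Set.range (X : Fin (n + 1) → MvPolynomial (Fin (n + 1)) ℂ)) = ⊤ := by
  have h1 : Algebra.adjoin ℂ (Set.range (X : Fin (n + 1) → MvPolynomial (Fin (n + 1)) ℂ)) = ⊤ :=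
    adjoin_range_X
  refine top_le_iff.1 fun f _ => ?_
  have hf : f ∈ Algebra.adjoin ℂ (Set.range (X : Fin (n + 1) → MvPolynomial (Fin (n + 1)) ℂ)) :=
    h1 ▸ trivial
  induction hf using Algebra.adjoin_induction with
  | mem x hx => exact Algebra.subset_adjoin hx
  | algebraMap r => exact Subalgebra.algebraMap_mem _ (algebraMap ℂ (gr n 0) r)
  | add x y _ _ h1 h2 => exact add_mem (h1 trivial) (h2 trivial)
  | mul x y _ _ h1 h2 => exact mul_mem (h1 trivial) (h2 trivial)

theorem exists_mem_basicOpen (z : PP n) : ∃ i, z ∈ Proj.basicOpen (gr n) (X i) := by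
  have h : ⨆ i, Proj.basicOpen (gr n) (X i) = ⊤ :=
    Proj.iSup_basicOpen_eq_top' (gr n) _ (fun i => ⟨1, X_mem i⟩) (adjoin_gr_zero_range_X n)
  have hz : z ∈ ⨆ i, Proj.basicOpen (gr n) (X i) := h ▸ trivial
  exact Opens.mem_iSup.1 hz

theorem exists_mem_stdOpen (z : PPP m n) : ∃ i j, z ∈ stdOpen i j := by
  obtain ⟨i, hi⟩ := exists_mem_basicOpen (pullback.fst (PP.str m) (PP.str n) z)
  obtain ⟨j, hj⟩ := exists_mem_basicOpen (pullback.snd (PP.str m) (PP.str n) z)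
  exact ⟨i, j, hi, hj⟩

end BiProj

/-! ### Pull-backs of ideal sheaves to spectra of rings -/

namespace Blow

open Scheme

/-- The ideal of `A` that is the inverse image of an ideal sheaf under `F : Spec A ⟶ X`. -/
def pullIdeal {X : Scheme.{u}} (I : X.IdealSheafData) {A : Type u} [CommRing A]
    (F : Spec (CommRingCat.of A) ⟶ X) : Ideal A :=
  ((I.comap F).ideal ⟨⊤, isAffineOpen_top _⟩).comap (ΓSpecIso (CommRingCat.of A)).inv.hom

variable {X : Scheme.{u}} (I : X.IdealSheafData) {A B : Type u} [CommRing A] [CommRing B]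

theorem ker_specMap_of_injective {φ : A →+* B} (h : Function.Injective φ) :
    (Spec.map (CommRingCat.ofHom φ)).ker = ⊥ := by
  refine IdealSheafData.ext_of_isAffine ?_
  rw [Hom.ker_apply]
  change RingHom.ker (Spec.map (CommRingCat.ofHom φ)).appTop.hom = ⊥
  rw [← RingHom.injective_iff_ker_eq_bot]
  have := ΓSpecIso_inv_naturality (CommRingCat.ofHom φ)
  have h2 : (Spec.map (CommRingCat.ofHom φ)).appTop = (ΓSpecIso (CommRingCat.of A)).hom ≫
      CommRingCat.ofHom φ ≫ (ΓSpecIso (CommRingCat.of B)).inv := by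
    rw [this, Iso.hom_inv_id_assoc]
  rw [h2]
  exact ((ConcreteCategory.bijective_of_isIso (ΓSpecIso (CommRingCat.of B)).inv).1.comp h).comp
    (ConcreteCategory.bijective_of_isIso (ΓSpecIso (CommRingCat.of A)).hom).1

theorem ideal_ker_specMap (φ : A →+* B) :
    ((Spec.map (CommRingCat.ofHom φ)).ker.ideal ⟨⊤, isAffineOpen_top _⟩).comap
      (ΓSpecIso (CommRingCat.of A)).inv.hom = RingHom.ker φ := by
  rw [Hom.ker_apply]
  change (RingHom.ker (Spec.map (CommRingCat.ofHom φ)).appTop.hom).comap _ = _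
  rw [RingHom.comap_ker, ← CommRingCat.hom_comp, ← ΓSpecIso_inv_naturality, CommRingCat.hom_comp,
    ← RingHom.comap_ker, (RingHom.injective_iff_ker_eq_bot _).1
    (ConcreteCategory.bijective_of_isIso (ΓSpecIso (CommRingCat.of B)).inv).1]
  rfl

theorem le_iff_comap_ΓSpecIso_inv (J J' : Ideal Γ(Spec (CommRingCat.of A), ⊤)) :
    J ≤ J' ↔ J.comap (ΓSpecIso (CommRingCat.of A)).inv.hom ≤
      J'.comap (ΓSpecIso (CommRingCat.of A)).inv.hom :=
  (Ideal.comap_le_comap_iff_of_surjective _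
    (ConcreteCategory.bijective_of_isIso (ΓSpecIso (CommRingCat.of A)).inv).2 _ _).symm

theorem pullIdeal_le_iff (F : Spec (CommRingCat.of A) ⟶ X) (J : Ideal A) :
    pullIdeal I F ≤ J ↔ I ≤ (Spec.map (CommRingCat.ofHom (Ideal.Quotient.mk J)) ≫ F).ker := by
  rw [← IdealSheafData.map_ker, IdealSheafData.le_map_iff_comap_le]
  have h := ideal_ker_specMap (Ideal.Quotient.mk J)
  rw [Ideal.mk_ker] at h
  rw [pullIdeal]
  nth_rw 1 [← h]
  rw [← le_iff_comap_ΓSpecIso_inv]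
  exact ⟨IdealSheafData.le_of_isAffine, fun h => h _⟩

theorem pullIdeal_specMap (F : Spec (CommRingCat.of A) ⟶ X) (φ : A →+* B) :
    pullIdeal I (Spec.map (CommRingCat.ofHom φ) ≫ F) = (pullIdeal I F).map φ := by
  refine eq_of_forall_ge_iff fun J => ?_
  rw [pullIdeal_le_iff, Ideal.map_le_iff_le_comap, pullIdeal_le_iff]
  have h : (CommRingCat.ofHom φ) ≫ CommRingCat.ofHom (Ideal.Quotient.mk J) =
      CommRingCat.ofHom (Ideal.Quotient.mk (J.comap φ)) ≫
      CommRingCat.ofHom (Ideal.quotientMap J φ le_rfl) := by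
    rw [← CommRingCat.ofHom_comp, ← CommRingCat.ofHom_comp]
    rfl
  rw [← Category.assoc, ← Spec.map_comp, h, Spec.map_comp, Category.assoc,
    ← IdealSheafData.map_ker (Spec.map (CommRingCat.ofHom (Ideal.quotientMap J φ le_rfl))),
    ker_specMap_of_injective Ideal.quotientMap_injective, IdealSheafData.map_bot]

theorem pullIdeal_eq_bot_iff (F : Spec (CommRingCat.of A) ⟶ X) :
    pullIdeal I F = ⊥ ↔ I ≤ F.ker := by
  rw [← le_bot_iff, pullIdeal_le_iff, ← IdealSheafData.map_ker, ker_specMap_of_injective,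
    IdealSheafData.map_bot]
  rw [RingHom.injective_iff_ker_eq_bot, Ideal.mk_ker]

theorem exists_fac_of_pullIdeal_eq_bot {F : Spec (CommRingCat.of A) ⟶ X} (h : pullIdeal I F = ⊥) :
    ∃ G, G ≫ I.subschemeι = F := by
  rw [pullIdeal_eq_bot_iff] at h
  exact ⟨IsClosedImmersion.lift I.subschemeι F (by simpa using h), IsClosedImmersion.lift_fac _ _ _⟩

theorem pullIdeal_of_fac (G : Spec (CommRingCat.of A) ⟶ I.subscheme) :
    pullIdeal I (G ≫ I.subschemeι) = ⊥ := by
  rw [pullIdeal_eq_bot_iff]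
  simpa using G.le_ker_comp I.subschemeι

theorem pullIdeal_comap {Z : Scheme.{u}} (g : Z ⟶ X) (F : Spec (CommRingCat.of A) ⟶ Z) :
    pullIdeal (I.comap g) F = pullIdeal I (F ≫ g) := by
  rw [pullIdeal, pullIdeal, IdealSheafData.comap_comp]

theorem pullIdeal_fromSpec {U : X.Opens} (hU : IsAffineOpen U) :
    pullIdeal I (A := Γ(X, U)) hU.fromSpec = I.ideal ⟨U, hU⟩ := by
  have h : hU.fromSpec ''ᵁ ⊤ = U := by simp
  have h1 : (ΓSpecIso (CommRingCat.of Γ(X, U))).inv ≫ (hU.fromSpec.appIso ⊤).inv =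
      X.presheaf.map (eqToHom h).op := by
    rw [Iso.comp_inv_eq, Scheme.Hom.appIso_hom, hU.fromSpec.naturality_assoc,
      hU.fromSpec_app_self, Category.assoc, ← Functor.map_comp, ← Functor.map_comp]
    refine (Category.comp_id _).symm.trans (congrArg _ ?_)
    rw [← CategoryTheory.Functor.map_id]
    rfl
  rw [pullIdeal, IdealSheafData.ideal_comap_of_isOpenImmersion, Ideal.comap_comap,
    ← CommRingCat.hom_comp, h1, ← IdealSheafData.map_ideal' I (U := ⟨hU.fromSpec ''ᵁ ⊤,
      (isAffineOpen_top _).image_of_isOpenImmersion _⟩) (V := ⟨U, hU⟩) (eqToHom h).op]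
  exact Ideal.comap_map_of_bijective _ (ConcreteCategory.bijective_of_isIso _)

theorem mem_support_iff_pullIdeal_le (F : Spec (CommRingCat.of A) ⟶ X) (y : PrimeSpectrum A) :
    F y ∈ I.support ↔ pullIdeal I F ≤ y.asIdeal := by
  have h1 : F y ∈ I.support ↔ (show Spec (CommRingCat.of A) from y) ∈ (I.comap F).support := by
    rw [IdealSheafData.support_comap]; rfl
  rw [h1, IdealSheafData.mem_support_iff_of_mem (U := ⟨⊤, isAffineOpen_top _⟩) trivial,
    Scheme.mem_zeroLocus_iff]
  have h2 : ∀ a : A, y ∈ Scheme.basicOpen _ ((ΓSpecIso (CommRingCat.of A)).inv.hom a) ↔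
      a ∉ y.asIdeal := fun a => by
    rw [basicOpen_eq_of_affine (R := CommRingCat.of A) a]
    rfl
  constructor
  · intro h a ha
    by_contra hy
    exact h _ ha ((h2 a).2 hy)
  · intro h f hf hy
    obtain ⟨a, rfl⟩ :=
      (ConcreteCategory.bijective_of_isIso (ΓSpecIso (CommRingCat.of A)).inv).2 f
    exact (h2 a).1 hy (h hf)

/-- Near a given point, a morphism from an affine scheme factors through a given affine open
subset. -/
theorem exists_away_factor (F : Spec (CommRingCat.of A) ⟶ X) (y : PrimeSpectrum A)
    {U : X.Opens} (hU : IsAffineOpen U) (hy : F y ∈ U) :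
    ∃ a, a ∉ y.asIdeal ∧ ∃ γ : Γ(X, U) ⟶ CommRingCat.of (Localization.Away a),
      Spec.map (CommRingCat.ofHom (algebraMap A (Localization.Away a))) ≫ F =
        Spec.map γ ≫ hU.fromSpec := by
  obtain ⟨_, ⟨a, rfl⟩, hya, haU⟩ := PrimeSpectrum.isTopologicalBasis_basic_opens
    (R := A) |>.exists_subset_of_mem_open (a := y) hy (F ⁻¹ᵁ U).2
  refine ⟨a, hya, ?_⟩
  have hr : Set.range (Spec.map (CommRingCat.ofHom (algebraMap A (Localization.Away a))) ≫ F) ⊆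
      Set.range hU.fromSpec := by
    rw [IsAffineOpen.range_fromSpec]
    rintro _ ⟨z, rfl⟩
    refine haU ?_
    have := PrimeSpectrum.localization_away_comap_range (Localization.Away a) a
    exact this.le ⟨z, rfl⟩
  obtain ⟨γ, hγ⟩ := Spec.map_surjective (IsOpenImmersion.lift _ _ hr)
  exact ⟨γ, by rw [hγ, IsOpenImmersion.lift_fac]⟩

end Blow

/-! ### Points of subschemes of products of projective spaces -/

namespace BiProj

attribute [local instance] MvPolynomial.gradedAlgebra

open ProjPt MvPolynomial Blow

/-- The `ℂ`-algebra structure of a ring whose spectrum is a scheme over `ℂ`. -/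
abbrev algebraOfHom {A : Type} [CommRing A] (s : Spec (CommRingCat.of A) ⟶ Spec (CommRingCat.of ℂ)) :
    Algebra ℂ A := (Spec.preimage s).hom.toAlgebra

theorem specMap_algebraOfHom {A : Type} [CommRing A]
    (s : Spec (CommRingCat.of A) ⟶ Spec (CommRingCat.of ℂ)) :
    letI := algebraOfHom s
    Spec.map (CommRingCat.ofHom (algebraMap ℂ A)) = s :=
  Spec.map_preimage s

/-- A ring homomorphism compatible with the structure morphisms is a homomorphism of algebras. -/
theorem comp_algebraMap_of_specMap_comp {A B : Type} [CommRing A] [Algebra ℂ A] [CommRing B]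
    [Algebra ℂ B] {γ : A →+* B}
    (h : Spec.map (CommRingCat.ofHom γ) ≫ Spec.map (CommRingCat.ofHom (algebraMap ℂ A)) =
      Spec.map (CommRingCat.ofHom (algebraMap ℂ B))) :
    γ.comp (algebraMap ℂ A) = algebraMap ℂ B := by
  rw [← Spec.map_comp] at h
  exact congrArg CommRingCat.Hom.hom (Spec.map_injective h)

/-- The algebra homomorphism given by a ring homomorphism compatible with the structure
morphisms. -/
abbrev algHomOf {A B : Type} [CommRing A] [Algebra ℂ A] [CommRing B] [Algebra ℂ B] (γ : A →+* B)
    (h : γ.comp (algebraMap ℂ A) = algebraMap ℂ B) : A →ₐ[ℂ] B :=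
  { γ with commutes' := fun c => DFunLike.congr_fun h c }

variable {m n : ℕ} {A B : Type} [CommRing A] [Algebra ℂ A] [CommRing B] [Algebra ℂ B]

/-- A polynomial is bihomogeneous: it is multiplied by monomials in the scalars when the two groups
of coordinates are scaled. -/
def IsBihom (f : BiPoly m n) : Prop :=
  ∃ d e : ℕ, ∀ (A : Type) [CommRing A] [Algebra ℂ A] (c c' : A) (l : Fin (m + 1) → A)
    (x : Fin (n + 1) → A), aeval (Sum.elim (fun i => c * l i) (fun j => c' * x j)) f =
      c ^ d * c' ^ e * aeval (Sum.elim l x) f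

theorem IsBihom.eq_zero {f : BiPoly m n} (hf : IsBihom f) {l l' : Fin (m + 1) → A}
    {x x' : Fin (n + 1) → A} (hl : ∀ i j, l i * l' j = l j * l' i)
    (hx : ∀ i j, x i * x' j = x j * x' i) {i : Fin (m + 1)} {j : Fin (n + 1)} (hi : IsUnit (l i))
    (hj : IsUnit (x j)) (h : aeval (Sum.elim l x) f = 0) : aeval (Sum.elim l' x') f = 0 := by
  obtain ⟨d, e, hf⟩ := hf
  obtain ⟨a, ha⟩ := hi.exists_left_inv
  obtain ⟨b, hb⟩ := hj.exists_left_inv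
  have h1 : l' = fun k => a * l' i * l k := funext fun k => by
    linear_combination a * hl i k - l' k * ha
  have h2 : x' = fun k => b * x' j * x k := funext fun k => by
    linear_combination b * hx j k - x' k * hb
  rw [h1, h2, hf, h, mul_zero]

theorem aeval_algHom (φ : A →ₐ[ℂ] B) (l : Fin (m + 1) → A) (x : Fin (n + 1) → A)
    (f : BiPoly m n) : aeval (Sum.elim (φ ∘ l) (φ ∘ x)) f = φ (aeval (Sum.elim l x) f) := by
  rw [← Sum.comp_elim]
  exact (DFunLike.congr_fun (comp_aeval (R := ℂ) (Sum.elim l x) φ) f).symm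

variable {S : Set (BiPoly m n)}

theorem chart_mk_eq_zero {f : BiPoly m n} (hf : f ∈ S) (i : Fin (m + 1)) (j : Fin (n + 1)) :
    aeval (Sum.elim (fun a => Ideal.Quotient.mk (chartIdeal S i j) (X (Sum.inl a)))
      (fun b => Ideal.Quotient.mk (chartIdeal S i j) (X (Sum.inr b)))) f = 0 := by
  have : (Sum.elim (fun a => Ideal.Quotient.mk (chartIdeal S i j) (X (Sum.inl a)))
      (fun b => Ideal.Quotient.mk (chartIdeal S i j) (X (Sum.inr b)))) =
      (Ideal.Quotient.mkₐ ℂ (chartIdeal S i j)) ∘ X := by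
    ext (a | b) <;> rfl
  rw [this]
  refine (DFunLike.congr_fun (comp_aeval (R := ℂ) (X : _ → BiPoly m n)
    (Ideal.Quotient.mkₐ ℂ (chartIdeal S i j))) f).symm.trans ?_
  rw [AlgHom.comp_apply, aeval_X_left, AlgHom.id_apply]
  exact Ideal.Quotient.eq_zero_iff_mem.2 (Ideal.subset_span (Or.inl hf))

theorem eq_zero_of_locally {A : Type*} [CommRing A] {z : A}
    (h : ∀ y : PrimeSpectrum A, ∃ a, a ∉ y.asIdeal ∧ algebraMap A (Localization.Away a) z = 0) :
    z = 0 := by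
  choose a ha ha0 using h
  refine eq_zero_of_span (s := Set.range a) ?_ (by rintro _ ⟨y, rfl⟩; exact ha0 y)
  by_contra hne
  obtain ⟨M, hM, hle⟩ := Ideal.exists_le_maximal _ hne
  exact ha ⟨M, hM.isPrime⟩ (hle (Ideal.subset_span ⟨_, rfl⟩))

theorem map_aeval_eq_zero_iff {R B O : Type} [CommRing R] [CommRing B] [CommRing O] [Algebra ℂ R]
    [Algebra ℂ B] (G : R →+* O) (ρ : B →+* O) {l : Fin (m + 1) → R} {x : Fin (n + 1) → R}
    {hl : Ideal.span (Set.range l) = ⊤} {hx : Ideal.span (Set.range x) = ⊤}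
    {i : Fin (m + 1)} {j : Fin (n + 1)} (hi : IsUnit (G (l i))) (hj : IsUnit (G (x j)))
    {l' : Fin (m + 1) → B} {x' : Fin (n + 1) → B}
    {hl' : Ideal.span (Set.range l') = ⊤} {hx' : Ideal.span (Set.range x') = ⊤}
    (h : Spec.map (CommRingCat.ofHom G) ≫ bipt l x hl hx =
      Spec.map (CommRingCat.ofHom ρ) ≫ bipt l' x' hl' hx') {f : BiPoly m n} (hf : IsBihom f) :
    G (aeval (Sum.elim l x) f) = 0 ↔ ρ (aeval (Sum.elim l' x') f) = 0 := by
  let : Algebra ℂ O := (ρ.comp (algebraMap ℂ B)).toAlgebra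
  have e3 : ρ.comp (algebraMap ℂ B) = algebraMap ℂ O := rfl
  have e2 : G.comp (algebraMap ℂ R) = algebraMap ℂ O := by
    have := congrArg (· ≫ PPP.str m n) h
    simp only [Category.assoc, bipt_str] at this
    apply comp_algebraMap_of_specMap_comp
    rw [this, ← e3, CommRingCat.ofHom_comp, Spec.map_comp]
  have h1 := specMap_bipt (algHomOf G e2) l x hl hx (span_range_map _ hl) (span_range_map _ hx)
  have h2 := specMap_bipt (algHomOf ρ e3) l' x' hl' hx' (span_range_map _ hl')
    (span_range_map _ hx')
  obtain ⟨h3, h4⟩ := minors_of_bipt_eq_bipt (h1.symm.trans (h.trans h2))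
  have h5 := aeval_algHom (algHomOf G e2) l x f
  have h6 := aeval_algHom (algHomOf ρ e3) l' x' f
  change _ = G _ at h5
  change _ = ρ _ at h6
  rw [← h5, ← h6]
  constructor
  · exact hf.eq_zero h3 h4 hi hj
  · refine hf.eq_zero (fun i j => ?_) (fun i j => ?_)
      (isUnit_of_minors (span_range_map (algHomOf ρ e3) hl') h3 hi)
      (isUnit_of_minors (span_range_map (algHomOf ρ e3) hx') h4 hj)
    · rw [mul_comm, h3, mul_comm]
    · rw [mul_comm, h4, mul_comm]

instance (n : ℕ) : IsProper (PP.str n) := by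
  have h1 : Algebra.FiniteType (gr n 0) (MvPolynomial (Fin (n + 1)) ℂ) :=
    ⟨⟨(Set.finite_range X).toFinset, by
      rw [Set.Finite.coe_toFinset, adjoin_gr_zero_range_X]⟩⟩
  have h2 : Function.Bijective (algebraMap ℂ (gr n 0)) := by
    constructor
    · intro a b h
      exact C_injective (Fin (n + 1)) ℂ (congrArg Subtype.val h)
    · rintro ⟨f, hf⟩
      obtain ⟨c, hc⟩ := Submodule.mem_one.1 ((homogeneousSubmodule_zero (σ := Fin (n + 1))
        (R := ℂ)).le hf)
      exact ⟨c, Subtype.ext hc⟩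
  have h3 : IsIso (CommRingCat.ofHom (algebraMap ℂ (gr n 0))) :=
    (ConcreteCategory.isIso_iff_bijective _).2 h2
  rw [PP.str]
  infer_instance

instance : IsProper (PPP.str m n) := by
  rw [PPP.str]
  infer_instance

instance (S : Set (BiPoly m n)) : IsProper (str S) := by
  rw [str]
  infer_instance

instance (i : Fin (m + 1)) (j : Fin (n + 1)) : IsAffineHom (chart S i j) := by
  have : IsAffineHom (chart S i j ≫ PPP.str m n) := by
    rw [chart, bipt_str]
    infer_instance
  have h2 : IsSeparated (PPP.str m n) := inferInstance
  exact MorphismProperty.of_postcomp @IsAffineHom (chart S i j) (PPP.str m n) h2 this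

theorem aeval_mem_ideal_ker_chart (hS : ∀ f ∈ S, IsBihom f) {f : BiPoly m n} (hf : f ∈ S)
    {V : (PPP m n).Opens} (hV : IsAffineOpen V) (i i' : Fin (m + 1)) (j j' : Fin (n + 1))
    [Algebra ℂ Γ(PPP m n, V)] (l : Fin (m + 1) → Γ(PPP m n, V)) (x : Fin (n + 1) → Γ(PPP m n, V))
    (hl : Ideal.span (Set.range l) = ⊤) (hx : Ideal.span (Set.range x) = ⊤) (hli : l i' = 1)
    (hxj : x j' = 1) (h : hV.fromSpec = bipt l x hl hx) :
    aeval (Sum.elim l x) f ∈ (chart S i j).ker.ideal ⟨V, hV⟩ := by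
  rw [Scheme.Hom.ker_apply, RingHom.mem_ker]
  have hO : IsAffineOpen (chart S i j ⁻¹ᵁ V) := hV.preimage _
  let G := (chart S i j).app V
  let ρ : CommRingCat.of (BiPoly m n ⧸ chartIdeal S i j) ⟶ _ := Spec.preimage hO.fromSpec
  have hρ : Spec.map ρ = hO.fromSpec := Spec.map_preimage _
  have e1 : Spec.map G ≫ bipt l x hl hx = Spec.map ρ ≫ chart S i j := by
    have := hV.SpecMap_appLE_fromSpec (chart S i j) hO le_rfl
    rw [← Scheme.Hom.app_eq_appLE] at this
    rw [hρ, ← this, h]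
  exact (map_aeval_eq_zero_iff G.hom ρ.hom (i := i') (j := j') (by simp [hli]) (by simp [hxj]) e1
    (hS f hf)).2 (by rw [chart_mk_eq_zero hf, map_zero])

theorem le_ker_bipt_iff (hS : ∀ f ∈ S, IsBihom f) (l : Fin (m + 1) → A) (x : Fin (n + 1) → A)
    (hl : Ideal.span (Set.range l) = ⊤) (hx : Ideal.span (Set.range x) = ⊤) :
    zeroIdeal S ≤ (bipt l x hl hx).ker ↔ ∀ f ∈ S, aeval (Sum.elim l x) f = 0 := by
  constructor
  · intro h f hf
    have hloc : ∀ y : PrimeSpectrum A, ∃ a, a ∉ y.asIdeal ∧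
        algebraMap A (Localization.Away a) (aeval (Sum.elim l x) f) = 0 := by
      intro y
      obtain ⟨i, j, hij⟩ := exists_mem_stdOpen (bipt l x hl hx y)
      obtain ⟨_, ⟨V, hV, rfl⟩, hyV, hVij⟩ := (PPP m n).isBasis_affineOpens.exists_subset_of_mem_open
        hij (stdOpen i j).2
      obtain ⟨a, ha, γ, hγ⟩ := exists_away_factor (bipt l x hl hx) y hV hyV
      refine ⟨a, ha, ?_⟩
      let : Algebra ℂ Γ(PPP m n, V) := algebraOfHom (A := Γ(PPP m n, V)) (hV.fromSpec ≫ PPP.str m n)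
      obtain ⟨l', x', hl', hx', hli, hxj, hb⟩ := exists_eq_bipt (A := Γ(PPP m n, V)) hV.fromSpec
        (specMap_algebraOfHom (A := Γ(PPP m n, V)) (hV.fromSpec ≫ PPP.str m n)).symm i j
        (fun y => hVij (hV.range_fromSpec.le ⟨y, rfl⟩))
      rw [hb] at hγ
      refine (map_aeval_eq_zero_iff γ.hom (algebraMap A (Localization.Away a)) (i := i) (j := j)
        (by simp [hli]) (by simp [hxj]) hγ.symm (hS f hf)).1 ?_
      have h1 : aeval (Sum.elim l' x') f ∈ (zeroIdeal S).ideal ⟨V, hV⟩ := by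
        rw [zeroIdeal, Scheme.IdealSheafData.ideal_iInf]
        simp only [iInf_apply, Ideal.mem_iInf, Scheme.IdealSheafData.ideal_iInf]
        intro i' j'
        exact aeval_mem_ideal_ker_chart hS hf hV i' i j' j l' x' hl' hx' hli hxj hb
      replace h1 := (pullIdeal_fromSpec (zeroIdeal S) hV).ge h1
      have h2 : pullIdeal (zeroIdeal S) (Spec.map (CommRingCat.ofHom γ.hom) ≫ hV.fromSpec) = ⊥ := by
        rw [pullIdeal_eq_bot_iff]
        refine h.trans ?_
        have := Scheme.Hom.le_ker_comp (Spec.map (CommRingCat.ofHom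
          (algebraMap A (Localization.Away a)))) (bipt l x hl hx)
        rw [hγ, ← hb] at this
        exact this
      rw [pullIdeal_specMap] at h2
      have h3 := Ideal.mem_map_of_mem γ.hom h1
      rw [h2] at h3
      exact h3
    exact eq_zero_of_locally hloc
  · intro h
    rw [← pullIdeal_eq_bot_iff, eq_bot_iff]
    intro z hz
    refine eq_zero_of_locally fun y => ?_
    obtain ⟨i, hi⟩ := exists_notMem_of_span_eq_top hl y
    obtain ⟨j, hj⟩ := exists_notMem_of_span_eq_top hx y
    refine ⟨l i * x j, fun h => (y.2.mem_or_mem h).elim hi hj, ?_⟩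
    have hu := IsLocalization.Away.algebraMap_isUnit (S := Localization.Away (l i * x j)) (l i * x j)
    rw [map_mul] at hu
    obtain ⟨u, hu1⟩ := (isUnit_of_mul_isUnit_left hu).exists_left_inv
    obtain ⟨v, hv1⟩ := (isUnit_of_mul_isUnit_right hu).exists_left_inv
    let φ := locHom (l i * x j)
    change u * φ (l i) = 1 at hu1
    change v * φ (x j) = 1 at hv1
    let e : BiPoly m n →ₐ[ℂ] Localization.Away (l i * x j) :=
      aeval (Sum.elim (fun k => u * φ (l k)) (fun k => v * φ (x k)))
    have he : ∀ f ∈ chartIdeal S i j, e f = 0 := by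
      suffices hle : chartIdeal S i j ≤ RingHom.ker e from fun f hf => hle hf
      rw [chartIdeal, Ideal.span_le]
      rintro f (hf | rfl | rfl)
      · obtain ⟨d, d', hd⟩ := hS f hf
        refine (hd _ u v (φ ∘ l) (φ ∘ x)).trans ?_
        rw [aeval_algHom, h f hf, map_zero, mul_zero]
      · refine RingHom.mem_ker.2 ?_
        simp [e, hu1]
      · refine RingHom.mem_ker.2 ?_
        simp [e, hv1]
    let ρ := Ideal.Quotient.liftₐ (chartIdeal S i j) e he
    have h1 : Spec.map (CommRingCat.ofHom φ.toRingHom) ≫ bipt l x hl hx =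
        Spec.map (CommRingCat.ofHom ρ.toRingHom) ≫ chart S i j := by
      rw [specMap_bipt φ l x hl hx (span_range_map _ hl) (span_range_map _ hx)]
      refine Eq.trans ?_ (specMap_bipt ρ _ _ _ _ (span_range_map _ (span_eq_top_of_one _ i ?_))
        (span_range_map _ (span_eq_top_of_one _ j ?_))).symm
      · have hl1 : ∀ k, ρ (Ideal.Quotient.mk _ (X (Sum.inl k))) = u * φ (l k) := fun k =>
          (rfl : _ = e _).trans (by simp [e])
        have hx1 : ∀ k, ρ (Ideal.Quotient.mk _ (X (Sum.inr k))) = v * φ (x k) := fun k =>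
          (rfl : _ = e _).trans (by simp [e])
        refine bipt_eq_bipt (fun a b => ?_) (fun a b => ?_)
        · simp only [Function.comp, hl1]
          ring
        · simp only [Function.comp, hx1]
          ring
      · exact (Ideal.Quotient.mk_eq_mk_iff_sub_mem _ _).2 (Ideal.subset_span (by simp))
      · exact (Ideal.Quotient.mk_eq_mk_iff_sub_mem _ _).2 (Ideal.subset_span (by simp))
    have h2 : pullIdeal (zeroIdeal S)
        (Spec.map (CommRingCat.ofHom φ.toRingHom) ≫ bipt l x hl hx) = ⊥ := by
      rw [pullIdeal_eq_bot_iff, h1]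
      exact ((iInf_le _ i).trans (iInf_le _ j)).trans (Scheme.Hom.le_ker_comp _ _)
    have h3 := Ideal.mem_map_of_mem φ.toRingHom hz
    rw [← pullIdeal_specMap, h2] at h3
    exact h3

end BiProj

/-! ### Effective Cartier divisors and blowups -/

namespace Blow

open Scheme

variable {X : Scheme.{u}} {I : X.IdealSheafData}

theorem isEffectiveCartier_of_charts
    (h : ∀ x : X, ∃ (B : Type u) (_ : CommRing B) (j : Spec (CommRingCat.of B) ⟶ X)
      (_ : IsOpenImmersion j), x ∈ Set.range j ∧
      ∃ f ∈ nonZeroDivisors B, pullIdeal I j = Ideal.span {f}) : IsEffectiveCartier I := by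
  intro x
  obtain ⟨B, _, j, _, hx, f, hf, hI⟩ := h x
  have hU : IsAffineOpen j.opensRange := isAffineOpen_opensRange j
  have hr : Set.range j = Set.range hU.fromSpec := by
    rw [IsAffineOpen.range_fromSpec]
    rfl
  let e := IsOpenImmersion.isoOfRangeEq j hU.fromSpec hr
  obtain ⟨γ, hγ⟩ := Spec.map_surjective e.hom
  have hfac : Spec.map γ ≫ hU.fromSpec = j := by
    rw [hγ, IsOpenImmersion.isoOfRangeEq_hom_fac]
  have hb : Function.Bijective γ.hom := by
    rw [← isIso_SpecMap_iff, hγ]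
    infer_instance
  obtain ⟨f', rfl⟩ := hb.2 f
  refine ⟨⟨_, hU⟩, hx, f', ?_, ?_⟩
  · rw [mem_nonZeroDivisors_iff_right] at hf ⊢
    intro z hz
    refine hb.1 ?_
    rw [map_zero]
    refine hf _ ?_
    rw [← map_mul, hz, map_zero]
  · rw [← pullIdeal_fromSpec]
    have e : pullIdeal I j = _ :=
      (congrArg (pullIdeal I) hfac.symm).trans (pullIdeal_specMap I hU.fromSpec γ.hom)
    rw [hI] at e
    have e2 := congrArg (Ideal.comap γ.hom) e
    rw [Ideal.comap_map_of_bijective _ hb] at e2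
    rw [← e2, ← Set.image_singleton, ← Ideal.map_span, Ideal.comap_map_of_bijective _ hb]

theorem map_mem_nonZeroDivisors_away {B : Type*} [CommRing B] {f : B} (hf : f ∈ nonZeroDivisors B)
    (a : B) : algebraMap B (Localization.Away a) f ∈ nonZeroDivisors (Localization.Away a) :=
  IsLocalization.map_nonZeroDivisors_le (Submonoid.powers a) _ ⟨f, hf, rfl⟩

/-- An effective Cartier divisor has charts with principal ideals in arbitrarily small open
neighbourhoods of each point. -/
theorem IsEffectiveCartier.exists_chart (h : IsEffectiveCartier I) {T : Scheme.{u}} (j : T ⟶ X)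
    [IsOpenImmersion j] (t : T) :
    ∃ (B : Type u) (_ : CommRing B) (k : Spec (CommRingCat.of B) ⟶ T)
      (_ : IsOpenImmersion k), t ∈ Set.range k ∧
      ∃ f ∈ nonZeroDivisors B, pullIdeal I (k ≫ j) = Ideal.span {f} := by
  obtain ⟨⟨U, hU⟩, hx, f, hf, hI⟩ := h (j t)
  have hU : IsAffineOpen U := hU
  obtain ⟨z, hz⟩ : j t ∈ Set.range hU.fromSpec := hU.range_fromSpec.ge hx
  obtain ⟨_, ⟨a, rfl⟩, hza, ha⟩ := PrimeSpectrum.isTopologicalBasis_basic_opens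
    (R := Γ(X, U)) |>.exists_subset_of_mem_open (a := z)
    (show hU.fromSpec z ∈ j.opensRange from hz ▸ ⟨t, rfl⟩) (hU.fromSpec ⁻¹ᵁ j.opensRange).2
  let c : Spec (CommRingCat.of (Localization.Away a)) ⟶ Spec Γ(X, U) :=
    Spec.map (CommRingCat.ofHom (algebraMap Γ(X, U) (Localization.Away a)))
  have hc : IsOpenImmersion c := by
    exact isOpenImmersion_SpecMap_localizationAway (R := CommRingCat.of _) a
  have hrc : Set.range c = (PrimeSpectrum.basicOpen a : Set (PrimeSpectrum Γ(X, U))) :=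
    PrimeSpectrum.localization_away_comap_range (Localization.Away a) a
  have hr : Set.range (c ≫ hU.fromSpec) ⊆ Set.range j := by
    rintro _ ⟨y, rfl⟩
    exact ha (hrc.le ⟨y, rfl⟩)
  let k := IsOpenImmersion.lift j (c ≫ hU.fromSpec) hr
  have hk : k ≫ j = c ≫ hU.fromSpec := IsOpenImmersion.lift_fac _ _ _
  refine ⟨_, _, k, ?_, ?_, _, map_mem_nonZeroDivisors_away hf a, ?_⟩
  · have : IsOpenImmersion (k ≫ j) := by rw [hk]; infer_instance
    exact IsOpenImmersion.of_comp k j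
  · obtain ⟨y, hy⟩ := hrc.ge hza
    refine ⟨y, j.injective ?_⟩
    rw [← Scheme.Hom.comp_apply, hk, Scheme.Hom.comp_apply, hy, hz]
  · rw [hk]
    refine (pullIdeal_specMap I hU.fromSpec (algebraMap Γ(X, U) (Localization.Away a))).trans ?_
    rw [pullIdeal_fromSpec I hU]
    refine (congrArg (Ideal.map _) hI).trans ?_
    rw [Ideal.map_span, Set.image_singleton]

theorem IsEffectiveCartier.comap_of_isOpenImmersion (h : IsEffectiveCartier I) {T : Scheme.{u}}
    (j : T ⟶ X) [IsOpenImmersion j] : IsEffectiveCartier (I.comap j) := by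
  refine isEffectiveCartier_of_charts fun t => ?_
  obtain ⟨B, hB, k, hk, ht, f, hf, hI⟩ := h.exists_chart j t
  exact ⟨B, hB, k, hk, ht, f, hf, by rw [pullIdeal_comap, hI]⟩

theorem isEffectiveCartier_of_cover
    (h : ∀ x : X, ∃ (T : Scheme.{u}) (j : T ⟶ X) (_ : IsOpenImmersion j), x ∈ Set.range j ∧
      IsEffectiveCartier (I.comap j)) : IsEffectiveCartier I := by
  refine isEffectiveCartier_of_charts fun x => ?_
  obtain ⟨T, j, _, ⟨t, rfl⟩, hc⟩ := h x
  obtain ⟨B, hB, k, hk, ⟨y, rfl⟩, f, hf, hI⟩ := hc.exists_chart (𝟙 T) t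
  rw [Category.comp_id, pullIdeal_comap] at hI
  exact ⟨B, hB, k ≫ j, inferInstance, ⟨y, by simp⟩, f, hf, hI⟩

variable {A : Type u} [CommRing A]

theorem isEffectiveCartier_comap_of_locally (F : Spec (CommRingCat.of A) ⟶ X)
    (h : ∀ y : PrimeSpectrum A, ∃ a, a ∉ y.asIdeal ∧ ∃ f ∈ nonZeroDivisors (Localization.Away a),
      (pullIdeal I F).map (algebraMap A (Localization.Away a)) = Ideal.span {f}) :
    IsEffectiveCartier (I.comap F) := by
  refine isEffectiveCartier_of_charts fun y => ?_
  obtain ⟨a, ha, f, hf, hI⟩ := h y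
  refine ⟨_, _, Spec.map (CommRingCat.ofHom (algebraMap A (Localization.Away a))),
    isOpenImmersion_SpecMap_localizationAway (R := CommRingCat.of _) a, ?_, f, hf, ?_⟩
  · have := PrimeSpectrum.localization_away_comap_range (Localization.Away a) a
    exact this.ge ha
  · rw [pullIdeal_comap, pullIdeal_specMap, hI]

theorem isEffectiveCartier_comap_of_eq_span (F : Spec (CommRingCat.of A) ⟶ X) {f : A}
    (hf : f ∈ nonZeroDivisors A) (h : pullIdeal I F = Ideal.span {f}) :
    IsEffectiveCartier (I.comap F) := by
  refine isEffectiveCartier_comap_of_locally F fun y => ⟨1, y.2.one_notMem, _,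
    map_mem_nonZeroDivisors_away hf 1, ?_⟩
  rw [h, Ideal.map_span, Set.image_singleton]

theorem IsEffectiveCartier.exists_away (h : IsEffectiveCartier I)
    (F : Spec (CommRingCat.of A) ⟶ X) (y : PrimeSpectrum A) : ∃ a, a ∉ y.asIdeal ∧ ∃ f,
      (pullIdeal I F).map (algebraMap A (Localization.Away a)) = Ideal.span {f} := by
  obtain ⟨⟨U, hU⟩, hx, f, hf, hI⟩ := h (F y)
  have hU : IsAffineOpen U := hU
  obtain ⟨a, ha, γ, hγ⟩ := exists_away_factor F y hU hx
  refine ⟨a, ha, γ.hom f, ?_⟩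
  rw [← pullIdeal_specMap, hγ]
  refine (pullIdeal_specMap I hU.fromSpec γ.hom).trans ?_
  rw [pullIdeal_fromSpec I hU]
  refine (congrArg (Ideal.map _) hI).trans ?_
  rw [Ideal.map_span, Set.image_singleton]

theorem mem_nonZeroDivisors_of_dvd {B : Type*} [CommRing B] {f n : B} (hn : n ∈ nonZeroDivisors B)
    (h : f ∣ n) : f ∈ nonZeroDivisors B := by
  obtain ⟨c, rfl⟩ := h
  exact (mul_mem_nonZeroDivisors.1 hn).1

/-- The inverse image of an effective Cartier divisor is an effective Cartier divisor as soon as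
its ideal contains a nonzerodivisor. -/
theorem IsEffectiveCartier.comap_of_mem (h : IsEffectiveCartier I)
    (F : Spec (CommRingCat.of A) ⟶ X) {n : A} (hn : n ∈ nonZeroDivisors A)
    (hnI : n ∈ pullIdeal I F) : IsEffectiveCartier (I.comap F) := by
  refine isEffectiveCartier_comap_of_locally F fun y => ?_
  obtain ⟨a, ha, f, hf⟩ := h.exists_away F y
  refine ⟨a, ha, f, mem_nonZeroDivisors_of_dvd (map_mem_nonZeroDivisors_away hn a) ?_, hf⟩
  rw [← Ideal.mem_span_singleton, ← hf]
  exact Ideal.mem_map_of_mem _ hnI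

variable {B : Scheme.{u}} {b : B ⟶ X}

/-- Morphisms to a blowup are determined by their composition to the base if the inverse image of
the center contains a nonzerodivisor. -/
theorem IsBlowup.hom_ext (hb : IsBlowup b I) {h h' : Spec (CommRingCat.of A) ⟶ B}
    (e : h ≫ b = h' ≫ b) {n : A} (hn : n ∈ nonZeroDivisors A) (hnI : n ∈ pullIdeal I (h ≫ b)) :
    h = h' := by
  have hc : IsEffectiveCartier (I.comap (h ≫ b)) := by
    rw [IdealSheafData.comap_comp]
    exact hb.cartier.comap_of_mem h hn (by rwa [pullIdeal_comap])
  exact (hb.universal _ (h ≫ b) hc).unique rfl e.symm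

theorem IsBlowup.of_isPullback (hb : IsBlowup b I) {U B' : Scheme.{u}} {j : U ⟶ X}
    [IsOpenImmersion j] {j' : B' ⟶ B} {b' : B' ⟶ U} (sq : IsPullback j' b' b j) :
    IsBlowup b' (I.comap j) := by
  have : IsOpenImmersion j' := MorphismProperty.of_isPullback sq.flip inferInstance
  refine ⟨?_, fun T g hg => ?_⟩
  · rw [← IdealSheafData.comap_comp, ← sq.w, IdealSheafData.comap_comp]
    exact hb.cartier.comap_of_isOpenImmersion j'
  · rw [← IdealSheafData.comap_comp] at hg
    obtain ⟨h, hh, hu⟩ := hb.universal T (g ≫ j) hg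
    refine ⟨sq.lift h g hh, sq.lift_snd _ _ _, fun k hk => ?_⟩
    apply sq.hom_ext
    · rw [sq.lift_fst]
      refine hu _ ?_
      change (k ≫ j') ≫ b = g ≫ j
      rw [Category.assoc, sq.w, reassoc_of% hk]
    · rw [sq.lift_snd, hk]

end Blow

/-! ### The blowup of an affine scheme -/

namespace Rees

open Polynomial

variable {A : Type u} [CommRing A] (I : Ideal A)

/-- The degree `n` part of the Rees algebra. -/
def gr (n : ℕ) : Submodule A (reesAlgebra I) :=
  (LinearMap.range (monomial n : A →ₗ[A] A[X])).comap (reesAlgebra I).val.toLinearMap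

variable {I}

theorem mem_gr_iff {n : ℕ} {f : reesAlgebra I} : f ∈ gr I n ↔ monomial n (f.1.coeff n) = f.1 := by
  constructor
  · rintro ⟨a, ha⟩
    change monomial n a = f.1 at ha
    rw [← ha, coeff_monomial_same]
  · exact fun h => ⟨_, h⟩

/-- The element `a Tⁿ` of the Rees algebra. -/
def mono (n : ℕ) (a : A) (ha : a ∈ I ^ n) : reesAlgebra I :=
  ⟨monomial n a, reesAlgebra.monomial_mem.2 ha⟩

theorem mono_mem (n : ℕ) (a : A) (ha : a ∈ I ^ n) : mono n a ha ∈ gr I n := ⟨a, rfl⟩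

theorem exists_eq_mono {n : ℕ} {f : reesAlgebra I} (h : f ∈ gr I n) :
    ∃ a ha, f = mono n a ha :=
  ⟨f.1.coeff n, f.2 n, Subtype.ext (mem_gr_iff.1 h).symm⟩

theorem mono_mul (m n : ℕ) (a b : A) (ha : a ∈ I ^ m) (hb : b ∈ I ^ n) :
    mono m a ha * mono n b hb = mono (m + n) (a * b) (by rw [pow_add]; exact Ideal.mul_mem_mul ha hb) :=
  Subtype.ext (monomial_mul_monomial m n a b)

instance : SetLike.GradedMonoid (gr I) where
  one_mem := ⟨1, rfl⟩
  mul_mem := by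
    rintro m n f g hf hg
    obtain ⟨a, ha, rfl⟩ := exists_eq_mono hf
    obtain ⟨b, hb, rfl⟩ := exists_eq_mono hg
    rw [mono_mul]
    exact mono_mem _ _ _

theorem coeff_coeAddMonoidHom (x : DirectSum ℕ fun n => gr I n) (n : ℕ) :
    (DirectSum.coeAddMonoidHom (gr I) x).1.coeff n = (x n).1.1.coeff n := by
  induction x using DirectSum.induction_on with
  | zero => simp
  | of m f =>
    rw [DirectSum.coeAddMonoidHom_of]
    by_cases h : m = n
    · subst h
      rw [DirectSum.of_eq_same]
    · rw [DirectSum.of_eq_of_ne _ _ _ (Ne.symm h), ← mem_gr_iff.1 f.2, coeff_monomial_of_ne _ (Ne.symm h)]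
      rfl
  | add x y hx hy =>
    rw [map_add, DirectSum.add_apply]
    simp only [Subalgebra.coe_add, Submodule.coe_add, coeff_add, hx, hy]

theorem isInternal : DirectSum.IsInternal (gr I) := by
  constructor
  · intro x y hxy
    ext n : 1
    refine Subtype.ext (Subtype.ext ?_)
    rw [← mem_gr_iff.1 (x n).2, ← mem_gr_iff.1 (y n).2, ← coeff_coeAddMonoidHom, hxy,
      coeff_coeAddMonoidHom]
  · intro f
    refine ⟨∑ n ∈ f.1.support, DirectSum.of (fun n => gr I n) n
      ⟨mono n (f.1.coeff n) (f.2 n), mono_mem _ _ _⟩, ?_⟩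
    rw [map_sum]
    simp only [DirectSum.coeAddMonoidHom_of]
    refine Subtype.ext ?_
    conv_rhs => rw [f.1.as_sum_support]
    rw [AddSubmonoidClass.coe_finsetSum]
    rfl

instance : GradedAlgebra (gr I) where
  toDecomposition := isInternal.chooseDecomposition

open HomogeneousLocalization

variable (I)

/-- The morphism from the blowup of an affine scheme to the base. -/
def toBase : Proj (gr I) ⟶ Spec (CommRingCat.of A) :=
  Proj.toSpecZero (gr I) ≫ Spec.map (CommRingCat.ofHom (algebraMap A (gr I 0)))

variable {I}

theorem isProper_toBase (hI : I.FG) : IsProper (toBase I) := by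
  have h2 : Function.Bijective (algebraMap A (gr I 0)) := by
    constructor
    · intro a b h
      have h1 : C a = C b := congrArg (fun z : gr I 0 => z.1.1) h
      exact C_injective h1
    · rintro ⟨f, hf⟩
      obtain ⟨c, hc, rfl⟩ := exists_eq_mono hf
      exact ⟨c, Subtype.ext (Subtype.ext rfl)⟩
  have h3 : IsIso (Spec.map (CommRingCat.ofHom (algebraMap A (gr I 0))) :
      Spec (CommRingCat.of (gr I 0)) ⟶ Spec (CommRingCat.of A)) :=
    (Scheme.Spec.mapIso (RingEquiv.ofBijective _ h2).toCommRingCatIso.op).isIso_hom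
  have h4 : IsScalarTower A (gr I 0) (reesAlgebra I) :=
    ⟨fun a b c => smul_mul_assoc a b.1 c⟩
  have h5 : Algebra.FiniteType A (reesAlgebra I) :=
    (Subalgebra.fg_iff_finiteType _).1 (reesAlgebra.fg hI)
  have h1 : Algebra.FiniteType (gr I 0) (reesAlgebra I) :=
    Algebra.FiniteType.of_restrictScalars_finiteType A (gr I 0) (reesAlgebra I)
  rw [toBase]
  infer_instance

/-- The element `f T` of the Rees algebra. -/
abbrev tt (f : I) : reesAlgebra I := mono 1 f.1 (by simp)

theorem tt_mem (f : I) : tt f ∈ gr I 1 := mono_mem _ _ _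

theorem adjoin_tt : Algebra.adjoin A (Set.range (tt (I := I))) = ⊤ := by
  have h := adjoin_monomial_eq_reesAlgebra I
  have h2 : (Submodule.map (monomial 1 : A →ₗ[A] A[X]) I : Set A[X]) =
      (reesAlgebra I).val '' Set.range (tt (I := I)) := by
    ext f
    constructor
    · rintro ⟨a, ha, rfl⟩
      exact ⟨_, ⟨⟨a, ha⟩, rfl⟩, rfl⟩
    · rintro ⟨_, ⟨a, rfl⟩, rfl⟩
      exact ⟨a.1, a.2, rfl⟩
  rw [h2, ← AlgHom.map_adjoin] at h
  refine top_le_iff.1 fun f _ => ?_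
  have hf : f.1 ∈ (Algebra.adjoin A (Set.range (tt (I := I)))).map (reesAlgebra I).val := by
    rw [h]; exact f.2
  obtain ⟨g, hg, hgf⟩ := hf
  rwa [← Subtype.ext hgf]

theorem exists_mem_basicOpen (x : Proj (gr I)) : ∃ f : I, x ∈ Proj.basicOpen (gr I) (tt f) := by
  have h : ⨆ f : I, Proj.basicOpen (gr I) (tt f) = ⊤ := by
    refine Proj.iSup_basicOpen_eq_top' (gr I) _ (fun f => ⟨1, tt_mem f⟩) (top_le_iff.1 fun f _ => ?_)
    have hf : f ∈ Algebra.adjoin A (Set.range (tt (I := I))) := by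
      rw [adjoin_tt]
      trivial
    induction hf using Algebra.adjoin_induction with
    | mem x hx => exact Algebra.subset_adjoin hx
    | algebraMap r => exact Subalgebra.algebraMap_mem _ (algebraMap A (gr I 0) r)
    | add x y _ _ h1 h2 => exact add_mem (h1 trivial) (h2 trivial)
    | mul x y _ _ h1 h2 => exact mul_mem (h1 trivial) (h2 trivial)
  have hz : x ∈ ⨆ f : I, Proj.basicOpen (gr I) (tt f) := h ▸ trivial
  exact Opens.mem_iSup.1 hz

/-- The structure homomorphism of an affine chart of the blowup. -/
def chartMap (f : I) : A →+* Away (gr I) (tt f) :=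
  (fromZeroRingHom (gr I) _).comp (algebraMap A (gr I 0))

theorem awayι_toBase (f : I) : Proj.awayι (gr I) (tt f) (tt_mem f) one_pos ≫ toBase I =
    Spec.map (CommRingCat.ofHom (chartMap f)) := by
  rw [toBase, Proj.awayι_toSpecZero_assoc, ← Spec.map_comp]
  rfl

theorem mk_mul_pow (f : I) (n : ℕ) (a : A) (ha : a ∈ I ^ n) :
    Away.mk (gr I) (tt_mem f) n (mono n a ha) (by simpa using mono_mem n a ha) *
      chartMap f (f.1 ^ n) = chartMap f a := by
  apply HomogeneousLocalization.val_injective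
  rw [HomogeneousLocalization.val_mul, Away.val_mk]
  have hc : ∀ c : A, (chartMap f c).val = Localization.mk (algebraMap A _ c) 1 := fun c => rfl
  rw [hc, hc, Localization.mk_mul, Localization.mk_eq_mk_iff,
    Localization.r_iff_exists]
  refine ⟨1, ?_⟩
  simp only [OneMemClass.coe_one, one_mul, mul_one]
  refine Subtype.ext ?_
  simp only [Subalgebra.coe_mul, Subalgebra.coe_pow]
  change monomial n a * C (f.1 ^ n) = (monomial 1 f.1) ^ n * C a
  rw [monomial_mul_C, monomial_pow, monomial_mul_C, one_mul, mul_comm]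

theorem map_chartMap (f : I) : I.map (chartMap f) = Ideal.span {chartMap f f.1} := by
  apply le_antisymm
  · rw [Ideal.map_le_iff_le_comap]
    intro a ha
    rw [Ideal.mem_comap, Ideal.mem_span_singleton']
    have := mk_mul_pow f 1 a (by simpa using ha)
    exact ⟨_, (congrArg (fun c => _ * chartMap f c) (pow_one f.1).symm).trans this⟩
  · rw [Ideal.span_le, Set.singleton_subset_iff]
    exact Ideal.mem_map_of_mem _ f.2

theorem mem_nonZeroDivisors_of_forall {B : Type*} [CommRing B] {x : B}
    (h : ∀ z : B, z * x = 0 → z = 0) : x ∈ nonZeroDivisors B :=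
  mem_nonZeroDivisors_iff_right.2 h

theorem chartMap_mem_nonZeroDivisors (f : I) : chartMap f f.1 ∈ nonZeroDivisors (Away (gr I) (tt f)) := by
  refine mem_nonZeroDivisors_of_forall fun z hz => ?_
  obtain ⟨n, g, hg, rfl⟩ := Away.mk_surjective (gr I) (tt_mem f) z
  obtain ⟨a, ha, rfl⟩ := exists_eq_mono (by simpa using hg : g ∈ gr I n)
  apply HomogeneousLocalization.val_injective
  have h := congrArg HomogeneousLocalization.val hz
  have hc : (chartMap f f.1).val = Localization.mk (algebraMap A _ f.1) 1 := rfl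
  rw [HomogeneousLocalization.val_mul, Away.val_mk, hc, Localization.mk_mul,
    HomogeneousLocalization.val_zero, Localization.mk_eq_mk', IsLocalization.mk'_eq_zero_iff] at h
  rw [Away.val_mk, HomogeneousLocalization.val_zero, Localization.mk_eq_mk',
    IsLocalization.mk'_eq_zero_iff]
  obtain ⟨⟨_, k, rfl⟩, hk⟩ := h
  refine ⟨⟨_, k + 1, rfl⟩, ?_⟩
  have h1 : f.1 ^ k * a * f.1 = 0 := by
    have h2 := congrArg Subtype.val hk
    simp only [Subalgebra.coe_mul, Subalgebra.coe_pow] at h2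
    change (monomial 1 f.1) ^ k * (monomial n a * C f.1) = 0 at h2
    rw [monomial_pow, monomial_mul_C, monomial_mul_monomial, monomial_eq_zero_iff] at h2
    rw [← h2]; ring
  refine Subtype.ext ?_
  simp only [Subalgebra.coe_mul, Subalgebra.coe_pow]
  change (monomial 1 f.1) ^ (k + 1) * monomial n a = 0
  rw [monomial_pow, monomial_mul_monomial, monomial_eq_zero_iff, ← h1]
  ring

variable {R : Type u} [CommRing R] (α : A →+* R) {g : R}

/-- A homomorphism under which `I` generates the ideal of a nonzerodivisor `g` extends to the Rees
algebra by `a Tⁿ ↦ a / gⁿ`. -/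
theorem exists_lift (hg : g ∈ nonZeroDivisors R) (hI : I.map α = Ideal.span {g}) :
    ∃ e : reesAlgebra I →+* R, e.comp (algebraMap A _) = α ∧ ∀ f : I, e (tt f) * g = α f.1 := by
  let S := Localization.Away g
  have hinj : Function.Injective (algebraMap R S) :=
    IsLocalization.injective S (Submonoid.powers_le.2 hg)
  let E : reesAlgebra I →+* S :=
    (eval₂RingHom ((algebraMap R S).comp α) (IsLocalization.Away.invSelf g)).comp
      (reesAlgebra I).val.toRingHom
  have hEC : ∀ a : A, E (algebraMap A _ a) = algebraMap R S (α a) := fun a => by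
    change eval₂ _ _ (C a) = _
    rw [eval₂_C]
    rfl
  have hEt : ∀ f : I, E (tt f) * algebraMap R S g = algebraMap R S (α f.1) := fun f => by
    change eval₂ _ _ (monomial 1 f.1) * _ = _
    rw [eval₂_monomial, pow_one, mul_assoc, mul_comm (IsLocalization.Away.invSelf g),
      IsLocalization.Away.mul_invSelf, mul_one]
    rfl
  have hr : ∀ p, E p ∈ (algebraMap R S).range := by
    intro p
    have hp : p ∈ Algebra.adjoin A (Set.range (tt (I := I))) := by
      rw [adjoin_tt]
      trivial
    induction hp using Algebra.adjoin_induction with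
    | mem x hx =>
      obtain ⟨f, rfl⟩ := hx
      have hf : α f.1 ∈ Ideal.span {g} := hI ▸ Ideal.mem_map_of_mem _ f.2
      obtain ⟨c, hc⟩ := Ideal.mem_span_singleton.1 hf
      refine ⟨c, (IsLocalization.Away.algebraMap_isUnit (S := S) g).mul_right_cancel ?_⟩
      rw [hEt, hc, ← map_mul, mul_comm]
    | algebraMap r => exact ⟨α r, (hEC r).symm⟩
    | add x y _ _ h1 h2 => rw [map_add]; exact add_mem h1 h2
    | mul x y _ _ h1 h2 => rw [map_mul]; exact mul_mem h1 h2
  choose c hc using hr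
  let e : reesAlgebra I →+* R :=
    { toFun := c
      map_one' := hinj (by rw [hc, map_one, map_one])
      map_mul' := fun x y => hinj (by rw [hc, map_mul, map_mul, hc, hc])
      map_zero' := hinj (by rw [hc, map_zero, map_zero])
      map_add' := fun x y => hinj (by rw [hc, map_add, map_add, hc, hc]) }
  refine ⟨e, RingHom.ext fun a => hinj ((hc _).trans (hEC a)), fun f => hinj ?_⟩
  rw [map_mul]
  refine (congrArg (· * algebraMap R S g) (hc (tt f))).trans (hEt f)

theorem exists_lift_toBase (hg : g ∈ nonZeroDivisors R) (hI : I.map α = Ideal.span {g}) :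
    ∃ h : Spec (CommRingCat.of R) ⟶ Proj (gr I), h ≫ toBase I = Spec.map (CommRingCat.ofHom α) := by
  obtain ⟨e, he, het⟩ := exists_lift α hg hI
  have h1 : (HomogeneousIdeal.irrelevant (gr I)).toIdeal.map e = ⊤ := by
    have h2 : Ideal.span {g} ≤ Ideal.span {g} * (HomogeneousIdeal.irrelevant (gr I)).toIdeal.map e := by
      nth_rw 1 [← hI]
      rw [Ideal.map_le_iff_le_comap]
      intro a ha
      rw [Ideal.mem_comap, ← het ⟨a, ha⟩, mul_comm _ g]
      refine Ideal.mul_mem_mul (Ideal.mem_span_singleton_self g) (Ideal.mem_map_of_mem _ ?_)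
      change _ ∈ HomogeneousIdeal.irrelevant (gr I)
      rw [HomogeneousIdeal.mem_irrelevant_iff]
      exact DirectSum.decompose_of_mem_ne (gr I) (tt_mem _) one_ne_zero
    have h3 := h2 (Ideal.mem_span_singleton_self g)
    rw [Ideal.mem_span_singleton_mul] at h3
    obtain ⟨z, hz, hgz⟩ := h3
    rw [Ideal.eq_top_iff_one]
    have : z = 1 := by
      refine (mem_nonZeroDivisors_iff_right.1 hg (z - 1) ?_ : z - 1 = 0) |> sub_eq_zero.1
      rw [sub_mul, one_mul, mul_comm, hgz, sub_self]
    rwa [← this]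
  refine ⟨ProjPt.projPt (gr I) e h1, ?_⟩
  rw [ProjPt.projPt, toBase, Proj.fromOfGlobalSections_toSpecZero_assoc, ← Spec.map_comp,
    ← CommRingCat.ofHom_comp]
  have h : ((((Scheme.ΓSpecIso (CommRingCat.of R)).inv.hom.comp e).comp
      (algebraMap (gr I 0) (reesAlgebra I))).comp (algebraMap A (gr I 0))) =
      (Scheme.ΓSpecIso (CommRingCat.of R)).inv.hom.comp α := by
    rw [← he]
    rfl
  rw [h, CommRingCat.ofHom_comp, Spec.map_comp]
  simp

theorem hom_ext_of_chart (f : I) {β β' : Away (gr I) (tt f) →+* R}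
    (hg : β (chartMap f f.1) ∈ nonZeroDivisors R) (h : β.comp (chartMap f) = β'.comp (chartMap f)) :
    β = β' := by
  refine ProjPt.away_hom_ext (gr I) (tt_mem f) fun n a ha => ?_
  obtain ⟨a, ha', rfl⟩ := exists_eq_mono (by simpa using ha : a ∈ gr I n)
  have e1 := congrArg β (mk_mul_pow f n a ha')
  have e2 := congrArg β' (mk_mul_pow f n a ha')
  have h' := fun a => DFunLike.congr_fun h a
  simp only [RingHom.comp_apply] at h'
  have h2 : β (chartMap f (f.1 ^ n)) ∈ nonZeroDivisors R := by
    rw [← RingHom.comp_apply, map_pow]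
    exact pow_mem hg n
  rw [map_mul] at e1
  rw [map_mul, ← h', ← h', ← e1] at e2
  exact ((mul_cancel_right_mem_nonZeroDivisors h2).1 e2).symm

theorem exists_eq_comp_awayι (f : I) (h : Spec (CommRingCat.of R) ⟶ Proj (gr I))
    (hh : ∀ y, h y ∈ Proj.basicOpen (gr I) (tt f)) :
    ∃ β : Away (gr I) (tt f) →+* R, h =
      Spec.map (CommRingCat.ofHom β) ≫ Proj.awayι (gr I) (tt f) (tt_mem f) one_pos := by
  have hr : Set.range h ⊆ Set.range (Proj.awayι (gr I) (tt f) (tt_mem f) one_pos) := by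
    have := congrArg (fun U : Opens _ => (U : Set (Proj (gr I))))
      (Proj.opensRange_awayι (gr I) (tt f) (tt_mem f) one_pos)
    refine subset_of_subset_of_eq ?_ this.symm
    rintro _ ⟨y, rfl⟩
    exact hh y
  obtain ⟨β, hβ⟩ := Spec.map_surjective (IsOpenImmersion.lift _ _ hr)
  exact ⟨β.hom, by rw [CommRingCat.ofHom_hom, hβ, IsOpenImmersion.lift_fac]⟩

theorem hom_ext_of_mem_basicOpen {f f' : I} {h h' : Spec (CommRingCat.of R) ⟶ Proj (gr I)}
    (e : h' ≫ toBase I = Spec.map (CommRingCat.ofHom α))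
    (hα : h ≫ toBase I = Spec.map (CommRingCat.ofHom α))
    (hg : g ∈ nonZeroDivisors R) (hI : I.map α = Ideal.span {g})
    (hf : ∀ y, h y ∈ Proj.basicOpen (gr I) (tt f))
    (hf' : ∀ y, h' y ∈ Proj.basicOpen (gr I) (tt f')) : h = h' := by
  have key : ∀ (f : I) (h : Spec (CommRingCat.of R) ⟶ Proj (gr I)),
      h ≫ toBase I = Spec.map (CommRingCat.ofHom α) → 
      (∀ y, h y ∈ Proj.basicOpen (gr I) (tt f)) → 
      ∃ β : Away (gr I) (tt f) →+* R, β.comp (chartMap f) = α ∧ h =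
      Spec.map (CommRingCat.ofHom β) ≫ Proj.awayι (gr I) (tt f) (tt_mem f) one_pos := by
    intro f h hα hf
    obtain ⟨β, hβ⟩ := exists_eq_comp_awayι f h hf
    refine ⟨β, ?_, hβ⟩
    rw [hβ, Category.assoc, awayι_toBase, ← Spec.map_comp] at hα
    exact congrArg CommRingCat.Hom.hom (Spec.map_injective hα)
  have hgen : ∀ f : I, ∀ β : Away (gr I) (tt f) →+* R, β.comp (chartMap f) = α →
      Ideal.span {α f.1} = Ideal.span {g} := by
    intro f β hβ
    rw [← hI, ← hβ, ← Ideal.map_map, map_chartMap, Ideal.map_span, Set.image_singleton,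
      RingHom.comp_apply]
  obtain ⟨β, hβ, rfl⟩ := key f h hα hf
  obtain ⟨β', hβ', rfl⟩ := key f' h' e hf'
  have h1 : α f.1 ∈ nonZeroDivisors R := by
    refine Blow.mem_nonZeroDivisors_of_dvd hg ?_
    rw [← Ideal.mem_span_singleton, hgen f β hβ]
    exact Ideal.mem_span_singleton_self g
  have h2 : IsUnit (β' (Away.isLocalizationElem (tt_mem f') (tt_mem f))) := by
    have h3 := congrArg β' (mk_mul_pow f' 1 f.1 (by simp))
    rw [map_mul] at h3
    have h4 : β' (chartMap f' (f'.1 ^ 1)) = α f'.1 := by rw [← hβ', pow_one, RingHom.comp_apply]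
    rw [h4, ← RingHom.comp_apply, hβ'] at h3
    have h5 : α f'.1 ∈ Ideal.span {α f.1} := by
      rw [hgen f β hβ, ← hgen f' β' hβ']
      exact Ideal.mem_span_singleton_self _
    obtain ⟨c, hc⟩ := Ideal.mem_span_singleton.1 h5
    have h6 : β' (Away.isLocalizationElem (tt_mem f') (tt_mem f)) * α f'.1 = α f.1 := by
      rw [← h3]
      congr 2
      apply HomogeneousLocalization.val_injective
      rw [Away.val_mk, Away.val_mk]
      simp only [pow_one]
    refine IsUnit.of_mul_eq_one c ?_
    have h7 : (β' (Away.isLocalizationElem (tt_mem f') (tt_mem f)) * c - 1) * α f.1 = 0 := by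
      rw [sub_mul, one_mul, mul_assoc, mul_comm c, ← hc, h6, sub_self]
    exact sub_eq_zero.1 (mem_nonZeroDivisors_iff_right.1 h1 _ h7)
  obtain ⟨β'', hβ'', hh⟩ := key f _ e fun y => by
    have h3 := Proj.awayι_preimage_basicOpen (gr I) (tt_mem f') one_pos (tt_mem f) one_pos
    have h4 : Spec.map (CommRingCat.ofHom β') y ∈
        Proj.awayι (gr I) (tt f') (tt_mem f') one_pos ⁻¹ᵁ Proj.basicOpen (gr I) (tt f) := by
      rw [h3]
      intro h5
      exact y.2.ne_top (Ideal.eq_top_of_isUnit_mem _ h5 h2)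
    rwa [Scheme.Hom.comp_apply]
  rw [hh]
  congr 3
  refine hom_ext_of_chart f ?_ (hβ.trans hβ''.symm)
  rwa [← RingHom.comp_apply, hβ]

theorem hom_ext_toBase {h h' : Spec (CommRingCat.of R) ⟶ Proj (gr I)}
    (e : h' ≫ toBase I = Spec.map (CommRingCat.ofHom α))
    (hα : h ≫ toBase I = Spec.map (CommRingCat.ofHom α))
    (hg : g ∈ nonZeroDivisors R) (hI : I.map α = Ideal.span {g}) : h = h' := by
  have h1 : ∀ y : PrimeSpectrum R, ∃ a, a ∉ y.asIdeal ∧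
      Spec.map (CommRingCat.ofHom (algebraMap R (Localization.Away a))) ≫ h = 
      Spec.map (CommRingCat.ofHom (algebraMap R (Localization.Away a))) ≫ h' := by
    intro y
    obtain ⟨f, hf⟩ := exists_mem_basicOpen (h y)
    obtain ⟨f', hf'⟩ := exists_mem_basicOpen (h' y)
    obtain ⟨_, ⟨a, rfl⟩, hya, haU⟩ := PrimeSpectrum.isTopologicalBasis_basic_opens
      (R := R) |>.exists_subset_of_mem_open (a := y) (u := ((h ⁻¹ᵁ Proj.basicOpen (gr I) (tt f) ⊓
        h' ⁻¹ᵁ Proj.basicOpen (gr I) (tt f') : (Spec (CommRingCat.of R)).Opens) : Set (Spec (CommRingCat.of R)))) (And.intro hf hf') (Opens.isOpen _)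
    have hz : ∀ z : Spec (CommRingCat.of (Localization.Away a)),
        Spec.map (CommRingCat.ofHom (algebraMap R (Localization.Away a))) z ∈
        h ⁻¹ᵁ Proj.basicOpen (gr I) (tt f) ⊓ h' ⁻¹ᵁ Proj.basicOpen (gr I) (tt f') := fun z => 
      haU ((PrimeSpectrum.localization_away_comap_range (Localization.Away a) a).le ⟨z, rfl⟩)
    refine ⟨a, hya, hom_ext_of_mem_basicOpen ((algebraMap R (Localization.Away a)).comp α)
      (f := f) (f' := f') (g := algebraMap R _ g) ?_ ?_ (Blow.map_mem_nonZeroDivisors_away hg a) ?_ ?_ ?_⟩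
    · rw [Category.assoc, e, ← Spec.map_comp, ← CommRingCat.ofHom_comp]
    · rw [Category.assoc, hα, ← Spec.map_comp, ← CommRingCat.ofHom_comp]
    · rw [← Ideal.map_map, hI, Ideal.map_span, Set.image_singleton]
    · exact fun z => (hz z).1
    · exact fun z => (hz z).2
  choose a ha hh using h1
  refine ProjPt.spec_hom_ext_of_span (Set.range a) ?_ ?_
  · by_contra hne
    obtain ⟨m, hm, hle⟩ := Ideal.exists_le_maximal _ hne
    exact ha ⟨m, hm.isPrime⟩ (hle (Ideal.subset_span ⟨_, rfl⟩))
  · rintro _ ⟨y, rfl⟩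
    exact hh y

end Rees

/-! ### Existence of blowups -/

namespace Blow

open Scheme

variable {X B : Scheme.{u}} {I : X.IdealSheafData} {b : B ⟶ X}

theorem comp_eq_comp_of_range {T Z V : Scheme.{u}} (k : V ⟶ T) [IsOpenImmersion k] {h h' : T ⟶ Z}
    (e : k ≫ h = k ≫ h') : k.opensRange.ι ≫ h = k.opensRange.ι ≫ h' := by
  rw [← cancel_epi k.isoOpensRange.hom]
  simpa using e

/-- The universal property of the blowup can be checked locally on the base and for affine test
schemes. -/
theorem isBlowup_of_locally (hc : IsEffectiveCartier (I.comap b))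
    (hloc : ∀ x : X, ∃ U : X.Opens, x ∈ U ∧ ∀ (R : Type u) [CommRing R]
      (G : Spec (CommRingCat.of R) ⟶ X) (f : R), Set.range G ⊆ U → f ∈ nonZeroDivisors R →
      pullIdeal I G = Ideal.span {f} → ∃! h, h ≫ b = G) : IsBlowup b I := by
  have key : ∀ (T : Scheme.{u}) (g : T ⟶ X), IsEffectiveCartier (I.comap g) → ∀ t : T,
      ∃ (V : Scheme.{u}) (k : V ⟶ T) (_ : IsOpenImmersion k), t ∈ Set.range k ∧
        ∃! h, h ≫ b = k ≫ g := by
    intro T g hg t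
    obtain ⟨U, hU, hloc⟩ := hloc (g t)
    obtain ⟨R, _, k, hk, ⟨y, hy⟩, f, hf, hI⟩ := hg.exists_chart (g ⁻¹ᵁ U).ι ⟨t, hU⟩
    rw [pullIdeal_comap] at hI
    refine ⟨_, k ≫ (g ⁻¹ᵁ U).ι, inferInstance, ⟨y, ?_⟩, hloc R _ f ?_ hf hI⟩
    · rw [Scheme.Hom.comp_apply, hy]
      rfl
    · rintro _ ⟨z, rfl⟩
      simp only [Scheme.Hom.comp_apply]
      exact (k z).2
  have huniq : ∀ (T : Scheme.{u}) (h h' : T ⟶ B), h ≫ b = h' ≫ b →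
      IsEffectiveCartier (I.comap (h ≫ b)) → h = h' := by
    intro T h h' e hh
    refine hom_ext_of_locally fun t => ?_
    obtain ⟨V, k, _, ht, hu⟩ := key T (h ≫ b) hh t
    refine ⟨k.opensRange, ht, comp_eq_comp_of_range k (hu.unique (Category.assoc _ _ _) ?_)⟩
    rw [Category.assoc, e]
  refine ⟨hc, fun T g hg => ?_⟩
  have hcart : ∀ U : T.Opens, IsEffectiveCartier (I.comap (U.ι ≫ g)) := fun U => by
    rw [IdealSheafData.comap_comp]
    exact hg.comap_of_isOpenImmersion _
  obtain ⟨h, hh⟩ := exists_glue (T := T) (Z := B) (fun U k => k ≫ b = U.ι ≫ g) (fun t => by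
    obtain ⟨V, k, _, ht, h, hu, -⟩ := key T g hg t
    refine ⟨k.opensRange, ht, k.isoOpensRange.inv ≫ h, ?_⟩
    change h ≫ b = k ≫ g at hu
    rw [Category.assoc, hu]
    simp) (fun U V h k hh hk => by
    have e : (T.homOfLE (inf_le_left : U ⊓ V ≤ U) ≫ h) ≫ b = (U ⊓ V).ι ≫ g := by
      rw [Category.assoc, hh]
      simp
    refine huniq _ _ _ ?_ ?_
    · rw [e, Category.assoc, hk]
      simp
    · rw [e]
      exact hcart _)
  have hhb : h ≫ b = g := by
    refine hom_ext_of_locally fun t => ?_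
    obtain ⟨V, k, _, ht, h₁, hu, -⟩ := key T g hg t
    change h₁ ≫ b = k ≫ g at hu
    have e : (k.isoOpensRange.inv ≫ h₁) ≫ b = k.opensRange.ι ≫ g := by
      rw [Category.assoc, hu]
      simp
    refine ⟨k.opensRange, ht, ?_⟩
    rw [← Category.assoc, hh _ _ e, e]
  refine ⟨h, hhb, fun h' hh' => huniq _ _ _ (hh'.trans hhb.symm) ?_⟩
  rw [show h' ≫ b = g from hh']
  exact hg

/-- The blowup of an affine scheme. -/
theorem isBlowup_toBase {A : Type u} [CommRing A] (J : (Spec (CommRingCat.of A)).IdealSheafData) :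
    IsBlowup (Rees.toBase (pullIdeal J (𝟙 _))) J := by
  have hpull : ∀ {R : Type u} [CommRing R] (α : A →+* R),
      pullIdeal J (Spec.map (CommRingCat.ofHom α)) = (pullIdeal J (𝟙 _)).map α := by
    intro R _ α
    rw [← pullIdeal_specMap, Category.comp_id]
  refine isBlowup_of_locally ?_ fun x => ⟨⊤, trivial, ?_⟩
  · refine isEffectiveCartier_of_charts fun x => ?_
    obtain ⟨f, hf⟩ := Rees.exists_mem_basicOpen x
    refine ⟨_, _, Proj.awayι _ (Rees.tt f) (Rees.tt_mem f) one_pos, inferInstance, ?_, _,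
      Rees.chartMap_mem_nonZeroDivisors f, ?_⟩
    · rw [← Proj.opensRange_awayι _ (Rees.tt f) (Rees.tt_mem f) one_pos] at hf
      exact hf
    · rw [pullIdeal_comap, Rees.awayι_toBase, hpull, Rees.map_chartMap]
  · intro R _ G f _ hf hG
    obtain ⟨α, rfl⟩ := Spec.map_surjective G
    have hα : (pullIdeal J (𝟙 _)).map α.hom = Ideal.span {f} := by
      rw [← hG, ← hpull]
      rfl
    obtain ⟨h, hh⟩ := Rees.exists_lift_toBase α.hom hf hα
    exact ⟨h, hh, fun h' hh' => Rees.hom_ext_toBase α.hom hh hh' hf hα⟩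

/-- The blowup is determined by its universal property; in particular, it commutes with open
immersions. -/
theorem IsBlowup.isPullback (hb : IsBlowup b I) {U B' : Scheme.{u}} {j : U ⟶ X}
    [IsOpenImmersion j] {j' : B' ⟶ B} {b' : B' ⟶ U} (hb' : IsBlowup b' (I.comap j))
    (w : j' ≫ b = b' ≫ j) : IsPullback j' b' b j := by
  have sq := IsPullback.of_hasPullback b j
  have hP := hb.of_isPullback sq
  obtain ⟨k, hk, -⟩ := hb'.universal _ _ hP.cartier
  have h1 : k ≫ sq.lift j' b' w = 𝟙 _ :=
    (hP.universal _ _ hP.cartier).unique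
      (by rw [Category.assoc, sq.lift_snd, hk]) (Category.id_comp _)
  have h2 : sq.lift j' b' w ≫ k = 𝟙 _ :=
    (hb'.universal _ _ hb'.cartier).unique
      (by rw [Category.assoc, hk, sq.lift_snd]) (Category.id_comp _)
  let e : B' ≅ pullback b j := ⟨sq.lift j' b' w, k, h2, h1⟩
  refine IsPullback.of_iso_pullback ⟨w⟩ e ?_ ?_
  · exact sq.lift_fst _ _ _
  · exact sq.lift_snd _ _ _

theorem exists_isBlowup_of_isAffine [IsAffine X] [IsLocallyNoetherian X] (I : X.IdealSheafData) :
    ∃ (B : Scheme.{u}) (b : B ⟶ X), IsBlowup b I ∧ IsProper b := by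
  have hn : IsNoetherianRing Γ(X, ⊤) := IsLocallyNoetherian.component_noetherian ⟨⊤, isAffineOpen_top X⟩
  let J := I.comap X.isoSpec.inv
  have hb := isBlowup_toBase (A := Γ(X, ⊤)) J
  have hp : IsProper (Rees.toBase (pullIdeal J (𝟙 _))) := Rees.isProper_toBase (Ideal.fg_of_isNoetherianRing _)
  have sq : IsPullback (𝟙 _) (Rees.toBase (pullIdeal J (𝟙 _)) ≫ X.isoSpec.inv)
      (Rees.toBase (pullIdeal J (𝟙 _))) X.isoSpec.hom :=
    IsPullback.of_horiz_isIso ⟨by simp⟩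
  refine ⟨_, _, ?_, (inferInstance : IsProper (Rees.toBase (pullIdeal J (𝟙 _)) ≫ X.isoSpec.inv))⟩
  have := hb.of_isPullback sq
  rwa [← IdealSheafData.comap_comp, Iso.hom_inv_id, IdealSheafData.comap_id] at this

section Glue

theorem isBlowup_of_isPullback_cover {ι : Type*} {U C : ι → Scheme.{u}} (f : ∀ i, U i ⟶ X)
    [∀ i, IsOpenImmersion (f i)] (hf : ∀ x, ∃ i, x ∈ Set.range (f i)) {j : ∀ i, C i ⟶ B}
    {c : ∀ i, C i ⟶ U i} (sq : ∀ i, IsPullback (j i) (c i) b (f i))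
    (hc : ∀ i, IsBlowup (c i) (I.comap (f i))) : IsBlowup b I := by
  refine isBlowup_of_locally ?_ ?_
  · refine isEffectiveCartier_of_cover fun x => ?_
    obtain ⟨i, y, hy⟩ := hf (b x)
    obtain ⟨z, hz, -⟩ := exists_preimage_of_isPullback (sq i) x y hy.symm
    have : IsOpenImmersion (j i) := MorphismProperty.of_isPullback (sq i).flip inferInstance
    refine ⟨_, j i, this, ⟨z, hz⟩, ?_⟩
    rw [← IdealSheafData.comap_comp, (sq i).w, IdealSheafData.comap_comp]
    exact (hc i).cartier
  · intro x
    obtain ⟨i, y, hy⟩ := hf x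
    refine ⟨(f i).opensRange, ⟨y, hy⟩, fun R _ G g hG hg hI => ?_⟩
    let G' := IsOpenImmersion.lift (f i) G hG
    have hG' : G' ≫ f i = G := IsOpenImmersion.lift_fac _ _ _
    obtain ⟨h, hh, hu⟩ := (hc i).universal _ G'
      (isEffectiveCartier_comap_of_eq_span G' hg (by rw [pullIdeal_comap, hG', hI]))
    refine ⟨h ≫ j i, ?_, fun k hk => ?_⟩
    · change (h ≫ j i) ≫ b = G
      rw [Category.assoc, (sq i).w, reassoc_of% hh, hG']
    · have hk' : k ≫ b = G' ≫ f i := hk.trans hG'.symm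
      rw [← hu ((sq i).lift k G' hk') ((sq i).lift_snd _ _ _), (sq i).lift_fst]

theorem isProper_of_isPullback_cover (𝒰 : X.OpenCover) {C : 𝒰.I₀ → Scheme.{u}}
    {j : ∀ i, C i ⟶ B} {c : ∀ i, C i ⟶ 𝒰.X i} (sq : ∀ i, IsPullback (j i) (c i) b (𝒰.f i))
    (hp : ∀ i, IsProper (c i)) : IsProper b := by
  refine (IsZariskiLocalAtTarget.iff_of_openCover (P := @IsProper) 𝒰).2 fun i => ?_
  have e := (sq i).isoPullback_inv_snd
  have h := hp i
  change IsProper (pullback.snd b (𝒰.f i))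
  rw [← e]
  infer_instance

variable (𝒰 : X.OpenCover) [Category 𝒰.I₀] [𝒰.LocallyDirected] [Small.{u} 𝒰.I₀]
  [Quiver.IsThin 𝒰.I₀]

theorem exists_isPullback_of_gluing (d : Cover.RelativeGluingData 𝒰) :
    ∃ (B : Scheme.{u}) (b : B ⟶ X) (j : ∀ i, d.functor.obj i ⟶ B),
      ∀ i, IsPullback (j i) (d.natTrans.app i) b (𝒰.f i) :=
  ⟨d.glued, d.toBase, fun i => colimit.ι d.functor i,
    fun i => (d.isPullback_natTrans_ι_toBase i).flip⟩

theorem exists_isBlowup_of_cover [IsLocallyNoetherian X] (I : X.IdealSheafData)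
    [∀ i, IsAffine (𝒰.X i)] :
    ∃ (B : Scheme.{u}) (b : B ⟶ X), IsBlowup b I ∧ IsProper b := by
  choose B b hb hp using fun i => exists_isBlowup_of_isAffine (I.comap (𝒰.f i))
  have htr : ∀ {i j : 𝒰.I₀} (f : i ⟶ j),
      (I.comap (𝒰.f j)).comap (𝒰.trans f) = I.comap (𝒰.f i) := by
    intro i j f
    rw [← IdealSheafData.comap_comp, 𝒰.trans_map]
  have hlift : ∀ {i j : 𝒰.I₀} (f : i ⟶ j),
      ∃! h : B i ⟶ B j, h ≫ b j = b i ≫ 𝒰.trans f := by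
    intro i j f
    refine (hb j).universal _ _ ?_
    rw [IdealSheafData.comap_comp, htr]
    exact (hb i).cartier
  choose m hm hmu using @hlift
  have hpb : ∀ {i j : 𝒰.I₀} (f : i ⟶ j), IsPullback (m f) (b i) (b j) (𝒰.trans f) := by
    intro i j f
    have hbi := hb i
    rw [← htr f] at hbi
    exact (hb j).isPullback hbi (hm f)
  let F : 𝒰.I₀ ⥤ Scheme.{u} :=
    { obj := B
      map := m
      map_id := fun i => (hmu (𝟙 i) _ (by simp)).symm
      map_comp := fun f g => (hmu (f ≫ g) _ (by
        simp only [Category.assoc, hm, Cover.trans_comp]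
        rw [reassoc_of% hm])).symm }
  let d : Cover.RelativeGluingData 𝒰 :=
    { functor := F
      natTrans := { app := b, naturality := fun i j f => hm f }
      equifibered := fun i j f => hpb f }
  obtain ⟨B', b', j, sq⟩ := exists_isPullback_of_gluing 𝒰 d
  exact ⟨B', b', isBlowup_of_isPullback_cover 𝒰.f 𝒰.exists_eq sq hb,
    isProper_of_isPullback_cover 𝒰 sq hp⟩

end Glue

/-- Blowups of locally noetherian schemes exist, and they are proper. -/
theorem exists_isBlowup [IsLocallyNoetherian X] (I : X.IdealSheafData) :
    ∃ (B : Scheme.{u}) (b : B ⟶ X), IsBlowup b I ∧ IsProper b :=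
  have : ∀ i, IsAffine (X.directedAffineCover.X i) := fun U => U.2
  exists_isBlowup_of_cover X.directedAffineCover I

end Blow

/-! ### Orders of vanishing in affine charts -/

namespace ZeroCycle

section Chart

variable {C : Scheme.{u}} {R : Type u} [CommRing R] (c : Spec (CommRingCat.of R) ⟶ C)
  [IsOpenImmersion c]

theorem exists_chart_stalk (y : PrimeSpectrum R) :
    ∃ σ : R →+* C.presheaf.stalk (c y),
      Spec.map (CommRingCat.ofHom σ) ≫ c = C.fromSpecStalk (c y) ∧
      @IsLocalization.AtPrime R _ (C.presheaf.stalk (c y)) _ σ.toAlgebra y.asIdeal _ := by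
  have hiso : ∀ z, IsIso (c.stalkMap z) := inferInstance
  have : IsIso (c.stalkMap y) := hiso y
  let τ : CommRingCat.of R ⟶ (Spec (CommRingCat.of R)).presheaf.stalk y :=
    StructureSheaf.toStalk R y
  refine ⟨(τ ≫ inv (c.stalkMap y)).hom, ?_, ?_⟩
  · rw [CommRingCat.ofHom_hom, Spec.map_comp, Category.assoc]
    have h1 : Spec.map τ = (Spec (CommRingCat.of R)).fromSpecStalk y :=
      (Spec.fromSpecStalk_eq (CommRingCat.of R) y).symm
    have h2 : ∀ (z : Spec (CommRingCat.of R)), Spec.map (inv (c.stalkMap z)) ≫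
        (Spec (CommRingCat.of R)).fromSpecStalk z ≫ c = C.fromSpecStalk (c z) := fun z => by
      rw [← Scheme.SpecMap_stalkMap_fromSpecStalk, ← Category.assoc, ← Spec.map_comp,
        IsIso.hom_inv_id, Spec.map_id, Category.id_comp]
    rw [h1]
    exact h2 y
  · let _ := (τ ≫ inv (c.stalkMap y)).hom.toAlgebra
    let _ : Algebra R ((Spec (CommRingCat.of R)).presheaf.stalk y) := τ.hom.toAlgebra
    have h2 : IsLocalization.AtPrime ((Spec (CommRingCat.of R)).presheaf.stalk y) y.asIdeal :=
      StructureSheaf.IsLocalization.to_stalk R y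
    let e : (Spec (CommRingCat.of R)).presheaf.stalk y ≃+* C.presheaf.stalk (c y) :=
      (asIso (c.stalkMap y)).symm.commRingCatIsoToRingEquiv
    exact IsLocalization.isLocalization_of_algEquiv y.asIdeal.primeCompl
      (AlgEquiv.ofRingEquiv (f := e) fun r => rfl)

theorem exists_chart_functionField [IsIntegral C] (y : PrimeSpectrum R) :
    ∃ χ : R →+* C.functionField,
      Spec.map (CommRingCat.ofHom χ) ≫ c = C.fromSpecStalk (genericPoint C) := by
  obtain ⟨σ, hσ, -⟩ := exists_chart_stalk c y
  refine ⟨(algebraMap (C.presheaf.stalk (c y)) C.functionField).comp σ, ?_⟩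
  rw [CommRingCat.ofHom_comp, Spec.map_comp, Category.assoc, hσ]
  exact Scheme.SpecMap_stalkSpecializes_fromSpecStalk (genericPoint_specializes (c y))

theorem isIntegrallyClosed_stalk_chart [IsDomain R] [IsIntegrallyClosed R]
    (y : PrimeSpectrum R) : IsIntegrallyClosed (C.presheaf.stalk (c y)) := by
  obtain ⟨σ, hσ, hl⟩ := exists_chart_stalk c y
  let _ := σ.toAlgebra
  exact isIntegrallyClosed_of_isLocalization _ y.asIdeal.primeCompl
    y.asIdeal.primeCompl_le_nonZeroDivisors

variable [IsIntegral C] {χ : R →+* C.functionField}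
  (hχ : Spec.map (CommRingCat.ofHom χ) ≫ c = C.fromSpecStalk (genericPoint C))

include hχ in
theorem chart_eq_comp {y : PrimeSpectrum R} {σ : R →+* C.presheaf.stalk (c y)}
    (hσ : Spec.map (CommRingCat.ofHom σ) ≫ c = C.fromSpecStalk (c y)) (r : R) :
    χ r = algebraMap (C.presheaf.stalk (c y)) C.functionField (σ r) := by
  have h : Spec.map (CommRingCat.ofHom ((algebraMap (C.presheaf.stalk (c y)) C.functionField).comp σ))
      ≫ c = Spec.map (CommRingCat.ofHom χ) ≫ c := by
    rw [CommRingCat.ofHom_comp, Spec.map_comp, Category.assoc, hσ, hχ]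
    exact Scheme.SpecMap_stalkSpecializes_fromSpecStalk (genericPoint_specializes (c y))
  rw [cancel_mono] at h
  have := congrArg CommRingCat.Hom.hom (Spec.map_injective h)
  exact (DFunLike.congr_fun this r).symm

include hχ in
theorem chart_injective [IsDomain R] : Function.Injective χ := by
  let y : PrimeSpectrum R := ⟨⊥, Ideal.isPrime_bot⟩
  obtain ⟨σ, hσ, hl⟩ := exists_chart_stalk c y
  intro a b hab
  rw [chart_eq_comp c hχ hσ, chart_eq_comp c hχ hσ] at hab
  let _ := σ.toAlgebra
  have h1 : Function.Injective (algebraMap R (C.presheaf.stalk (c y))) :=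
    IsLocalization.injective _ (M := y.asIdeal.primeCompl) y.asIdeal.primeCompl_le_nonZeroDivisors
  exact h1 (IsFractionRing.injective _ _ hab)

include hχ in
theorem ord_chart_of_notMem [IsLocallyNoetherian C] {y : PrimeSpectrum R} {r : R}
    (hr : r ∉ y.asIdeal) : Scheme.ord (χ r) (c y) = 0 := by
  obtain ⟨σ, hσ, hl⟩ := exists_chart_stalk c y
  by_cases hx : Order.coheight (c y) = 1
  · let _ := σ.toAlgebra
    have hu : IsUnit (σ r) := IsLocalization.map_units (M := y.asIdeal.primeCompl) _ ⟨r, hr⟩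
    have : Ring.KrullDimLE 1 (C.presheaf.stalk (c y)) := krullDimLE_of_coheight_le hx.le
    rw [chart_eq_comp c hχ hσ, Scheme.ord_eq_iff hx]
    · exact Ring.ordFrac_of_isUnit hu
    · exact (hu.map _).ne_zero
  · exact Scheme.ord_eq_zero_of_coheight_neq_one hx _

include hχ in
theorem ord_chart_of_eq_span [IsDomain R] [IsLocallyNoetherian C] {y : PrimeSpectrum R} {r : R}
    (hr : y.asIdeal = Ideal.span {r}) (hr0 : r ≠ 0) : Scheme.ord (χ r) (c y) = 1 := by
  obtain ⟨σ, hσ, hl⟩ := exists_chart_stalk c y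
  let _ := σ.toAlgebra
  have hinj : Function.Injective (algebraMap R (C.presheaf.stalk (c y))) :=
    IsLocalization.injective _ (M := y.asIdeal.primeCompl) y.asIdeal.primeCompl_le_nonZeroDivisors
  have hs0 : σ r ≠ 0 := fun h => hr0 (hinj (h.trans (map_zero σ).symm))
  have hm : IsLocalRing.maximalIdeal (C.presheaf.stalk (c y)) = Ideal.span {σ r} := by
    rw [← IsLocalization.AtPrime.map_eq_maximalIdeal y.asIdeal (C.presheaf.stalk (c y)), hr,
      Ideal.map_span, Set.image_singleton]
    rfl
  have hnf : ¬ IsField (C.presheaf.stalk (c y)) := by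
    rw [IsLocalRing.isField_iff_maximalIdeal_eq, hm, Ideal.span_singleton_eq_bot]
    exact hs0
  have hdvr : IsDiscreteValuationRing (C.presheaf.stalk (c y)) := by
    have := (IsDiscreteValuationRing.TFAE (C.presheaf.stalk (c y)) hnf).out 0 4
    exact this.2 ⟨⟨_, hm⟩⟩
  have hx : Order.coheight (c y) = 1 := by
    have h1 := ringKrullDim_stalk_eq_coheight (c y)
    have h2 : ringKrullDim (C.presheaf.stalk (c y)) = 1 :=
      IsPrincipalIdealRing.ringKrullDim_eq_one _ hnf
    rw [h2] at h1
    exact_mod_cast h1.symm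
  have : Ring.KrullDimLE 1 (C.presheaf.stalk (c y)) := krullDimLE_of_coheight_le hx.le
  have hirr : Irreducible (σ r) :=
    IsDiscreteValuationRing.irreducible_of_span_eq_maximalIdeal _ hs0 hm
  rw [chart_eq_comp c hχ hσ, Scheme.ord_eq_iff hx]
  · exact Ring.ordFrac_irreducible hirr
  · exact fun h => hs0 (IsFractionRing.injective _ _ (h.trans (map_zero _).symm))

end Chart

end ZeroCycle

/-! ### The projective line -/

namespace ProjLine

attribute [local instance] MvPolynomial.gradedAlgebra

open ProjPt HomogeneousLocalization

variable (L : Type u) [Field L]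

/-- The standard grading of `L[X₀, X₁]`. -/
abbrev gr : ℕ → Submodule L (MvPolynomial (Fin 2) L) := MvPolynomial.homogeneousSubmodule (Fin 2) L

theorem X_mem (i : Fin 2) : (MvPolynomial.X i : MvPolynomial (Fin 2) L) ∈ gr L 1 :=
  MvPolynomial.isHomogeneous_X L i

theorem bijective_algebraMap : Function.Bijective (algebraMap L (gr L 0)) := by
  constructor
  · intro a b h
    exact MvPolynomial.C_injective (Fin 2) L (congrArg Subtype.val h)
  · rintro ⟨f, hf⟩
    obtain ⟨c, hc⟩ := Submodule.mem_one.1 ((MvPolynomial.homogeneousSubmodule_zero (σ := Fin 2)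
      (R := L)).le hf)
    exact ⟨c, Subtype.ext hc⟩

theorem adjoin_range_X : Algebra.adjoin (gr L 0)
    (Set.range (MvPolynomial.X : Fin 2 → MvPolynomial (Fin 2) L)) = ⊤ := by
  have h1 : Algebra.adjoin L (Set.range (MvPolynomial.X : Fin 2 → MvPolynomial (Fin 2) L)) = ⊤ :=
    MvPolynomial.adjoin_range_X
  refine top_le_iff.1 fun f _ => ?_
  have hf : f ∈ Algebra.adjoin L (Set.range (MvPolynomial.X : Fin 2 → MvPolynomial (Fin 2) L)) :=
    h1 ▸ trivial
  induction hf using Algebra.adjoin_induction with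
  | mem x hx => exact Algebra.subset_adjoin hx
  | algebraMap r => exact Subalgebra.algebraMap_mem _ (algebraMap L (gr L 0) r)
  | add x y _ _ h1 h2 => exact add_mem (h1 trivial) (h2 trivial)
  | mul x y _ _ h1 h2 => exact mul_mem (h1 trivial) (h2 trivial)

/-- The structure morphism of the projective line. -/
def str : Proj (gr L) ⟶ Spec (CommRingCat.of L) :=
  Proj.toSpecZero (gr L) ≫ Spec.map (CommRingCat.ofHom (algebraMap L (gr L 0)))

instance : IsProper (str L) := by
  have h1 : Algebra.FiniteType (gr L 0) (MvPolynomial (Fin 2) L) :=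
    ⟨⟨(Set.finite_range MvPolynomial.X).toFinset, by
      rw [Set.Finite.coe_toFinset, adjoin_range_X]⟩⟩
  have h3 : IsIso (CommRingCat.ofHom (algebraMap L (gr L 0))) :=
    (ConcreteCategory.isIso_iff_bijective _).2 (bijective_algebraMap L)
  rw [str]
  infer_instance

/-- The homomorphism `L[X₀, X₁] → L[t]` with `Xᵢ ↦ 1` that sends the other variable to `t`. -/
def chartEval (i : Fin 2) : MvPolynomial (Fin 2) L →ₐ[L] Polynomial L :=
  MvPolynomial.aeval fun j => if j = i then 1 else Polynomial.X

theorem chartEval_X (i j : Fin 2) :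
    chartEval L i (MvPolynomial.X j) = if j = i then 1 else Polynomial.X := by
  simp [chartEval]

theorem isUnit_chartEval (i : Fin 2) : IsUnit ((chartEval L i).toRingHom (MvPolynomial.X i)) := by
  have : (chartEval L i).toRingHom (MvPolynomial.X i) = 1 := (chartEval_X L i i).trans (if_pos rfl)
  rw [this]
  exact isUnit_one

/-- The affine charts of the projective line. -/
def chart (i : Fin 2) : Spec (CommRingCat.of (Polynomial L)) ⟶ Proj (gr L) :=
  projPt (gr L) (chartEval L i).toRingHom
    (map_irrelevant_eq_top _ _ one_pos (X_mem L i) (isUnit_chartEval L i))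

theorem chart_eq (i : Fin 2) : chart L i =
    Spec.map (CommRingCat.ofHom (awayEval (gr L) (chartEval L i).toRingHom _
      (isUnit_chartEval L i))) ≫ Proj.awayι (gr L) (MvPolynomial.X i) (X_mem L i) one_pos :=
  projPt_eq _ _ _ _ _ _

theorem chart_str (i : Fin 2) :
    chart L i ≫ str L = Spec.map (CommRingCat.ofHom Polynomial.C) := by
  rw [chart, projPt, str, Proj.fromOfGlobalSections_toSpecZero_assoc, ← Spec.map_comp,
    ← CommRingCat.ofHom_comp]
  have h : ((((Scheme.ΓSpecIso (CommRingCat.of (Polynomial L))).inv.hom.comp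
      (chartEval L i).toRingHom).comp (algebraMap (gr L 0) (MvPolynomial (Fin 2) L))).comp
      (algebraMap L (gr L 0))) =
      (Scheme.ΓSpecIso (CommRingCat.of (Polynomial L))).inv.hom.comp Polynomial.C := by
    ext a
    simp only [RingHom.comp_apply]
    congr 1
    exact (chartEval L i).commutes a
  rw [h, CommRingCat.ofHom_comp, Spec.map_comp]
  simp

theorem awayEval_mk_chartEval (i : Fin 2) (n : ℕ) (a : MvPolynomial (Fin 2) L)
    (ha : a ∈ gr L (n • 1)) : awayEval (gr L) (chartEval L i).toRingHom _ (isUnit_chartEval L i)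
      (Away.mk (gr L) (X_mem L i) n a ha) = chartEval L i a := by
  have h := awayEval_mk (gr L) (chartEval L i).toRingHom _ (isUnit_chartEval L i) (X_mem L i) n a ha
  have h1 : (chartEval L i).toRingHom (MvPolynomial.X i) = 1 :=
    (chartEval_X L i i).trans (if_pos rfl)
  rw [h1, one_pow, mul_one] at h
  exact h

theorem bijective_awayEval (i : Fin 2) : Function.Bijective
    (awayEval (gr L) (chartEval L i).toRingHom _ (isUnit_chartEval L i)) := by
  constructor
  · rw [injective_iff_map_eq_zero]
    intro z hz
    obtain ⟨n, a, ha, rfl⟩ := Away.mk_surjective (gr L) (X_mem L i) z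
    rw [awayEval_mk_chartEval] at hz
    have hm : a.IsHomogeneous n := by simpa using (MvPolynomial.mem_homogeneousSubmodule _ _).1 ha
    let S := Localization.Away (MvPolynomial.X i : MvPolynomial (Fin 2) L)
    let u : S := IsLocalization.Away.invSelf (MvPolynomial.X i : MvPolynomial (Fin 2) L)
    have hu : algebraMap (MvPolynomial (Fin 2) L) S (MvPolynomial.X i) * u = 1 :=
      IsLocalization.Away.mul_invSelf _
    let v : Fin 2 → S := fun j => algebraMap (MvPolynomial (Fin 2) L) S (MvPolynomial.X j) * u
    let E : Polynomial L →ₐ[L] S := Polynomial.aeval (v (i + 1))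
    have hE : E.comp (chartEval L i) = MvPolynomial.aeval v := by
      refine MvPolynomial.algHom_ext fun j => ?_
      rw [AlgHom.comp_apply, chartEval_X, MvPolynomial.aeval_X]
      split_ifs with h
      · rw [map_one, h]
        exact hu.symm
      · have : j = i + 1 := by
          fin_cases i <;> fin_cases j <;> simp_all
        rw [this]
        exact Polynomial.aeval_X _
    have h1 : MvPolynomial.aeval v a = 0 := by
      rw [← hE, AlgHom.comp_apply, hz, map_zero]
    have h2 := BiProj.aeval_mul_of_isHomogeneous hm
      (algebraMap (MvPolynomial (Fin 2) L) S (MvPolynomial.X i)) v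
    have h3 : (fun j => algebraMap (MvPolynomial (Fin 2) L) S (MvPolynomial.X i) * v j) =
        fun j => algebraMap (MvPolynomial (Fin 2) L) S (MvPolynomial.X j) := funext fun j => by
      rw [mul_left_comm, hu, mul_one]
    rw [h1, mul_zero, h3] at h2
    have h4 : algebraMap (MvPolynomial (Fin 2) L) S a = 0 := by
      rw [← h2]
      have : (Algebra.ofId (MvPolynomial (Fin 2) L) S).restrictScalars L =
          MvPolynomial.aeval fun j => algebraMap (MvPolynomial (Fin 2) L) S (MvPolynomial.X j) :=
        MvPolynomial.algHom_ext fun j => by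
          rw [MvPolynomial.aeval_X]
          rfl
      exact DFunLike.congr_fun this a
    apply HomogeneousLocalization.val_injective
    rw [Away.val_mk, HomogeneousLocalization.val_zero, Localization.mk_eq_mk',
      IsLocalization.mk'_eq_mul_mk'_one]
    exact (congrArg (· * _) h4).trans (zero_mul _)
  · intro p
    have h : (awayEval (gr L) (chartEval L i).toRingHom _ (isUnit_chartEval L i)).range = ⊤ := by
      rw [eq_top_iff]
      intro p _
      induction p using Polynomial.induction_on' with
      | add p q hp hq => exact add_mem (hp trivial) (hq trivial)
      | monomial n a =>
        rw [← Polynomial.C_mul_X_pow_eq_monomial]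
        refine mul_mem ?_ (pow_mem ?_ n)
        · refine ⟨Away.mk (gr L) (X_mem L i) 0 (MvPolynomial.C a)
            (by simp), ?_⟩
          rw [awayEval_mk_chartEval]
          exact (chartEval L i).commutes a
        · refine ⟨Away.mk (gr L) (X_mem L i) 1 (MvPolynomial.X (i + 1))
            (by simpa using X_mem L (i + 1)), ?_⟩
          rw [awayEval_mk_chartEval, chartEval_X, if_neg (by fin_cases i <;> simp)]
    have hp : p ∈ (awayEval (gr L) (chartEval L i).toRingHom _ (isUnit_chartEval L i)).range :=
      h ▸ trivial
    exact hp

instance (i : Fin 2) : IsOpenImmersion (chart L i) := by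
  rw [chart_eq]
  have : IsIso (CommRingCat.ofHom (awayEval (gr L) (chartEval L i).toRingHom _
      (isUnit_chartEval L i))) :=
    (ConcreteCategory.isIso_iff_bijective _).2 (bijective_awayEval L i)
  infer_instance

theorem exists_mem_range_chart (x : Proj (gr L)) : ∃ i, x ∈ Set.range (chart L i) := by
  have h : ⨆ i, Proj.basicOpen (gr L) (MvPolynomial.X i) = ⊤ :=
    Proj.iSup_basicOpen_eq_top' (gr L) _ (fun i => ⟨1, X_mem L i⟩) (adjoin_range_X L)
  have hz : x ∈ ⨆ i, Proj.basicOpen (gr L) (MvPolynomial.X i : MvPolynomial (Fin 2) L) := h ▸ trivial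
  obtain ⟨i, hi⟩ := Opens.mem_iSup.1 hz
  refine ⟨i, ?_⟩
  rw [← Proj.opensRange_awayι (gr L) (MvPolynomial.X i) (X_mem L i) one_pos] at hi
  obtain ⟨y, hy⟩ := hi
  have : IsIso (CommRingCat.ofHom (awayEval (gr L) (chartEval L i).toRingHom _
      (isUnit_chartEval L i))) :=
    (ConcreteCategory.isIso_iff_bijective _).2 (bijective_awayEval L i)
  obtain ⟨z, rfl⟩ := (Spec.map (CommRingCat.ofHom (awayEval (gr L) (chartEval L i).toRingHom _
    (isUnit_chartEval L i)))).surjective y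
  exact ⟨z, by rw [chart_eq, Scheme.Hom.comp_apply, hy]⟩

variable {L}

theorem specMap_chart_eq {R : Type u} [CommRing R] {α β : Polynomial L →+* R}
    (h : α.comp Polynomial.C = β.comp Polynomial.C) (hX : α Polynomial.X * β Polynomial.X = 1) :
    Spec.map (CommRingCat.ofHom α) ≫ chart L 0 = Spec.map (CommRingCat.ofHom β) ≫ chart L 1 := by
  let _ : Algebra L R := (α.comp Polynomial.C).toAlgebra
  let a' : MvPolynomial (Fin 2) L →ₐ[L] R := MvPolynomial.aeval ![1, α Polynomial.X]
  let b' : MvPolynomial (Fin 2) L →ₐ[L] R := MvPolynomial.aeval ![β Polynomial.X, 1]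
  have ha : α.comp (chartEval L 0).toRingHom = a'.toRingHom := by
    refine MvPolynomial.ringHom_ext (fun c => ?_) fun j => ?_
    · refine (congrArg α ((chartEval L 0).commutes c)).trans (a'.commutes c).symm
    · refine (congrArg α (chartEval_X L 0 j)).trans ?_
      change _ = MvPolynomial.aeval _ _
      rw [MvPolynomial.aeval_X]
      fin_cases j <;> simp
  have hb : β.comp (chartEval L 1).toRingHom = b'.toRingHom := by
    refine MvPolynomial.ringHom_ext (fun c => ?_) fun j => ?_
    · refine (congrArg β ((chartEval L 1).commutes c)).trans ((b'.commutes c).trans ?_).symm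
      exact DFunLike.congr_fun h c
    · refine (congrArg β (chartEval_X L 1 j)).trans ?_
      change _ = MvPolynomial.aeval _ _
      rw [MvPolynomial.aeval_X]
      fin_cases j <;> simp
  have ha0 : α.comp (chartEval L 0).toRingHom (MvPolynomial.X 0) = 1 := by
    rw [ha]
    exact MvPolynomial.aeval_X _ _
  have hb0 : β.comp (chartEval L 1).toRingHom (MvPolynomial.X 0) = β Polynomial.X := by
    rw [hb]
    exact MvPolynomial.aeval_X _ _
  have hua : IsUnit (α.comp (chartEval L 0).toRingHom (MvPolynomial.X 0)) := by
    rw [ha0]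
    exact isUnit_one
  have hub : IsUnit (β.comp (chartEval L 1).toRingHom (MvPolynomial.X 0)) := by
    rw [hb0]
    exact IsUnit.of_mul_eq_one _ ((mul_comm _ _).trans hX)
  rw [chart, chart, specMap_projPt_eq _ _ _ _ one_pos (X_mem L 0) hua,
    specMap_projPt_eq _ _ _ _ one_pos (X_mem L 0) hub]
  congr 3
  refine away_hom_ext (gr L) (X_mem L 0) fun n a hn => ?_
  have h1 := awayEval_mk (gr L) _ _ hua (X_mem L 0) n a hn
  have h2 := awayEval_mk (gr L) _ _ hub (X_mem L 0) n a hn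
  rw [ha0, one_pow, mul_one] at h1
  have hm : a.IsHomogeneous n := by simpa using (MvPolynomial.mem_homogeneousSubmodule _ _).1 hn
  have h3 := BiProj.aeval_mul_of_isHomogeneous hm (β Polynomial.X) ![1, α Polynomial.X]
  have h4 : (fun j => β Polynomial.X * ![1, α Polynomial.X] j) = ![β Polynomial.X, 1] := by
    funext j
    fin_cases j
    · simp
    · simpa [mul_comm] using hX
  rw [h4] at h3
  rw [h1, ha]
  rw [hb0] at h2
  rw [hb0] at hub
  refine ((hub.pow n).mul_left_inj).1 (Eq.trans ?_ h2.symm)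
  rw [hb, mul_comm]
  exact h3.symm

end ProjLine

namespace ProjLine

attribute [local instance] MvPolynomial.gradedAlgebra

open ZeroCycle

variable {L : Type u} [Field L]

theorem exists_inverse {K : Type u} [Field K] (α : Polynomial L →+* K) :
    ∃ β : Polynomial L →+* K, α.comp Polynomial.C = β.comp Polynomial.C ∧
      β Polynomial.X = (α Polynomial.X)⁻¹ :=
  ⟨Polynomial.eval₂RingHom (α.comp Polynomial.C) (α Polynomial.X)⁻¹,
    RingHom.ext fun _ => (Polynomial.eval₂_C _ _).symm, Polynomial.eval₂_X _ _⟩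

theorem exists_chart_eq_chart (i : Fin 2) (y : PrimeSpectrum (Polynomial L))
    (hy : Polynomial.X ∉ y.asIdeal) :
    ∃ y' : PrimeSpectrum (Polynomial L), Polynomial.X ∉ y'.asIdeal ∧
      chart L i y = chart L (i + 1) y' := by
  let α := algebraMap (Polynomial L) y.asIdeal.ResidueField
  obtain ⟨β, hβ, hX⟩ := exists_inverse α
  have hα0 : α Polynomial.X ≠ 0 := fun h =>
    hy ((Ideal.algebraMap_residueField_eq_zero (I := y.asIdeal)).1 h)
  have e : Spec.map (CommRingCat.ofHom α) ≫ chart L i =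
      Spec.map (CommRingCat.ofHom β) ≫ chart L (i + 1) := by
    fin_cases i
    · exact specMap_chart_eq hβ (by rw [hX, mul_inv_cancel₀ hα0])
    · exact (specMap_chart_eq hβ.symm (by rw [hX, inv_mul_cancel₀ hα0])).symm
  let o : PrimeSpectrum y.asIdeal.ResidueField := ⊥
  have e1 := congrArg (fun m : Spec (CommRingCat.of y.asIdeal.ResidueField) ⟶ Proj (gr L) => m o) e
  refine ⟨PrimeSpectrum.comap β o, ?_, ?_⟩
  · intro h
    have : β Polynomial.X = 0 := h
    rw [hX, inv_eq_zero] at this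
    exact hα0 this
  · have h2 : PrimeSpectrum.comap α o = y := by
      ext z
      exact Ideal.algebraMap_residueField_eq_zero (I := y.asIdeal)
    exact (congrArg (chart L i) h2).symm.trans e1

theorem X_notMem_bot : Polynomial.X ∉ (⊥ : PrimeSpectrum (Polynomial L)).asIdeal :=
  fun h => Polynomial.X_ne_zero h

theorem specializes_of_bot (i : Fin 2) (y : PrimeSpectrum (Polynomial L)) :
    chart L i (⊥ : PrimeSpectrum (Polynomial L)) ⤳ chart L i y :=
  ((PrimeSpectrum.le_iff_specializes _ _).1 bot_le).map (chart L i).continuous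

theorem chart_zero_bot_specializes (x : Proj (gr L)) :
    chart L 0 (⊥ : PrimeSpectrum (Polynomial L)) ⤳ x := by
  obtain ⟨i, y, rfl⟩ := exists_mem_range_chart L x
  fin_cases i
  · exact specializes_of_bot 0 y
  · obtain ⟨y', -, hy'⟩ := exists_chart_eq_chart 1 (⊥ : PrimeSpectrum (Polynomial L)) X_notMem_bot
    have h1 := specializes_of_bot 0 y'
    have e : chart L (1 + 1) y' = chart L 0 y' := rfl
    rw [← e, ← hy'] at h1
    exact h1.trans (specializes_of_bot 1 y)

instance : IrreducibleSpace (Proj (gr L)) := by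
  have h : closure {chart L 0 (⊥ : PrimeSpectrum (Polynomial L))} = Set.univ :=
    Set.eq_univ_of_forall fun x => specializes_iff_mem_closure.1 (chart_zero_bot_specializes x)
  have h2 : IsIrreducible (Set.univ : Set (Proj (gr L))) := by
    rw [← h]
    exact isIrreducible_singleton.closure
  exact { isPreirreducible_univ := h2.2, toNonempty := ⟨h2.1.some⟩ }

instance : IsReduced (Proj (gr L)) := by
  have : ∀ x : Proj (gr L), _root_.IsReduced ((Proj (gr L)).presheaf.stalk x) := by
    intro x
    obtain ⟨i, y, rfl⟩ := exists_mem_range_chart L x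
    have := PrimeSpectrum.isPrime y
    obtain ⟨σ, -, hl⟩ := exists_chart_stalk (chart L i) y
    let _ := σ.toAlgebra
    have := IsLocalization.isDomain_of_le_nonZeroDivisors
      ((Proj (gr L)).presheaf.stalk (chart L i y)) y.asIdeal.primeCompl_le_nonZeroDivisors
    infer_instance
  exact isReduced_of_isReduced_stalk _

instance : IsIntegral (Proj (gr L)) := isIntegral_of_irreducibleSpace_of_isReduced _

instance : IsLocallyNoetherian (Proj (gr L)) := LocallyOfFiniteType.isLocallyNoetherian (str L)

variable (L) in
theorem isNormalCurve : IsNormalCurve (Proj (gr L)) where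
  integral := inferInstance
  noetherian := inferInstance
  normal x := by
    obtain ⟨i, y, rfl⟩ := exists_mem_range_chart L x
    exact isIntegrallyClosed_stalk_chart (chart L i) y
  dim := by
    have h1 : ringKrullDim (Polynomial L) = 1 :=
      IsPrincipalIdealRing.ringKrullDim_eq_one _ (Polynomial.not_isField L)
    apply le_antisymm
    · have h2 : topologicalKrullDim (Proj (gr L)) = Order.krullDim (Proj (gr L)) :=
        Order.krullDim_eq_of_orderIso irreducibleSetEquivPoints
      rw [h2, Order.krullDim_eq_iSup_coheight]
      refine iSup_le fun x => ?_
      obtain ⟨i, y, rfl⟩ := exists_mem_range_chart L x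
      have h3 : Order.coheight (chart L i y) = _ := coheight_eq_of_isOpenImmersion (chart L i)
      rw [h3, ← idealHeight_eq_coheight, ← h1]
      exact Ideal.height_le_ringKrullDim_of_ne_top (PrimeSpectrum.isPrime y).ne_top
    · rw [← h1, ← PrimeSpectrum.topologicalKrullDim_eq_ringKrullDim]
      exact (chart L 0).isOpenEmbedding.isInducing.topologicalKrullDim_le

variable (L) in
/-- The origin of an affine chart of the projective line. -/
def origin (i : Fin 2) : Spec (CommRingCat.of L) ⟶ Proj (gr L) :=
  Spec.map (CommRingCat.ofHom (Polynomial.evalRingHom 0)) ≫ chart L i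

theorem origin_str (i : Fin 2) : origin L i ≫ str L = 𝟙 _ := by
  rw [origin, Category.assoc, chart_str, ← Spec.map_comp, ← CommRingCat.ofHom_comp]
  have : (Polynomial.evalRingHom (0 : L)).comp Polynomial.C = RingHom.id L := by
    ext a
    simp
  rw [this, CommRingCat.ofHom_id, Spec.map_id]

instance (i : Fin 2) : IsProper (origin L i) := by
  have : IsProper (origin L i ≫ str L) := by
    rw [origin_str]
    infer_instance
  exact IsProper.of_comp (origin L i) (str L)

variable (L) in
/-- The point of the spectrum of a field. -/
def specPt : ClosedPt (Spec (CommRingCat.of L)) :=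
  ⟨(⊥ : PrimeSpectrum L), by
    have h : ({(⊥ : PrimeSpectrum L)} : Set (PrimeSpectrum L)) = Set.univ :=
      Set.eq_univ_of_forall fun y => Subsingleton.elim _ _
    exact h ▸ isClosed_univ⟩

/-- The zero-cycle of a point with values in a field. -/
def cyc {X : Scheme.{u}} (q : Spec (CommRingCat.of L) ⟶ X) [IsProper q] : Z0 X :=
  push q (Finsupp.single (specPt L) 1)

theorem cyc_eq {X : Scheme.{u}} (q : Spec (CommRingCat.of L) ⟶ X) [IsProper q] :
    cyc q = Finsupp.single (mapPt q (specPt L)) (q.residueDegree (specPt L).1 : ℤ) := by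
  simp [cyc, push]

theorem push_cyc {X Y : Scheme.{u}} (q : Spec (CommRingCat.of L) ⟶ X) [IsProper q] (f : X ⟶ Y)
    [IsProper f] : push f (cyc q) = cyc (q ≫ f) := (push_comp _ _ _).symm

theorem residueDegree_eq_one_of_comp_eq_id {X Y : Scheme.{u}} {f : X ⟶ Y} {g : Y ⟶ X}
    (h : f ≫ g = 𝟙 X) (x : X) : f.residueDegree x = 1 := by
  have h1 := residueDegree_comp f g x
  rw [h, Scheme.Hom.residueDegree_id] at h1
  exact Nat.eq_one_of_mul_eq_one_left h1.symm

theorem cyc_origin (i : Fin 2) :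
    cyc (origin L i) = Finsupp.single (mapPt (origin L i) (specPt L)) 1 := by
  rw [cyc_eq, residueDegree_eq_one_of_comp_eq_id (origin_str i), Nat.cast_one]

theorem exists_charts : ∃ χ : Fin 2 → Polynomial L →+* (Proj (gr L)).functionField,
    (∀ i, Spec.map (CommRingCat.ofHom (χ i)) ≫ chart L i =
      (Proj (gr L)).fromSpecStalk (genericPoint (Proj (gr L)))) ∧
    χ 0 Polynomial.X * χ 1 Polynomial.X = 1 := by
  choose χ hχ using fun i => exists_chart_functionField (chart L i) (⊥ : PrimeSpectrum (Polynomial L))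
  refine ⟨χ, hχ, ?_⟩
  obtain ⟨β, hβ, hX⟩ := exists_inverse (χ 0)
  have h0 : χ 0 Polynomial.X ≠ 0 := fun h =>
    Polynomial.X_ne_zero (chart_injective (chart L 0) (hχ 0) (h.trans (map_zero _).symm))
  have e := specMap_chart_eq hβ (by rw [hX, mul_inv_cancel₀ h0])
  rw [hχ 0, ← hχ 1, cancel_mono] at e
  have e2 : χ 1 = β := congrArg CommRingCat.Hom.hom (Spec.map_injective e)
  rw [e2, hX, mul_inv_cancel₀ h0]

theorem origin_apply (i : Fin 2) {y : PrimeSpectrum (Polynomial L)} (hy : Polynomial.X ∈ y.asIdeal) :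
    chart L i y = (mapPt (origin L i) (specPt L)).1 ∧ y.asIdeal = Ideal.span {Polynomial.X} := by
  have h1 : y.asIdeal = Ideal.span {Polynomial.X} := by
    have hm : (Ideal.span {Polynomial.X} : Ideal (Polynomial L)).IsMaximal := by
      have := PrincipalIdealRing.isMaximal_of_irreducible (Polynomial.irreducible_X (R := L))
      exact this
    exact (hm.eq_of_le y.2.ne_top ((Ideal.span_singleton_le_iff_mem _).2 hy)).symm
  refine ⟨?_, h1⟩
  have h2 : y = PrimeSpectrum.comap (Polynomial.evalRingHom (0 : L)) ⊥ := by
    apply PrimeSpectrum.ext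
    rw [h1, ← Polynomial.ker_constantCoeff]
    ext p
    change Polynomial.constantCoeff p = 0 ↔ Polynomial.eval 0 p = 0
    rw [Polynomial.constantCoeff_apply, Polynomial.coeff_zero_eq_eval_zero]
  rw [h2]
  rfl

/-- The divisor of the coordinate function of the projective line. -/
theorem isDivisorOf_coordinate {χ : Fin 2 → Polynomial L →+* (Proj (gr L)).functionField}
    (hχ : ∀ i, Spec.map (CommRingCat.ofHom (χ i)) ≫ chart L i =
      (Proj (gr L)).fromSpecStalk (genericPoint (Proj (gr L))))
    (h : χ 0 Polynomial.X * χ 1 Polynomial.X = 1) :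
    IsDivisorOf (Proj (gr L)) (cyc (origin L 1) - cyc (origin L 0)) (χ 1 Polynomial.X) := by
  have hne0 : χ 0 Polynomial.X ≠ 0 := left_ne_zero_of_mul_eq_one h
  have hne1 : χ 1 Polynomial.X ≠ 0 := right_ne_zero_of_mul_eq_one h
  have hsum : ∀ x, Scheme.ord (χ 0 Polynomial.X) x + Scheme.ord (χ 1 Polynomial.X) x = 0 := by
    intro x
    rw [← Scheme.ord_mul hne0 hne1, h]
    have := Scheme.ord_mul (x := x) (one_ne_zero (α := (Proj (gr L)).functionField)) one_ne_zero
    rw [mul_one] at this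
    omega
  have hpos : ∀ (i : Fin 2) (y : PrimeSpectrum (Polynomial L)), Polynomial.X ∈ y.asIdeal →
      Scheme.ord (χ i Polynomial.X) (chart L i y) = 1 := fun i y hy =>
    ord_chart_of_eq_span (chart L i) (hχ i) (origin_apply i hy).2 Polynomial.X_ne_zero
  have hzero : ∀ (i : Fin 2) (y : PrimeSpectrum (Polynomial L)), Polynomial.X ∉ y.asIdeal →
      Scheme.ord (χ i Polynomial.X) (chart L i y) = 0 := fun i y hy =>
    ord_chart_of_notMem (chart L i) (hχ i) hy
  let o : PrimeSpectrum (Polynomial L) := PrimeSpectrum.comap (Polynomial.evalRingHom (0 : L)) ⊥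
  have ho : Polynomial.X ∈ o.asIdeal := by
    change Polynomial.eval 0 Polynomial.X = 0
    simp
  have hoi : ∀ i, Scheme.ord (χ i Polynomial.X) (mapPt (origin L i) (specPt L)).1 = 1 := fun i => by
    rw [← (origin_apply i ho).1]
    exact hpos i o ho
  intro x
  rw [cyc_origin, cyc_origin, Finsupp.sub_apply]
  by_cases h1 : x = mapPt (origin L 1) (specPt L)
  · have h0 : mapPt (origin L 0) (specPt L) ≠ x := by
      intro h0
      have := hsum x.1
      rw [h1, hoi 1, ← h1, ← h0, hoi 0] at this
      omega
    rw [Finsupp.single_eq_of_ne (Ne.symm h0), h1, Finsupp.single_eq_same, hoi 1, sub_zero]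
  · by_cases h0 : x = mapPt (origin L 0) (specPt L)
    · rw [Finsupp.single_eq_of_ne h1, h0, Finsupp.single_eq_same]
      have := hsum x.1
      rw [h0, hoi 0] at this
      omega
    · rw [Finsupp.single_eq_of_ne h1, Finsupp.single_eq_of_ne h0, sub_zero]
      obtain ⟨i, y, hy⟩ := exists_mem_range_chart L x.1
      have hX : Polynomial.X ∉ PrimeSpectrum.asIdeal y := by
        intro hX
        have := (origin_apply i hX).1
        rw [hy] at this
        fin_cases i
        · exact h0 (Subtype.ext this)
        · exact h1 (Subtype.ext this)
      have := hzero i y hX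
      have hs := hsum x.1
      rw [hy] at this
      fin_cases i
      · simp only [Fin.zero_eta] at this
        omega
      · exact this.symm

end ProjLine

/-! ### Rational equivalence of points joined by a rational curve -/

namespace ZeroCycle

attribute [local instance] MvPolynomial.gradedAlgebra

open ProjLine Polynomial

variable {L : Type u} [Field L]

section LocalRing

instance : (Ideal.span {X} : Ideal L[X]).IsPrime :=
  (Ideal.span_singleton_prime X_ne_zero).2 prime_X

variable (L) in
/-- The local ring of the affine line at the origin. -/
abbrev Loc : Type u := Localization.AtPrime (Ideal.span {X} : Ideal L[X])

theorem notMem_span_X {p : L[X]} : p ∉ (Ideal.span {X} : Ideal L[X]) ↔ p.eval 0 ≠ 0 := by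
  rw [Ideal.mem_span_singleton, X_dvd_iff, coeff_zero_eq_eval_zero]

theorem isUnit_eval_zero (p : (Ideal.span {X} : Ideal L[X]).primeCompl) :
    IsUnit (evalRingHom (0 : L) p) :=
  isUnit_iff_ne_zero.2 (notMem_span_X.1 p.2)

variable (L) in
/-- Evaluation at the origin. -/
def Loc.eval : Loc L →+* L := IsLocalization.lift isUnit_eval_zero

theorem Loc.eval_algebraMap (p : L[X]) : Loc.eval L (algebraMap _ _ p) = p.eval 0 :=
  IsLocalization.lift_eq _ _

theorem Loc.isUnit_of_eval_ne_zero {z : Loc L} (h : Loc.eval L z ≠ 0) : IsUnit z := by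
  obtain ⟨p, q, rfl⟩ := IsLocalization.exists_mk'_eq (Ideal.span {X} : Ideal L[X]).primeCompl z
  have hp : p ∉ (Ideal.span {X} : Ideal L[X]) := by
    rw [notMem_span_X]
    intro h0
    refine h ?_
    rw [Loc.eval, IsLocalization.lift_mk'_spec]
    simpa using h0
  have := IsLocalization.map_units (Loc L) (⟨p, hp⟩ : (Ideal.span {X} : Ideal L[X]).primeCompl)
  refine isUnit_of_mul_isUnit_left (y := algebraMap _ _ (q : L[X])) ?_
  rw [IsLocalization.mk'_spec]
  exact this

variable {g : L[X]}

/-- Evaluation of a localized polynomial at an element of the local ring. -/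
theorem Loc.exists_lift (w : Loc L) {e : Localization.Away g →+* L}
    (he : e.comp (algebraMap L[X] _) = evalRingHom (Loc.eval L w)) :
    ∃ m : Localization.Away g →+* Loc L,
      m.comp ((algebraMap L[X] _).comp C) = (algebraMap L[X] _).comp C ∧
      m (algebraMap L[X] _ X) = w ∧ (Loc.eval L).comp m = e := by
  let m' : L[X] →+* Loc L := eval₂RingHom ((algebraMap L[X] (Loc L)).comp C) w
  have hm' : (Loc.eval L).comp m' = evalRingHom (Loc.eval L w) := by
    refine Polynomial.ringHom_ext (fun a => ?_) ?_
    · simp [m', Loc.eval_algebraMap]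
    · simp [m']
  have hu : IsUnit (m' g) := by
    refine Loc.isUnit_of_eval_ne_zero ?_
    rw [← RingHom.comp_apply, hm', ← he]
    exact ((IsLocalization.Away.algebraMap_isUnit (S := Localization.Away g) g).map e).ne_zero
  refine ⟨IsLocalization.Away.lift g hu, ?_, ?_, ?_⟩
  · ext a
    simp only [RingHom.comp_apply, IsLocalization.Away.lift_eq]
    simp [m']
  · rw [IsLocalization.Away.lift_eq]
    simp [m']
  · refine IsLocalization.ringHom_ext (Submonoid.powers g) ?_
    rw [RingHom.comp_assoc, IsLocalization.Away.lift_comp, hm', he]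

end LocalRing

/-- Two points of `V` with values in a field are linked if they are joined by a rational curve
contained in a fibre of `f`. -/
def Linked {V W : Scheme.{u}} (f : V ⟶ W) (q₀ q₁ : Spec (CommRingCat.of L) ⟶ V) : Prop :=
  ∃ (g : L[X]) (h : Spec (CommRingCat.of (Localization.Away g)) ⟶ V)
    (e₀ e₁ : Localization.Away g →+* L),
    e₀.comp (algebraMap L[X] _) = evalRingHom 0 ∧ e₁.comp (algebraMap L[X] _) = evalRingHom 1 ∧
    Spec.map (CommRingCat.ofHom e₀) ≫ h = q₀ ∧ Spec.map (CommRingCat.ofHom e₁) ≫ h = q₁ ∧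
    h ≫ f = Spec.map (CommRingCat.ofHom ((algebraMap L[X] (Localization.Away g)).comp C)) ≫ q₀ ≫ f

variable {V W : Scheme.{u}} {f : V ⟶ W}

theorem Linked.comp_eq {q₀ q₁ : Spec (CommRingCat.of L) ⟶ V} (h : Linked f q₀ q₁) :
    q₀ ≫ f = q₁ ≫ f := by
  obtain ⟨g, h, e₀, e₁, h0, h1, rfl, rfl, hh⟩ := h
  have key : ∀ (e : Localization.Away g →+* L) (a : L),
      e.comp (algebraMap L[X] _) = evalRingHom a →
      (Spec.map (CommRingCat.ofHom e) ≫ h) ≫ f = (Spec.map (CommRingCat.ofHom e₀) ≫ h) ≫ f := by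
    intro e a he
    have : e.comp ((algebraMap L[X] (Localization.Away g)).comp C) = RingHom.id L := by
      rw [← RingHom.comp_assoc, he]
      ext
      simp
    nth_rw 1 [Category.assoc, hh]
    rw [← Category.assoc, ← Spec.map_comp, ← CommRingCat.ofHom_comp, this, CommRingCat.ofHom_id,
      Spec.map_id, Category.id_comp]
  rw [key e₁ 1 h1]

theorem cyc_sub_cyc_mem_rat [IsProper f] {q₀ q₁ : Spec (CommRingCat.of L) ⟶ V} [IsProper q₀]
    [IsProper q₁] (h : Linked f q₀ q₁) : cyc q₀ - cyc q₁ ∈ rat V := by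
  obtain ⟨g, h, e₀, e₁, h0, h1, hq₀, hq₁, hh⟩ := h
  obtain ⟨χ, hχ, hχX⟩ := exists_charts (L := L)
  have hC := isNormalCurve L
  let K := (Proj (gr L)).functionField
  have hinj : ∀ i, Function.Injective (χ i) := fun i => chart_injective (chart L i) (hχ i)
  have hunit : ∀ i (p : (Ideal.span {X} : Ideal L[X]).primeCompl), IsUnit (χ i p) := fun i p =>
    isUnit_iff_ne_zero.2 fun h => notMem_span_X.1 p.2 (by
      rw [hinj i (h.trans (map_zero _).symm), eval_zero])
  let κ : Fin 2 → Loc L →+* K := fun i => IsLocalization.lift (hunit i)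
  have hκ : ∀ i p, κ i (algebraMap _ _ p) = χ i p := fun i p => IsLocalization.lift_eq _ _
  have hκinj : ∀ i, Function.Injective (κ i) := fun i => by
    refine (IsLocalization.lift_injective_iff _).2 fun x y => ?_
    rw [(hinj i).eq_iff, (IsLocalization.injective (Loc L)
      (Ideal.span {X} : Ideal L[X]).primeCompl_le_nonZeroDivisors).eq_iff]
  have hu : IsUnit (algebraMap L[X] (Loc L) (X - 1)) :=
    Loc.isUnit_of_eval_ne_zero (by simp [Loc.eval_algebraMap])
  obtain ⟨v, hv⟩ := hu.exists_right_inv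
  have hv0 : Loc.eval L v = -1 := by
    have := congrArg (Loc.eval L) hv
    rw [map_mul, Loc.eval_algebraMap, map_one] at this
    simp at this
    linear_combination -this
  let w : Fin 2 → Loc L := ![-v, algebraMap L[X] (Loc L) X * v]
  have hw0 : Loc.eval L (w 0) = 1 := by simp [w, hv0]
  have hw1 : Loc.eval L (w 1) = 0 := by simp [w, Loc.eval_algebraMap]
  obtain ⟨m₀, hm₀C, hm₀X, hm₀⟩ := Loc.exists_lift (w 0) (e := e₁) (by rw [hw0, h1])
  obtain ⟨m₁, hm₁C, hm₁X, hm₁⟩ := Loc.exists_lift (w 1) (e := e₀) (by rw [hw1, h0])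
  have hCC : (χ 0).comp C = (χ 1).comp C := by
    have e := (congrArg (· ≫ str L) (hχ 0)).trans (congrArg (· ≫ str L) (hχ 1)).symm
    simp only [Category.assoc, chart_str, ← Spec.map_comp, ← CommRingCat.ofHom_comp] at e
    exact congrArg CommRingCat.Hom.hom (Spec.map_injective e)
  have hκv : ∀ i, (χ i X - 1) * κ i v = 1 := fun i => by
    have := congrArg (κ i) hv
    rw [map_mul, hκ, map_one, map_sub, map_one] at this
    exact this
  have hev : (κ 0).comp m₀ = (κ 1).comp m₁ := by
    refine IsLocalization.ringHom_ext (Submonoid.powers g) (Polynomial.ringHom_ext (fun a => ?_) ?_)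
    · have e0 := DFunLike.congr_fun hm₀C a
      have e1 := DFunLike.congr_fun hm₁C a
      simp only [RingHom.comp_apply] at e0 e1 ⊢
      rw [e0, e1, hκ, hκ]
      exact DFunLike.congr_fun hCC a
    · simp only [RingHom.comp_apply]
      rw [hm₀X, hm₁X]
      have hw0' : κ 0 (w 0) = - κ 0 v := by simp [w]
      have hw1' : κ 1 (w 1) = χ 1 X * κ 1 v := by simp [w, hκ]
      have a0 := hκv 0
      have a1 := hκv 1
      rw [hw0', hw1']
      have hne : χ 0 X - 1 ≠ 0 := left_ne_zero_of_mul_eq_one a0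
      have hne1 : χ 1 X - 1 ≠ 0 := left_ne_zero_of_mul_eq_one a1
      refine mul_left_cancel₀ hne (mul_left_cancel₀ hne1 ?_)
      linear_combination (-(χ 1 X - 1)) * a0 - (χ 0 X - 1) * χ 1 X * a1 - hχX
  let G : Spec (CommRingCat.of K) ⟶ V := Spec.map (CommRingCat.ofHom ((κ 1).comp m₁)) ≫ h
  have hK : ∀ (i : Fin 2) (m : Localization.Away g →+* Loc L),
      m.comp ((algebraMap L[X] _).comp C) = (algebraMap L[X] _).comp C →
      (Spec.map (CommRingCat.ofHom m) ≫ h) ≫ f =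
        Spec.map (CommRingCat.ofHom (algebraMap L[X] (Loc L))) ≫ chart L i ≫ str L ≫ q₀ ≫ f := by
    intro i m hm
    rw [Category.assoc, hh, ← Category.assoc, ← Spec.map_comp, ← CommRingCat.ofHom_comp, hm,
      CommRingCat.ofHom_comp, Spec.map_comp, Category.assoc, ← chart_str L i, Category.assoc]
  have hκs : ∀ i, Spec.map (CommRingCat.ofHom (κ i)) ≫
      Spec.map (CommRingCat.ofHom (algebraMap L[X] (Loc L))) ≫ chart L i =
      (Proj (gr L)).fromSpecStalk (genericPoint (Proj (gr L))) := fun i => by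
    rw [← Category.assoc, ← Spec.map_comp, ← CommRingCat.ofHom_comp, ← hχ i]
    congr 3
    exact RingHom.ext (hκ i)
  obtain ⟨H, hH, hHG⟩ := hC.exists_lift f (str L ≫ q₀ ≫ f) G (by
    have e := hK 1 m₁ hm₁C
    change (Spec.map (CommRingCat.ofHom ((κ 1).comp m₁)) ≫ h) ≫ f = _
    rw [← hκs 1]
    simp only [Category.assoc] at e ⊢
    rw [← e, CommRingCat.ofHom_comp, Spec.map_comp, Category.assoc])
  have hHp : IsProper H := by
    have : IsProper (H ≫ f) := by
      rw [hH]
      infer_instance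
    exact IsProper.of_comp H f
  have hend : ∀ (i : Fin 2) (m : Localization.Away g →+* Loc L),
      m.comp ((algebraMap L[X] _).comp C) = (algebraMap L[X] _).comp C →
      (κ i).comp m = (κ 1).comp m₁ →
      origin L i ≫ H = Spec.map (CommRingCat.ofHom ((Loc.eval L).comp m)) ≫ h := by
    intro i m hm hκm
    have hdom : IsDominant (Spec.map (CommRingCat.ofHom (κ i))) :=
      ⟨(PrimeSpectrum.denseRange_comap_iff_ker_le_nilRadical (κ i)).2 (by
        rw [(RingHom.injective_iff_ker_eq_bot _).1 (hκinj i)]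
        exact bot_le)⟩
    have e : Spec.map (CommRingCat.ofHom m) ≫ h =
        Spec.map (CommRingCat.ofHom (algebraMap L[X] (Loc L))) ≫ chart L i ≫ H := by
      refine ext_of_isDominant_of_isSeparated f ?_ (Spec.map (CommRingCat.ofHom (κ i))) ?_
      · rw [hK i m hm]
        simp only [Category.assoc, hH]
      · rw [← Category.assoc, ← Spec.map_comp, ← CommRingCat.ofHom_comp, hκm]
        refine hHG.symm.trans ?_
        rw [← hκs i]
        simp only [Category.assoc]
    have hev0 : (Loc.eval L).comp (algebraMap L[X] (Loc L)) = evalRingHom 0 :=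
      RingHom.ext Loc.eval_algebraMap
    rw [CommRingCat.ofHom_comp, Spec.map_comp, Category.assoc, e, ← Category.assoc,
      ← Spec.map_comp, ← CommRingCat.ofHom_comp, hev0, origin, Category.assoc]
  have hend0 : origin L 1 ≫ H = q₀ := by
    rw [hend 1 m₁ hm₁C rfl, hm₁, hq₀]
  have hend1 : origin L 0 ≫ H = q₁ := by
    rw [hend 0 m₀ hm₀C hev, hm₀, hq₁]
  refine AddSubgroup.subset_closure ⟨_, hC, H, hHp, χ 1 X, cyc (origin L 1) - cyc (origin L 0),
    right_ne_zero_of_mul_eq_one hχX, isDivisorOf_coordinate hχ hχX, ?_⟩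
  rw [map_sub, push_cyc, push_cyc]
  congr 1
  · congr 1
    exact hend0.symm
  · congr 1
    exact hend1.symm

end ZeroCycle

/-! ### A criterion for universal `CH₀`-triviality -/

namespace ZeroCycle

open ProjLine

theorem residueDegree_of_isPreimmersion {X Y : Scheme.{u}} (f : X ⟶ Y) [IsPreimmersion f] (x : X) :
    f.residueDegree x = 1 := by
  have h : Function.Surjective (f.residueFieldMap x) := by
    have h1 : Y.residue (f x) ≫ f.residueFieldMap x = f.stalkMap x ≫ X.residue x :=
      Scheme.residue_residueFieldMap f x
    intro z
    obtain ⟨w, rfl⟩ := X.residue_surjective x z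
    obtain ⟨v, rfl⟩ := f.stalkMap_surjective x w
    exact ⟨Y.residue (f x) v, congr($(h1) v)⟩
  let := (f.residueFieldMap x).hom.toAlgebra
  let e : Y.residueField (f x) ≃ₗ[Y.residueField (f x)] X.residueField x :=
    LinearEquiv.ofBijective (Algebra.linearMap _ _) ⟨(f.residueFieldMap x).hom.injective, h⟩
  change Module.finrank (Y.residueField (f x)) (X.residueField x) = 1
  rw [← e.finrank_eq, Module.finrank_self]

variable {X Y : Scheme.{u}}

theorem isProper_fromSpecResidueField (x : ClosedPt X) : IsProper (X.fromSpecResidueField x.1) :=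
  have := isClosed_singleton_iff_isClosedImmersion.1 x.2
  inferInstance

theorem cyc_fromSpecResidueField (x : ClosedPt X) :
    haveI := isProper_fromSpecResidueField x
    cyc (L := X.residueField x.1) (X.fromSpecResidueField x.1) = Finsupp.single x 1 := by
  have := isProper_fromSpecResidueField x
  have h : mapPt (X.fromSpecResidueField x.1) (specPt (X.residueField x.1)) = x :=
    Subtype.ext (Scheme.fromSpecResidueField_apply _ _)
  have h2 := cyc_eq (L := X.residueField x.1) (X.fromSpecResidueField x.1)
  rw [h2, residueDegree_of_isPreimmersion, h, Nat.cast_one]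

theorem cyc_eq_smul {L M : Type u} [Field L] [Field M]
    (a : Spec (CommRingCat.of L) ⟶ Spec (CommRingCat.of M)) [IsProper a] :
    ∃ n : ℤ, cyc a = n • Finsupp.single (specPt M) 1 := by
  refine ⟨(a.residueDegree (specPt L).1 : ℤ), (cyc_eq a).trans ?_⟩
  have : mapPt a (specPt L) = specPt M :=
    Subtype.ext (Subsingleton.elim (α := PrimeSpectrum M) _ _)
  rw [this, Finsupp.smul_single, smul_eq_mul, mul_one]

variable {f : X ⟶ Y}

theorem eqvGen_baseChange {k : Type u} [Field k] (s : Y ⟶ Spec (CommRingCat.of k))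
    {K : Type u} [Field K] [Algebra k K] {L : Type u} [Field L]
    {q₀ q₁ : Spec (CommRingCat.of L) ⟶ X} (h : Relation.EqvGen (Linked f) q₀ q₁) :
    q₀ ≫ f = q₁ ≫ f ∧ ∀ (r : Spec (CommRingCat.of L) ⟶ Spec (CommRingCat.of K))
      (w₀ : q₀ ≫ f ≫ s = r ≫ specExt k K) (w₁ : q₁ ≫ f ≫ s = r ≫ specExt k K),
      Relation.EqvGen (Linked (baseChange s f K)) (pullback.lift q₀ r w₀)
        (pullback.lift q₁ r w₁) := by
  induction h with
  | rel q₀ q₁ h =>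
    refine ⟨h.comp_eq, fun r w₀ w₁ => .rel _ _ ?_⟩
    obtain ⟨g, h, e₀, e₁, he₀, he₁, h₀, h₁, hf⟩ := h
    have hw : h ≫ f ≫ s = (Spec.map (CommRingCat.ofHom ((algebraMap (Polynomial L)
        (Localization.Away g)).comp Polynomial.C)) ≫ r) ≫ specExt k K := by
      rw [reassoc_of% hf, w₀, Category.assoc]
    have hc : ∀ (e : Localization.Away g →+* L) (a : L),
        e.comp (algebraMap (Polynomial L) _) = Polynomial.evalRingHom a →
        Spec.map (CommRingCat.ofHom e) ≫ Spec.map (CommRingCat.ofHom ((algebraMap (Polynomial L)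
          (Localization.Away g)).comp Polynomial.C)) = 𝟙 _ := by
      intro e a he
      rw [← Spec.map_comp, ← CommRingCat.ofHom_comp, ← RingHom.comp_assoc, he]
      have : (Polynomial.evalRingHom a).comp Polynomial.C = RingHom.id L := by ext; simp
      rw [this]
      exact Spec.map_id _
    refine ⟨g, pullback.lift h _ hw, e₀, e₁, he₀, he₁, ?_, ?_, ?_⟩
    · refine pullback.hom_ext ?_ ?_
      · rw [Category.assoc, pullback.lift_fst, pullback.lift_fst, h₀]
      · rw [Category.assoc, pullback.lift_snd, pullback.lift_snd, reassoc_of% hc e₀ 0 he₀]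
    · refine pullback.hom_ext ?_ ?_
      · rw [Category.assoc, pullback.lift_fst, pullback.lift_fst, h₁]
      · rw [Category.assoc, pullback.lift_snd, pullback.lift_snd, reassoc_of% hc e₁ 1 he₁]
    · refine pullback.hom_ext ?_ ?_
      · simp only [baseChange, Category.assoc, pullback.lift_fst, pullback.lift_fst_assoc, hf]
      · simp only [baseChange, Category.assoc, pullback.lift_snd]
  | refl q => exact ⟨rfl, fun r w₀ w₁ => .refl _⟩
  | symm q₀ q₁ _ ih =>
    exact ⟨ih.1.symm, fun r w₀ w₁ => (ih.2 r w₁ w₀).symm _ _⟩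
  | trans q₀ q₁ q₂ _ _ ih₀ ih₁ =>
    refine ⟨ih₀.1.trans ih₁.1, fun r w₀ w₂ => ?_⟩
    have w₁ : q₁ ≫ f ≫ s = r ≫ specExt k K := by rw [← reassoc_of% ih₀.1, w₀]
    exact (ih₀.2 r w₀ w₁).trans _ _ _ (ih₁.2 r w₁ w₂)

variable [IsProper f]

theorem isProper_iff_comp {Z : Scheme.{u}} (q : Z ⟶ X) : IsProper q ↔ IsProper (q ≫ f) :=
  ⟨fun _ => inferInstance, fun _ => IsProper.of_comp q f⟩

theorem mk_cyc_eq {L : Type u} [Field L] {q₀ q₁ : Spec (CommRingCat.of L) ⟶ X}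
    (h : Relation.EqvGen (Linked f) q₀ q₁) :
    q₀ ≫ f = q₁ ≫ f ∧ ∀ [IsProper q₀] [IsProper q₁],
      (QuotientAddGroup.mk (cyc q₀) : CH0 X) = QuotientAddGroup.mk (cyc q₁) := by
  induction h with
  | rel q₀ q₁ h =>
    refine ⟨h.comp_eq, ?_⟩
    intro _ _
    rw [← sub_eq_zero, ← QuotientAddGroup.mk_sub, QuotientAddGroup.eq_zero_iff]
    exact cyc_sub_cyc_mem_rat h
  | refl q => exact ⟨rfl, rfl⟩
  | symm q₀ q₁ _ ih =>
    exact ⟨ih.1.symm, ih.2.symm⟩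
  | trans q₀ q₁ q₂ _ _ ih₀ ih₁ =>
    refine ⟨ih₀.1.trans ih₁.1, ?_⟩
    intro h0 h2
    have : IsProper q₁ := by
      rw [isProper_iff_comp (f := f), ← ih₀.1]
      infer_instance
    exact ih₀.2.trans ih₁.2

/-- A proper morphism along which points with values in fields lift, uniquely up to chains of
rational curves in the fibres, induces an isomorphism on Chow groups of zero-cycles. -/
theorem bijective_push
    (hlift : ∀ (L : Type u) [Field L] (p : Spec (CommRingCat.of L) ⟶ Y), ∃ q, q ≫ f = p)
    (hlink : ∀ (L : Type u) [Field L] (q₀ q₁ : Spec (CommRingCat.of L) ⟶ X),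
      q₀ ≫ f = q₁ ≫ f → Relation.EqvGen (Linked f) q₀ q₁) :
    Function.Bijective (CH0.push f) := by
  choose q hq using fun y : ClosedPt Y =>
    hlift (Y.residueField y.1) (Y.fromSpecResidueField y.1)
  have hqp : ∀ y, IsProper (q y) := fun y => by
    rw [isProper_iff_comp (f := f), hq]
    exact isProper_fromSpecResidueField y
  let σ : Z0 Y →+ CH0 X := Finsupp.liftAddHom fun y =>
    zmultiplesHom _ (QuotientAddGroup.mk (cyc (q y)) : CH0 X)
  have hσ : ∀ y, σ (Finsupp.single y 1) = QuotientAddGroup.mk (cyc (q y)) := fun y => by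
    simp [σ]
  have key : ∀ z : Z0 X, σ (push f z) = QuotientAddGroup.mk z := by
    suffices h : σ.comp (push f) = QuotientAddGroup.mk' (rat X) from fun z => DFunLike.congr_fun h z
    refine Finsupp.addHom_ext' fun x => AddMonoidHom.ext_int ?_
    change σ (push f (Finsupp.single x 1)) = QuotientAddGroup.mk (Finsupp.single x 1)
    have hx := isProper_fromSpecResidueField x
    let y := mapPt f x
    have hy := isProper_fromSpecResidueField y
    let a : Spec (CommRingCat.of (X.residueField x.1)) ⟶ Spec (CommRingCat.of (Y.residueField y.1)) :=
      Spec.map (f.residueFieldMap x.1)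
    have ha : a ≫ Y.fromSpecResidueField y.1 = X.fromSpecResidueField x.1 ≫ f :=
      Scheme.Hom.SpecMap_residueFieldMap_fromSpecResidueField f x.1
    have hap : IsProper a := by
      rw [isProper_iff_comp (f := Y.fromSpecResidueField y.1), ha]
      infer_instance
    obtain ⟨n, hn⟩ := cyc_eq_smul a
    have e1 : (QuotientAddGroup.mk (cyc (L := X.residueField x.1) (X.fromSpecResidueField x.1)) :
        CH0 X) = QuotientAddGroup.mk (cyc (a ≫ q y)) := by
      refine (mk_cyc_eq (f := f) (hlink (X.residueField x.1) (X.fromSpecResidueField x.1)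
        (a ≫ q y) ?_)).2
      rw [Category.assoc, hq, ha]
    have e2 : push f (Finsupp.single x 1) = n • Finsupp.single y 1 := by
      rw [← cyc_fromSpecResidueField x, push_cyc]
      have e3 : cyc (L := X.residueField x.1) (X.fromSpecResidueField x.1 ≫ f) =
          push (Y.fromSpecResidueField y.1) (cyc a) := by
        rw [push_cyc]
        congr 1
        exact ha.symm
      rw [e3, hn, map_zsmul]
      congr 1
      exact cyc_fromSpecResidueField y
    rw [e2, map_zsmul, hσ, ← cyc_fromSpecResidueField x, e1, ← push_cyc, hn, map_zsmul]
    rfl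
  constructor
  · rw [injective_iff_map_eq_zero]
    intro z hz
    obtain ⟨z, rfl⟩ := QuotientAddGroup.mk_surjective z
    change (QuotientAddGroup.mk (push f z) : CH0 Y) = 0 at hz
    rw [QuotientAddGroup.eq_zero_iff] at hz
    have hr : rat Y ≤ σ.ker := by
      refine (AddSubgroup.closure_le _).2 ?_
      rintro _ ⟨C, hC, π, hπ, g, D, hg, hD, rfl⟩
      have := hC.integral
      obtain ⟨t, ht⟩ := hlift C.functionField (C.fromSpecStalk (genericPoint C) ≫ π)
      obtain ⟨p, hp, -⟩ := hC.exists_lift f π t ht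
      have hpp : IsProper p := by
        rw [isProper_iff_comp (f := f), hp]
        infer_instance
      subst hp
      change σ (push (p ≫ f) D) = 0
      rw [push_comp, key, QuotientAddGroup.eq_zero_iff]
      exact AddSubgroup.subset_closure ⟨C, hC, p, hpp, g, D, hg, hD, rfl⟩
    rw [← key]
    exact hr hz
  · have : Function.Surjective (push f) := by
      rw [← AddMonoidHom.range_eq_top, eq_top_iff]
      intro z _
      induction z using Finsupp.induction_linear with
      | zero => exact zero_mem _
      | add z w hz hw => exact add_mem (hz trivial) (hw trivial)
      | single y n =>
        have h1 : Finsupp.single y n = n • Finsupp.single y (1 : ℤ) := by simp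
        rw [h1]
        refine zsmul_mem ?_ n
        refine ⟨cyc (q y), ?_⟩
        rw [push_cyc, ← cyc_fromSpecResidueField y]
        congr 1
        exact hq y
    intro z
    obtain ⟨z, rfl⟩ := QuotientAddGroup.mk_surjective z
    obtain ⟨w, rfl⟩ := this z
    exact ⟨QuotientAddGroup.mk w, rfl⟩

theorem isUniversallyCH0Trivial_of {k : Type u} [Field k] (s : Y ⟶ Spec (CommRingCat.of k))
    (hlift : ∀ (L : Type u) [Field L] (p : Spec (CommRingCat.of L) ⟶ Y), ∃ q, q ≫ f = p)
    (hlink : ∀ (L : Type u) [Field L] (q₀ q₁ : Spec (CommRingCat.of L) ⟶ X),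
      q₀ ≫ f = q₁ ≫ f → Relation.EqvGen (Linked f) q₀ q₁) :
    IsUniversallyCH0Trivial s f := by
  refine ⟨inferInstance, fun K _ _ => bijective_push (fun L _ p => ?_) fun L _ q₀ q₁ h => ?_⟩
  · obtain ⟨q, hq⟩ := hlift L (p ≫ pullback.fst _ _)
    refine ⟨pullback.lift q (p ≫ pullback.snd _ _) ?_, ?_⟩
    · rw [reassoc_of% hq, Category.assoc, pullback.condition]
    · refine pullback.hom_ext ?_ ?_
      · simp only [baseChange, Category.assoc, pullback.lift_fst, pullback.lift_fst_assoc, hq]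
      · simp only [baseChange, Category.assoc, pullback.lift_snd]
  · have h₁ := congr($h ≫ pullback.fst _ _)
    have h₂ := congr($h ≫ pullback.snd _ _)
    simp only [baseChange, Category.assoc, pullback.lift_fst, pullback.lift_snd] at h₁ h₂
    have := (eqvGen_baseChange (K := K) s (hlink L (q₀ ≫ pullback.fst _ _)
      (q₁ ≫ pullback.fst _ _) (by simpa using h₁))).2 (q₀ ≫ pullback.snd _ _)
      (by simp [pullback.condition]) (by rw [h₂]; simp [pullback.condition])
    convert this using 1
    · exact pullback.hom_ext (pullback.lift_fst ..).symm (pullback.lift_snd ..).symm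
    · exact pullback.hom_ext (pullback.lift_fst ..).symm (h₂.symm.trans (pullback.lift_snd ..).symm)

end ZeroCycle

/-! ### Morphisms given by their values on affine charts -/

namespace Charts

variable {T Z : Scheme.{u}} {A B : Type u} [CommRing A] [CommRing B]

theorem exists_specMap (f : Spec (CommRingCat.of A) ⟶ Spec (CommRingCat.of B)) :
    ∃ φ : B →+* A, f = Spec.map (CommRingCat.ofHom φ) := by
  obtain ⟨γ, hγ⟩ := Spec.map_surjective f
  exact ⟨γ.hom, hγ.symm⟩

theorem exists_chart {U : T.Opens} {t : T} (ht : t ∈ U) :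
    ∃ (B : Type u) (_ : CommRing B) (k : Spec (CommRingCat.of B) ⟶ T) (_ : IsOpenImmersion k),
      t ∈ Set.range k ∧ Set.range k ⊆ U := by
  obtain ⟨_, ⟨W, hW, rfl⟩, htW, hWU⟩ :=
    T.isBasis_affineOpens.exists_subset_of_mem_open ht U.2
  have hW : IsAffineOpen W := hW
  exact ⟨Γ(T, W), inferInstance, hW.fromSpec, inferInstance, hW.range_fromSpec.ge htW,
    hW.range_fromSpec.le.trans hWU⟩

theorem spec_hom_ext_of_locally {f g : Spec (CommRingCat.of A) ⟶ Z}
    (h : ∀ y : PrimeSpectrum A, ∃ a, a ∉ y.asIdeal ∧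
      Spec.map (CommRingCat.ofHom (algebraMap A (Localization.Away a))) ≫ f =
      Spec.map (CommRingCat.ofHom (algebraMap A (Localization.Away a))) ≫ g) : f = g := by
  choose a ha e using h
  refine ProjPt.spec_hom_ext_of_span (Set.range a) ?_ (by rintro _ ⟨y, rfl⟩; exact e y)
  by_contra hne
  obtain ⟨m, hm, hle⟩ := Ideal.exists_le_maximal _ hne
  exact ha ⟨m, hm.isPrime⟩ (hle (Ideal.subset_span ⟨_, rfl⟩))

theorem range_specMap_away (a : A) :
    Set.range (Spec.map (CommRingCat.ofHom (algebraMap A (Localization.Away a)))) =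
      (PrimeSpectrum.basicOpen a : Set (PrimeSpectrum A)) :=
  PrimeSpectrum.localization_away_comap_range (Localization.Away a) a

instance (a : A) :
    IsOpenImmersion (Spec.map (CommRingCat.ofHom (algebraMap A (Localization.Away a)))) :=
  Scheme.isOpenImmersion_SpecMap_localizationAway (R := CommRingCat.of _) a

theorem exists_away_lift (F : Spec (CommRingCat.of A) ⟶ T) (y : PrimeSpectrum A)
    (k : Z ⟶ T) [IsOpenImmersion k] (hy : F y ∈ Set.range k) :
    ∃ a, a ∉ y.asIdeal ∧ ∃ j : Spec (CommRingCat.of (Localization.Away a)) ⟶ Z,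
      Spec.map (CommRingCat.ofHom (algebraMap A (Localization.Away a))) ≫ F = j ≫ k := by
  obtain ⟨_, ⟨a, rfl⟩, hya, haU⟩ := PrimeSpectrum.isTopologicalBasis_basic_opens
    (R := A) |>.exists_subset_of_mem_open (a := y) hy (F ⁻¹ᵁ k.opensRange).2
  refine ⟨a, hya, ?_⟩
  have hr : Set.range (Spec.map (CommRingCat.ofHom (algebraMap A (Localization.Away a))) ≫ F) ⊆
      Set.range k := by
    rintro _ ⟨z, rfl⟩
    exact haU ((range_specMap_away a).le ⟨z, rfl⟩)
  exact ⟨IsOpenImmersion.lift _ _ hr, (IsOpenImmersion.lift_fac _ _ _).symm⟩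

theorem exists_away_factor (F : Spec (CommRingCat.of A) ⟶ T) (y : PrimeSpectrum A)
    (k : Spec (CommRingCat.of B) ⟶ T) [IsOpenImmersion k] (hy : F y ∈ Set.range k) :
    ∃ a, a ∉ y.asIdeal ∧ ∃ φ : B →+* Localization.Away a,
      Spec.map (CommRingCat.ofHom (algebraMap A (Localization.Away a))) ≫ F =
        Spec.map (CommRingCat.ofHom φ) ≫ k := by
  obtain ⟨a, ha, j, hj⟩ := exists_away_lift F y k hy
  obtain ⟨φ, rfl⟩ := exists_specMap j
  exact ⟨a, ha, φ, hj⟩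

/-- A morphism can be given by its values on charts. -/
theorem exists_hom_of_charts
    (P : ∀ {B : Type u} [CommRing B], (Spec (CommRingCat.of B) ⟶ T) →
      (Spec (CommRingCat.of B) ⟶ Z) → Prop)
    (hnat : ∀ {B D : Type u} [CommRing B] [CommRing D] (k : Spec (CommRingCat.of B) ⟶ T)
      (v : Spec (CommRingCat.of B) ⟶ Z) (φ : B →+* D),
      IsOpenImmersion k → IsOpenImmersion (Spec.map (CommRingCat.ofHom φ)) → P k v →
      P (Spec.map (CommRingCat.ofHom φ) ≫ k) (Spec.map (CommRingCat.ofHom φ) ≫ v))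
    (huniq : ∀ {B : Type u} [CommRing B] (k : Spec (CommRingCat.of B) ⟶ T)
      (v w : Spec (CommRingCat.of B) ⟶ Z), IsOpenImmersion k → P k v → P k w → v = w)
    (hex : ∀ t : T, ∃ (B : Type u) (_ : CommRing B) (k : Spec (CommRingCat.of B) ⟶ T)
      (_ : IsOpenImmersion k), t ∈ Set.range k ∧ ∃ v, P k v) :
    ∃ f : T ⟶ Z, ∀ (B : Type u) [CommRing B] (k : Spec (CommRingCat.of B) ⟶ T)
      (v : Spec (CommRingCat.of B) ⟶ Z), IsOpenImmersion k → P k v → k ≫ f = v := by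
  let P' (U : T.Opens) (h : U.toScheme ⟶ Z) : Prop := ∃ (B : Type u) (_ : CommRing B)
    (m : Spec (CommRingCat.of B) ⟶ U.toScheme), IsIso m ∧ P (m ≫ U.ι) (m ≫ h)
  have h1 : ∀ t : T, ∃ U : T.Opens, t ∈ U ∧ ∃ h, P' U h := by
    intro t
    obtain ⟨B, _, k, hk, ht, v, hv⟩ := hex t
    have e : k.isoOpensRange.hom ≫ k.opensRange.ι = k := by simp
    exact ⟨k.opensRange, ht, k.isoOpensRange.inv ≫ v, B, inferInstance, k.isoOpensRange.hom,
      inferInstance, by rwa [e, Iso.hom_inv_id_assoc]⟩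
  have h2 : ∀ U V h k, P' U h → P' V k →
      T.homOfLE (inf_le_left : U ⊓ V ≤ U) ≫ h = T.homOfLE (inf_le_right : U ⊓ V ≤ V) ≫ k := by
    rintro U V h k ⟨B, _, m, hm, hP⟩ ⟨B', _, m', hm', hP'⟩
    refine hom_ext_of_locally fun t => ?_
    obtain ⟨D, _, j, _, ht, -⟩ := exists_chart (U := (⊤ : (U ⊓ V).toScheme.Opens)) (t := t) trivial
    refine ⟨j.opensRange, ht, Blow.comp_eq_comp_of_range j ?_⟩
    have key : ∀ {W : T.Opens} {C : Type u} [CommRing C] (le : U ⊓ V ≤ W)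
        (n : Spec (CommRingCat.of C) ⟶ W.toScheme) (h : W.toScheme ⟶ Z), IsIso n →
        P (n ≫ W.ι) (n ≫ h) → P (j ≫ (U ⊓ V).ι) (j ≫ T.homOfLE le ≫ h) := by
      intro W C _ le n h hn hP
      obtain ⟨φ, hφ⟩ := exists_specMap (j ≫ T.homOfLE le ≫ inv n)
      have := hnat _ _ φ inferInstance (by rw [← hφ]; infer_instance) hP
      rwa [← hφ, Category.assoc, Category.assoc, IsIso.inv_hom_id_assoc, Scheme.homOfLE_ι,
        Category.assoc, Category.assoc, IsIso.inv_hom_id_assoc] at this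
    exact huniq _ _ _ inferInstance (key inf_le_left m h hm hP) (key inf_le_right m' k hm' hP')
  obtain ⟨f, hf⟩ := exists_glue P' h1 h2
  refine ⟨f, fun B _ k v hk hP => ?_⟩
  have e : k.isoOpensRange.hom ≫ k.opensRange.ι = k := by simp
  have := hf k.opensRange (k.isoOpensRange.inv ≫ v)
    ⟨B, inferInstance, k.isoOpensRange.hom, inferInstance, by rwa [e, Iso.hom_inv_id_assoc]⟩
  rw [← e, Category.assoc, this, Iso.hom_inv_id_assoc]

/-- A morphism can be given by its values on points with values in rings. -/
theorem exists_hom_of_points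
    (P : ∀ {B : Type u} [CommRing B], (Spec (CommRingCat.of B) ⟶ T) →
      (Spec (CommRingCat.of B) ⟶ Z) → Prop)
    (hnat : ∀ {B D : Type u} [CommRing B] [CommRing D] (k : Spec (CommRingCat.of B) ⟶ T)
      (v : Spec (CommRingCat.of B) ⟶ Z) (φ : B →+* D), P k v →
      P (Spec.map (CommRingCat.ofHom φ) ≫ k) (Spec.map (CommRingCat.ofHom φ) ≫ v))
    (huniq : ∀ {B : Type u} [CommRing B] (k : Spec (CommRingCat.of B) ⟶ T)
      (v w : Spec (CommRingCat.of B) ⟶ Z), P k v → P k w → v = w)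
    (hex : ∀ t : T, ∃ (B : Type u) (_ : CommRing B) (k : Spec (CommRingCat.of B) ⟶ T)
      (_ : IsOpenImmersion k), t ∈ Set.range k ∧ ∃ v, P k v) :
    ∃ f : T ⟶ Z, ∀ (B : Type u) [CommRing B] (k : Spec (CommRingCat.of B) ⟶ T)
      (v : Spec (CommRingCat.of B) ⟶ Z), P k v → k ≫ f = v := by
  obtain ⟨f, hf⟩ := exists_hom_of_charts P (fun k v φ _ _ => hnat k v φ)
    (fun k v w _ => huniq k v w) hex
  refine ⟨f, fun B _ k v hP => spec_hom_ext_of_locally fun y => ?_⟩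
  obtain ⟨D, _, c, hc, ht, w, hw⟩ := hex (k y)
  obtain ⟨a, ha, φ, hφ⟩ := exists_away_factor k y c ht
  refine ⟨a, ha, ?_⟩
  rw [reassoc_of% hφ, hf D c w hc hw]
  refine huniq _ _ _ (hnat c w φ hw) ?_
  rw [← hφ]
  exact hnat k v _ hP

end Charts

/-! ### Open sets where families of functions generate the unit ideal -/

section Uni

variable {R A B : Type u} [CommRing R] [CommRing A] [CommRing B] {ι : Type}

theorem Uni.isOpen [Finite ι] (V : ι → Set R) :
    IsOpen {y : PrimeSpectrum R | ∀ i, ∃ f ∈ V i, f ∉ y.asIdeal} := by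
  have : {y : PrimeSpectrum R | ∀ i, ∃ f ∈ V i, f ∉ y.asIdeal} =
      ⋂ i, ⋃ f ∈ V i, (PrimeSpectrum.basicOpen f : Set (PrimeSpectrum R)) := by
    ext y
    simp
  rw [this]
  exact isOpen_iInter_of_finite fun i => isOpen_biUnion fun f _ =>
    (PrimeSpectrum.basicOpen f).2

/-- The open subset of `Spec R` where each of the sets `V i` generates the unit ideal. -/
def Uni [Finite ι] (V : ι → Set R) : (Spec (CommRingCat.of R)).Opens :=
  ⟨{y : PrimeSpectrum R | ∀ i, ∃ f ∈ V i, f ∉ y.asIdeal}, Uni.isOpen V⟩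

namespace Uni

variable {V : ι → Set R}

theorem exists_image_notMem {f : R →+* A} {s : Set R} (hf : Ideal.span (f '' s) = ⊤)
    (y : PrimeSpectrum A) : ∃ g ∈ s, f g ∉ y.asIdeal := by
  by_contra! h
  refine y.2.ne_top (eq_top_iff.2 (hf.ge.trans ?_))
  rw [Ideal.span_le]
  rintro _ ⟨g, hg, rfl⟩
  exact h g hg

theorem span_image_comp {f : R →+* A} (hf : ∀ i, Ideal.span (f '' V i) = ⊤) (φ : A →+* B) (i : ι) :
    Ideal.span (φ.comp f '' V i) = ⊤ := by
  rw [RingHom.coe_comp, Set.image_comp, ← Ideal.map_span, hf, Ideal.map_top]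

theorem prod_notMem [Fintype ι] (y : PrimeSpectrum R) {g : ι → R} (hg : ∀ i, g i ∉ y.asIdeal) :
    ∏ i, g i ∉ y.asIdeal := by
  rw [Ideal.IsPrime.prod_mem_iff]
  simpa using hg

variable [Finite ι]

/-- The point of `Uni V` given by a ring homomorphism that maps the sets `V i` to sets generating
the unit ideal. -/
def pt (f : R →+* A) (hf : ∀ i, Ideal.span (f '' V i) = ⊤) :
    Spec (CommRingCat.of A) ⟶ (Uni V).toScheme :=
  IsOpenImmersion.lift (Uni V).ι (Spec.map (CommRingCat.ofHom f)) (by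
    rw [Scheme.Opens.range_ι]
    rintro _ ⟨y, rfl⟩
    exact fun i => exists_image_notMem (hf i) y)

theorem pt_ι (f : R →+* A) (hf : ∀ i, Ideal.span (f '' V i) = ⊤) :
    pt f hf ≫ (Uni V).ι = Spec.map (CommRingCat.ofHom f) :=
  IsOpenImmersion.lift_fac _ _ _

theorem specMap_pt (f : R →+* A) (hf : ∀ i, Ideal.span (f '' V i) = ⊤) (φ : A →+* B)
    (hf' : ∀ i, Ideal.span (φ.comp f '' V i) = ⊤) :
    Spec.map (CommRingCat.ofHom φ) ≫ pt f hf = pt (φ.comp f) hf' := by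
  rw [← cancel_mono (Uni V).ι, Category.assoc, pt_ι, pt_ι, CommRingCat.ofHom_comp, Spec.map_comp]

/-- The points of `Uni V` have affine neighbourhoods given by inverting one element of each of the
sets `V i`. -/
theorem exists_chart [Fintype ι] (y : (Uni V).toScheme) : ∃ (g : ι → R) (_ : ∀ i, g i ∈ V i)
    (hf : ∀ i, Ideal.span (algebraMap R (Localization.Away (∏ i, g i)) '' V i) = ⊤),
      IsOpenImmersion (pt (V := V) (algebraMap R (Localization.Away (∏ i, g i))) hf) ∧
      y ∈ Set.range (pt (V := V) (algebraMap R (Localization.Away (∏ i, g i))) hf) := by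
  have hy : ∀ i, ∃ f ∈ V i, f ∉ PrimeSpectrum.asIdeal y.1 := y.2
  choose g hg hgy using hy
  have hf : ∀ i, Ideal.span (algebraMap R (Localization.Away (∏ i, g i)) '' V i) = ⊤ := by
    intro i
    refine Ideal.eq_top_of_isUnit_mem _ (Ideal.subset_span ⟨g i, hg i, rfl⟩) ?_
    refine isUnit_of_dvd_unit (map_dvd _ (Finset.dvd_prod_of_mem g (Finset.mem_univ i)))
      (IsLocalization.Away.algebraMap_isUnit (∏ i, g i))
  have e := pt_ι (V := V) (algebraMap R (Localization.Away (∏ i, g i))) hf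
  have ho : IsOpenImmersion (pt (V := V) (algebraMap R (Localization.Away (∏ i, g i))) hf) := by
    have : IsOpenImmersion (pt (V := V) (algebraMap R (Localization.Away (∏ i, g i))) hf ≫
        (Uni V).ι) := by
      rw [e]
      infer_instance
    exact IsOpenImmersion.of_comp _ (Uni V).ι
  refine ⟨g, hg, hf, ho, ?_⟩
  have h1 : (y.1 : PrimeSpectrum R) ∈ (PrimeSpectrum.basicOpen (∏ i, g i) : Set (PrimeSpectrum R)) :=
    prod_notMem y.1 hgy
  obtain ⟨z, hz⟩ := (Charts.range_specMap_away _).ge h1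
  refine ⟨z, (Uni V).ι.injective ?_⟩
  rw [← Scheme.Hom.comp_apply, e, hz]
  rfl

end Uni

end Uni

/-! ### Vanishing ideals and blowups -/

namespace Blow

open Scheme

variable {X : Scheme.{u}} {A B : Type u} [CommRing A] [CommRing B]

/-- A chart is isomorphic to the spectrum of the ring of functions on its image. -/
theorem exists_fromSpec_eq (k : Spec (CommRingCat.of B) ⟶ X) [IsOpenImmersion k] :
    ∃ (hU : IsAffineOpen k.opensRange) (γ : Γ(X, k.opensRange) ⟶ CommRingCat.of B),
      Function.Bijective γ.hom ∧ Spec.map γ ≫ hU.fromSpec = k := by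
  have hU : IsAffineOpen k.opensRange := isAffineOpen_opensRange k
  have hr : Set.range k = Set.range hU.fromSpec := by
    rw [IsAffineOpen.range_fromSpec]
    rfl
  let e := IsOpenImmersion.isoOfRangeEq k hU.fromSpec hr
  obtain ⟨γ, hγ⟩ := Spec.map_surjective e.hom
  refine ⟨hU, γ, ?_, ?_⟩
  · rw [← isIso_SpecMap_iff, hγ]
    infer_instance
  · rw [hγ, IsOpenImmersion.isoOfRangeEq_hom_fac]

theorem pullIdeal_chart (I : X.IdealSheafData) (k : Spec (CommRingCat.of B) ⟶ X)
    [IsOpenImmersion k] (hU : IsAffineOpen k.opensRange) (γ : Γ(X, k.opensRange) ⟶ CommRingCat.of B)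
    (hγ : Spec.map γ ≫ hU.fromSpec = k) :
    pullIdeal I k = (I.ideal ⟨k.opensRange, hU⟩).map γ.hom := by
  rw [← pullIdeal_fromSpec]
  exact (congrArg (pullIdeal I) hγ.symm).trans (pullIdeal_specMap I hU.fromSpec γ.hom)

theorem le_of_charts {I J : X.IdealSheafData}
    (h : ∀ x : X, ∃ (B : Type u) (_ : CommRing B) (k : Spec (CommRingCat.of B) ⟶ X)
      (_ : IsOpenImmersion k), x ∈ Set.range k ∧ pullIdeal I k ≤ pullIdeal J k) : I ≤ J := by
  choose B hB k hk hx hle using h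
  have hU := fun x => exists_fromSpec_eq (k x)
  choose hU γ hb hγ using hU
  refine IdealSheafData.le_of_iSup_eq_top (fun x => ⟨_, hU x⟩) ?_ fun x => ?_
  · rw [eq_top_iff]
    exact fun x _ => Opens.mem_iSup.2 ⟨x, hx x⟩
  · have := hle x
    rw [pullIdeal_chart I (k x) (hU x) (γ x) (hγ x), pullIdeal_chart J (k x) (hU x) (γ x) (hγ x)]
      at this
    have h2 := Ideal.comap_mono (f := (γ x).hom) this
    rwa [Ideal.comap_map_of_bijective _ (hb x), Ideal.comap_map_of_bijective _ (hb x)] at h2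

theorem mem_pullIdeal_vanishingIdeal (Z : Closeds X) (k : Spec (CommRingCat.of B) ⟶ X)
    [IsOpenImmersion k] (f : B) :
    f ∈ pullIdeal (IdealSheafData.vanishingIdeal Z) k ↔
      ∀ y : PrimeSpectrum B, k y ∈ Z → f ∈ y.asIdeal := by
  obtain ⟨hU, γ, hb, hγ⟩ := exists_fromSpec_eq k
  rw [pullIdeal_chart _ k hU γ hγ, IdealSheafData.vanishingIdeal_ideal]
  obtain ⟨f, rfl⟩ := hb.2 f
  have h1 : γ.hom f ∈ Ideal.map γ.hom (PrimeSpectrum.vanishingIdeal (hU.fromSpec ⁻¹' Z)) ↔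
      f ∈ PrimeSpectrum.vanishingIdeal (hU.fromSpec ⁻¹' Z) := by
    rw [← Ideal.mem_comap, Ideal.comap_map_of_bijective _ hb]
  refine h1.trans ?_
  rw [PrimeSpectrum.mem_vanishingIdeal]
  constructor
  · intro h y hy
    refine h (PrimeSpectrum.comap γ.hom y) ?_
    rw [← hγ] at hy
    exact hy
  · intro h y hy
    let e : Γ(X, k.opensRange) ≃+* B := RingEquiv.ofBijective γ.hom hb
    let y' : PrimeSpectrum B := PrimeSpectrum.comap (e.symm : B →+* Γ(X, k.opensRange)) y
    have hy' : PrimeSpectrum.comap γ.hom y' = y := by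
      ext g
      change e.symm (e g) ∈ y.asIdeal ↔ _
      rw [e.symm_apply_apply]
    have h2 : k y' ∈ Z := by
      rw [← hγ]
      change hU.fromSpec (PrimeSpectrum.comap γ.hom y') ∈ Z
      rw [hy']
      exact hy
    have h3 := h y' h2
    rw [← hy']
    exact h3

theorem pullIdeal_vanishingIdeal_le {Z : Closeds X} (F : Spec (CommRingCat.of A) ⟶ X)
    {y : PrimeSpectrum A} (hy : F y ∈ Z) :
    pullIdeal (IdealSheafData.vanishingIdeal Z) F ≤ y.asIdeal := by
  rw [← mem_support_iff_pullIdeal_le]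
  exact hy

variable {B' : Scheme.{u}} {b : B' ⟶ X} {I : X.IdealSheafData}

theorem isEffectiveCartier_top : IsEffectiveCartier (⊤ : X.IdealSheafData) := by
  intro x
  obtain ⟨_, ⟨U, hU, rfl⟩, hxU, -⟩ :=
    X.isBasis_affineOpens.exists_subset_of_mem_open (Set.mem_univ x) isOpen_univ
  exact ⟨⟨U, hU⟩, hxU, 1, one_mem _, by simp⟩

theorem IsBlowup.isIso (hb : IsBlowup b I) (hI : I = ⊤) : IsIso b := by
  subst hI
  have h : ∀ {T : Scheme.{u}} (g : T ⟶ X), IsEffectiveCartier ((⊤ : X.IdealSheafData).comap g) :=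
    fun g => by
      rw [IdealSheafData.comap_top]
      exact isEffectiveCartier_top
  obtain ⟨k, hk, -⟩ := hb.universal X (𝟙 X) (h _)
  exact ⟨k, (hb.universal B' b (h b)).unique (by rw [Category.assoc, hk, Category.comp_id])
    (Category.id_comp b), hk⟩

theorem IsBlowup.isIso_restrict (hb : IsBlowup b I) {U : X.Opens}
    (hU : ∀ x ∈ U, x ∉ I.support) : IsIso (b ∣_ U) := by
  refine (hb.of_isPullback (isPullback_morphismRestrict b U).flip).isIso ?_
  rw [← IdealSheafData.support_eq_bot_iff]
  ext x
  rw [IdealSheafData.support_comap]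
  exact ⟨fun h => hU x.1 x.2 h, fun h => h.elim⟩

/-- A blowup is compatible with the formation of vanishing ideals of closed sets not meeting the
centre. -/
theorem IsBlowup.comap_vanishingIdeal (hb : IsBlowup b I) {Z : Closeds X}
    (hZ : ∀ x ∈ Z, x ∉ I.support) :
    (IdealSheafData.vanishingIdeal Z).comap b =
      IdealSheafData.vanishingIdeal ⟨b ⁻¹' Z, Z.isClosed.preimage b.continuous⟩ := by
  refine le_antisymm (IdealSheafData.le_support_iff_le_vanishingIdeal.1 ?_) (le_of_charts ?_)
  · intro x hx
    rw [IdealSheafData.support_comap]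
    exact hx
  · intro x
    by_cases hx : b x ∈ Z
    · let U : X.Opens := I.support.compl
      have hxU : b x ∈ U := hZ _ hx
      have := hb.isIso_restrict (U := U) fun x hx => hx
      obtain ⟨D, _, k, hk, hxk, hkU⟩ := Charts.exists_chart (U := U) hxU
      let m : Spec (CommRingCat.of D) ⟶ U.toScheme := IsOpenImmersion.lift U.ι k (by simpa using hkU)
      have hm : m ≫ U.ι = k := IsOpenImmersion.lift_fac _ _ _
      let k' : Spec (CommRingCat.of D) ⟶ B' := m ≫ inv (b ∣_ U) ≫ (b ⁻¹ᵁ U).ι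
      have hk' : k' ≫ b = k := by
        simp only [k', Category.assoc]
        rw [← morphismRestrict_ι, IsIso.inv_hom_id_assoc, hm]
      have hmo : IsOpenImmersion m := by
        have : IsOpenImmersion (m ≫ U.ι) := by rw [hm]; infer_instance
        exact IsOpenImmersion.of_comp m U.ι
      refine ⟨D, inferInstance, k', inferInstance, ?_, ?_⟩
      · obtain ⟨z, hz⟩ := hxk
        refine ⟨z, ?_⟩
        let x' : (b ⁻¹ᵁ U).toScheme := ⟨x, hxU⟩
        have hx' : (b ⁻¹ᵁ U).ι x' = x := rfl
        have h1 : m z = (b ∣_ U) x' := by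
          refine U.ι.injective ?_
          rw [← Scheme.Hom.comp_apply, hm, hz, ← Scheme.Hom.comp_apply, morphismRestrict_ι,
            Scheme.Hom.comp_apply, hx']
        simp only [k']
        rw [Scheme.Hom.comp_apply, h1, ← Scheme.Hom.comp_apply, IsIso.hom_inv_id_assoc, hx']
      · intro f hf
        rw [pullIdeal_comap, hk', mem_pullIdeal_vanishingIdeal]
        intro y hy
        refine (mem_pullIdeal_vanishingIdeal _ k' f).1 hf y ?_
        change (k' ≫ b) y ∈ Z
        rwa [hk']
    · obtain ⟨D, _, k, hk, hxk, hkU⟩ :=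
        Charts.exists_chart (U := b ⁻¹ᵁ Z.compl) (t := x) hx
      refine ⟨D, inferInstance, k, inferInstance, hxk, ?_⟩
      have : pullIdeal ((IdealSheafData.vanishingIdeal Z).comap b) k = ⊤ := by
        by_contra hne
        obtain ⟨p, hp, hle⟩ := Ideal.exists_le_maximal _ hne
        have := (mem_support_iff_pullIdeal_le _ k ⟨p, hp.isPrime⟩).2 hle
        rw [IdealSheafData.support_comap] at this
        exact hkU ⟨⟨p, hp.isPrime⟩, rfl⟩ this
      rw [this]
      exact le_top

end Blow

/-! ### Homogeneous coordinates of points with values in rings -/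

namespace BiProj

attribute [local instance] MvPolynomial.gradedAlgebra

open MvPolynomial Blow

variable {m n : ℕ} {A B : Type} [CommRing A] [CommRing B]

/-- `p` is the point with homogeneous coordinates `(l, x)`. -/
def IsPt (p : Spec (CommRingCat.of A) ⟶ PPP m n) (l : Fin (m + 1) → A) (x : Fin (n + 1) → A) :
    Prop :=
  ∃ (_ : Algebra ℂ A) (hl : Ideal.span (Set.range l) = ⊤) (hx : Ideal.span (Set.range x) = ⊤),
    p = bipt l x hl hx

theorem algebra_eq {i j : Algebra ℂ A}
    (h : Spec.map (CommRingCat.ofHom (@algebraMap ℂ A _ _ i)) =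
      Spec.map (CommRingCat.ofHom (@algebraMap ℂ A _ _ j))) : i = j :=
  Algebra.algebra_ext _ _ fun c =>
    DFunLike.congr_fun (congrArg CommRingCat.Hom.hom (Spec.map_injective h)) c

variable {p p' : Spec (CommRingCat.of A) ⟶ PPP m n} {l l' : Fin (m + 1) → A}
  {x x' : Fin (n + 1) → A}

theorem IsPt.span_left (h : IsPt p l x) : Ideal.span (Set.range l) = ⊤ :=
  let ⟨_, hl, _⟩ := h; hl

theorem IsPt.span_right (h : IsPt p l x) : Ideal.span (Set.range x) = ⊤ :=
  let ⟨_, _, hx, _⟩ := h; hx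

theorem IsPt.eq_bipt [a : Algebra ℂ A] (h : IsPt p l x)
    (hp : p ≫ PPP.str m n = Spec.map (CommRingCat.ofHom (algebraMap ℂ A))) :
    p = bipt l x h.span_left h.span_right := by
  obtain ⟨a', hl, hx, rfl⟩ := h
  obtain rfl : a' = a := algebra_eq (by rw [← hp, bipt_str])
  rfl

theorem IsPt.map (h : IsPt p l x) (φ : A →+* B) :
    IsPt (Spec.map (CommRingCat.ofHom φ) ≫ p) (φ ∘ l) (φ ∘ x) := by
  obtain ⟨_, hl, hx, rfl⟩ := h
  let := (φ.comp (algebraMap ℂ A)).toAlgebra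
  let φ' : A →ₐ[ℂ] B := { φ with commutes' := fun c => rfl }
  exact ⟨_, span_range_map φ' hl, span_range_map φ' hx, specMap_bipt φ' l x hl hx _ _⟩

theorem IsPt.minors (h : IsPt p l x) (h' : IsPt p l' x') :
    (∀ i j, l i * l' j = l j * l' i) ∧ ∀ i j, x i * x' j = x j * x' i := by
  obtain ⟨_, hl, hx, rfl⟩ := h
  exact minors_of_bipt_eq_bipt (h'.eq_bipt (bipt_str ..))

theorem IsPt.hom_ext (h : IsPt p l x) (h' : IsPt p' l' x')
    (hs : p ≫ PPP.str m n = p' ≫ PPP.str m n) (hl : ∀ i j, l i * l' j = l j * l' i)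
    (hx : ∀ i j, x i * x' j = x j * x' i) : p = p' := by
  obtain ⟨_, hl, hx, rfl⟩ := h
  rw [h'.eq_bipt (hs.symm.trans (bipt_str ..))]
  exact bipt_eq_bipt ‹_› ‹_›

theorem IsPt.hom_ext' (h : IsPt p l x) (h' : IsPt p' l x)
    (hs : p ≫ PPP.str m n = p' ≫ PPP.str m n) : p = p' :=
  h.hom_ext h' hs (fun _ _ => mul_comm _ _) fun _ _ => mul_comm _ _

theorem IsPt.mem_stdOpen_iff (h : IsPt p l x) (i : Fin (m + 1)) (j : Fin (n + 1))
    (y : PrimeSpectrum A) : p y ∈ stdOpen i j ↔ l i ∉ y.asIdeal ∧ x j ∉ y.asIdeal := by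
  obtain ⟨_, hl, hx, rfl⟩ := h
  exact bipt_mem_stdOpen_iff ..

variable {S : Set (BiPoly m n)}

theorem mem_vanL_iff [Algebra ℂ A] {p : Spec (CommRingCat.of A) ⟶ zeroScheme S}
    {hl : Ideal.span (Set.range l) = ⊤} {hx : Ideal.span (Set.range x) = ⊤}
    (h : p ≫ incl S = bipt l x hl hx) {f : MvPolynomial (Fin (m + 1)) ℂ} {d : ℕ} (hd : 0 < d)
    (hf : f.IsHomogeneous d) (y : PrimeSpectrum A) :
    p y ∈ vanL S f ↔ aeval l f ∈ y.asIdeal := by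
  have e : p ≫ incl S ≫ pullback.fst (PP.str m) (PP.str n) = pt l hl := by
    rw [← Category.assoc, h, bipt, pullback.lift_fst]
  have h1 := mem_pt_preimage_basicOpen l hl hd hf y
  rw [← e] at h1
  exact (not_congr h1).trans not_not

theorem mem_vanX_iff [Algebra ℂ A] {p : Spec (CommRingCat.of A) ⟶ zeroScheme S}
    {hl : Ideal.span (Set.range l) = ⊤} {hx : Ideal.span (Set.range x) = ⊤}
    (h : p ≫ incl S = bipt l x hl hx) {f : MvPolynomial (Fin (n + 1)) ℂ} {d : ℕ} (hd : 0 < d)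
    (hf : f.IsHomogeneous d) (y : PrimeSpectrum A) :
    p y ∈ vanX S f ↔ aeval x f ∈ y.asIdeal := by
  have e : p ≫ incl S ≫ pullback.snd (PP.str m) (PP.str n) = pt x hx := by
    rw [← Category.assoc, h, bipt, pullback.lift_snd]
  have h1 := mem_pt_preimage_basicOpen x hx hd hf y
  rw [← e] at h1
  exact (not_congr h1).trans not_not

/-- Points of a closed subscheme of `ℙᵐ × ℙⁿ` have affine neighbourhoods with normalized
coordinates. -/
theorem exists_chart_isPt {z : zeroScheme S} {O : (zeroScheme S).Opens} (hz : z ∈ O)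
    {i : Fin (m + 1)} {j : Fin (n + 1)} (hij : incl S z ∈ stdOpen i j) :
    ∃ (B : Type) (_ : CommRing B) (k : Spec (CommRingCat.of B) ⟶ zeroScheme S)
      (_ : IsOpenImmersion k), z ∈ Set.range k ∧ Set.range k ⊆ O ∧ ∃ l x,
      IsPt (k ≫ incl S) l x ∧ l i = 1 ∧ x j = 1 := by
  obtain ⟨B, _, k, hk, hzk, hkO⟩ := Charts.exists_chart (U := O ⊓ incl S ⁻¹ᵁ stdOpen i j)
    (t := z) ⟨hz, hij⟩
  let := algebraOfHom (k ≫ str S)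
  obtain ⟨l, x, hl, hx, h1, h2, h3⟩ := exists_eq_bipt (k ≫ incl S)
    (by rw [specMap_algebraOfHom, Category.assoc, str]) i j
    (fun y => (hkO ⟨y, rfl⟩ : _ ∧ _).2)
  exact ⟨B, _, k, hk, hzk, fun y hy => (hkO hy : _ ∧ _).1, l, x, ⟨_, hl, hx, h3⟩, h1, h2⟩

theorem exists_isPt_of_field {L : Type} [Field L] (p : Spec (CommRingCat.of L) ⟶ zeroScheme S) :
    ∃ l x, IsPt (p ≫ incl S) l x := by
  let y : PrimeSpectrum L := ⊥
  obtain ⟨i, j, hij⟩ := exists_mem_stdOpen (incl S (p y))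
  let := algebraOfHom (p ≫ str S)
  obtain ⟨l, x, hl, hx, h1, h2, h3⟩ := exists_eq_bipt (p ≫ incl S)
    (by rw [specMap_algebraOfHom, Category.assoc, str]) i j
    (fun y' => by
      obtain rfl : y' = y := Subsingleton.elim (α := PrimeSpectrum L) _ _
      exact hij)
  exact ⟨l, x, ⟨_, hl, hx, h3⟩⟩

end BiProj

/-! ### Points of the two fourfolds -/

namespace Example

open BiProj MvPolynomial Blow

section

variable {A : Type} [CommRing A]

/-- The equation of `Y`. -/
def yEq (l : Fin 3 → A) (x : Fin 4 → A) : A :=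
  l 1 * l 2 * x 0 ^ 2 + l 0 * l 2 * x 1 ^ 2 + l 0 * l 1 * x 2 ^ 2 +
    (l 0 ^ 2 + l 1 ^ 2 + l 2 ^ 2 - 2 * l 0 * l 1 - 2 * l 0 * l 2 - 2 * l 1 * l 2) * x 3 ^ 2

/-- The quadratic equation of `Q`. -/
def qEq (l : Fin 3 → A) (x : Fin 6 → A) : A :=
  l 1 * x 0 ^ 2 + l 0 * x 1 ^ 2 + l 0 * x 2 * x 4 + (l 2 - 2 * l 0 - 2 * l 1) * x 3 ^ 2 +
    l 2 * x 5 ^ 2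

theorem forall_eqY_iff [Algebra ℂ A] (l : Fin 3 → A) (x : Fin 4 → A) :
    (∀ f ∈ eqY, aeval (Sum.elim l x) f = 0) ↔ yEq l x = 0 := by
  simp [eqY, F, yEq]

theorem forall_eqQ_iff [Algebra ℂ A] (l : Fin 3 → A) (x : Fin 6 → A) :
    (∀ f ∈ eqQ, aeval (Sum.elim l x) f = 0) ↔
      (l 0 - l 1) * x 3 = l 2 * x 5 ∧ l 1 * x 2 = l 2 * x 4 ∧ qEq l x = 0 := by
  simp [eqQ, qEq, sub_eq_zero]

theorem isBihom_eqY : ∀ f ∈ eqY, IsBihom f := by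
  rintro f rfl
  refine ⟨2, 2, fun A _ _ c c' l x => ?_⟩
  simp only [F, map_add, map_sub, map_mul, map_pow, map_ofNat, aeval_X, Sum.elim_inl, Sum.elim_inr]
  ring

theorem isBihom_eqQ : ∀ f ∈ eqQ, IsBihom f := by
  rintro f (rfl | rfl | rfl)
  · refine ⟨1, 1, fun A _ _ c c' l x => ?_⟩
    simp only [map_sub, map_mul, aeval_X, Sum.elim_inl, Sum.elim_inr]
    ring
  · refine ⟨1, 1, fun A _ _ c c' l x => ?_⟩
    simp only [map_sub, map_mul, aeval_X, Sum.elim_inl, Sum.elim_inr]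
    ring
  · refine ⟨1, 2, fun A _ _ c c' l x => ?_⟩
    simp only [map_add, map_sub, map_mul, map_pow, map_ofNat, aeval_X, Sum.elim_inl, Sum.elim_inr]
    ring

theorem exists_lift_of_forall {m n : ℕ} {S : Set (BiPoly m n)} (hS : ∀ f ∈ S, IsBihom f)
    [Algebra ℂ A] {l : Fin (m + 1) → A} {x : Fin (n + 1) → A} (hl : Ideal.span (Set.range l) = ⊤)
    (hx : Ideal.span (Set.range x) = ⊤) (h : ∀ f ∈ S, aeval (Sum.elim l x) f = 0) :
    ∃ p : Spec (CommRingCat.of A) ⟶ zeroScheme S, p ≫ incl S = bipt l x hl hx :=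
  exists_fac_of_pullIdeal_eq_bot _
    ((pullIdeal_eq_bot_iff _ _).2 ((le_ker_bipt_iff hS l x hl hx).2 h))

theorem forall_of_lift {m n : ℕ} {S : Set (BiPoly m n)} (hS : ∀ f ∈ S, IsBihom f)
    [Algebra ℂ A] {l : Fin (m + 1) → A} {x : Fin (n + 1) → A} {hl : Ideal.span (Set.range l) = ⊤}
    {hx : Ideal.span (Set.range x) = ⊤} {p : Spec (CommRingCat.of A) ⟶ zeroScheme S}
    (h : p ≫ incl S = bipt l x hl hx) : ∀ f ∈ S, aeval (Sum.elim l x) f = 0 := by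
  rw [← le_ker_bipt_iff hS l x hl hx, ← h, ← pullIdeal_eq_bot_iff]
  exact pullIdeal_of_fac _ p

theorem yEq_eq_zero {p : Spec (CommRingCat.of A) ⟶ Y} {l : Fin 3 → A} {x : Fin 4 → A}
    (h : IsPt (p ≫ incl eqY) l x) : yEq l x = 0 := by
  obtain ⟨_, hl, hx, h⟩ := h
  exact (forall_eqY_iff l x).1 (forall_of_lift isBihom_eqY h)

theorem qEq_eq_zero {p : Spec (CommRingCat.of A) ⟶ Q} {l : Fin 3 → A} {x : Fin 6 → A}
    (h : IsPt (p ≫ incl eqQ) l x) :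
    (l 0 - l 1) * x 3 = l 2 * x 5 ∧ l 1 * x 2 = l 2 * x 4 ∧ qEq l x = 0 := by
  obtain ⟨_, hl, hx, h⟩ := h
  exact (forall_eqQ_iff l x).1 (forall_of_lift isBihom_eqQ h)

variable {p : Spec (CommRingCat.of A) ⟶ Y} {l : Fin 3 → A} {x : Fin 4 → A}

theorem mem_Y₁_iff (h : IsPt (p ≫ incl eqY) l x) (y : PrimeSpectrum A) :
    p y ∈ Y₁ ↔ l 2 ∈ y.asIdeal ∧ x 2 ∈ y.asIdeal ∧ x 3 ∈ y.asIdeal := by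
  obtain ⟨_, hl, hx, h⟩ := h
  change (_ ∧ _) ∧ _ ↔ _
  simp only [SetLike.mem_coe]
  rw [mem_vanL_iff h one_pos (isHomogeneous_X ℂ 2), mem_vanX_iff h one_pos (isHomogeneous_X ℂ 2),
    mem_vanX_iff h one_pos (isHomogeneous_X ℂ 3), aeval_X, aeval_X, aeval_X, and_assoc]

theorem mem_Y₂_iff (h : IsPt (p ≫ incl eqY) l x) (y : PrimeSpectrum A) :
    p y ∈ Y₂ ↔ l 1 ∈ y.asIdeal ∧ l 2 ∈ y.asIdeal ∧ x 3 ∈ y.asIdeal := by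
  obtain ⟨_, hl, hx, h⟩ := h
  change (_ ∧ _) ∧ _ ↔ _
  simp only [SetLike.mem_coe]
  rw [mem_vanL_iff h one_pos (isHomogeneous_X ℂ 1), mem_vanL_iff h one_pos (isHomogeneous_X ℂ 2),
    mem_vanX_iff h one_pos (isHomogeneous_X ℂ 3), aeval_X, aeval_X, aeval_X, and_assoc]

theorem mem_Y₃_iff (h : IsPt (p ≫ incl eqY) l x) (y : PrimeSpectrum A) :
    p y ∈ Y₃ ↔ l 0 - l 1 ∈ y.asIdeal ∧ l 2 ∈ y.asIdeal ∧ x 2 ∈ y.asIdeal := by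
  obtain ⟨_, hl, hx, h⟩ := h
  change (_ ∧ _) ∧ _ ↔ _
  simp only [SetLike.mem_coe]
  rw [mem_vanL_iff h one_pos ((isHomogeneous_X ℂ 0).sub (isHomogeneous_X ℂ 1)),
    mem_vanL_iff h one_pos (isHomogeneous_X ℂ 2),
    mem_vanX_iff h one_pos (isHomogeneous_X ℂ 2), map_sub, aeval_X, aeval_X, aeval_X, aeval_X,
    and_assoc]

end

end Example

/-! ### The ideal of the first centre -/

namespace Blow

variable {X : Scheme.{u}} {R A : Type u} [CommRing R] [CommRing A]

theorem pullIdeal_le_of_isPrime {K : Ideal R} (hK : K.IsPrime) {u : R}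
    (F : Spec (CommRingCat.of (Localization.Away u)) ⟶ X) {Z : Closeds X}
    (hF : ∀ y : PrimeSpectrum (Localization.Away u),
      y.asIdeal.comap (algebraMap R (Localization.Away u)) = K → F y ∈ Z) :
    pullIdeal (Scheme.IdealSheafData.vanishingIdeal Z) F ≤
      K.map (algebraMap R (Localization.Away u)) := by
  by_cases hu : u ∈ K
  · rw [Ideal.eq_top_of_isUnit_mem _ (Ideal.mem_map_of_mem _ hu)
      (IsLocalization.Away.algebraMap_isUnit u)]
    exact le_top
  · have hd : Disjoint (Submonoid.powers u : Set R) K := by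
      rw [Set.disjoint_left]
      rintro _ ⟨n, rfl⟩ h
      exact hu (hK.mem_of_pow_mem n h)
    let y : PrimeSpectrum (Localization.Away u) :=
      ⟨K.map (algebraMap R (Localization.Away u)),
        IsLocalization.isPrime_of_isPrime_disjoint (Submonoid.powers u) _ K hK hd⟩
    exact pullIdeal_vanishingIdeal_le F (y := y)
      (hF y (IsLocalization.under_map_of_isPrime_disjoint (Submonoid.powers u) _ hK hd))

theorem mem_of_locally {I : Ideal A} {f : A} (h : ∀ y : PrimeSpectrum A, ∃ a, a ∉ y.asIdeal ∧
    algebraMap A (Localization.Away a) f ∈ I.map (algebraMap A (Localization.Away a))) : f ∈ I := by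
  choose a ha hf using h
  refine Submodule.mem_of_span_eq_top_of_smul_pow_mem I (Set.range a) ?_ f ?_
  · by_contra hne
    obtain ⟨m, hm, hle⟩ := Ideal.exists_le_maximal _ hne
    exact ha ⟨m, hm.isPrime⟩ (hle (Ideal.subset_span ⟨_, rfl⟩))
  · rintro ⟨_, y, rfl⟩
    obtain ⟨⟨⟨i, hi⟩, ⟨_, n, rfl⟩⟩, h⟩ :=
      (IsLocalization.mem_map_algebraMap_iff (Submonoid.powers (a y)) _).1 (hf y)
    simp only at h
    rw [← map_mul] at h
    obtain ⟨⟨_, k, rfl⟩, hk⟩ := (IsLocalization.eq_iff_exists (Submonoid.powers (a y)) _).1 h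
    refine ⟨k + n, ?_⟩
    simp only at hk ⊢
    rw [pow_add, smul_eq_mul, mul_assoc, mul_comm _ f, hk]
    exact I.mul_mem_left _ hi

/-- Containments between pulled-back ideals can be checked after factoring through charts. -/
theorem mem_pullIdeal_of_charts {I : X.IdealSheafData} (F : Spec (CommRingCat.of A) ⟶ X) {f : A}
    (h : ∀ y : PrimeSpectrum A, ∃ (B : Type u) (_ : CommRing B)
      (k : Spec (CommRingCat.of B) ⟶ X) (_ : IsOpenImmersion k), F y ∈ Set.range k ∧
      ∀ (a : A) (φ : B →+* Localization.Away a),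
      Spec.map (CommRingCat.ofHom (algebraMap A (Localization.Away a))) ≫ F =
        Spec.map (CommRingCat.ofHom φ) ≫ k →
      algebraMap A (Localization.Away a) f ∈ (pullIdeal I k).map φ) : f ∈ pullIdeal I F := by
  refine mem_of_locally fun y => ?_
  obtain ⟨B, _, k, hk, hy, h⟩ := h y
  obtain ⟨a, ha, φ, hφ⟩ := Charts.exists_away_factor F y k hy
  refine ⟨a, ha, ?_⟩
  rw [← pullIdeal_specMap, hφ, pullIdeal_specMap]
  exact h a φ hφ

end Blow

namespace Example

open BiProj MvPolynomial Blow

/-- The bihomogeneous coordinate ring of `Y`. -/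
abbrev Cone : Type := BiPoly 2 3 ⧸ Ideal.span eqY

namespace Cone

/-- The coordinates `λ`. -/
abbrev l (i : Fin 3) : Cone := Ideal.Quotient.mk _ (lam i)

/-- The coordinates `x`. -/
abbrev x (j : Fin 4) : Cone := Ideal.Quotient.mk _ (xx j)

variable {A : Type} [CommRing A]

/-- Homomorphisms from the bihomogeneous coordinate ring of `Y`. -/
def hom [Algebra ℂ A] (v : Fin 3 → A) (w : Fin 4 → A) (h : yEq v w = 0) : Cone →ₐ[ℂ] A :=
  Ideal.Quotient.liftₐ _ (aeval (Sum.elim v w)) fun a ha => by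
    have : Ideal.span eqY ≤ RingHom.ker (aeval (R := ℂ) (Sum.elim v w)) :=
      Ideal.span_le.2 fun f hf => (forall_eqY_iff v w).2 h f hf
    exact this ha

theorem hom_l [Algebra ℂ A] (v : Fin 3 → A) (w : Fin 4 → A) (h : yEq v w = 0) (i : Fin 3) :
    hom v w h (l i) = v i := by
  change aeval (Sum.elim v w) (X (Sum.inl i)) = _
  simp

theorem hom_x [Algebra ℂ A] (v : Fin 3 → A) (w : Fin 4 → A) (h : yEq v w = 0) (j : Fin 4) :
    hom v w h (x j) = w j := by
  change aeval (Sum.elim v w) (X (Sum.inr j)) = _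
  simp

theorem algHom_ext [Algebra ℂ A] {f g : Cone →ₐ[ℂ] A} (hl : ∀ i, f (l i) = g (l i))
    (hx : ∀ j, f (x j) = g (x j)) : f = g := by
  refine Ideal.Quotient.algHom_ext _ (MvPolynomial.algHom_ext ?_)
  rintro (i | j)
  · exact hl i
  · exact hx j

theorem yEq_l_x : yEq l x = 0 := by
  rw [← forall_eqY_iff]
  intro f hf
  have : (Sum.elim l x) = (Ideal.Quotient.mkₐ ℂ (Ideal.span eqY)) ∘ X := by
    ext (a | b) <;> rfl
  rw [this]
  have h2 := DFunLike.congr_fun (comp_aeval (R := ℂ) X (Ideal.Quotient.mkₐ ℂ (Ideal.span eqY))) f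
  refine h2.symm.trans ?_
  simpa [aeval_X_left_apply, Ideal.Quotient.eq_zero_iff_mem] using Ideal.subset_span hf

/-- The restriction to `Y₁`. -/
def toCentre : Cone →ₐ[ℂ] BiPoly 2 3 :=
  hom ![lam 0, lam 1, 0] ![xx 0, xx 1, 0, 0] (by simp [yEq])

theorem ker_toCentre_le : RingHom.ker toCentre ≤ Ideal.span {l 2, x 2, x 3} := by
  intro f hf
  let J : Ideal Cone := Ideal.span {l 2, x 2, x 3}
  have h1 : l 2 ∈ J := Ideal.subset_span (by simp)
  have h2 : x 2 ∈ J := Ideal.subset_span (by simp)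
  have h3 : x 3 ∈ J := Ideal.subset_span (by simp)
  have key : ((Ideal.Quotient.mkₐ ℂ J).comp (Ideal.Quotient.mkₐ ℂ (Ideal.span eqY))).comp toCentre =
      Ideal.Quotient.mkₐ ℂ J := by
    refine algHom_ext (A := Cone ⧸ J) (fun i => ?_) (fun j => ?_)
    · rw [AlgHom.comp_apply, toCentre, hom_l]
      fin_cases i
      · rfl
      · rfl
      · exact (map_zero _).trans (Ideal.Quotient.eq_zero_iff_mem.2 h1).symm
    · rw [AlgHom.comp_apply, toCentre, hom_x]
      fin_cases j
      · rfl
      · rfl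
      · exact (map_zero _).trans (Ideal.Quotient.eq_zero_iff_mem.2 h2).symm
      · exact (map_zero _).trans (Ideal.Quotient.eq_zero_iff_mem.2 h3).symm
  have h4 := DFunLike.congr_fun key f
  rw [AlgHom.comp_apply, (RingHom.mem_ker).1 hf, map_zero] at h4
  exact Ideal.Quotient.eq_zero_iff_mem.1 h4.symm

end Cone

variable {A : Type} [CommRing A] {p : Spec (CommRingCat.of A) ⟶ Y} {l : Fin 3 → A} {x : Fin 4 → A}

theorem pullIdeal_Y₁_le (hp : IsPt (p ≫ incl eqY) l x) {i : Fin 3} {j : Fin 4}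
    (hi : IsUnit (l i)) (hj : IsUnit (x j)) :
    pullIdeal (Scheme.IdealSheafData.vanishingIdeal Y₁) p ≤ Ideal.span {l 2, x 2, x 3} := by
  have hy := yEq_eq_zero hp
  obtain ⟨_, hl, hx, hp⟩ := hp
  let u : Cone := Cone.l i * Cone.x j
  let D := Localization.Away u
  have hu := IsLocalization.Away.algebraMap_isUnit (S := D) u
  rw [map_mul] at hu
  let lD : Fin 3 → D := locHom u ∘ Cone.l
  let xD : Fin 4 → D := locHom u ∘ Cone.x
  have hlD : Ideal.span (Set.range lD) = ⊤ := Ideal.eq_top_of_isUnit_mem _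
    (Ideal.subset_span ⟨i, rfl⟩) (isUnit_of_mul_isUnit_left hu)
  have hxD : Ideal.span (Set.range xD) = ⊤ := Ideal.eq_top_of_isUnit_mem _
    (Ideal.subset_span ⟨j, rfl⟩) (isUnit_of_mul_isUnit_right hu)
  obtain ⟨pD, hpD⟩ := exists_lift_of_forall isBihom_eqY hlD hxD (by
    intro f hf
    rw [aeval_algHom, (forall_eqY_iff _ _).2 Cone.yEq_l_x f hf, map_zero])
  have he : IsUnit (Cone.hom l x hy u) := by
    rw [map_mul, Cone.hom_l, Cone.hom_x]
    exact hi.mul hj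
  let e : D →ₐ[ℂ] A := IsLocalization.liftAlgHom (M := Submonoid.powers u) (f := Cone.hom l x hy)
    (by
      rintro ⟨_, n, rfl⟩
      rw [map_pow]
      exact he.pow n)
  have hee : ∀ c, e (locHom u c) = Cone.hom l x hy c := fun c => IsLocalization.lift_eq _ _
  have hel : e ∘ lD = l := funext fun i => (hee _).trans (Cone.hom_l ..)
  have hex : e ∘ xD = x := funext fun i => (hee _).trans (Cone.hom_x ..)
  have hfac : Spec.map (CommRingCat.ofHom e.toRingHom) ≫ pD = p := by
    rw [← cancel_mono (incl eqY), Category.assoc, hpD, hp,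
      specMap_bipt e lD xD hlD hxD (by rwa [hel]) (by rwa [hex])]
    congr 1
  have hle := pullIdeal_le_of_isPrime (K := RingHom.ker Cone.toCentre) (RingHom.ker_isPrime _) pD
    (Z := Y₁) (by
      intro y hyK
      have hmem : ∀ c, Cone.toCentre c = 0 → locHom u c ∈ y.asIdeal := fun c hc => by
        have : c ∈ RingHom.ker Cone.toCentre := hc
        rw [← hyK] at this
        exact this
      refine (mem_Y₁_iff ⟨_, hlD, hxD, hpD⟩ y).2 ⟨hmem _ ?_, hmem _ ?_, hmem _ ?_⟩
      · rw [Cone.toCentre, Cone.hom_l]; rfl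
      · rw [Cone.toCentre, Cone.hom_x]; rfl
      · rw [Cone.toCentre, Cone.hom_x]; rfl)
  rw [← hfac, pullIdeal_specMap]
  refine (Ideal.map_mono (hle.trans (Ideal.map_mono Cone.ker_toCentre_le))).trans ?_
  rw [Ideal.map_map, Ideal.map_span, Ideal.span_le]
  rintro _ ⟨c, hc, rfl⟩
  refine Ideal.subset_span ?_
  have : (e.toRingHom.comp (algebraMap Cone D)) c = Cone.hom l x hy c := hee c
  rw [this]
  rcases hc with rfl | rfl | rfl
  · rw [Cone.hom_l]; simp
  · rw [Cone.hom_x]; simp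
  · rw [Cone.hom_x]; simp

theorem le_pullIdeal_Y₁ (hp : IsPt (p ≫ incl eqY) l x) {i : Fin 3} {j : Fin 4}
    (hi : IsUnit (l i)) (hj : IsUnit (x j)) :
    Ideal.span {l 2, x 2, x 3} ≤ pullIdeal (Scheme.IdealSheafData.vanishingIdeal Y₁) p := by
  rw [Ideal.span_le]
  intro f hf
  refine mem_pullIdeal_of_charts p fun y => ?_
  have hij : incl eqY (p y) ∈ stdOpen i j := (hp.mem_stdOpen_iff i j y).2
    ⟨fun h => y.2.ne_top (Ideal.eq_top_of_isUnit_mem _ h hi),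
      fun h => y.2.ne_top (Ideal.eq_top_of_isUnit_mem _ h hj)⟩
  obtain ⟨B, _, k, hk, hy, -, l', x', hp', hli, hxj⟩ :=
    exists_chart_isPt (O := ⊤) (z := p y) trivial hij
  refine ⟨B, inferInstance, k, hk, hy, fun a φ hφ => ?_⟩
  have h1 := hp.map (algebraMap A (Localization.Away a))
  have h2 := hp'.map φ
  rw [← Category.assoc] at h1 h2
  rw [hφ] at h1
  obtain ⟨hl, hx⟩ := h1.minors h2
  have hl' : ∀ c, algebraMap A (Localization.Away a) (l c) = algebraMap A _ (l i) * φ (l' c) := by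
    intro c
    have := hl c i
    simp only [Function.comp_apply, hli, map_one, mul_one] at this
    exact this
  have hx' : ∀ c, algebraMap A (Localization.Away a) (x c) = algebraMap A _ (x j) * φ (x' c) := by
    intro c
    have := hx c j
    simp only [Function.comp_apply, hxj, map_one, mul_one] at this
    exact this
  have hm : ∀ g : B, (∀ y : PrimeSpectrum B, k y ∈ Y₁ → g ∈ y.asIdeal) →
      φ g ∈ (pullIdeal (Scheme.IdealSheafData.vanishingIdeal Y₁) k).map φ := fun g hg =>
    Ideal.mem_map_of_mem _ ((mem_pullIdeal_vanishingIdeal _ _ _).2 hg)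
  rcases hf with rfl | rfl | rfl
  · rw [hl']
    exact Ideal.mul_mem_left _ _ (hm _ fun y hy => ((mem_Y₁_iff hp' y).1 hy).1)
  · rw [hx']
    exact Ideal.mul_mem_left _ _ (hm _ fun y hy => ((mem_Y₁_iff hp' y).1 hy).2.1)
  · rw [hx']
    exact Ideal.mul_mem_left _ _ (hm _ fun y hy => ((mem_Y₁_iff hp' y).1 hy).2.2)

theorem pullIdeal_Y₁ (hp : IsPt (p ≫ incl eqY) l x) {i : Fin 3} {j : Fin 4}
    (hi : IsUnit (l i)) (hj : IsUnit (x j)) :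
    pullIdeal (Scheme.IdealSheafData.vanishingIdeal Y₁) p = Ideal.span {l 2, x 2, x 3} :=
  le_antisymm (pullIdeal_Y₁_le hp hi hj) (le_pullIdeal_Y₁ hp hi hj)

end Example

/-! ### Coordinates on the first blowup -/

theorem mk_X_mem_nonZeroDivisors {σ : Type*} {h : MvPolynomial σ ℂ} {i : σ} (v : σ → ℂ)
    (hv : v i = 0) (hh : MvPolynomial.aeval v h ≠ 0) :
    Ideal.Quotient.mk (Ideal.span {h}) (MvPolynomial.X i) ∈
      nonZeroDivisors (MvPolynomial σ ℂ ⧸ Ideal.span {h}) := by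
  rw [mem_nonZeroDivisors_iff_right]
  intro z hz
  obtain ⟨f, rfl⟩ := Ideal.Quotient.mk_surjective z
  rw [← map_mul, Ideal.Quotient.eq_zero_iff_mem, Ideal.mem_span_singleton] at hz
  obtain ⟨g, hg⟩ := hz
  rcases (MvPolynomial.X_prime (R := ℂ) (i := i)).dvd_or_dvd (Dvd.intro_left _ hg) with h1 | ⟨g', rfl⟩
  · have := map_dvd (MvPolynomial.aeval (R := ℂ) v) h1
    rw [MvPolynomial.aeval_X, hv, zero_dvd_iff] at this
    exact absurd this hh
  · rw [Ideal.Quotient.eq_zero_iff_mem, Ideal.mem_span_singleton]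
    refine ⟨g', mul_right_cancel₀ (MvPolynomial.X_ne_zero (R := ℂ) i) ?_⟩
    rw [hg]
    ring

theorem exists_eq_smul_of_minors {A : Type*} [CommRing A] {n : ℕ} {v w : Fin n → A}
    (hw : Ideal.span (Set.range w) = ⊤) (h : ∀ i j, v i * w j = v j * w i) :
    ∃ c, ∀ i, v i = c * w i := by
  obtain ⟨α, hα⟩ := (Ideal.mem_span_range_iff_exists_fun).1 (hw.ge (Submodule.mem_top (x := 1)))
  refine ⟨∑ j, α j * v j, fun i => ?_⟩
  calc v i = v i * ∑ j, α j * w j := by rw [hα, mul_one]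
    _ = _ := by
      rw [Finset.mul_sum, Finset.sum_mul]
      refine Finset.sum_congr rfl fun j _ => ?_
      linear_combination α j * h i j

theorem Ideal.span_range_vec_three {A : Type*} [CommRing A] (a b c : A) :
    Ideal.span (Set.range ![a, b, c]) = Ideal.span {a, b, c} := by
  congr 1
  ext z
  simp only [Matrix.range_cons, Matrix.range_empty, Set.union_empty, Set.singleton_union]

namespace Example

open BiProj MvPolynomial Blow

/-- Coordinates on the blowup of `Y` along `Y₁`: here `λ₂ = t L`, `x₄ = t a` and `x₅ = t b`. -/
@[ext]
structure HTuple (A : Type) [CommRing A] where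
  (l0 l1 x0 x1 t L a b : A)
  rel : t * (l0 * l1 * a ^ 2 + (l0 - l1) ^ 2 * b ^ 2) +
    L * (l1 * x0 ^ 2 + l0 * x1 ^ 2 + (t * L - 2 * l0 - 2 * l1) * (t * b) ^ 2) = 0

namespace HTuple

variable {A B : Type} [CommRing A] [CommRing B] (e : HTuple A)

/-- The coordinates `λ`. -/
def l : Fin 3 → A := ![e.l0, e.l1, e.t * e.L]

/-- The coordinates `x`. -/
def x : Fin 4 → A := ![e.x0, e.x1, e.t * e.a, e.t * e.b]

/-- The coordinates on the fibre of the blowup. -/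
def w : Fin 3 → A := ![e.L, e.a, e.b]

/-- Base change of coordinates. -/
def map (φ : A →+* B) : HTuple B where
  l0 := φ e.l0
  l1 := φ e.l1
  x0 := φ e.x0
  x1 := φ e.x1
  t := φ e.t
  L := φ e.L
  a := φ e.a
  b := φ e.b
  rel := by simpa only [map_add, map_mul, map_sub, map_pow, map_ofNat, map_zero] using congrArg φ e.rel

theorem map_l (φ : A →+* B) : (e.map φ).l = φ ∘ e.l := by
  ext i; fin_cases i <;> simp [l, map]

theorem map_x (φ : A →+* B) : (e.map φ).x = φ ∘ e.x := by
  ext i; fin_cases i <;> simp [x, map]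

theorem map_w (φ : A →+* B) : (e.map φ).w = φ ∘ e.w := by
  ext i; fin_cases i <;> simp [w, map]

theorem yEq_eq_zero : yEq e.l e.x = 0 := by
  simp only [yEq, l, x, Matrix.cons_val]
  linear_combination e.t * e.rel

/-- The three groups of homogeneous coordinates are unimodular. -/
structure IsUni : Prop where
  hl : Ideal.span (Set.range e.l) = ⊤
  hx : Ideal.span (Set.range e.x) = ⊤
  hw : Ideal.span (Set.range e.w) = ⊤

end HTuple

/-- The relation between the coordinates on the blowup of `Y` along `Y₁`. -/
def hPoly : MvPolynomial (Fin 8) ℂ :=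
  X 4 * (X 0 * X 1 * X 6 ^ 2 + (X 0 - X 1) ^ 2 * X 7 ^ 2) +
    X 5 * (X 1 * X 2 ^ 2 + X 0 * X 3 ^ 2 + (X 4 * X 5 - 2 * X 0 - 2 * X 1) * (X 4 * X 7) ^ 2)

/-- The ring of the coordinates on the blowup of `Y` along `Y₁`. -/
abbrev HRing : Type := MvPolynomial (Fin 8) ℂ ⧸ Ideal.span {hPoly}

namespace HRing

/-- The generators. -/
abbrev X' (i : Fin 8) : HRing := Ideal.Quotient.mk _ (X i)

/-- The universal coordinates. -/
def univ : HTuple HRing where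
  l0 := X' 0
  l1 := X' 1
  x0 := X' 2
  x1 := X' 3
  t := X' 4
  L := X' 5
  a := X' 6
  b := X' 7
  rel := by
    have : Ideal.Quotient.mk (Ideal.span {hPoly}) hPoly = 0 :=
      Ideal.Quotient.eq_zero_iff_mem.2 (Ideal.subset_span rfl)
    conv_lhs at this => arg 2; rw [hPoly]
    simpa only [map_add, map_mul, map_sub, map_pow, map_ofNat] using this

variable {A B : Type} [CommRing A] [CommRing B]

/-- Homomorphisms to `A` are given by coordinates in `A`. -/
def hom [Algebra ℂ A] (e : HTuple A) : HRing →ₐ[ℂ] A :=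
  Ideal.Quotient.liftₐ _ (aeval ![e.l0, e.l1, e.x0, e.x1, e.t, e.L, e.a, e.b]) fun z hz => by
    have : Ideal.span {hPoly} ≤
        RingHom.ker (aeval (R := ℂ) ![e.l0, e.l1, e.x0, e.x1, e.t, e.L, e.a, e.b]) := by
      rw [Ideal.span_le, Set.singleton_subset_iff, SetLike.mem_coe, RingHom.mem_ker]
      simpa [hPoly] using e.rel
    exact this hz

theorem hom_X' [Algebra ℂ A] (e : HTuple A) (i : Fin 8) :
    hom e (X' i) = ![e.l0, e.l1, e.x0, e.x1, e.t, e.L, e.a, e.b] i :=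
  aeval_X _ i

theorem univ_map_hom [Algebra ℂ A] (e : HTuple A) : univ.map (hom e).toRingHom = e := by
  ext <;> exact hom_X' e _

theorem algHom_ext [Algebra ℂ A] {f g : HRing →ₐ[ℂ] A} (h : ∀ i, f (X' i) = g (X' i)) : f = g :=
  Ideal.Quotient.algHom_ext _ (MvPolynomial.algHom_ext h)

theorem univ_t_mem : univ.t ∈ nonZeroDivisors HRing := by
  refine mk_X_mem_nonZeroDivisors (i := (4 : Fin 8)) ![1, 0, 0, 1, 0, 1, 0, 0] rfl ?_
  simp [hPoly]

/-- The groups of homogeneous coordinates. -/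
def groups : Fin 3 → Set HRing := ![Set.range univ.l, Set.range univ.x, Set.range univ.w]

/-- The open set where the groups of homogeneous coordinates are unimodular. -/
abbrev U : (Spec (CommRingCat.of HRing)).Opens := Uni groups

theorem forall_span_iff (f : HRing →+* A) :
    (∀ i, Ideal.span (f '' groups i) = ⊤) ↔ (univ.map f).IsUni := by
  constructor
  · intro h
    refine ⟨?_, ?_, ?_⟩
    · rw [HTuple.map_l, Set.range_comp]; exact h 0
    · rw [HTuple.map_x, Set.range_comp]; exact h 1
    · rw [HTuple.map_w, Set.range_comp]; exact h 2
  · rintro ⟨h0, h1, h2⟩ i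
    rw [HTuple.map_l, Set.range_comp] at h0
    rw [HTuple.map_x, Set.range_comp] at h1
    rw [HTuple.map_w, Set.range_comp] at h2
    fin_cases i
    · exact h0
    · exact h1
    · exact h2

theorem exists_toY : ∃ q : U.toScheme ⟶ Y, q ≫ str eqY = U.ι ≫ Spec.map (CommRingCat.ofHom (algebraMap ℂ HRing)) ∧
    ∀ (A : Type) [CommRing A] (f : HRing →+* A) (hf : ∀ i, Ideal.span (f '' groups i) = ⊤),
      IsPt (Uni.pt f hf ≫ q ≫ incl eqY) (univ.map f).l (univ.map f).x := by
  let P {A : Type} [CommRing A] (h : Spec (CommRingCat.of A) ⟶ U.toScheme)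
      (k : Spec (CommRingCat.of A) ⟶ Y) : Prop :=
    ∃ f : HRing →+* A, h ≫ U.ι = Spec.map (CommRingCat.ofHom f) ∧
      IsPt (k ≫ incl eqY) (univ.map f).l (univ.map f).x ∧
      k ≫ str eqY = h ≫ U.ι ≫ Spec.map (CommRingCat.ofHom (algebraMap ℂ HRing))
  have hex : ∀ (A : Type) [CommRing A] (f : HRing →+* A)
      (hf : ∀ i, Ideal.span (f '' groups i) = ⊤), ∃ k, P (Uni.pt f hf) k := by
    intro A _ f hf
    let := (f.comp (algebraMap ℂ HRing)).toAlgebra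
    have hu := (forall_span_iff f).1 hf
    obtain ⟨k, hk⟩ := exists_lift_of_forall isBihom_eqY hu.hl hu.hx
      ((forall_eqY_iff _ _).2 (univ.map f).yEq_eq_zero)
    refine ⟨k, f, Uni.pt_ι .., ⟨_, _, _, hk⟩, ?_⟩
    rw [str, reassoc_of% hk, bipt_str, ← Category.assoc, Uni.pt_ι, ← Spec.map_comp,
      ← CommRingCat.ofHom_comp]
  have hnat : ∀ {A B : Type} [CommRing A] [CommRing B] (h : Spec (CommRingCat.of A) ⟶ U.toScheme)
      (k : Spec (CommRingCat.of A) ⟶ Y) (φ : A →+* B), P h k →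
      P (Spec.map (CommRingCat.ofHom φ) ≫ h) (Spec.map (CommRingCat.ofHom φ) ≫ k) := by
    rintro A B _ _ h k φ ⟨f, h1, h2, h3⟩
    refine ⟨φ.comp f, ?_, ?_, ?_⟩
    · rw [Category.assoc, h1, CommRingCat.ofHom_comp, Spec.map_comp]
    · have := h2.map φ
      rwa [← HTuple.map_l, ← HTuple.map_x, ← Category.assoc] at this
    · rw [Category.assoc, h3, Category.assoc]
  have huniq : ∀ {A : Type} [CommRing A] (h : Spec (CommRingCat.of A) ⟶ U.toScheme)
      (k k' : Spec (CommRingCat.of A) ⟶ Y), P h k → P h k' → k = k' := by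
    rintro A _ h k k' ⟨f, h1, h2, h3⟩ ⟨f', h1', h2', h3'⟩
    obtain rfl : f = f' := congrArg CommRingCat.Hom.hom (Spec.map_injective (h1.symm.trans h1'))
    rw [← cancel_mono (incl eqY)]
    exact h2.hom_ext' h2' (by simpa only [str, Category.assoc] using h3.trans h3'.symm)
  obtain ⟨q, hq⟩ := Charts.exists_hom_of_points (T := U.toScheme) (Z := Y) P hnat huniq (by
    intro y
    obtain ⟨g, -, hf, ho, hy⟩ := Uni.exists_chart y
    exact ⟨_, _, _, ho, hy, hex _ _ hf⟩)
  have hq' : ∀ (A : Type) [CommRing A] (f : HRing →+* A)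
      (hf : ∀ i, Ideal.span (f '' groups i) = ⊤), P (Uni.pt f hf) (Uni.pt f hf ≫ q) := by
    intro A _ f hf
    obtain ⟨k, hk⟩ := hex A f hf
    rwa [hq A _ k hk]
  refine ⟨q, hom_ext_of_locally fun y => ?_, fun A _ f hf => ?_⟩
  · obtain ⟨g, -, hf, ho, hy⟩ := Uni.exists_chart y
    obtain ⟨f', h1, h2, h3⟩ := hq' _ _ hf
    exact ⟨_, hy, comp_eq_comp_of_range _ (by simpa only [Category.assoc] using h3)⟩
  · obtain ⟨f', h1, h2, h3⟩ := hq' A f hf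
    rw [Uni.pt_ι] at h1
    obtain rfl : f = f' := congrArg CommRingCat.Hom.hom (Spec.map_injective h1)
    simpa only [Category.assoc] using h2

/-- The morphism to `Y` given by the coordinates `(λ, x)`. -/
def toY : U.toScheme ⟶ Y := exists_toY.choose

theorem toY_str : toY ≫ str eqY =
    U.ι ≫ Spec.map (CommRingCat.ofHom (algebraMap ℂ HRing)) := exists_toY.choose_spec.1

theorem isPt_toY (f : HRing →+* A) (hf : ∀ i, Ideal.span (f '' groups i) = ⊤) :
    IsPt (Uni.pt f hf ≫ toY ≫ incl eqY) (univ.map f).l (univ.map f).x :=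
  exists_toY.choose_spec.2 A f hf

end HRing

end Example

/-! ### Charts of the first blowup -/

namespace Blow

theorem ideal_eq_of_locally {A : Type u} [CommRing A] {I J : Ideal A}
    (h : ∀ y : PrimeSpectrum A, ∃ a, a ∉ y.asIdeal ∧
      I.map (algebraMap A (Localization.Away a)) = J.map (algebraMap A (Localization.Away a))) :
    I = J := by
  refine le_antisymm (fun f hf => mem_of_locally fun y => ?_)
    (fun f hf => mem_of_locally fun y => ?_)
  · obtain ⟨a, ha, h⟩ := h y
    exact ⟨a, ha, h ▸ Ideal.mem_map_of_mem _ hf⟩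
  · obtain ⟨a, ha, h⟩ := h y
    exact ⟨a, ha, h ▸ Ideal.mem_map_of_mem _ hf⟩

end Blow

namespace Example

open BiProj MvPolynomial Blow Scheme.IdealSheafData

theorem pullIdeal_Y₁_eq {A : Type} [CommRing A] {p : Spec (CommRingCat.of A) ⟶ Y} {l : Fin 3 → A}
    {x : Fin 4 → A} (hp : IsPt (p ≫ incl eqY) l x) :
    pullIdeal (vanishingIdeal Y₁) p = Ideal.span {l 2, x 2, x 3} := by
  refine ideal_eq_of_locally fun y => ?_
  obtain ⟨i, hi⟩ := exists_notMem_of_span_eq_top hp.span_left y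
  obtain ⟨j, hj⟩ := exists_notMem_of_span_eq_top hp.span_right y
  refine ⟨l i * x j, fun h => (y.2.mem_or_mem h).elim hi hj, ?_⟩
  have hu := IsLocalization.Away.algebraMap_isUnit (S := Localization.Away (l i * x j)) (l i * x j)
  rw [map_mul] at hu
  have h := hp.map (algebraMap A (Localization.Away (l i * x j)))
  rw [← Category.assoc] at h
  rw [← pullIdeal_specMap, pullIdeal_Y₁ h (i := i) (j := j) (isUnit_of_mul_isUnit_left hu)
    (isUnit_of_mul_isUnit_right hu), Ideal.map_span, Set.image_insert_eq, Set.image_pair]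
  rfl

theorem HTuple.IsUni.span_eq {A : Type} [CommRing A] {e : HTuple A} (h : e.IsUni) :
    Ideal.span {e.l 2, e.x 2, e.x 3} = Ideal.span {e.t} := by
  refine le_antisymm (Ideal.span_le.2 ?_) ?_
  · rintro z (rfl | rfl | rfl)
    · exact Ideal.mem_span_singleton.2 ⟨e.L, rfl⟩
    · exact Ideal.mem_span_singleton.2 ⟨e.a, rfl⟩
    · exact Ideal.mem_span_singleton.2 ⟨e.b, rfl⟩
  · have h1 : (1 : A) ∈ Ideal.span {e.L, e.a, e.b} := by
      rw [← Ideal.span_range_vec_three]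
      exact h.hw.ge trivial
    rw [Ideal.mem_span_insert] at h1
    obtain ⟨α, z, hz, h1⟩ := h1
    obtain ⟨β, γ, rfl⟩ := Ideal.mem_span_pair.1 hz
    rw [Ideal.span_le, Set.singleton_subset_iff, SetLike.mem_coe, Ideal.mem_span_insert]
    refine ⟨α, _, Ideal.mem_span_pair.2 ⟨β, γ, rfl⟩, ?_⟩
    simp only [HTuple.l, HTuple.x, Matrix.cons_val]
    linear_combination e.t * h1

variable {Y' : Scheme.{0}} {b₁ : Y' ⟶ Y}

theorem isEffectiveCartier_comap_toY : IsEffectiveCartier ((vanishingIdeal Y₁).comap HRing.toY) := by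
  refine isEffectiveCartier_of_charts fun y => ?_
  obtain ⟨g, -, hf, ho, hy⟩ := Uni.exists_chart y
  refine ⟨_, _, _, ho, hy, _, map_mem_nonZeroDivisors_away HRing.univ_t_mem _, ?_⟩
  have h := HRing.isPt_toY _ hf
  rw [← Category.assoc] at h
  rw [pullIdeal_comap, pullIdeal_Y₁_eq h, ((HRing.forall_span_iff _).1 hf).span_eq]
  rfl

variable (h₁ : IsBlowupAlong b₁ Y₁) {q₁ : HRing.U.toScheme ⟶ Y'} (hq₁ : q₁ ≫ b₁ = HRing.toY)

include h₁ hq₁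

/-- The points of the first blowup have neighbourhoods with coordinates. -/
theorem exists_section₁ (y : Y') : ∃ (B : Type) (_ : CommRing B)
    (k : Spec (CommRingCat.of B) ⟶ Y') (_ : IsOpenImmersion k), y ∈ Set.range k ∧
    ∃ f hf, Uni.pt (V := HRing.groups) f hf ≫ q₁ = k ∧
      (HRing.univ.map f).t ∈ nonZeroDivisors B := by
  obtain ⟨i, j, hij⟩ := exists_mem_stdOpen (incl eqY (b₁ y))
  obtain ⟨B₀, _, k₀, hk₀, hyk, -, l₀, x₀, hp₀, -, -⟩ :=
    exists_chart_isPt (O := ⊤) (z := b₁ y) trivial hij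
  obtain ⟨B, _, k', hk', hy', t, ht, hI⟩ :=
    h₁.cartier.exists_chart (b₁ ⁻¹ᵁ k₀.opensRange).ι ⟨y, hyk⟩
  let k := k' ≫ (b₁ ⁻¹ᵁ k₀.opensRange).ι
  have hyk' : y ∈ Set.range k := by
    obtain ⟨z, hz⟩ := hy'
    refine ⟨z, ?_⟩
    simp only [k]
    rw [Scheme.Hom.comp_apply, hz]
    rfl
  have hr : Set.range (k ≫ b₁) ⊆ Set.range k₀ := by
    rintro _ ⟨z, rfl⟩
    exact (k' z).2
  obtain ⟨φ, hφ⟩ := Charts.exists_specMap (IsOpenImmersion.lift k₀ (k ≫ b₁) hr)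
  have hfac : k ≫ b₁ = Spec.map (CommRingCat.ofHom φ) ≫ k₀ := by
    rw [← hφ, IsOpenImmersion.lift_fac]
  have hp := hp₀.map φ
  rw [← Category.assoc, ← hfac] at hp
  set l := φ ∘ l₀
  set x := φ ∘ x₀
  have hspan : Ideal.span {l 2, x 2, x 3} = Ideal.span {t} := by
    rw [← pullIdeal_Y₁_eq hp, ← hI, pullIdeal_comap]
  have hdvd : ∀ z ∈ ({l 2, x 2, x 3} : Set B), t ∣ z := fun z hz => by
    rw [← Ideal.mem_span_singleton, ← hspan]
    exact Ideal.subset_span hz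
  obtain ⟨L, hL⟩ := hdvd (l 2) (by simp)
  obtain ⟨a, ha⟩ := hdvd (x 2) (by simp)
  obtain ⟨b, hb⟩ := hdvd (x 3) (by simp)
  have hyeq := yEq_eq_zero hp
  let e : HTuple B :=
    { l0 := l 0, l1 := l 1, x0 := x 0, x1 := x 1, t := t, L := L, a := a, b := b
      rel := by
        rw [mem_nonZeroDivisors_iff_right] at ht
        refine ht _ ?_
        rw [← hyeq, yEq, hL, ha, hb]
        ring }
  have hel : e.l = l := by
    ext i; fin_cases i
    · rfl
    · rfl
    · exact hL.symm
  have hex : e.x = x := by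
    ext i; fin_cases i
    · rfl
    · rfl
    · exact ha.symm
    · exact hb.symm
  have hu : e.IsUni := by
    refine ⟨hel ▸ hp.span_left, hex ▸ hp.span_right, ?_⟩
    have htm : t ∈ Ideal.span {l 2, x 2, x 3} := hspan ▸ Ideal.mem_span_singleton_self t
    rw [hL, ha, hb, Ideal.mem_span_insert] at htm
    obtain ⟨α, z, hz, h⟩ := htm
    rw [Ideal.mem_span_pair] at hz
    obtain ⟨β, γ, rfl⟩ := hz
    rw [HTuple.w, Ideal.span_range_vec_three, Ideal.eq_top_iff_one, Ideal.mem_span_insert]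
    refine ⟨α, β * a + γ * b, Ideal.mem_span_pair.2 ⟨β, γ, rfl⟩, ?_⟩
    rw [mem_nonZeroDivisors_iff_right] at ht
    rw [← sub_eq_zero]
    refine ht _ ?_
    linear_combination h
  obtain ⟨_, hl, hx, hpe⟩ := id hp
  have hef := HRing.univ_map_hom e
  have hf := (HRing.forall_span_iff (HRing.hom e).toRingHom).2 (hef.symm ▸ hu)
  refine ⟨B, inferInstance, k, inferInstance, hyk', (HRing.hom e).toRingHom, hf, ?_, ?_⟩
  · have hpt := HRing.isPt_toY _ hf
    rw [hef, hel, hex] at hpt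
    refine IsBlowup.hom_ext h₁ ?_ ht ?_
    · rw [Category.assoc, hq₁, ← cancel_mono (incl eqY)]
      rw [← Category.assoc] at hpt
      refine hpt.hom_ext' hp ?_
      have h1 : (k ≫ b₁) ≫ str eqY = Spec.map (CommRingCat.ofHom (algebraMap ℂ B)) := by
        rw [str, ← Category.assoc, hpe, bipt_str]
      have h2 : (Uni.pt _ hf ≫ HRing.toY) ≫ str eqY =
          Spec.map (CommRingCat.ofHom (algebraMap ℂ B)) := by
        rw [Category.assoc, HRing.toY_str, ← Category.assoc, Uni.pt_ι, ← Spec.map_comp,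
          ← CommRingCat.ofHom_comp]
        congr 2
        exact (HRing.hom e).comp_algebraMap
      simpa only [str, Category.assoc] using h2.trans h1.symm
    · rw [Category.assoc, hq₁]
      rw [← Category.assoc] at hpt
      rw [pullIdeal_Y₁_eq hpt, hspan]
      exact Ideal.mem_span_singleton_self t
  · rw [hef]
    exact ht

omit h₁ in
theorem isPt_comp (A : Type) [CommRing A] (f : HRing →+* A)
    (hf : ∀ i, Ideal.span (f '' HRing.groups i) = ⊤) :
    IsPt (((Uni.pt f hf ≫ q₁) ≫ b₁) ≫ incl eqY) (HRing.univ.map f).l (HRing.univ.map f).x := by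
  have := HRing.isPt_toY f hf
  rwa [← hq₁, ← Category.assoc, ← Category.assoc] at this

/-- The ideal of the proper transform of a closed subset. -/
theorem pullIdeal_properTransform (W : Closeds Y)
    (g : ∀ {A : Type} [CommRing A], HTuple A → Fin 3 → A)
    (hg : ∀ {A B : Type} [CommRing A] [CommRing B] (e : HTuple A) (φ : A →+* B),
      g (e.map φ) = φ ∘ g e)
    (hin : ∀ {A : Type} [CommRing A] (e : HTuple A) (p : Spec (CommRingCat.of A) ⟶ Y)
      (y : PrimeSpectrum A), IsPt (p ≫ incl eqY) e.l e.x → (∀ i, g e i ∈ y.asIdeal) → p y ∈ W)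
    (hout : ∀ {A : Type} [CommRing A] (e : HTuple A) (p : Spec (CommRingCat.of A) ⟶ Y)
      (y : PrimeSpectrum A), IsPt (p ≫ incl eqY) e.l e.x → p y ∈ W → p y ∉ Y₁ →
      ∀ i, g e i ∈ y.asIdeal)
    (hscale : ∀ {A : Type} [CommRing A] (e e' : HTuple A) (c d s : A), e.l0 = c * e'.l0 →
      e.l1 = c * e'.l1 → e.L = c * s * e'.L → e.a = d * s * e'.a → e.b = d * s * e'.b →
      ∀ i, g e i ∈ Ideal.span (Set.range (g e')))
    (π : HRing →ₐ[ℂ] MvPolynomial (Fin 8) ℂ)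
    (hker : RingHom.ker π ≤ Ideal.span (Set.range (g HRing.univ)))
    (hπ : ∀ i, π (g HRing.univ i) = 0)
    (hπ' : π (HRing.univ.x 2) ≠ 0 ∨ π (HRing.univ.x 3) ≠ 0)
    {A : Type} [CommRing A] (f : HRing →+* A)
    (hf : ∀ i, Ideal.span (f '' HRing.groups i) = ⊤) :
    pullIdeal (vanishingIdeal (properTransform b₁ Y₁ W)) (Uni.pt f hf ≫ q₁) =
      Ideal.span (Set.range (g (HRing.univ.map f))) := by
  have huniv : ∀ (u : HRing)
      (hu : ∀ i, Ideal.span (algebraMap HRing (Localization.Away u) '' HRing.groups i) = ⊤),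
      pullIdeal (vanishingIdeal (properTransform b₁ Y₁ W)) (Uni.pt _ hu ≫ q₁) =
        Ideal.span (Set.range (g (HRing.univ.map (algebraMap HRing (Localization.Away u))))) := by
    intro u hu
    have hp := isPt_comp hq₁ _ _ hu
    refine le_antisymm ?_ (Ideal.span_le.2 ?_)
    · refine (pullIdeal_le_of_isPrime (K := RingHom.ker π) (RingHom.ker_isPrime _) _ ?_).trans
        ((Ideal.map_mono hker).trans ?_)
      · intro y hy
        have hmem : ∀ z, algebraMap HRing (Localization.Away u) z ∈ y.asIdeal ↔ π z = 0 :=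
          fun z => by
            rw [← Ideal.mem_comap, hy]
            rfl
        refine subset_closure ?_
        change b₁ _ ∈ W ∧ ¬ (b₁ _ ∈ Y₁)
        constructor
        · refine hin _ _ y hp fun i => ?_
          rw [hg]
          exact (hmem _).2 (hπ i)
        · intro h
          have := (mem_Y₁_iff hp y).1 h
          rw [HTuple.map_x] at this
          exact hπ'.elim (fun h => h ((hmem _).1 this.2.1)) fun h => h ((hmem _).1 this.2.2)
      · rw [Ideal.map_span, hg, Set.range_comp]
    · rintro _ ⟨i, rfl⟩
      refine mem_pullIdeal_of_charts _ fun y => ?_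
      obtain ⟨B, _, k, hk, hy, f', hf', hfac, -⟩ := exists_section₁ h₁ hq₁ ((Uni.pt _ hu ≫ q₁) y)
      refine ⟨B, inferInstance, k, hk, hy, fun a φ hφ => ?_⟩
      set e' := HRing.univ.map f'
      have hle : Ideal.span (Set.range (g e')) ≤
          pullIdeal (vanishingIdeal (properTransform b₁ Y₁ W)) k := by
        rw [Ideal.span_le]
        rintro _ ⟨i, rfl⟩
        rw [SetLike.mem_coe, mem_pullIdeal_vanishingIdeal]
        intro y hy
        let O : Set (PrimeSpectrum B) := {y | g e' i ∈ y.asIdeal}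
        have hO : IsClosed O := by
          have : O = PrimeSpectrum.zeroLocus {g e' i} := by
            ext z
            simp [O, PrimeSpectrum.mem_zeroLocus]
          rw [this]
          exact PrimeSpectrum.isClosed_zeroLocus _
        have h2 : y ∈ closure (k ⁻¹' (b₁ ⁻¹' ((W : Set Y) \ Y₁))) := by
          rw [← k.isOpenEmbedding.isOpenMap.preimage_closure_eq_closure_preimage k.continuous]
          exact hy
        refine closure_minimal ?_ hO h2
        intro z hz
        have hp' := isPt_comp hq₁ _ _ hf'
        rw [hfac] at hp'
        exact hout e' (k ≫ b₁) z hp' hz.1 hz.2 i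
      refine Ideal.map_mono hle ?_
      rw [Ideal.map_span, ← Set.range_comp, ← hg]
      have hp2 := hp.map (algebraMap _ (Localization.Away a))
      have hp' := (isPt_comp hq₁ _ _ hf').map φ
      rw [hfac] at hp'
      have e2 : Spec.map (CommRingCat.ofHom (algebraMap _ (Localization.Away a))) ≫
          ((Uni.pt _ hu ≫ q₁) ≫ b₁) ≫ incl eqY = Spec.map (CommRingCat.ofHom φ) ≫ (k ≫ b₁) ≫
            incl eqY := by
        simp only [← Category.assoc] at hφ ⊢
        rw [hφ]
      rw [e2] at hp2
      have hmin := hp2.minors hp'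
      rw [← HTuple.map_l, ← HTuple.map_x, ← HTuple.map_l, ← HTuple.map_x] at hmin
      have hg' : algebraMap _ (Localization.Away a) (g (HRing.univ.map
          (algebraMap HRing (Localization.Away u))) i) = g ((HRing.univ.map
          (algebraMap HRing (Localization.Away u))).map (algebraMap _ (Localization.Away a))) i :=
        (congrFun (hg _ _) i).symm
      rw [hg']
      have ht : ((HRing.univ.map (algebraMap HRing (Localization.Away u))).map
          (algebraMap _ (Localization.Away a))).t ∈ nonZeroDivisors (Localization.Away a) :=
        map_mem_nonZeroDivisors_away (map_mem_nonZeroDivisors_away HRing.univ_t_mem u) a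
      have hu1 : (e'.map φ).IsUni := (HRing.forall_span_iff (φ.comp f')).1
        (Uni.span_image_comp hf' φ)
      have hu2 : ((HRing.univ.map (algebraMap HRing (Localization.Away u))).map
          (algebraMap _ (Localization.Away a))).IsUni := (HRing.forall_span_iff
            ((algebraMap _ (Localization.Away a)).comp (algebraMap HRing (Localization.Away u)))).1
        (Uni.span_image_comp hu _)
      generalize (HRing.univ.map (algebraMap HRing (Localization.Away u))).map
          (algebraMap _ (Localization.Away a)) = e₀ at *
      generalize e'.map φ = e₁ at *
      obtain ⟨c, hc⟩ := exists_eq_smul_of_minors hu1.hl hmin.1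
      obtain ⟨d, hd⟩ := exists_eq_smul_of_minors hu1.hx hmin.2
      obtain ⟨c', hc'⟩ := exists_eq_smul_of_minors hu2.hl fun i j => by
        rw [mul_comm, mul_comm (e₁.l j)]; exact (hmin.1 j i)
      obtain ⟨d', hd'⟩ := exists_eq_smul_of_minors hu2.hx fun i j => by
        rw [mul_comm, mul_comm (e₁.x j)]; exact (hmin.2 j i)
      have htt : e₁.t ∈ Ideal.span {e₀.t} := by
        have h3 := hu1.span_eq ▸ Ideal.mem_span_singleton_self e₁.t
        refine (Ideal.span_le.2 ?_ : _ ≤ Ideal.span {e₀.t}) h3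
        rintro z (rfl | rfl | rfl)
        · rw [hc' 2]
          exact Ideal.mul_mem_left _ _ (Ideal.mem_span_singleton.2 ⟨e₀.L, rfl⟩)
        · rw [hd' 2]
          exact Ideal.mul_mem_left _ _ (Ideal.mem_span_singleton.2 ⟨e₀.a, rfl⟩)
        · rw [hd' 3]
          exact Ideal.mul_mem_left _ _ (Ideal.mem_span_singleton.2 ⟨e₀.b, rfl⟩)
      obtain ⟨s, hs⟩ := Ideal.mem_span_singleton.1 htt
      rw [mem_nonZeroDivisors_iff_right] at ht
      have hcancel : ∀ z z', e₀.t * z = e₀.t * z' → z = z' := fun z z' h => by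
        rw [← sub_eq_zero]
        exact ht _ (by linear_combination h)
      refine hscale e₀ e₁ c d s (hc 0) (hc 1) (hcancel _ _ ?_) (hcancel _ _ ?_)
        (hcancel _ _ ?_) i
      · have := hc 2
        simp only [HTuple.l, Matrix.cons_val] at this
        rw [this, hs]; ring
      · have := hd 2
        simp only [HTuple.x, Matrix.cons_val] at this
        rw [this, hs]; ring
      · have := hd 3
        simp only [HTuple.x, Matrix.cons_val] at this
        rw [this, hs]; ring
  refine ideal_eq_of_locally fun y => ?_
  obtain ⟨v, -, hv, ho, hy⟩ := Uni.exists_chart (Uni.pt f hf y)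
  obtain ⟨a, ha, φ, hφ⟩ := Charts.exists_away_factor (Uni.pt f hf) y (Uni.pt _ hv) hy
  refine ⟨a, ha, ?_⟩
  have hcomp : φ.comp (algebraMap HRing _) = (algebraMap A (Localization.Away a)).comp f := by
    have := congrArg (· ≫ HRing.U.ι) hφ
    simp only [Category.assoc, Uni.pt_ι, ← Spec.map_comp, ← CommRingCat.ofHom_comp] at this
    exact (congrArg CommRingCat.Hom.hom (Spec.map_injective this)).symm
  rw [← pullIdeal_specMap, ← Category.assoc, hφ, Category.assoc, pullIdeal_specMap,
    huniv _ hv, Ideal.map_span, ← Set.range_comp, ← hg, Ideal.map_span, ← Set.range_comp, ← hg]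
  change Ideal.span (Set.range (g (HRing.univ.map (φ.comp _)))) = _
  rw [hcomp]
  rfl

end Example

/-! ### The ideals of the second and third centres -/

namespace Example

open BiProj MvPolynomial Blow Scheme.IdealSheafData

namespace HTuple

variable {A B : Type} [CommRing A] [CommRing B]

/-- Generators of the ideal of the proper transform of `Y₂`. -/
def gens₂ (e : HTuple A) : Fin 3 → A := ![e.L, e.l1, e.b]

/-- Generators of the ideal of the proper transform of `Y₃`. -/
def gens₃ (e : HTuple A) : Fin 3 → A := ![e.L, e.a, e.l0 - e.l1]

theorem gens₂_map (e : HTuple A) (φ : A →+* B) : gens₂ (e.map φ) = φ ∘ gens₂ e := by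
  ext i; fin_cases i <;> simp [gens₂, map]

theorem gens₃_map (e : HTuple A) (φ : A →+* B) : gens₃ (e.map φ) = φ ∘ gens₃ e := by
  ext i; fin_cases i <;> simp [gens₃, map]

end HTuple

theorem HRing.ker_hom_le (τ : HTuple (MvPolynomial (Fin 8) ℂ)) {J : Ideal HRing}
    (h : ∀ i, Ideal.Quotient.mk (Ideal.span {hPoly})
      (![τ.l0, τ.l1, τ.x0, τ.x1, τ.t, τ.L, τ.a, τ.b] i) - X' i ∈ J) :
    RingHom.ker (hom τ) ≤ J := by
  intro f hf
  have key : ((Ideal.Quotient.mkₐ ℂ J).comp (Ideal.Quotient.mkₐ ℂ (Ideal.span {hPoly}))).comp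
      (hom τ) = Ideal.Quotient.mkₐ ℂ J := by
    refine algHom_ext (A := HRing ⧸ J) fun i => ?_
    rw [AlgHom.comp_apply, hom_X']
    exact Ideal.Quotient.eq.2 (h i)
  have h4 := DFunLike.congr_fun key f
  rw [AlgHom.comp_apply, (RingHom.mem_ker).1 hf, map_zero] at h4
  exact Ideal.Quotient.eq_zero_iff_mem.1 h4.symm

variable {Y' : Scheme.{0}} {b₁ : Y' ⟶ Y} (h₁ : IsBlowupAlong b₁ Y₁)
  {q₁ : HRing.U.toScheme ⟶ Y'} (hq₁ : q₁ ≫ b₁ = HRing.toY)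

include h₁ hq₁

theorem pullIdeal_Y₂' {A : Type} [CommRing A] (f : HRing →+* A)
    (hf : ∀ i, Ideal.span (f '' HRing.groups i) = ⊤) :
    pullIdeal (vanishingIdeal (properTransform b₁ Y₁ Y₂)) (Uni.pt f hf ≫ q₁) =
      Ideal.span (Set.range (HRing.univ.map f).gens₂) := by
  let τ : HTuple (MvPolynomial (Fin 8) ℂ) :=
    { l0 := X 0, l1 := 0, x0 := X 2, x1 := X 3, t := X 4, L := 0, a := X 6, b := 0
      rel := by ring }
  refine pullIdeal_properTransform h₁ hq₁ Y₂ HTuple.gens₂ HTuple.gens₂_map ?_ ?_ ?_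
    (HRing.hom τ) (HRing.ker_hom_le τ ?_) ?_ ?_ f hf
  · intro A _ e p y hp h
    exact (mem_Y₂_iff hp y).2 ⟨h 1, Ideal.mul_mem_left _ _ (h 0), Ideal.mul_mem_left _ _ (h 2)⟩
  · intro A _ e p y hp h h' i
    obtain ⟨h1, h2, h3⟩ := (mem_Y₂_iff hp y).1 h
    have ht : e.t ∉ y.asIdeal := fun ht => h' ((mem_Y₁_iff hp y).2
      ⟨Ideal.mul_mem_right _ _ ht, Ideal.mul_mem_right _ _ ht, Ideal.mul_mem_right _ _ ht⟩)
    fin_cases i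
    · exact (y.2.mem_or_mem h2).resolve_left ht
    · exact h1
    · exact (y.2.mem_or_mem h3).resolve_left ht
  · intro A _ e e' c d s h0 h1 hL ha hb i
    have hm : ∀ i, e'.gens₂ i ∈ Ideal.span (Set.range e'.gens₂) := fun i =>
      Ideal.subset_span ⟨i, rfl⟩
    fin_cases i
    · change e.L ∈ _
      exact hL ▸ Ideal.mul_mem_left _ _ (hm 0)
    · change e.l1 ∈ _
      exact h1 ▸ Ideal.mul_mem_left _ _ (hm 1)
    · change e.b ∈ _
      exact hb ▸ Ideal.mul_mem_left _ _ (hm 2)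
  · have hm : ∀ i, HRing.univ.gens₂ i ∈ Ideal.span (Set.range HRing.univ.gens₂) := fun i =>
      Ideal.subset_span ⟨i, rfl⟩
    have h1 : HRing.X' 1 ∈ Ideal.span (Set.range HRing.univ.gens₂) := hm 1
    have h5 : HRing.X' 5 ∈ Ideal.span (Set.range HRing.univ.gens₂) := hm 0
    have h7 : HRing.X' 7 ∈ Ideal.span (Set.range HRing.univ.gens₂) := hm 2
    intro i
    fin_cases i <;> simp [τ] <;> assumption
  · intro i
    fin_cases i <;> exact HRing.hom_X' τ _
  · left
    change HRing.hom τ (HRing.X' 4 * HRing.X' 6) ≠ 0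
    rw [map_mul, HRing.hom_X', HRing.hom_X']
    exact mul_ne_zero (X_ne_zero _) (X_ne_zero _)

theorem pullIdeal_Y₃' {A : Type} [CommRing A] (f : HRing →+* A)
    (hf : ∀ i, Ideal.span (f '' HRing.groups i) = ⊤) :
    pullIdeal (vanishingIdeal (properTransform b₁ Y₁ Y₃)) (Uni.pt f hf ≫ q₁) =
      Ideal.span (Set.range (HRing.univ.map f).gens₃) := by
  let τ : HTuple (MvPolynomial (Fin 8) ℂ) :=
    { l0 := X 0, l1 := X 0, x0 := X 2, x1 := X 3, t := X 4, L := 0, a := 0, b := X 7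
      rel := by ring }
  refine pullIdeal_properTransform h₁ hq₁ Y₃ HTuple.gens₃ HTuple.gens₃_map ?_ ?_ ?_
    (HRing.hom τ) (HRing.ker_hom_le τ ?_) ?_ ?_ f hf
  · intro A _ e p y hp h
    exact (mem_Y₃_iff hp y).2 ⟨h 2, Ideal.mul_mem_left _ _ (h 0), Ideal.mul_mem_left _ _ (h 1)⟩
  · intro A _ e p y hp h h' i
    obtain ⟨h1, h2, h3⟩ := (mem_Y₃_iff hp y).1 h
    have ht : e.t ∉ y.asIdeal := fun ht => h' ((mem_Y₁_iff hp y).2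
      ⟨Ideal.mul_mem_right _ _ ht, Ideal.mul_mem_right _ _ ht, Ideal.mul_mem_right _ _ ht⟩)
    fin_cases i
    · exact (y.2.mem_or_mem h2).resolve_left ht
    · exact (y.2.mem_or_mem h3).resolve_left ht
    · exact h1
  · intro A _ e e' c d s h0 h1 hL ha hb i
    have hm : ∀ i, e'.gens₃ i ∈ Ideal.span (Set.range e'.gens₃) := fun i =>
      Ideal.subset_span ⟨i, rfl⟩
    fin_cases i
    · change e.L ∈ _
      exact hL ▸ Ideal.mul_mem_left _ _ (hm 0)
    · change e.a ∈ _
      exact ha ▸ Ideal.mul_mem_left _ _ (hm 1)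
    · change e.l0 - e.l1 ∈ _
      rw [h0, h1, ← mul_sub]
      exact Ideal.mul_mem_left _ _ (hm 2)
  · have hm : ∀ i, HRing.univ.gens₃ i ∈ Ideal.span (Set.range HRing.univ.gens₃) := fun i =>
      Ideal.subset_span ⟨i, rfl⟩
    have h1 : HRing.X' 0 - HRing.X' 1 ∈ Ideal.span (Set.range HRing.univ.gens₃) := hm 2
    have h5 : HRing.X' 5 ∈ Ideal.span (Set.range HRing.univ.gens₃) := hm 0
    have h7 : HRing.X' 6 ∈ Ideal.span (Set.range HRing.univ.gens₃) := hm 1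
    intro i
    fin_cases i <;> simp [τ] <;> assumption
  · intro i
    fin_cases i
    · exact HRing.hom_X' τ 5
    · exact HRing.hom_X' τ 6
    · change HRing.hom τ (HRing.X' 0 - HRing.X' 1) = 0
      rw [map_sub, HRing.hom_X', HRing.hom_X']
      exact sub_self _
  · right
    change HRing.hom τ (HRing.X' 4 * HRing.X' 7) ≠ 0
    rw [map_mul, HRing.hom_X', HRing.hom_X']
    exact mul_ne_zero (X_ne_zero _) (X_ne_zero _)

theorem disjoint_Y₂'_Y₃' (y : Y') (h2 : y ∈ properTransform b₁ Y₁ Y₂)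
    (h3 : y ∈ properTransform b₁ Y₁ Y₃) : False := by
  obtain ⟨B, _, k, hk, ⟨z, rfl⟩, f, hf, hfac, -⟩ := exists_section₁ h₁ hq₁ y
  have e2 := pullIdeal_vanishingIdeal_le k h2
  have e3 := pullIdeal_vanishingIdeal_le k h3
  rw [← hfac, pullIdeal_Y₂' h₁ hq₁, Ideal.span_le] at e2
  rw [← hfac, pullIdeal_Y₃' h₁ hq₁, Ideal.span_le] at e3
  obtain ⟨i, hi⟩ := exists_notMem_of_span_eq_top ((HRing.forall_span_iff f).1 hf).hw z
  fin_cases i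
  · exact hi (e2 ⟨0, rfl⟩)
  · exact hi (e3 ⟨1, rfl⟩)
  · exact hi (e2 ⟨2, rfl⟩)

/-- The third centre is the preimage of the proper transform of `Y₃` in the first blowup. -/
theorem isBlowup_third {Y'' Yt : Scheme.{0}} {b₂ : Y'' ⟶ Y'} {b₃ : Yt ⟶ Y''}
    (h₂ : IsBlowupAlong b₂ (properTransform b₁ Y₁ Y₂))
    (h₃ : IsBlowupAlong b₃ (properTransform b₂ (properTransform b₁ Y₁ Y₂)
      (properTransform b₁ Y₁ Y₃))) :
    IsBlowup b₃ ((vanishingIdeal (properTransform b₁ Y₁ Y₃)).comap b₂) := by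
  have hd := disjoint_Y₂'_Y₃' h₁ hq₁
  rw [IsBlowup.comap_vanishingIdeal h₂ fun x h3 h2 => hd x h2 h3]
  have : properTransform b₂ (properTransform b₁ Y₁ Y₂) (properTransform b₁ Y₁ Y₃) =
      ⟨b₂ ⁻¹' (properTransform b₁ Y₁ Y₃),
        (properTransform b₁ Y₁ Y₃).isClosed.preimage b₂.continuous⟩ := by
    refine Closeds.ext ?_
    change closure (b₂ ⁻¹' (((properTransform b₁ Y₁ Y₃ : Closeds Y') : Set Y') \
      (properTransform b₁ Y₁ Y₂ : Closeds Y'))) = b₂ ⁻¹' (properTransform b₁ Y₁ Y₃ : Closeds Y')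
    have e : ((properTransform b₁ Y₁ Y₃ : Closeds Y') : Set Y') \
        (properTransform b₁ Y₁ Y₂ : Closeds Y') = (properTransform b₁ Y₁ Y₃ : Closeds Y') := by
      ext x
      exact ⟨fun h => h.1, fun h => ⟨h, fun h2 => hd x h2 h⟩⟩
    rw [e]
    exact ((properTransform b₁ Y₁ Y₃).isClosed.preimage b₂.continuous).closure_eq
  rw [← this]
  exact h₃

end Example

/-! ### Coordinates on the iterated blowup -/

namespace Example

open BiProj MvPolynomial Blow

/-- Coordinates on the iterated blowup of `Y`: here `λ₂ = t r P`, `x₄ = t a`, `x₅ = t b`. -/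
@[ext]
structure ETuple (A : Type) [CommRing A] where
  (l0 l1 x0 x1 t a b r P c d : A)
  r1 : l1 * a = r * c
  r2 : (l0 - l1) * b = r * d
  r3 : P * (l1 * x0 ^ 2 + l0 * x1 ^ 2 + (t * r * P - 2 * l0 - 2 * l1) * (t * b) ^ 2) +
    l0 * c * a * t + (l0 - l1) * d * b * t = 0

namespace ETuple

variable {A B : Type} [CommRing A] [CommRing B] (e : ETuple A)

/-- The coordinates on the first blowup. -/
def toH : HTuple A where
  l0 := e.l0
  l1 := e.l1
  x0 := e.x0
  x1 := e.x1
  t := e.t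
  L := e.r * e.P
  a := e.a
  b := e.b
  rel := by
    linear_combination e.r * e.r3 + e.t * e.l0 * e.a * e.r1 +
      e.t * (e.l0 - e.l1) * e.b * e.r2

/-- The coordinates `λ`. -/
def l : Fin 3 → A := e.toH.l

/-- The coordinates `x`. -/
def x : Fin 4 → A := e.toH.x

/-- The coordinates on the fibres of the last two blowups. -/
def z : Fin 3 → A := ![e.P, e.c, e.d]

/-- The coordinates of the image in `ℙ⁵`. -/
def image : Fin 6 → A :=
  ![e.P * e.x0, e.P * e.x1, e.P * (e.t * e.a), e.P * (e.t * e.b), e.c, e.d]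

/-- Base change of coordinates. -/
def map (φ : A →+* B) : ETuple B where
  l0 := φ e.l0
  l1 := φ e.l1
  x0 := φ e.x0
  x1 := φ e.x1
  t := φ e.t
  a := φ e.a
  b := φ e.b
  r := φ e.r
  P := φ e.P
  c := φ e.c
  d := φ e.d
  r1 := by simpa only [map_mul] using congrArg φ e.r1
  r2 := by simpa only [map_mul, map_sub] using congrArg φ e.r2
  r3 := by simpa only [map_add, map_mul, map_sub, map_pow, map_ofNat, map_zero] using congrArg φ e.r3

theorem toH_map (φ : A →+* B) : (e.map φ).toH = e.toH.map φ := by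
  ext <;> simp [toH, map, HTuple.map]

theorem map_l (φ : A →+* B) : (e.map φ).l = φ ∘ e.l := by rw [l, toH_map, HTuple.map_l]; rfl

theorem map_x (φ : A →+* B) : (e.map φ).x = φ ∘ e.x := by rw [x, toH_map, HTuple.map_x]; rfl

theorem map_z (φ : A →+* B) : (e.map φ).z = φ ∘ e.z := by
  ext i; fin_cases i <;> simp [z, map]

theorem map_image (φ : A →+* B) : (e.map φ).image = φ ∘ e.image := by
  ext i; fin_cases i <;> simp [image, map]

/-- The four groups of homogeneous coordinates are unimodular. -/
structure IsUni : Prop where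
  toH : e.toH.IsUni
  hz : Ideal.span (Set.range e.z) = ⊤

theorem phiCoord_eq (i : Fin 6) : phiCoord e.l e.x i = e.t * e.r * e.image i := by
  fin_cases i
  · simp [phiCoord, l, x, image, toH, HTuple.l, HTuple.x]; ring
  · simp [phiCoord, l, x, image, toH, HTuple.l, HTuple.x]; ring
  · simp [phiCoord, l, x, image, toH, HTuple.l, HTuple.x]; ring
  · simp [phiCoord, l, x, image, toH, HTuple.l, HTuple.x]; ring
  · simp [phiCoord, l, x, image, toH, HTuple.l, HTuple.x]; linear_combination e.t * e.r1
  · simp [phiCoord, l, x, image, toH, HTuple.l, HTuple.x]; linear_combination e.t * e.r2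

theorem image_rel : (e.l 0 - e.l 1) * e.image 3 = e.l 2 * e.image 5 ∧
    e.l 1 * e.image 2 = e.l 2 * e.image 4 ∧ qEq e.l e.image = 0 := by
  simp only [qEq, l, image, toH, HTuple.l, Matrix.cons_val]
  refine ⟨?_, ?_, ?_⟩
  · linear_combination e.P * e.t * e.r2
  · linear_combination e.P * e.t * e.r1
  · linear_combination e.P * e.r3 - e.t * e.P * e.d * e.r2

theorem IsUni.span_image (h : e.IsUni) : Ideal.span (Set.range e.image) = ⊤ := by
  have hc : e.c ∈ Ideal.span (Set.range e.image) := Ideal.subset_span ⟨4, rfl⟩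
  have hd : e.d ∈ Ideal.span (Set.range e.image) := Ideal.subset_span ⟨5, rfl⟩
  have hP : ∀ j, e.P * e.x j ∈ Ideal.span (Set.range e.image) := by
    intro j
    fin_cases j
    · exact Ideal.subset_span ⟨0, rfl⟩
    · exact Ideal.subset_span ⟨1, rfl⟩
    · exact Ideal.subset_span ⟨2, rfl⟩
    · exact Ideal.subset_span ⟨3, rfl⟩
  have hP' : e.P ∈ Ideal.span (Set.range e.image) := by
    have h1 : (1 : A) ∈ Ideal.span (Set.range e.x) := h.toH.hx.ge trivial
    obtain ⟨α, hα⟩ := Ideal.mem_span_range_iff_exists_fun.1 h1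
    rw [← mul_one e.P, ← hα, Finset.mul_sum]
    refine Ideal.sum_mem _ fun j _ => ?_
    rw [mul_left_comm]
    exact Ideal.mul_mem_left _ _ (hP j)
  rw [eq_top_iff, ← h.hz, Ideal.span_le]
  rintro _ ⟨i, rfl⟩
  fin_cases i
  · exact hP'
  · exact hc
  · exact hd

end ETuple

/-- The relations between the coordinates on the iterated blowup. -/
def ePolys : Set (MvPolynomial (Fin 11) ℂ) :=
  {X 1 * X 5 - X 7 * X 9, (X 0 - X 1) * X 6 - X 7 * X 10,
    X 8 * (X 1 * X 2 ^ 2 + X 0 * X 3 ^ 2 + (X 4 * X 7 * X 8 - 2 * X 0 - 2 * X 1) * (X 4 * X 6) ^ 2) +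
    X 0 * X 9 * X 5 * X 4 + (X 0 - X 1) * X 10 * X 6 * X 4}

/-- The ring of the coordinates on the iterated blowup. -/
abbrev ERing : Type := MvPolynomial (Fin 11) ℂ ⧸ Ideal.span ePolys

namespace ERing

/-- The generators. -/
abbrev X' (i : Fin 11) : ERing := Ideal.Quotient.mk _ (X i)

theorem mk_eq_zero {f : MvPolynomial (Fin 11) ℂ} (hf : f ∈ ePolys) :
    Ideal.Quotient.mk (Ideal.span ePolys) f = 0 :=
  Ideal.Quotient.eq_zero_iff_mem.2 (Ideal.subset_span hf)

/-- The universal coordinates. -/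
def univ : ETuple ERing where
  l0 := X' 0
  l1 := X' 1
  x0 := X' 2
  x1 := X' 3
  t := X' 4
  a := X' 5
  b := X' 6
  r := X' 7
  P := X' 8
  c := X' 9
  d := X' 10
  r1 := by
    have := mk_eq_zero (f := X 1 * X 5 - X 7 * X 9) (by simp [ePolys])
    simpa only [map_mul, map_sub, sub_eq_zero] using this
  r2 := by
    have := mk_eq_zero (f := (X 0 - X 1) * X 6 - X 7 * X 10) (by simp [ePolys])
    rw [map_sub, sub_eq_zero] at this
    simpa only [map_mul, map_sub] using this
  r3 := by
    have := mk_eq_zero (f := X 8 * (X 1 * X 2 ^ 2 + X 0 * X 3 ^ 2 +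
      (X 4 * X 7 * X 8 - 2 * X 0 - 2 * X 1) * (X 4 * X 6) ^ 2) +
      X 0 * X 9 * X 5 * X 4 + (X 0 - X 1) * X 10 * X 6 * X 4) (by simp [ePolys])
    simpa only [map_add, map_mul, map_sub, map_pow, map_ofNat] using this

variable {A B : Type} [CommRing A] [CommRing B]

/-- Homomorphisms to `A` are given by coordinates in `A`. -/
def hom [Algebra ℂ A] (e : ETuple A) : ERing →ₐ[ℂ] A :=
  Ideal.Quotient.liftₐ _
    (aeval ![e.l0, e.l1, e.x0, e.x1, e.t, e.a, e.b, e.r, e.P, e.c, e.d]) fun z hz => by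
    have : Ideal.span ePolys ≤ RingHom.ker
        (aeval (R := ℂ) ![e.l0, e.l1, e.x0, e.x1, e.t, e.a, e.b, e.r, e.P, e.c, e.d]) := by
      rw [Ideal.span_le]
      rintro f (rfl | rfl | rfl)
      · rw [SetLike.mem_coe, RingHom.mem_ker]
        simpa [sub_eq_zero] using e.r1
      · rw [SetLike.mem_coe, RingHom.mem_ker, map_sub, sub_eq_zero]
        simpa using e.r2
      · rw [SetLike.mem_coe, RingHom.mem_ker]
        simpa using e.r3
    exact this hz

theorem hom_X' [Algebra ℂ A] (e : ETuple A) (i : Fin 11) :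
    hom e (X' i) = ![e.l0, e.l1, e.x0, e.x1, e.t, e.a, e.b, e.r, e.P, e.c, e.d] i :=
  aeval_X _ i

theorem univ_map_hom [Algebra ℂ A] (e : ETuple A) : univ.map (hom e).toRingHom = e := by
  ext <;> exact hom_X' e _

theorem algHom_ext [Algebra ℂ A] {f g : ERing →ₐ[ℂ] A}
    (h : univ.map f.toRingHom = univ.map g.toRingHom) : f = g := by
  refine Ideal.Quotient.algHom_ext _ (MvPolynomial.algHom_ext fun i => ?_)
  rw [ETuple.ext_iff] at h
  obtain ⟨h0, h1, h2, h3, h4, h5, h6, h7, h8, h9, h10⟩ := h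
  fin_cases i
  exacts [h0, h1, h2, h3, h4, h5, h6, h7, h8, h9, h10]

/-- The ring of the coordinates on the first blowup maps to that of the iterated blowup. -/
def ofH : HRing →ₐ[ℂ] ERing := HRing.hom univ.toH

theorem univ_map_ofH (f : ERing →+* A) :
    HRing.univ.map (f.comp ofH.toRingHom) = (univ.map f).toH := by
  rw [ETuple.toH_map, ← HRing.univ_map_hom univ.toH]
  rfl

/-- The groups of homogeneous coordinates. -/
def groups : Fin 4 → Set ERing :=
  ![Set.range univ.l, Set.range univ.x, Set.range univ.toH.w, Set.range univ.z]

/-- The open set where the groups of homogeneous coordinates are unimodular. -/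
abbrev U : (Spec (CommRingCat.of ERing)).Opens := Uni groups

theorem forall_span_iff (f : ERing →+* A) :
    (∀ i, Ideal.span (f '' groups i) = ⊤) ↔ (univ.map f).IsUni := by
  constructor
  · intro h
    refine ⟨⟨?_, ?_, ?_⟩, ?_⟩
    · rw [ETuple.toH_map, HTuple.map_l, Set.range_comp]; exact h 0
    · rw [ETuple.toH_map, HTuple.map_x, Set.range_comp]; exact h 1
    · rw [ETuple.toH_map, HTuple.map_w, Set.range_comp]; exact h 2
    · rw [ETuple.map_z, Set.range_comp]; exact h 3
  · rintro ⟨⟨h0, h1, h2⟩, h3⟩ i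
    rw [ETuple.toH_map, HTuple.map_l, Set.range_comp] at h0
    rw [ETuple.toH_map, HTuple.map_x, Set.range_comp] at h1
    rw [ETuple.toH_map, HTuple.map_w, Set.range_comp] at h2
    rw [ETuple.map_z, Set.range_comp] at h3
    fin_cases i
    · exact h0
    · exact h1
    · exact h2
    · exact h3

theorem exists_pow_mul_eq_zero {h : MvPolynomial (Fin 9) ℂ}
    (τ : ETuple (MvPolynomial (Fin 9) ℂ ⧸ Ideal.span {h})) {v : ERing}
    (s : Fin 9 → Localization.Away v) (hs : aeval s h = 0)
    (hτ : τ.l 2 ∈ nonZeroDivisors (MvPolynomial (Fin 9) ℂ ⧸ Ideal.span {h}))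
    (hcomp : ∀ σ : MvPolynomial (Fin 9) ℂ ⧸ Ideal.span {h} →ₐ[ℂ] Localization.Away v,
      (∀ i, σ (Ideal.Quotient.mk _ (X i)) = s i) →
      τ.map σ.toRingHom = univ.map (algebraMap ERing (Localization.Away v)))
    {f : ERing} (hf : univ.l 2 * f = 0) : ∃ m : ℕ, v ^ m * f = 0 := by
  let σ : MvPolynomial (Fin 9) ℂ ⧸ Ideal.span {h} →ₐ[ℂ] Localization.Away v :=
    Ideal.Quotient.liftₐ _ (aeval s) fun z hz => by
      have : Ideal.span {h} ≤ RingHom.ker (aeval (R := ℂ) s) := by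
        rw [Ideal.span_le, Set.singleton_subset_iff]
        exact hs
      exact this hz
  have hσ : ∀ i, σ (Ideal.Quotient.mk _ (X i)) = s i := fun i => aeval_X _ i
  have key : σ.comp (hom τ) = locHom v := by
    refine algHom_ext ?_
    refine Eq.trans ?_ (hcomp σ hσ)
    conv_rhs => rw [← univ_map_hom τ]
    rfl
  have h1 : hom τ f = 0 := by
    rw [mem_nonZeroDivisors_iff_right] at hτ
    refine hτ _ ?_
    have h2 : τ.l 2 = hom τ (univ.l 2) := by
      conv_lhs => rw [← univ_map_hom τ, ETuple.map_l]
      rfl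
    rw [h2, mul_comm, ← map_mul, hf, map_zero]
  have h2 : algebraMap ERing (Localization.Away v) f = 0 := by
    have := DFunLike.congr_fun key f
    rw [AlgHom.comp_apply, h1, map_zero] at this
    exact this.symm
  obtain ⟨⟨_, m, rfl⟩, hm⟩ := (IsLocalization.map_eq_zero_iff (Submonoid.powers v) _ _).1 h2
  exact ⟨m, hm⟩

end ERing

end Example

/-! ### The coordinate `λ₂` on the iterated blowup is a nonzerodivisor -/

namespace Example

open BiProj MvPolynomial Blow

namespace ERing

/-- The relation where `r` is invertible. -/
def hr : MvPolynomial (Fin 9) ℂ :=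
  X 8 * (X 1 * X 2 ^ 2 + X 0 * X 3 ^ 2 +
    (X 4 * X 7 * X 8 - 2 * X 0 - 2 * X 1) * (X 4 * (X 7 * X 6)) ^ 2) +
    X 0 * (X 1 * X 5) * (X 7 * X 5) * X 4 + (X 0 - X 1) * ((X 0 - X 1) * X 6) * (X 7 * X 6) * X 4

/-- The relation where `λ₁` and `b` are invertible. -/
def hlb : MvPolynomial (Fin 9) ℂ :=
  X 6 * (X 0 * X 1 ^ 2 + (X 0 + X 5 * X 8) * X 2 ^ 2 +
    (X 3 * X 5 * X 6 - 2 * (X 0 + X 5 * X 8) - 2 * X 0) * (X 3 * X 4) ^ 2) +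
    (X 0 + X 5 * X 8) * (X 0 * X 7) * (X 5 * X 7) * X 3 +
    (X 0 + X 5 * X 8 - X 0) * (X 4 * X 8) * X 4 * X 3

/-- The relation where `λ₀ - λ₁` and `a` are invertible. -/
def hma : MvPolynomial (Fin 9) ℂ :=
  X 6 * (X 5 * X 7 * X 1 ^ 2 + (X 0 + X 5 * X 7) * X 2 ^ 2 +
    (X 3 * X 5 * X 6 - 2 * (X 0 + X 5 * X 7) - 2 * (X 5 * X 7)) * (X 3 * (X 5 * X 8)) ^ 2) +
    (X 0 + X 5 * X 7) * (X 4 * X 7) * X 4 * X 3 +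
    (X 0 + X 5 * X 7 - X 5 * X 7) * (X 0 * X 8) * (X 5 * X 8) * X 3

theorem mk_self (h : MvPolynomial (Fin 9) ℂ) : Ideal.Quotient.mk (Ideal.span {h}) h = 0 :=
  Ideal.Quotient.eq_zero_iff_mem.2 (Ideal.subset_span rfl)

/-- The generators of the quotient by a relation. -/
abbrev gen (h : MvPolynomial (Fin 9) ℂ) (i : Fin 9) : MvPolynomial (Fin 9) ℂ ⧸ Ideal.span {h} :=
  Ideal.Quotient.mk _ (X i)

theorem exists_pow_mul_eq_zero_r {f : ERing} (hf : univ.l 2 * f = 0) :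
    ∃ m : ℕ, univ.r ^ m * f = 0 := by
  let τ : ETuple (MvPolynomial (Fin 9) ℂ ⧸ Ideal.span {hr}) :=
    { l0 := gen hr 0, l1 := gen hr 1, x0 := gen hr 2, x1 := gen hr 3, t := gen hr 4
      a := gen hr 7 * gen hr 5, b := gen hr 7 * gen hr 6, r := gen hr 7, P := gen hr 8
      c := gen hr 1 * gen hr 5, d := (gen hr 0 - gen hr 1) * gen hr 6
      r1 := by ring
      r2 := by ring
      r3 := by
        have := mk_self hr
        conv_lhs at this => arg 2; rw [hr]
        simpa only [map_add, map_mul, map_sub, map_pow, map_ofNat] using this }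
  let e := univ.map (algebraMap ERing (Localization.Away univ.r))
  obtain ⟨i, hi⟩ := (IsLocalization.Away.algebraMap_isUnit
    (S := Localization.Away univ.r) univ.r).exists_right_inv
  have hi : e.r * i = 1 := hi
  refine exists_pow_mul_eq_zero τ ![e.l0, e.l1, e.x0, e.x1, e.t, e.a * i, e.b * i, e.r, e.P]
    ?_ ?_ ?_ hf
  · simp only [hr, map_add, map_mul, map_sub, map_pow, map_ofNat, aeval_X, Matrix.cons_val]
    have h1 : e.r * (e.a * i) = e.a := by linear_combination e.a * hi
    have h2 : e.r * (e.b * i) = e.b := by linear_combination e.b * hi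
    have h3 : e.l1 * (e.a * i) = e.c := by linear_combination i * e.r1 + e.c * hi
    have h4 : (e.l0 - e.l1) * (e.b * i) = e.d := by linear_combination i * e.r2 + e.d * hi
    rw [h1, h2, h3, h4]
    exact e.r3
  · change gen hr 4 * (gen hr 7 * gen hr 8) ∈ nonZeroDivisors _
    refine Submonoid.mul_mem _ ?_ ?_
    · exact mk_X_mem_nonZeroDivisors ![1, 0, 0, 1, 0, 0, 0, 0, 1] rfl (by simp [hr])
    · refine Submonoid.mul_mem _ ?_ ?_
      · exact mk_X_mem_nonZeroDivisors ![1, 0, 0, 1, 0, 0, 0, 0, 1] rfl (by simp [hr])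
      · exact mk_X_mem_nonZeroDivisors ![1, 1, 0, 0, 1, 1, 0, 1, 0] rfl (by simp [hr])
  · intro σ hσ
    have hσ' : ∀ i, σ (gen hr i) = _ := hσ
    ext <;> change σ _ = _
    all_goals simp only [τ, map_mul, map_sub, hσ', Matrix.cons_val]
    any_goals rfl
    · change e.r * (e.a * i) = e.a
      linear_combination e.a * hi
    · change e.r * (e.b * i) = e.b
      linear_combination e.b * hi
    · change e.l1 * (e.a * i) = e.c
      linear_combination i * e.r1 + e.c * hi
    · change (e.l0 - e.l1) * (e.b * i) = e.d
      linear_combination i * e.r2 + e.d * hi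

theorem exists_pow_mul_eq_zero_lb {f : ERing} (hf : univ.l 2 * f = 0) :
    ∃ m : ℕ, (univ.l1 * univ.b) ^ m * f = 0 := by
  let τ : ETuple (MvPolynomial (Fin 9) ℂ ⧸ Ideal.span {hlb}) :=
    { l0 := gen hlb 0 + gen hlb 5 * gen hlb 8, l1 := gen hlb 0, x0 := gen hlb 1, x1 := gen hlb 2
      t := gen hlb 3, a := gen hlb 5 * gen hlb 7, b := gen hlb 4, r := gen hlb 5, P := gen hlb 6
      c := gen hlb 0 * gen hlb 7, d := gen hlb 4 * gen hlb 8
      r1 := by ring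
      r2 := by ring
      r3 := by
        have := mk_self hlb
        conv_lhs at this => arg 2; rw [hlb]
        simpa only [map_add, map_mul, map_sub, map_pow, map_ofNat] using this }
  let e := univ.map (algebraMap ERing (Localization.Away (univ.l1 * univ.b)))
  obtain ⟨i, hi⟩ := (IsLocalization.Away.algebraMap_isUnit
    (S := Localization.Away (univ.l1 * univ.b)) (univ.l1 * univ.b)).exists_right_inv
  have hi : e.l1 * e.b * i = 1 := by rwa [map_mul] at hi
  have h1 : e.l1 * (e.c * e.b * i) = e.c := by linear_combination e.c * hi
  have h2 : e.b * (e.d * e.l1 * i) = e.d := by linear_combination e.d * hi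
  have h3 : e.r * (e.c * e.b * i) = e.a := by linear_combination -e.b * i * e.r1 + e.a * hi
  have h4 : e.l1 + e.r * (e.d * e.l1 * i) = e.l0 := by
    linear_combination -e.l1 * i * e.r2 + (e.l0 - e.l1) * hi
  refine exists_pow_mul_eq_zero τ
    ![e.l1, e.x0, e.x1, e.t, e.b, e.r, e.P, e.c * e.b * i, e.d * e.l1 * i] ?_ ?_ ?_ hf
  · simp only [hlb, map_add, map_mul, map_sub, map_pow, map_ofNat, aeval_X, Matrix.cons_val]
    rw [h1, h2, h3, h4]
    exact e.r3
  · change gen hlb 3 * (gen hlb 5 * gen hlb 6) ∈ nonZeroDivisors _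
    refine Submonoid.mul_mem _ ?_ ?_
    · exact mk_X_mem_nonZeroDivisors ![1, 1, 0, 0, 0, 0, 1, 0, 0] rfl (by simp [hlb])
    · refine Submonoid.mul_mem _ ?_ ?_
      · exact mk_X_mem_nonZeroDivisors ![1, 1, 0, 0, 0, 0, 1, 0, 0] rfl (by simp [hlb])
      · exact mk_X_mem_nonZeroDivisors ![1, 0, 0, 1, 0, 1, 0, 1, 0] rfl (by simp [hlb])
  · intro σ hσ
    have hσ' : ∀ i, σ (gen hlb i) = _ := hσ
    ext <;> change σ _ = _
    all_goals simp only [τ, map_mul, map_add, hσ', Matrix.cons_val]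
    any_goals rfl
    · exact h4
    · exact h3
    · exact h1
    · exact h2

theorem exists_pow_mul_eq_zero_ma {f : ERing} (hf : univ.l 2 * f = 0) :
    ∃ m : ℕ, ((univ.l0 - univ.l1) * univ.a) ^ m * f = 0 := by
  let τ : ETuple (MvPolynomial (Fin 9) ℂ ⧸ Ideal.span {hma}) :=
    { l0 := gen hma 0 + gen hma 5 * gen hma 7, l1 := gen hma 5 * gen hma 7, x0 := gen hma 1
      x1 := gen hma 2, t := gen hma 3, a := gen hma 4, b := gen hma 5 * gen hma 8
      r := gen hma 5, P := gen hma 6, c := gen hma 4 * gen hma 7, d := gen hma 0 * gen hma 8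
      r1 := by ring
      r2 := by ring
      r3 := by
        have := mk_self hma
        conv_lhs at this => arg 2; rw [hma]
        simpa only [map_add, map_mul, map_sub, map_pow, map_ofNat] using this }
  let e := univ.map (algebraMap ERing (Localization.Away ((univ.l0 - univ.l1) * univ.a)))
  obtain ⟨i, hi⟩ := (IsLocalization.Away.algebraMap_isUnit
    (S := Localization.Away ((univ.l0 - univ.l1) * univ.a))
      ((univ.l0 - univ.l1) * univ.a)).exists_right_inv
  have hi : (e.l0 - e.l1) * e.a * i = 1 := by rwa [map_mul, map_sub] at hi
  let m := e.l0 - e.l1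
  have h1 : e.a * (e.c * m * i) = e.c := by linear_combination e.c * hi
  have h2 : m * (e.d * e.a * i) = e.d := by linear_combination e.d * hi
  have h3 : e.r * (e.c * m * i) = e.l1 := by linear_combination -m * i * e.r1 + e.l1 * hi
  have h4 : e.r * (e.d * e.a * i) = e.b := by linear_combination -e.a * i * e.r2 + e.b * hi
  have h5 : m + e.l1 = e.l0 := by simp [m]
  refine exists_pow_mul_eq_zero τ
    ![m, e.x0, e.x1, e.t, e.a, e.r, e.P, e.c * m * i, e.d * e.a * i] ?_ ?_ ?_ hf
  · simp only [hma, map_add, map_mul, map_sub, map_pow, map_ofNat, aeval_X, Matrix.cons_val]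
    rw [h1, h2, h3, h4, h5]
    exact e.r3
  · change gen hma 3 * (gen hma 5 * gen hma 6) ∈ nonZeroDivisors _
    refine Submonoid.mul_mem _ ?_ ?_
    · exact mk_X_mem_nonZeroDivisors ![1, 0, 1, 0, 0, 0, 1, 0, 0] rfl (by simp [hma])
    · refine Submonoid.mul_mem _ ?_ ?_
      · exact mk_X_mem_nonZeroDivisors ![1, 0, 1, 0, 0, 0, 1, 0, 0] rfl (by simp [hma])
      · exact mk_X_mem_nonZeroDivisors ![1, 0, 0, 1, 1, 0, 0, 1, 0] rfl (by simp [hma])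
  · intro σ hσ
    have hσ' : ∀ i, σ (gen hma i) = _ := hσ
    ext <;> change σ _ = _
    all_goals simp only [τ, map_mul, map_add, hσ', Matrix.cons_val]
    any_goals rfl
    · rw [h3]; exact h5
    · exact h3
    · exact h4
    · exact h1
    · exact h2

theorem ETuple.IsUni.exists_notMem {A : Type} [CommRing A] {e : ETuple A} (h : e.IsUni)
    (y : PrimeSpectrum A) :
    e.r ∉ y.asIdeal ∨ e.l1 * e.b ∉ y.asIdeal ∨ (e.l0 - e.l1) * e.a ∉ y.asIdeal := by
  by_contra! hcon
  obtain ⟨hr, h1, h2⟩ := hcon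
  have hL : e.r * e.P ∈ y.asIdeal := Ideal.mul_mem_right _ _ hr
  have h3 : e.l1 * e.a ∈ y.asIdeal := by rw [e.r1]; exact Ideal.mul_mem_right _ _ hr
  have h4 : (e.l0 - e.l1) * e.b ∈ y.asIdeal := by rw [e.r2]; exact Ideal.mul_mem_right _ _ hr
  have hab : ¬ (e.a ∈ y.asIdeal ∧ e.b ∈ y.asIdeal) := by
    rintro ⟨ha, hb⟩
    obtain ⟨i, hi⟩ := exists_notMem_of_span_eq_top h.toH.hw y
    fin_cases i
    exacts [hi hL, hi ha, hi hb]
  have hlm : ¬ (e.l1 ∈ y.asIdeal ∧ e.l0 - e.l1 ∈ y.asIdeal) := by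
    rintro ⟨ha, hb⟩
    obtain ⟨i, hi⟩ := exists_notMem_of_span_eq_top h.toH.hl y
    fin_cases i
    · refine hi ?_
      have := y.asIdeal.add_mem hb ha
      rwa [sub_add_cancel] at this
    · exact hi ha
    · exact hi (Ideal.mul_mem_left _ _ hL)
  have m1 := y.2.mem_or_mem h1
  have m2 := y.2.mem_or_mem h2
  have m3 := y.2.mem_or_mem h3
  have m4 := y.2.mem_or_mem h4
  tauto

theorem lam_two_mem {u : ERing}
    (hu : ∀ i, Ideal.span (algebraMap ERing (Localization.Away u) '' groups i) = ⊤) :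
    (univ.map (algebraMap ERing (Localization.Away u))).l 2 ∈
      nonZeroDivisors (Localization.Away u) := by
  rw [mem_nonZeroDivisors_iff_right, ETuple.map_l, Function.comp_apply]
  intro z hz
  obtain ⟨f, ⟨_, n, rfl⟩, rfl⟩ := IsLocalization.exists_mk'_eq (Submonoid.powers u) z
  have hz' : algebraMap ERing (Localization.Away u) (univ.l 2 * f) = 0 := by
    have := congrArg (· * algebraMap ERing (Localization.Away u) (u ^ n)) hz
    simp only [zero_mul] at this
    rw [map_mul, ← this, mul_right_comm,
      IsLocalization.mk'_spec (Localization.Away u) f (⟨u ^ n, n, rfl⟩ : Submonoid.powers u),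
      mul_comm]
  obtain ⟨⟨_, k, rfl⟩, hk⟩ := (IsLocalization.map_eq_zero_iff (Submonoid.powers u) _ _).1 hz'
  have hk : univ.l 2 * (u ^ k * f) = 0 := by
    rw [← hk]
    ring
  suffices h : algebraMap ERing (Localization.Away u) f = 0 by
    rw [IsLocalization.mk'_eq_mul_mk'_one, h, zero_mul]
  have hloc : ∀ {v : ERing} {m : ℕ}, v ^ m * (u ^ k * f) = 0 →
      algebraMap ERing (Localization.Away u) v ^ m * algebraMap ERing (Localization.Away u) f = 0 := by
    intro v m h
    have := congrArg (algebraMap ERing (Localization.Away u)) h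
    rw [map_zero, map_mul, map_mul, map_pow, map_pow, mul_left_comm] at this
    exact (((IsLocalization.Away.algebraMap_isUnit (S := Localization.Away u) u).pow k).mul_right_eq_zero).1
      this
  refine eq_zero_of_locally fun y => ?_
  have hin : ∀ {v : Localization.Away u} {m : ℕ},
      v ^ m * algebraMap ERing (Localization.Away u) f = 0 → v ∉ y.asIdeal → ∃ a, a ∉ y.asIdeal ∧
      algebraMap (Localization.Away u) (Localization.Away a)
        (algebraMap ERing (Localization.Away u) f) = 0 := by
    intro v m h hv
    refine ⟨v, hv, ?_⟩
    have := congrArg (algebraMap (Localization.Away u) (Localization.Away v)) h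
    rw [map_zero, map_mul, map_pow] at this
    exact (((IsLocalization.Away.algebraMap_isUnit (S := Localization.Away v) v).pow m).mul_right_eq_zero).1
      this
  obtain ⟨m1, hm1⟩ := exists_pow_mul_eq_zero_r hk
  obtain ⟨m2, hm2⟩ := exists_pow_mul_eq_zero_lb hk
  obtain ⟨m3, hm3⟩ := exists_pow_mul_eq_zero_ma hk
  have h1 := hloc hm1
  have h2 := hloc hm2
  have h3 := hloc hm3
  rw [map_mul] at h2
  rw [map_mul, map_sub] at h3
  rcases ETuple.IsUni.exists_notMem ((forall_span_iff _).1 hu) y with h | h | h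
  · exact hin h1 h
  · exact hin h2 h
  · exact hin h3 h

end ERing

end Example

/-! ### Charts of the iterated blowup -/

namespace Blow

open Scheme

theorem IsBlowup.isEffectiveCartier_comap {X B : Scheme.{u}} {b : B ⟶ X} {I J : X.IdealSheafData}
    (hb : IsBlowup b I) (hJ : IsEffectiveCartier J) (hd : ∀ x, x ∈ I.support → x ∉ J.support) :
    IsEffectiveCartier (J.comap b) := by
  refine isEffectiveCartier_of_cover fun x => ?_
  by_cases hx : b x ∈ I.support
  · let U : X.Opens := J.support.compl
    refine ⟨_, (b ⁻¹ᵁ U).ι, inferInstance, ?_, ?_⟩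
    · rw [Scheme.Opens.range_ι]
      exact hd _ hx
    · have : (J.comap b).comap (b ⁻¹ᵁ U).ι = ⊤ := by
        rw [← IdealSheafData.support_eq_bot_iff]
        ext z
        rw [IdealSheafData.support_comap, IdealSheafData.support_comap]
        exact ⟨fun h => z.2 h, fun h => h.elim⟩
      rw [this]
      exact isEffectiveCartier_top
  · let U : X.Opens := I.support.compl
    have : IsIso (b ∣_ U) := hb.isIso_restrict fun x hx => hx
    refine ⟨_, (b ⁻¹ᵁ U).ι, inferInstance, ?_, ?_⟩
    · rw [Scheme.Opens.range_ι]
      exact hx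
    · rw [← IdealSheafData.comap_comp, ← morphismRestrict_ι, IdealSheafData.comap_comp]
      exact (hJ.comap_of_isOpenImmersion U.ι).comap_of_isOpenImmersion (b ∣_ U)

end Blow

namespace Example

open BiProj MvPolynomial Blow Scheme.IdealSheafData

namespace HTuple

variable {A B : Type} [CommRing A] [CommRing B]

/-- Generators of the product of the ideals of the second and third centres. -/
def gens (e : HTuple A) : Fin 3 → A := ![e.L, e.l1 * e.a, (e.l0 - e.l1) * e.b]

theorem gens_map (e : HTuple A) (φ : A →+* B) : gens (e.map φ) = φ ∘ gens e := by
  ext i; fin_cases i <;> simp [gens, map]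

theorem span_gens_le₂ (e : HTuple A) :
    Ideal.span (Set.range e.gens) ≤ Ideal.span (Set.range e.gens₂) := by
  have hm : ∀ i, e.gens₂ i ∈ Ideal.span (Set.range e.gens₂) := fun i => Ideal.subset_span ⟨i, rfl⟩
  rw [Ideal.span_le]
  rintro _ ⟨i, rfl⟩
  fin_cases i
  exacts [hm 0, Ideal.mul_mem_right _ _ (hm 1), Ideal.mul_mem_left _ _ (hm 2)]

theorem span_gens_le₃ (e : HTuple A) :
    Ideal.span (Set.range e.gens) ≤ Ideal.span (Set.range e.gens₃) := by
  have hm : ∀ i, e.gens₃ i ∈ Ideal.span (Set.range e.gens₃) := fun i => Ideal.subset_span ⟨i, rfl⟩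
  rw [Ideal.span_le]
  rintro _ ⟨i, rfl⟩
  fin_cases i
  exacts [hm 0, Ideal.mul_mem_left _ _ (hm 1), Ideal.mul_mem_right _ _ (hm 2)]

theorem span_gens₂_eq_top {e : HTuple A} (h : IsUnit (e.l1 * e.b)) :
    Ideal.span (Set.range e.gens₂) = ⊤ :=
  Ideal.eq_top_of_isUnit_mem _ (Ideal.mul_mem_right _ _ (Ideal.subset_span ⟨1, rfl⟩)) h

theorem span_gens₃_eq_top {e : HTuple A} (h : IsUnit ((e.l0 - e.l1) * e.a)) :
    Ideal.span (Set.range e.gens₃) = ⊤ :=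
  Ideal.eq_top_of_isUnit_mem _ (Ideal.mul_mem_left _ _ (Ideal.subset_span ⟨1, rfl⟩)) h

theorem span_gens_eq₃ {e : HTuple A} (h : IsUnit (e.l1 * e.b)) :
    Ideal.span (Set.range e.gens) = Ideal.span (Set.range e.gens₃) := by
  have hm : ∀ i, e.gens i ∈ Ideal.span (Set.range e.gens) := fun i => Ideal.subset_span ⟨i, rfl⟩
  refine le_antisymm e.span_gens_le₃ (Ideal.span_le.2 ?_)
  rintro _ ⟨i, rfl⟩
  fin_cases i
  · exact hm 0
  · exact (Ideal.unit_mul_mem_iff_mem _ (isUnit_of_mul_isUnit_left h)).1 (hm 1)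
  · exact (Ideal.mul_unit_mem_iff_mem _ (isUnit_of_mul_isUnit_right h)).1 (hm 2)

theorem span_gens_eq₂ {e : HTuple A} (h : IsUnit ((e.l0 - e.l1) * e.a)) :
    Ideal.span (Set.range e.gens) = Ideal.span (Set.range e.gens₂) := by
  have hm : ∀ i, e.gens i ∈ Ideal.span (Set.range e.gens) := fun i => Ideal.subset_span ⟨i, rfl⟩
  refine le_antisymm e.span_gens_le₂ (Ideal.span_le.2 ?_)
  rintro _ ⟨i, rfl⟩
  fin_cases i
  · exact hm 0
  · exact (Ideal.mul_unit_mem_iff_mem _ (isUnit_of_mul_isUnit_right h)).1 (hm 1)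
  · exact (Ideal.unit_mul_mem_iff_mem _ (isUnit_of_mul_isUnit_left h)).1 (hm 2)

/-- Locally one of the two centres is empty. -/
theorem IsUni.exists_away {e : HTuple A} (h : e.IsUni) (y : PrimeSpectrum A) :
    ∃ a, a ∉ y.asIdeal ∧ ∀ {B : Type} [CommRing B] (φ : A →+* B), IsUnit (φ a) →
      (Ideal.span (Set.range (e.map φ).gens) = Ideal.span (Set.range (e.map φ).gens₃) ∧
        Ideal.span (Set.range (e.map φ).gens₂) = ⊤) ∨
      (Ideal.span (Set.range (e.map φ).gens) = Ideal.span (Set.range (e.map φ).gens₂) ∧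
        Ideal.span (Set.range (e.map φ).gens₃) = ⊤) := by
  by_cases h1 : e.l1 * e.b ∈ y.asIdeal
  swap
  · refine ⟨_, h1, fun {B} _ φ hφ => Or.inl ?_⟩
    have hφ : IsUnit ((e.map φ).l1 * (e.map φ).b) := by rwa [map_mul] at hφ
    exact ⟨span_gens_eq₃ hφ, span_gens₂_eq_top hφ⟩
  by_cases h2 : (e.l0 - e.l1) * e.a ∈ y.asIdeal
  swap
  · refine ⟨_, h2, fun {B} _ φ hφ => Or.inr ?_⟩
    have hφ : IsUnit (((e.map φ).l0 - (e.map φ).l1) * (e.map φ).a) := by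
      rwa [map_mul, map_sub] at hφ
    exact ⟨span_gens_eq₂ hφ, span_gens₃_eq_top hφ⟩
  obtain ⟨i, hi⟩ : ∃ i, e.gens i ∉ y.asIdeal := by
    by_contra! hcon
    have hab : ¬ (e.a ∈ y.asIdeal ∧ e.b ∈ y.asIdeal) := by
      rintro ⟨ha, hb⟩
      obtain ⟨i, hi⟩ := exists_notMem_of_span_eq_top h.hw y
      fin_cases i
      exacts [hi (hcon 0), hi ha, hi hb]
    have hlm : ¬ (e.l1 ∈ y.asIdeal ∧ e.l0 - e.l1 ∈ y.asIdeal) := by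
      rintro ⟨ha, hb⟩
      obtain ⟨i, hi⟩ := exists_notMem_of_span_eq_top h.hl y
      fin_cases i
      · refine hi ?_
        have := y.asIdeal.add_mem hb ha
        rwa [sub_add_cancel] at this
      · exact hi ha
      · exact hi (Ideal.mul_mem_left _ _ (hcon 0))
    have m1 := y.2.mem_or_mem h1
    have m2 := y.2.mem_or_mem h2
    have m3 := y.2.mem_or_mem (hcon 1)
    have m4 := y.2.mem_or_mem (hcon 2)
    tauto
  refine ⟨_, hi, fun {B} _ φ hφ => Or.inl ?_⟩
  have htop : Ideal.span (Set.range (e.map φ).gens) = ⊤ := by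
    refine Ideal.eq_top_of_isUnit_mem _ (Ideal.subset_span ⟨i, ?_⟩) hφ
    rw [gens_map]; rfl
  have e2 := (e.map φ).span_gens_le₂
  have e3 := (e.map φ).span_gens_le₃
  rw [htop, top_le_iff] at e2 e3
  exact ⟨htop.trans e3.symm, e2⟩

end HTuple

theorem ETuple.IsUni.span_gens {A : Type} [CommRing A] {e : ETuple A} (h : e.IsUni) :
    Ideal.span (Set.range e.toH.gens) = Ideal.span {e.r} := by
  have hg : ∀ i, e.toH.gens i = e.r * e.z i := by
    intro i
    fin_cases i
    exacts [rfl, e.r1, e.r2]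
  refine le_antisymm (Ideal.span_le.2 ?_) ?_
  · rintro _ ⟨i, rfl⟩
    exact Ideal.mem_span_singleton.2 ⟨_, hg i⟩
  · have h1 : (1 : A) ∈ Ideal.span (Set.range e.z) := h.hz.ge trivial
    obtain ⟨α, hα⟩ := Ideal.mem_span_range_iff_exists_fun.1 h1
    rw [Ideal.span_le, Set.singleton_subset_iff, SetLike.mem_coe, ← mul_one e.r, ← hα,
      Finset.mul_sum]
    refine Ideal.sum_mem _ fun j _ => ?_
    rw [mul_left_comm, ← hg]
    exact Ideal.mul_mem_left _ _ (Ideal.subset_span ⟨j, rfl⟩)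

namespace ERing

theorem ofH_image_groups (i : Fin 3) : ∃ j, groups j ⊆ ofH.toRingHom '' HRing.groups i := by
  have h : univ.toH = HRing.univ.map ofH.toRingHom := (univ_map_ofH (RingHom.id ERing)).symm
  fin_cases i
  · refine ⟨0, ?_⟩
    change Set.range univ.toH.l ⊆ _ '' Set.range HRing.univ.l
    rw [h, HTuple.map_l, Set.range_comp]
  · refine ⟨1, ?_⟩
    change Set.range univ.toH.x ⊆ _ '' Set.range HRing.univ.x
    rw [h, HTuple.map_x, Set.range_comp]
  · refine ⟨2, ?_⟩
    change Set.range univ.toH.w ⊆ _ '' Set.range HRing.univ.w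
    rw [h, HTuple.map_w, Set.range_comp]

theorem range_subset_U :
    Set.range (U.ι ≫ Spec.map (CommRingCat.ofHom ofH.toRingHom)) ⊆ Set.range HRing.U.ι := by
  rintro _ ⟨y, rfl⟩
  rw [Scheme.Opens.range_ι]
  intro i
  obtain ⟨j, hj⟩ := ofH_image_groups i
  obtain ⟨g, hg, hgy⟩ := y.2 j
  obtain ⟨g', hg', rfl⟩ := hj hg
  exact ⟨g', hg', hgy⟩

/-- The projection to the coordinates of the first blowup. -/
def toHU : U.toScheme ⟶ HRing.U.toScheme :=
  IsOpenImmersion.lift HRing.U.ι (U.ι ≫ Spec.map (CommRingCat.ofHom ofH.toRingHom)) range_subset_U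

theorem toHU_ι : toHU ≫ HRing.U.ι = U.ι ≫ Spec.map (CommRingCat.ofHom ofH.toRingHom) :=
  IsOpenImmersion.lift_fac _ _ _

theorem span_ofH {A : Type} [CommRing A] {f : ERing →+* A}
    (hf : ∀ i, Ideal.span (f '' groups i) = ⊤) :
    ∀ i, Ideal.span (f.comp ofH.toRingHom '' HRing.groups i) = ⊤ := by
  rw [HRing.forall_span_iff, univ_map_ofH]
  exact ((forall_span_iff f).1 hf).toH

theorem pt_toHU {A : Type} [CommRing A] (f : ERing →+* A)
    (hf : ∀ i, Ideal.span (f '' groups i) = ⊤) :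
    Uni.pt f hf ≫ toHU = Uni.pt (f.comp ofH.toRingHom) (span_ofH hf) := by
  rw [← cancel_mono HRing.U.ι, Category.assoc, Uni.pt_ι, toHU_ι,
    ← Category.assoc, Uni.pt_ι, ← Spec.map_comp, ← CommRingCat.ofHom_comp]

theorem r_mem {u : ERing}
    (hu : ∀ i, Ideal.span (algebraMap ERing (Localization.Away u) '' groups i) = ⊤) :
    (univ.map (algebraMap ERing (Localization.Away u))).r ∈
      nonZeroDivisors (Localization.Away u) := by
  refine mem_nonZeroDivisors_of_dvd (lam_two_mem hu) ?_
  set e := univ.map (algebraMap ERing (Localization.Away u))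
  exact ⟨e.t * e.P, by change e.t * (e.r * e.P) = _; ring⟩

end ERing


section Sections

variable {Y' Y'' Yt : Scheme.{0}} {b₁ : Y' ⟶ Y} {b₂ : Y'' ⟶ Y'} {b₃ : Yt ⟶ Y''}
  (h₁ : IsBlowupAlong b₁ Y₁) {q₁ : HRing.U.toScheme ⟶ Y'} (hq₁ : q₁ ≫ b₁ = HRing.toY)
  (h₂ : IsBlowupAlong b₂ (properTransform b₁ Y₁ Y₂))
  (h₃ : IsBlowup b₃ ((vanishingIdeal (properTransform b₁ Y₁ Y₃)).comap b₂))

include h₁ hq₁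

theorem pullIdeal_toHU₂ {A : Type} [CommRing A] (f : ERing →+* A)
    (hf : ∀ i, Ideal.span (f '' ERing.groups i) = ⊤) :
    pullIdeal (vanishingIdeal (properTransform b₁ Y₁ Y₂)) (Uni.pt f hf ≫ ERing.toHU ≫ q₁) =
      Ideal.span (Set.range (ERing.univ.map f).toH.gens₂) := by
  rw [← Category.assoc, ERing.pt_toHU, pullIdeal_Y₂' h₁ hq₁, ERing.univ_map_ofH]

theorem pullIdeal_toHU₃ {A : Type} [CommRing A] (f : ERing →+* A)
    (hf : ∀ i, Ideal.span (f '' ERing.groups i) = ⊤) :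
    pullIdeal (vanishingIdeal (properTransform b₁ Y₁ Y₃)) (Uni.pt f hf ≫ ERing.toHU ≫ q₁) =
      Ideal.span (Set.range (ERing.univ.map f).toH.gens₃) := by
  rw [← Category.assoc, ERing.pt_toHU, pullIdeal_Y₃' h₁ hq₁, ERing.univ_map_ofH]

theorem isEffectiveCartier_toHU :
    IsEffectiveCartier ((vanishingIdeal (properTransform b₁ Y₁ Y₂)).comap (ERing.toHU ≫ q₁)) ∧
    IsEffectiveCartier ((vanishingIdeal (properTransform b₁ Y₁ Y₃)).comap (ERing.toHU ≫ q₁)) := by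
  have key : ∀ y : ERing.U.toScheme, ∃ (u : ERing)
      (hu : ∀ i, Ideal.span (algebraMap ERing (Localization.Away u) '' ERing.groups i) = ⊤),
      IsOpenImmersion (Uni.pt _ hu) ∧ y ∈ Set.range (Uni.pt _ hu) ∧
      IsEffectiveCartier ((vanishingIdeal (properTransform b₁ Y₁ Y₂)).comap
        (Uni.pt _ hu ≫ ERing.toHU ≫ q₁)) ∧
      IsEffectiveCartier ((vanishingIdeal (properTransform b₁ Y₁ Y₃)).comap
        (Uni.pt _ hu ≫ ERing.toHU ≫ q₁)) := by
    intro y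
    obtain ⟨g, -, hu, ho, hy⟩ := Uni.exists_chart y
    refine ⟨_, hu, ho, hy, ?_⟩
    have hE := (ERing.forall_span_iff _).1 hu
    have hr := ERing.r_mem hu
    have hloc : ∀ y : PrimeSpectrum (Localization.Away (∏ i, g i)), ∃ a, a ∉ y.asIdeal ∧
        (∃ f ∈ nonZeroDivisors (Localization.Away a), (Ideal.span (Set.range
          (ERing.univ.map (algebraMap ERing (Localization.Away (∏ i, g i)))).toH.gens₂)).map
            (algebraMap _ (Localization.Away a)) = Ideal.span {f}) ∧
        ∃ f ∈ nonZeroDivisors (Localization.Away a), (Ideal.span (Set.range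
          (ERing.univ.map (algebraMap ERing (Localization.Away (∏ i, g i)))).toH.gens₃)).map
            (algebraMap _ (Localization.Away a)) = Ideal.span {f} := by
      intro y
      obtain ⟨a, ha, h⟩ := hE.toH.exists_away y
      refine ⟨a, ha, ?_⟩
      have h := h (algebraMap _ (Localization.Away a)) (IsLocalization.Away.algebraMap_isUnit a)
      have hs := congrArg (Ideal.map (algebraMap _ (Localization.Away a))) hE.span_gens
      simp only [Ideal.map_span, ← Set.range_comp, Set.image_singleton, ← HTuple.gens_map,
        ← HTuple.gens₂_map, ← HTuple.gens₃_map] at hs ⊢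
      have hr' := map_mem_nonZeroDivisors_away hr a
      rw [hs] at h
      rcases h with ⟨h3, h2⟩ | ⟨h2, h3⟩
      · exact ⟨⟨1, one_mem _, h2.trans (by simp)⟩, _, hr', h3.symm⟩
      · exact ⟨⟨_, hr', h2.symm⟩, 1, one_mem _, h3.trans (by simp)⟩
    constructor
    · refine isEffectiveCartier_comap_of_locally _ fun y => ?_
      rw [pullIdeal_toHU₂ h₁ hq₁]
      obtain ⟨a, ha, h2, h3⟩ := hloc y
      exact ⟨a, ha, h2⟩
    · refine isEffectiveCartier_comap_of_locally _ fun y => ?_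
      rw [pullIdeal_toHU₃ h₁ hq₁]
      obtain ⟨a, ha, h2, h3⟩ := hloc y
      exact ⟨a, ha, h3⟩
  constructor
  · refine isEffectiveCartier_of_cover fun y => ?_
    obtain ⟨u, hu, ho, hy, h2, h3⟩ := key y
    exact ⟨_, Uni.pt _ hu, ho, hy, by rwa [← comap_comp]⟩
  · refine isEffectiveCartier_of_cover fun y => ?_
    obtain ⟨u, hu, ho, hy, h2, h3⟩ := key y
    exact ⟨_, Uni.pt _ hu, ho, hy, by rwa [← comap_comp]⟩

include h₂ h₃

theorem exists_param : ∃ q : ERing.U.toScheme ⟶ Yt, q ≫ b₃ ≫ b₂ = ERing.toHU ≫ q₁ := by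
  obtain ⟨c2, c3⟩ := isEffectiveCartier_toHU h₁ hq₁
  obtain ⟨u, hu⟩ := (h₂.universal _ _ c2).exists
  rw [← hu, comap_comp] at c3
  obtain ⟨q, hq⟩ := (h₃.universal _ _ c3).exists
  exact ⟨q, by rw [reassoc_of% hq, hu]⟩

theorem isEffectiveCartier_comap₂ : IsEffectiveCartier
    ((vanishingIdeal (properTransform b₁ Y₁ Y₂)).comap (b₃ ≫ b₂)) := by
  rw [comap_comp]
  refine h₃.isEffectiveCartier_comap h₂.cartier fun x hx hx' => ?_
  rw [support_comap] at hx hx'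
  exact disjoint_Y₂'_Y₃' h₁ hq₁ _ hx' hx

/-- The points of the iterated blowup have neighbourhoods with coordinates. -/
theorem exists_section {q : ERing.U.toScheme ⟶ Yt} (hq : q ≫ b₃ ≫ b₂ = ERing.toHU ≫ q₁) (y : Yt) :
    ∃ (B : Type) (_ : CommRing B) (k : Spec (CommRingCat.of B) ⟶ Yt) (_ : IsOpenImmersion k),
    y ∈ Set.range k ∧ ∃ f hf, Uni.pt (V := ERing.groups) f hf ≫ q = k := by
  have hc3 : IsEffectiveCartier
      ((vanishingIdeal (properTransform b₁ Y₁ Y₃)).comap (b₃ ≫ b₂)) := by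
    rw [comap_comp]
    exact h₃.cartier
  have hc2 := isEffectiveCartier_comap₂ h₁ hq₁ h₂ h₃
  obtain ⟨B₀, _, k₀, hk₀, hy₀, f₀, hf₀, hfac₀, -⟩ := exists_section₁ h₁ hq₁ ((b₃ ≫ b₂) y)
  obtain ⟨B₁, _, k₁, hk₁, ⟨z, rfl⟩, hsub⟩ := Charts.exists_chart
    (U := (b₃ ≫ b₂) ⁻¹ᵁ k₀.opensRange) (t := y) hy₀
  have hr : Set.range (k₁ ≫ b₃ ≫ b₂) ⊆ Set.range k₀ := by
    rintro _ ⟨z, rfl⟩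
    exact hsub ⟨z, rfl⟩
  obtain ⟨φ, hφ⟩ := Charts.exists_specMap (IsOpenImmersion.lift k₀ (k₁ ≫ b₃ ≫ b₂) hr)
  have hfac : k₁ ≫ b₃ ≫ b₂ = Spec.map (CommRingCat.ofHom φ) ≫ k₀ := by
    rw [← hφ, IsOpenImmersion.lift_fac]
  have hu₀ := (HRing.forall_span_iff (φ.comp f₀)).1 (Uni.span_image_comp hf₀ φ)
  obtain ⟨a, ha, hloc⟩ := hu₀.exists_away z
  have hloc := hloc (algebraMap _ (Localization.Away a)) (IsLocalization.Away.algebraMap_isUnit a)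
  -- a chart where the product of the two ideals is generated by a nonzerodivisor
  have key : ∃ (B : Type) (_ : CommRing B) (k : Spec (CommRingCat.of B) ⟶ Yt)
      (_ : IsOpenImmersion k), k₁ z ∈ Set.range k ∧ ∃ (f : HRing →+* B)
      (hf : ∀ i, Ideal.span (f '' HRing.groups i) = ⊤), Uni.pt f hf ≫ q₁ = k ≫ b₃ ≫ b₂ ∧
      ∃ r ∈ nonZeroDivisors B, Ideal.span (Set.range (HRing.univ.map f).gens) = Ideal.span {r} := by
    have aux : ∀ (I : Y'.IdealSheafData) (g : ∀ {A : Type} [CommRing A], HTuple A → Fin 3 → A),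
        (∀ {A B : Type} [CommRing A] [CommRing B] (e : HTuple A) (φ : A →+* B),
          g (e.map φ) = φ ∘ g e) → IsEffectiveCartier (I.comap (b₃ ≫ b₂)) →
        (∀ (A : Type) [CommRing A] (f : HRing →+* A)
          (hf : ∀ i, Ideal.span (f '' HRing.groups i) = ⊤), pullIdeal I (Uni.pt f hf ≫ q₁) =
            Ideal.span (Set.range (g (HRing.univ.map f)))) →
        Ideal.span (Set.range ((HRing.univ.map (φ.comp f₀)).map
          (algebraMap _ (Localization.Away a))).gens) = Ideal.span (Set.range
          (g ((HRing.univ.map (φ.comp f₀)).map (algebraMap _ (Localization.Away a))))) →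
        ∃ (B : Type) (_ : CommRing B) (k : Spec (CommRingCat.of B) ⟶ Yt)
        (_ : IsOpenImmersion k), k₁ z ∈ Set.range k ∧ ∃ (f : HRing →+* B)
        (hf : ∀ i, Ideal.span (f '' HRing.groups i) = ⊤), Uni.pt f hf ≫ q₁ = k ≫ b₃ ≫ b₂ ∧
        ∃ r ∈ nonZeroDivisors B,
          Ideal.span (Set.range (HRing.univ.map f).gens) = Ideal.span {r} := by
      intro I g hg hI hpull heq
      obtain ⟨z', hz'⟩ := (Charts.range_specMap_away a).ge ha
      obtain ⟨B, _, k', hk', hy', r, hr, hIr⟩ := hI.exists_chart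
        (Spec.map (CommRingCat.ofHom (algebraMap B₁ (Localization.Away a))) ≫ k₁) z'
      obtain ⟨χ, rfl⟩ := Charts.exists_specMap k'
      have hf := Uni.span_image_comp (Uni.span_image_comp (Uni.span_image_comp hf₀ φ)
        (algebraMap _ (Localization.Away a))) χ
      have hpt : Uni.pt _ hf ≫ q₁ = (Spec.map (CommRingCat.ofHom χ) ≫
          Spec.map (CommRingCat.ofHom (algebraMap B₁ (Localization.Away a))) ≫ k₁) ≫ b₃ ≫ b₂ := by
        rw [← Uni.specMap_pt _ (Uni.span_image_comp (Uni.span_image_comp hf₀ φ) _) χ,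
          ← Uni.specMap_pt _ (Uni.span_image_comp hf₀ φ), ← Uni.specMap_pt _ hf₀]
        simp only [Category.assoc]
        rw [hfac₀, ← hfac]
      refine ⟨B, inferInstance, Spec.map (CommRingCat.ofHom χ) ≫
        Spec.map (CommRingCat.ofHom (algebraMap B₁ (Localization.Away a))) ≫ k₁, inferInstance,
        ?_, _, hf, hpt, r, hr, ?_⟩
      · obtain ⟨w, hw⟩ := hy'
        refine ⟨w, ?_⟩
        rw [Scheme.Hom.comp_apply, hw, Scheme.Hom.comp_apply, hz']
      · rw [← hIr, pullIdeal_comap, ← hpt, hpull]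
        have := congrArg (Ideal.map χ) heq
        simp only [Ideal.map_span, ← Set.range_comp, ← HTuple.gens_map, ← hg] at this
        exact this
    rcases hloc with h | h
    · exact aux _ HTuple.gens₃ HTuple.gens₃_map hc3 (fun A _ f hf => pullIdeal_Y₃' h₁ hq₁ f hf) h.1
    · exact aux _ HTuple.gens₂ HTuple.gens₂_map hc2 (fun A _ f hf => pullIdeal_Y₂' h₁ hq₁ f hf) h.1
  obtain ⟨B, _, k, hk, hy, f, hf, hpt, r, hr, hrI⟩ := key
  refine ⟨B, inferInstance, k, hk, hy, ?_⟩
  have hu := (HRing.forall_span_iff f).1 hf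
  have hdvd : ∀ i, r ∣ (HRing.univ.map f).gens i := fun i => by
    rw [← Ideal.mem_span_singleton, ← hrI]
    exact Ideal.subset_span ⟨i, rfl⟩
  have hpI2 := pullIdeal_Y₂' h₁ hq₁ f hf
  have hpI3 := pullIdeal_Y₃' h₁ hq₁ f hf
  set h := HRing.univ.map f with hh
  choose z hz using hdvd
  have hcancel : ∀ z z', r * z = r * z' → z = z' := fun z z' h => by
    rw [mem_nonZeroDivisors_iff_right] at hr
    rw [← sub_eq_zero]
    exact hr _ (by linear_combination h)
  have z0 : h.L = r * z 0 := hz 0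
  have z1 : h.l1 * h.a = r * z 1 := hz 1
  have z2 : (h.l0 - h.l1) * h.b = r * z 2 := hz 2
  let e : ETuple B :=
    { l0 := h.l0, l1 := h.l1, x0 := h.x0, x1 := h.x1, t := h.t, a := h.a, b := h.b
      r := r, P := z 0, c := z 1, d := z 2
      r1 := z1
      r2 := z2
      r3 := by
        refine hcancel _ _ ?_
        have := h.rel
        rw [z0] at this
        linear_combination this - h.t * h.l0 * h.a * z1 - h.t * (h.l0 - h.l1) * h.b * z2 }
  have heH : e.toH = h := by
    ext
    any_goals rfl
    exact z0.symm
  have heu : e.IsUni := by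
    refine ⟨heH ▸ hu, ?_⟩
    have : r ∈ Ideal.span (Set.range h.gens) := hrI ▸ Ideal.mem_span_singleton_self r
    obtain ⟨α, hα⟩ := Ideal.mem_span_range_iff_exists_fun.1 this
    rw [Ideal.eq_top_iff_one]
    have h1 : ∑ i, α i * z i = 1 := by
      refine hcancel _ _ ?_
      rw [mul_one, Finset.mul_sum]
      conv_rhs => rw [← hα]
      refine Finset.sum_congr rfl fun i _ => ?_
      rw [hz i]; ring
    rw [← h1]
    refine Ideal.sum_mem _ fun i _ => Ideal.mul_mem_left _ _ (Ideal.subset_span ⟨i, ?_⟩)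
    fin_cases i <;> rfl
  let : Algebra ℂ B := (f.comp (algebraMap ℂ HRing)).toAlgebra
  have hef := ERing.univ_map_hom e
  have hE := (ERing.forall_span_iff (ERing.hom e).toRingHom).2 (hef.symm ▸ heu)
  refine ⟨(ERing.hom e).toRingHom, hE, ?_⟩
  have hcomp : (ERing.hom e).toRingHom.comp ERing.ofH.toRingHom = f := by
    let f' : HRing →ₐ[ℂ] B := { f with commutes' := fun _ => rfl }
    have : (ERing.hom e).comp ERing.ofH = f' := by
      have h1 : HRing.univ.map ((ERing.hom e).toRingHom.comp ERing.ofH.toRingHom) =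
          HRing.univ.map f := by
        rw [ERing.univ_map_ofH, hef, heH]
      rw [HTuple.ext_iff] at h1
      obtain ⟨h0, h1, h2, h3, h4, h5, h6, h7⟩ := h1
      refine HRing.algHom_ext fun i => ?_
      fin_cases i
      exacts [h0, h1, h2, h3, h4, h5, h6, h7]
    exact congrArg AlgHom.toRingHom this
  have hpt' : (Uni.pt _ hE ≫ q) ≫ b₃ ≫ b₂ = k ≫ b₃ ≫ b₂ := by
    rw [Category.assoc, hq, ← Category.assoc, ERing.pt_toHU, ← hpt]
    congr 2
  have hr2 : r ∈ pullIdeal (vanishingIdeal (properTransform b₁ Y₁ Y₂)) (Uni.pt f hf ≫ q₁) := by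
    rw [hpI2]
    exact h.span_gens_le₂ (hrI ▸ Ideal.mem_span_singleton_self r)
  have hr3 : r ∈ pullIdeal (vanishingIdeal (properTransform b₁ Y₁ Y₃)) (Uni.pt f hf ≫ q₁) := by
    rw [hpI3]
    exact h.span_gens_le₃ (hrI ▸ Ideal.mem_span_singleton_self r)
  rw [hpt, ← hpt', ← Category.assoc] at hr2
  rw [hpt, ← hpt', ← Category.assoc] at hr3
  refine h₃.hom_ext (IsBlowup.hom_ext h₂ ?_ hr hr2) hr (by rwa [pullIdeal_comap])
  rw [Category.assoc, hpt', Category.assoc]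

omit h₁ hq₁ h₂ h₃ in
theorem isPt_param (hq₁ : q₁ ≫ b₁ = HRing.toY) {q : ERing.U.toScheme ⟶ Yt}
    (hq : q ≫ b₃ ≫ b₂ = ERing.toHU ≫ q₁) {A : Type} [CommRing A] (f : ERing →+* A)
    (hf : ∀ i, Ideal.span (f '' ERing.groups i) = ⊤) :
    IsPt ((Uni.pt f hf ≫ q) ≫ (b₃ ≫ b₂ ≫ b₁) ≫ incl eqY) (ERing.univ.map f).l
      (ERing.univ.map f).x := by
  have h := isPt_comp hq₁ A _ (ERing.span_ofH hf)
  rw [ERing.univ_map_ofH, ← ERing.pt_toHU f hf, Category.assoc (Uni.pt f hf), ← hq] at h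
  simp only [Category.assoc] at h ⊢
  exact h

end Sections

section Param

variable {Yt : Scheme.{0}} {ψ : Yt ⟶ Y} {q : ERing.U.toScheme ⟶ Yt}
  (hψ : ∀ {A : Type} [CommRing A] (f : ERing →+* A)
    (hf : ∀ i, Ideal.span (f '' ERing.groups i) = ⊤),
    IsPt ((Uni.pt f hf ≫ q) ≫ ψ ≫ incl eqY) (ERing.univ.map f).l (ERing.univ.map f).x)

include hψ

/-- The coordinate `λ₂` is a nonzerodivisor on each chart of the iterated blowup. -/
theorem lam_two_mem_of_section {B : Type} [CommRing B] {f : ERing →+* B}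
    (hf : ∀ i, Ideal.span (f '' ERing.groups i) = ⊤) [IsOpenImmersion (Uni.pt f hf ≫ q)] :
    (ERing.univ.map f).l 2 ∈ nonZeroDivisors B := by
  rw [mem_nonZeroDivisors_iff_right]
  intro g hg
  refine eq_zero_of_locally fun z => ?_
  obtain ⟨v, -, hu, ho, w, hw⟩ := Uni.exists_chart (Uni.pt f hf z)
  set k := Uni.pt f hf ≫ q with hk
  have hwk : (Uni.pt _ hu ≫ q) w ∈ Set.range k := by
    rw [Scheme.Hom.comp_apply, hw]
    exact ⟨z, rfl⟩
  obtain ⟨a, ha, φ, hφ⟩ := Charts.exists_away_factor (Uni.pt _ hu ≫ q) w k hwk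
  obtain ⟨w', hw'⟩ := (Charts.range_specMap_away a).ge ha
  have hφg : φ g = 0 := by
    have hp := (hψ _ hu).map (algebraMap _ (Localization.Away a))
    have hp' := (hψ _ hf).map φ
    rw [← Category.assoc, hφ, Category.assoc] at hp
    obtain ⟨c, hc⟩ := exists_eq_smul_of_minors hp'.span_left (hp.minors hp').1
    have hn : φ ((ERing.univ.map f).l 2) ∈ nonZeroDivisors (Localization.Away a) := by
      refine mem_nonZeroDivisors_of_dvd
        (map_mem_nonZeroDivisors_away (ERing.lam_two_mem hu) a) ⟨c, ?_⟩
      rw [mul_comm]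
      exact hc 2
    rw [mem_nonZeroDivisors_iff_right] at hn
    refine hn _ ?_
    rw [← map_mul, hg, map_zero]
  have hzk : Uni.pt f hf z ∈ Set.range
      (Spec.map (CommRingCat.ofHom (algebraMap _ (Localization.Away a))) ≫ Uni.pt _ hu) := by
    refine ⟨w', ?_⟩
    rw [Scheme.Hom.comp_apply, hw', hw]
  obtain ⟨b, hb, χ, hχ⟩ := Charts.exists_away_factor (Uni.pt f hf) z
    (Spec.map (CommRingCat.ofHom (algebraMap _ (Localization.Away a))) ≫ Uni.pt _ hu) hzk
  refine ⟨b, hb, ?_⟩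
  have hcomp : algebraMap B (Localization.Away b) = χ.comp φ := by
    have h1 : Spec.map (CommRingCat.ofHom (algebraMap B (Localization.Away b))) ≫ k =
        Spec.map (CommRingCat.ofHom (χ.comp φ)) ≫ k := by
      have h2 := congrArg (· ≫ q) hχ
      simp only [Category.assoc] at h2
      rw [hφ] at h2
      rw [CommRingCat.ofHom_comp φ χ, Spec.map_comp, Category.assoc]
      exact h2
    exact congrArg CommRingCat.Hom.hom (Spec.map_injective ((cancel_mono k).1 h1))
  rw [hcomp, RingHom.comp_apply, hφg, map_zero]

end Param

end Example

/-! ### The rational map `φ` -/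

namespace Blow

theorem isBirational_of_iso {X Z : Scheme.{u}} (g : X.PartialMap Z) {U : X.Opens} {V : Z.Opens}
    (hU : Dense (U : Set X)) (hV : Dense (V : Set Z)) (hUg : U ≤ g.domain)
    (e : U.toScheme ≅ V.toScheme) (he : e.hom ≫ V.ι = X.homOfLE hUg ≫ g.hom) :
    IsBirational g.toRationalMap := by
  refine ⟨⟨U, hU, V, hV, e⟩, Quotient.sound ⟨U, hU, le_rfl, hUg, ?_⟩⟩
  change X.homOfLE le_rfl ≫ e.hom ≫ V.ι = X.homOfLE hUg ≫ g.hom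
  simpa using he

theorem isBirational_toRationalMap {X Z : Scheme.{u}} (g : X ⟶ Z) {U : X.Opens} {V : Z.Opens}
    (hU : Dense (U : Set X)) (hV : Dense (V : Set Z))
    (e : U.toScheme ≅ V.toScheme) (he : e.hom ≫ V.ι = U.ι ≫ g) :
    IsBirational g.toRationalMap := by
  refine isBirational_of_iso _ hU hV le_top e ?_
  rw [he]
  change _ = X.homOfLE _ ≫ X.topIso.hom ≫ g
  simp

end Blow

namespace BiProj

open MvPolynomial Blow Example

theorem exists_chart_opens {m n : ℕ} {S : Set (BiPoly m n)} (O : (zeroScheme S).Opens)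
    (y : O.toScheme) : ∃ (B : Type) (_ : CommRing B) (c : Spec (CommRingCat.of B) ⟶ O.toScheme)
      (_ : IsOpenImmersion c), y ∈ Set.range c ∧ ∃ l x, IsPt (c ≫ O.ι ≫ incl S) l x := by
  obtain ⟨i, j, hij⟩ := exists_mem_stdOpen (incl S y.1)
  obtain ⟨B, _, k, hk, hy, hO, l, x, hp, -, -⟩ := exists_chart_isPt (O := O) (z := y.1) y.2 hij
  have hr : Set.range k ⊆ Set.range O.ι := by rwa [Scheme.Opens.range_ι]
  have hfac : IsOpenImmersion.lift O.ι k hr ≫ O.ι = k := IsOpenImmersion.lift_fac _ _ _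
  have ho : IsOpenImmersion (IsOpenImmersion.lift O.ι k hr) := by
    have : IsOpenImmersion (IsOpenImmersion.lift O.ι k hr ≫ O.ι) := by rwa [hfac]
    exact IsOpenImmersion.of_comp _ O.ι
  refine ⟨B, inferInstance, _, ho, ?_, l, x, by rwa [← Category.assoc, hfac]⟩
  obtain ⟨z, hz⟩ := hy
  refine ⟨z, O.ι.injective ?_⟩
  rw [← Scheme.Hom.comp_apply, hfac, hz]
  rfl

/-- A morphism from an open subset of a subscheme of `ℙᵐ × ℙⁿ` to a subscheme of `ℙᵐ × ℙⁿ'` can be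
given by a bihomogeneous formula. -/
theorem exists_hom_of_formula {m n n' : ℕ} {S : Set (BiPoly m n)} {S' : Set (BiPoly m n')}
    (hS' : ∀ f ∈ S', IsBihom f) (O : (zeroScheme S).Opens)
    (G : ∀ {A : Type} [CommRing A], (Fin (m + 1) → A) → (Fin (n + 1) → A) → Fin (n' + 1) → A)
    (hmap : ∀ {A B : Type} [CommRing A] [CommRing B] (φ : A →+* B) (l : Fin (m + 1) → A)
      (x : Fin (n + 1) → A), G (φ ∘ l) (φ ∘ x) = φ ∘ G l x)
    (hscale : ∀ {A : Type} [CommRing A] (c d : A) (l : Fin (m + 1) → A)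
      (x : Fin (n + 1) → A), ∃ s, ∀ i, G (fun i => c * l i) (fun j => d * x j) i = s * G l x i)
    (hspan : ∀ {A : Type} [CommRing A] (p : Spec (CommRingCat.of A) ⟶ zeroScheme S)
      (l : Fin (m + 1) → A) (x : Fin (n + 1) → A), Set.range p ⊆ O → IsPt (p ≫ incl S) l x →
      Ideal.span (Set.range (G l x)) = ⊤)
    (heq : ∀ {A : Type} [CommRing A] [Algebra ℂ A] (p : Spec (CommRingCat.of A) ⟶ zeroScheme S)
      (l : Fin (m + 1) → A) (x : Fin (n + 1) → A), Set.range p ⊆ O → IsPt (p ≫ incl S) l x →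
      ∀ f ∈ S', aeval (Sum.elim l (G l x)) f = 0) :
    ∃ g : O.toScheme ⟶ zeroScheme S', g ≫ str S' = O.ι ≫ str S ∧
      ∀ {A : Type} [CommRing A] (p : Spec (CommRingCat.of A) ⟶ O.toScheme) (l : Fin (m + 1) → A)
        (x : Fin (n + 1) → A), IsPt (p ≫ O.ι ≫ incl S) l x → IsPt (p ≫ g ≫ incl S') l (G l x) := by
  let P {A : Type} [CommRing A] (h : Spec (CommRingCat.of A) ⟶ O.toScheme)
      (k : Spec (CommRingCat.of A) ⟶ zeroScheme S') : Prop :=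
    ∃ l x, IsPt (h ≫ O.ι ≫ incl S) l x ∧ IsPt (k ≫ incl S') l (G l x) ∧
      k ≫ str S' = h ≫ O.ι ≫ str S
  have hrange : ∀ {A : Type} [CommRing A] (h : Spec (CommRingCat.of A) ⟶ O.toScheme),
      Set.range (h ≫ O.ι) ⊆ O := by
    rintro A _ h _ ⟨y, rfl⟩
    exact (h y).2
  have hval : ∀ {A : Type} [CommRing A] (h : Spec (CommRingCat.of A) ⟶ O.toScheme)
      (l : Fin (m + 1) → A) (x : Fin (n + 1) → A), IsPt (h ≫ O.ι ≫ incl S) l x →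
      ∃ k, P h k ∧ IsPt (k ≫ incl S') l (G l x) := by
    intro A _ h l x hp
    have hp' := hp
    obtain ⟨_, hl, hx, hb⟩ := hp
    rw [← Category.assoc] at hp'
    obtain ⟨k, hk⟩ := exists_lift_of_forall hS' hl (hspan _ _ _ (hrange h) hp')
      (heq _ _ _ (hrange h) hp')
    have hk' : IsPt (k ≫ incl S') l (G l x) := ⟨_, _, _, hk⟩
    refine ⟨k, ⟨l, x, ⟨_, hl, hx, hb⟩, hk', ?_⟩, hk'⟩
    have h1 : k ≫ str S' = Spec.map (CommRingCat.ofHom (algebraMap ℂ A)) := by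
      rw [str, reassoc_of% hk, bipt_str]
    have h2 : h ≫ O.ι ≫ str S = Spec.map (CommRingCat.ofHom (algebraMap ℂ A)) := by
      have := congrArg (· ≫ PPP.str m n) hb
      simp only [Category.assoc, bipt_str] at this
      exact this
    rw [h1, h2]
  have hnat : ∀ {A B : Type} [CommRing A] [CommRing B] (h : Spec (CommRingCat.of A) ⟶ O.toScheme)
      (k : Spec (CommRingCat.of A) ⟶ zeroScheme S') (φ : A →+* B), P h k →
      P (Spec.map (CommRingCat.ofHom φ) ≫ h) (Spec.map (CommRingCat.ofHom φ) ≫ k) := by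
    rintro A B _ _ h k φ ⟨l, x, h1, h2, h3⟩
    refine ⟨φ ∘ l, φ ∘ x, ?_, ?_, ?_⟩
    · have := h1.map φ
      rwa [← Category.assoc] at this
    · have := h2.map φ
      rwa [← hmap, ← Category.assoc] at this
    · rw [Category.assoc, h3, Category.assoc]
  have huniq : ∀ {A : Type} [CommRing A] (h : Spec (CommRingCat.of A) ⟶ O.toScheme)
      (k k' : Spec (CommRingCat.of A) ⟶ zeroScheme S'), P h k → P h k' → k = k' := by
    rintro A _ h k k' ⟨l, x, h1, h2, h3⟩ ⟨l', x', h1', h2', h3'⟩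
    have hm := h1.minors h1'
    rw [← cancel_mono (incl S')]
    refine h2.hom_ext h2' (by simpa only [str, Category.assoc] using h3.trans h3'.symm) hm.1 ?_
    obtain ⟨c, hc⟩ := exists_eq_smul_of_minors h1'.span_left hm.1
    obtain ⟨d, hd⟩ := exists_eq_smul_of_minors h1'.span_right hm.2
    obtain rfl : l = fun i => c * l' i := funext hc
    obtain rfl : x = fun i => d * x' i := funext hd
    obtain ⟨s, hs⟩ := hscale c d l' x'
    intro i j
    rw [hs, hs]
    ring
  have hex : ∀ y : O.toScheme, ∃ (B : Type) (_ : CommRing B) (k : Spec (CommRingCat.of B) ⟶ O.toScheme)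
      (_ : IsOpenImmersion k), y ∈ Set.range k ∧ ∃ v, P k v := by
    intro y
    obtain ⟨B, _, c, hc, hy, l, x, hp⟩ := exists_chart_opens O y
    obtain ⟨v, hv, -⟩ := hval c l x hp
    exact ⟨B, inferInstance, c, hc, hy, v, hv⟩
  obtain ⟨g, hg⟩ := Charts.exists_hom_of_points (T := O.toScheme) (Z := zeroScheme S') P hnat huniq
    hex
  refine ⟨g, hom_ext_of_locally fun y => ?_, fun {A} _ p l x hp => ?_⟩
  · obtain ⟨B, _, k, hk, hy, v, hv⟩ := hex y
    refine ⟨_, hy, comp_eq_comp_of_range k ?_⟩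
    rw [← Category.assoc, hg _ _ _ hv]
    exact hv.choose_spec.choose_spec.2.2
  · obtain ⟨k, hk, hk'⟩ := hval p l x hp
    rwa [← hg _ _ _ hk, Category.assoc] at hk'

end BiProj

namespace Example

open BiProj MvPolynomial Blow

/-- The open set `λ₂ ≠ 0` of `Y`. -/
abbrev UY : Y.Opens := (vanL eqY (X 2)).compl

/-- The open set `λ₂ ≠ 0` of `Q`. -/
abbrev UQ : Q.Opens := (vanL eqQ (X 2)).compl

/-- The domain of `φ`. -/
abbrev domainPhi : Y.Opens := (Y₁ ⊔ Y₂ ⊔ Y₃).compl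

section

variable {A B : Type} [CommRing A] [CommRing B]

theorem mem_UY_iff {p : Spec (CommRingCat.of A) ⟶ Y} {l : Fin 3 → A} {x : Fin 4 → A}
    (h : IsPt (p ≫ incl eqY) l x) (y : PrimeSpectrum A) : p y ∈ UY ↔ l 2 ∉ y.asIdeal := by
  obtain ⟨_, hl, hx, h⟩ := h
  have := mem_vanL_iff h one_pos (isHomogeneous_X ℂ 2) y
  rw [aeval_X] at this
  exact not_congr this

theorem mem_UQ_iff {p : Spec (CommRingCat.of A) ⟶ Q} {l : Fin 3 → A} {x : Fin 6 → A}
    (h : IsPt (p ≫ incl eqQ) l x) (y : PrimeSpectrum A) : p y ∈ UQ ↔ l 2 ∉ y.asIdeal := by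
  obtain ⟨_, hl, hx, h⟩ := h
  have := mem_vanL_iff h one_pos (isHomogeneous_X ℂ 2) y
  rw [aeval_X] at this
  exact not_congr this

theorem Y₁_le : Y₁ ≤ vanL eqY (X 2) := fun _ h => h.1.1

theorem Y₂_le : Y₂ ≤ vanL eqY (X 2) := fun _ h => h.1.2

theorem Y₃_le : Y₃ ≤ vanL eqY (X 2) := fun _ h => h.1.2

theorem UY_le : UY ≤ domainPhi := by
  rintro y hy ((h | h) | h)
  exacts [hy (Y₁_le h), hy (Y₂_le h), hy (Y₃_le h)]

theorem phiCoord_map (φ : A →+* B) (l : Fin 3 → A) (x : Fin 4 → A) :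
    phiCoord (φ ∘ l) (φ ∘ x) = φ ∘ phiCoord l x := by
  ext i; fin_cases i <;> simp [phiCoord]

theorem phiCoord_smul (c d : A) (l : Fin 3 → A) (x : Fin 4 → A) (i : Fin 6) :
    phiCoord (fun i => c * l i) (fun j => d * x j) i = c * d * phiCoord l x i := by
  fin_cases i <;> simp [phiCoord] <;> ring

theorem phiCoord_rel {l : Fin 3 → A} {x : Fin 4 → A} (h : yEq l x = 0) :
    (l 0 - l 1) * phiCoord l x 3 = l 2 * phiCoord l x 5 ∧
    l 1 * phiCoord l x 2 = l 2 * phiCoord l x 4 ∧ qEq l (phiCoord l x) = 0 := by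
  simp only [phiCoord, qEq, Matrix.cons_val]
  rw [yEq] at h
  refine ⟨by ring, by ring, by linear_combination l 2 * h⟩

theorem eq_top_of_forall_notMem {v : Fin 6 → A}
    (h : ∀ y : PrimeSpectrum A, ∃ i, v i ∉ y.asIdeal) : Ideal.span (Set.range v) = ⊤ := by
  by_contra hne
  obtain ⟨m, hm, hle⟩ := Ideal.exists_le_maximal _ hne
  obtain ⟨i, hi⟩ := h ⟨m, hm.isPrime⟩
  exact hi (hle (Ideal.subset_span ⟨i, rfl⟩))

theorem span_phiCoord {p : Spec (CommRingCat.of A) ⟶ Y} {l : Fin 3 → A} {x : Fin 4 → A}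
    (hr : Set.range p ⊆ domainPhi) (h : IsPt (p ≫ incl eqY) l x) :
    Ideal.span (Set.range (phiCoord l x)) = ⊤ := by
  refine eq_top_of_forall_notMem fun y => ?_
  by_contra! hcon
  have hl2 : l 2 ∈ y.asIdeal := by
    obtain ⟨j, hj⟩ := exists_notMem_of_span_eq_top h.span_right y
    refine (y.2.mem_or_mem (?_ : l 2 * x j ∈ _)).resolve_right hj
    fin_cases j
    exacts [hcon 0, hcon 1, hcon 2, hcon 3]
  refine hr ⟨y, rfl⟩ ?_
  have h4 : l 1 * x 2 ∈ y.asIdeal := hcon 4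
  have h5 : (l 0 - l 1) * x 3 ∈ y.asIdeal := hcon 5
  by_cases h1 : l 1 ∈ y.asIdeal
  · refine Or.inl (Or.inr ((mem_Y₂_iff h y).2 ⟨h1, hl2, (y.2.mem_or_mem h5).resolve_left ?_⟩))
    intro hm
    have h0 := y.asIdeal.add_mem hm h1
    rw [sub_add_cancel] at h0
    obtain ⟨i, hi⟩ := exists_notMem_of_span_eq_top h.span_left y
    fin_cases i
    exacts [hi h0, hi h1, hi hl2]
  · have hx2 := (y.2.mem_or_mem h4).resolve_left h1
    rcases y.2.mem_or_mem h5 with h6 | h6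
    · exact Or.inr ((mem_Y₃_iff h y).2 ⟨h6, hl2, hx2⟩)
    · exact Or.inl (Or.inl ((mem_Y₁_iff h y).2 ⟨hl2, hx2, h6⟩))

end

/-- The morphism given by the formula for `φ`. -/
theorem exists_phi : ∃ g : domainPhi.toScheme ⟶ Q, g ≫ str eqQ = domainPhi.ι ≫ str eqY ∧
    ∀ {A : Type} [CommRing A] (p : Spec (CommRingCat.of A) ⟶ domainPhi.toScheme) (l : Fin 3 → A)
      (x : Fin 4 → A), IsPt (p ≫ domainPhi.ι ≫ incl eqY) l x →
      IsPt (p ≫ g ≫ incl eqQ) l (phiCoord l x) :=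
  exists_hom_of_formula isBihom_eqQ domainPhi phiCoord phiCoord_map
    (fun c d l x => ⟨c * d, phiCoord_smul c d l x⟩) (fun _ _ _ hr h => span_phiCoord hr h)
    (fun _ _ _ _ h => (forall_eqQ_iff _ _).2 (phiCoord_rel (yEq_eq_zero h)))

/-- The inverse of `φ`, on `λ₂ ≠ 0`. -/
theorem exists_phi_inv : ∃ g : UQ.toScheme ⟶ Y, g ≫ str eqY = UQ.ι ≫ str eqQ ∧
    ∀ {A : Type} [CommRing A] (p : Spec (CommRingCat.of A) ⟶ UQ.toScheme) (l : Fin 3 → A)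
      (x : Fin 6 → A), IsPt (p ≫ UQ.ι ≫ incl eqQ) l x →
      IsPt (p ≫ g ≫ incl eqY) l ![x 0, x 1, x 2, x 3] := by
  refine exists_hom_of_formula (m := 2) (n := 5) (n' := 3) isBihom_eqY UQ
    (fun l x => ![x 0, x 1, x 2, x 3]) ?_ ?_ ?_ ?_
  · intro A B _ _ φ l x
    ext i; fin_cases i <;> rfl
  · intro A _ c d l x
    refine ⟨d, fun i => ?_⟩
    fin_cases i <;> rfl
  · intro A _ p l x hr h
    by_contra hne
    obtain ⟨m, hm, hle⟩ := Ideal.exists_le_maximal _ hne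
    let y : PrimeSpectrum A := ⟨m, hm.isPrime⟩
    have h2 : l 2 ∉ y.asIdeal := (mem_UQ_iff h y).1 (hr ⟨y, rfl⟩)
    have hx : ∀ i : Fin 4, (![x 0, x 1, x 2, x 3] : Fin 4 → A) i ∈ y.asIdeal := fun i =>
      hle (Ideal.subset_span ⟨i, rfl⟩)
    obtain ⟨e1, e2, -⟩ := qEq_eq_zero h
    have hx4 : x 4 ∈ y.asIdeal := by
      refine (y.2.mem_or_mem (?_ : l 2 * x 4 ∈ _)).resolve_left h2
      rw [← e2]
      exact Ideal.mul_mem_left _ _ (hx 2)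
    have hx5 : x 5 ∈ y.asIdeal := by
      refine (y.2.mem_or_mem (?_ : l 2 * x 5 ∈ _)).resolve_left h2
      rw [← e1]
      exact Ideal.mul_mem_left _ _ (hx 3)
    obtain ⟨i, hi⟩ := exists_notMem_of_span_eq_top h.span_right y
    fin_cases i
    exacts [hi (hx 0), hi (hx 1), hi (hx 2), hi (hx 3), hi hx4, hi hx5]
  · intro A _ _ p l x hr h
    refine (forall_eqY_iff l _).2 ?_
    obtain ⟨e1, e2, e3⟩ := qEq_eq_zero h
    rw [qEq] at e3
    simp only [yEq, Matrix.cons_val]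
    linear_combination l 2 * e3 + l 0 * x 2 * e2 +
      ((l 0 - l 1) * x 3 + l 2 * x 5) * e1

/-- `φ` is an isomorphism on `λ₂ ≠ 0`. -/
theorem exists_iso {g : domainPhi.toScheme ⟶ Q} (hs : g ≫ str eqQ = domainPhi.ι ≫ str eqY)
    (hg : ∀ {A : Type} [CommRing A] (p : Spec (CommRingCat.of A) ⟶ domainPhi.toScheme)
      (l : Fin 3 → A) (x : Fin 4 → A), IsPt (p ≫ domainPhi.ι ≫ incl eqY) l x →
      IsPt (p ≫ g ≫ incl eqQ) l (phiCoord l x)) :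
    ∃ e : UY.toScheme ≅ UQ.toScheme, e.hom ≫ UQ.ι = Y.homOfLE UY_le ≫ g := by
  obtain ⟨k, hks, hk⟩ := exists_phi_inv
  have hg' : ∀ {A : Type} [CommRing A] (p : Spec (CommRingCat.of A) ⟶ UY.toScheme)
      (l : Fin 3 → A) (x : Fin 4 → A), IsPt (p ≫ UY.ι ≫ incl eqY) l x →
      IsPt (p ≫ (Y.homOfLE UY_le ≫ g) ≫ incl eqQ) l (phiCoord l x) := by
    intro A _ p l x h
    have := hg (p ≫ Y.homOfLE UY_le) l x (by simpa using h)
    simpa only [Category.assoc] using this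
  set f := Y.homOfLE UY_le ≫ g with hf
  have hfs : f ≫ str eqQ = UY.ι ≫ str eqY := by rw [hf, Category.assoc, hs]; simp
  have hrf : Set.range f ⊆ Set.range UQ.ι := by
    rintro _ ⟨y, rfl⟩
    obtain ⟨B, _, c, hc, ⟨z, rfl⟩, l, x, hp⟩ := exists_chart_opens UY y
    have h := hg' c l x hp
    rw [← Category.assoc] at h hp
    rw [Scheme.Opens.range_ι]
    exact (mem_UQ_iff h z).2 ((mem_UY_iff hp z).1 (c z).2)
  have hrk : Set.range k ⊆ Set.range UY.ι := by
    rintro _ ⟨y, rfl⟩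
    obtain ⟨B, _, c, hc, ⟨z, rfl⟩, l, x, hp⟩ := exists_chart_opens UQ y
    have h := hk c l x hp
    rw [← Category.assoc] at h hp
    rw [Scheme.Opens.range_ι]
    exact (mem_UY_iff h z).2 ((mem_UQ_iff hp z).1 (c z).2)
  obtain ⟨F, hF⟩ : ∃ F, F ≫ UQ.ι = f := ⟨_, IsOpenImmersion.lift_fac UQ.ι f hrf⟩
  obtain ⟨K, hK⟩ : ∃ K, K ≫ UY.ι = k := ⟨_, IsOpenImmersion.lift_fac UY.ι k hrk⟩
  refine ⟨⟨F, K, ?_, ?_⟩, hF⟩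
  · rw [← cancel_mono UY.ι, Category.assoc, hK, Category.id_comp]
    refine hom_ext_of_locally fun y => ?_
    obtain ⟨B, _, c, hc, hy, l, x, hp⟩ := exists_chart_opens UY y
    refine ⟨_, hy, comp_eq_comp_of_range c ?_⟩
    have h := hg' c l x hp
    rw [← hF] at h
    have h' := hk (c ≫ F) l _ (by simpa only [Category.assoc] using h)
    have hss : F ≫ k ≫ str eqY = UY.ι ≫ str eqY := by rw [hks, reassoc_of% hF, hfs]
    rw [← cancel_mono (incl eqY)]
    simp only [Category.assoc] at h' ⊢
    refine h'.hom_ext hp ?_ (fun _ _ => mul_comm _ _) fun i j => ?_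
    · simp only [str, Category.assoc] at hss ⊢
      rw [hss]
    · have e : ∀ i : Fin 4, (![phiCoord l x 0, phiCoord l x 1, phiCoord l x 2, phiCoord l x 3] :
          Fin 4 → B) i = l 2 * x i := fun i => by fin_cases i <;> rfl
      rw [e, e]
      ring
  · rw [← cancel_mono UQ.ι, Category.assoc, hF, Category.id_comp]
    refine hom_ext_of_locally fun y => ?_
    obtain ⟨B, _, c, hc, hy, l, x, hp⟩ := exists_chart_opens UQ y
    refine ⟨_, hy, comp_eq_comp_of_range c ?_⟩
    have h := hk c l x hp
    rw [← hK] at h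
    have h' := hg' (c ≫ K) l _ (by simpa only [Category.assoc] using h)
    have hss : K ≫ f ≫ str eqQ = UQ.ι ≫ str eqQ := by rw [hfs, reassoc_of% hK, hks]
    rw [← cancel_mono (incl eqQ)]
    rw [← Category.assoc] at hp
    obtain ⟨e1, e2, -⟩ := qEq_eq_zero hp
    simp only [Category.assoc] at h' hp ⊢
    refine h'.hom_ext hp ?_ (fun _ _ => mul_comm _ _) fun i j => ?_
    · simp only [str, Category.assoc] at hss ⊢
      rw [hss]
    · have e : ∀ i : Fin 6, phiCoord l ![x 0, x 1, x 2, x 3] i = l 2 * x i := fun i => by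
        fin_cases i
        exacts [rfl, rfl, rfl, rfl, e2, e1]
      rw [e, e]
      ring

end Example

/-! ### The extension of `φ` to the iterated blowup -/

namespace Example

open BiProj MvPolynomial Blow Scheme.IdealSheafData

namespace ERing

theorem exists_toQ : ∃ g : U.toScheme ⟶ Q,
    g ≫ str eqQ = U.ι ≫ Spec.map (CommRingCat.ofHom (algebraMap ℂ ERing)) ∧
    ∀ (A : Type) [CommRing A] (f : ERing →+* A) (hf : ∀ i, Ideal.span (f '' groups i) = ⊤),
      IsPt (Uni.pt f hf ≫ g ≫ incl eqQ) (univ.map f).l (univ.map f).image := by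
  let P {A : Type} [CommRing A] (h : Spec (CommRingCat.of A) ⟶ U.toScheme)
      (k : Spec (CommRingCat.of A) ⟶ Q) : Prop :=
    ∃ f : ERing →+* A, h ≫ U.ι = Spec.map (CommRingCat.ofHom f) ∧
      IsPt (k ≫ incl eqQ) (univ.map f).l (univ.map f).image ∧
      k ≫ str eqQ = h ≫ U.ι ≫ Spec.map (CommRingCat.ofHom (algebraMap ℂ ERing))
  have hex : ∀ (A : Type) [CommRing A] (f : ERing →+* A)
      (hf : ∀ i, Ideal.span (f '' groups i) = ⊤), ∃ k, P (Uni.pt f hf) k := by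
    intro A _ f hf
    let := (f.comp (algebraMap ℂ ERing)).toAlgebra
    have hu := (forall_span_iff f).1 hf
    obtain ⟨k, hk⟩ := exists_lift_of_forall isBihom_eqQ hu.toH.hl hu.span_image
      ((forall_eqQ_iff _ _).2 (univ.map f).image_rel)
    refine ⟨k, f, Uni.pt_ι .., ⟨_, _, _, hk⟩, ?_⟩
    rw [str, reassoc_of% hk, bipt_str, ← Category.assoc, Uni.pt_ι, ← Spec.map_comp,
      ← CommRingCat.ofHom_comp]
  have hnat : ∀ {A B : Type} [CommRing A] [CommRing B] (h : Spec (CommRingCat.of A) ⟶ U.toScheme)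
      (k : Spec (CommRingCat.of A) ⟶ Q) (φ : A →+* B), P h k →
      P (Spec.map (CommRingCat.ofHom φ) ≫ h) (Spec.map (CommRingCat.ofHom φ) ≫ k) := by
    rintro A B _ _ h k φ ⟨f, h1, h2, h3⟩
    refine ⟨φ.comp f, ?_, ?_, ?_⟩
    · rw [Category.assoc, h1, CommRingCat.ofHom_comp, Spec.map_comp]
    · have := h2.map φ
      rwa [← ETuple.map_l, ← ETuple.map_image, ← Category.assoc] at this
    · rw [Category.assoc, h3, Category.assoc]
  have huniq : ∀ {A : Type} [CommRing A] (h : Spec (CommRingCat.of A) ⟶ U.toScheme)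
      (k k' : Spec (CommRingCat.of A) ⟶ Q), P h k → P h k' → k = k' := by
    rintro A _ h k k' ⟨f, h1, h2, h3⟩ ⟨f', h1', h2', h3'⟩
    obtain rfl : f = f' := congrArg CommRingCat.Hom.hom (Spec.map_injective (h1.symm.trans h1'))
    rw [← cancel_mono (incl eqQ)]
    exact h2.hom_ext' h2' (by simpa only [str, Category.assoc] using h3.trans h3'.symm)
  obtain ⟨q, hq⟩ := Charts.exists_hom_of_points (T := U.toScheme) (Z := Q) P hnat huniq (by
    intro y
    obtain ⟨g, -, hf, ho, hy⟩ := Uni.exists_chart y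
    exact ⟨_, _, _, ho, hy, hex _ _ hf⟩)
  have hq' : ∀ (A : Type) [CommRing A] (f : ERing →+* A)
      (hf : ∀ i, Ideal.span (f '' groups i) = ⊤), P (Uni.pt f hf) (Uni.pt f hf ≫ q) := by
    intro A _ f hf
    obtain ⟨k, hk⟩ := hex A f hf
    rwa [hq A _ k hk]
  refine ⟨q, hom_ext_of_locally fun y => ?_, fun A _ f hf => ?_⟩
  · obtain ⟨g, -, hf, ho, hy⟩ := Uni.exists_chart y
    obtain ⟨f', h1, h2, h3⟩ := hq' _ _ hf
    exact ⟨_, hy, comp_eq_comp_of_range _ (by simpa only [Category.assoc] using h3)⟩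
  · obtain ⟨f', h1, h2, h3⟩ := hq' A f hf
    rw [Uni.pt_ι] at h1
    obtain rfl : f = f' := congrArg CommRingCat.Hom.hom (Spec.map_injective h1)
    simpa only [Category.assoc] using h2

/-- The morphism to `Q` given by the coordinates of the image. -/
def toQ : U.toScheme ⟶ Q := exists_toQ.choose

theorem toQ_str : toQ ≫ str eqQ = U.ι ≫ Spec.map (CommRingCat.ofHom (algebraMap ℂ ERing)) :=
  exists_toQ.choose_spec.1

theorem isPt_toQ {A : Type} [CommRing A] (f : ERing →+* A)
    (hf : ∀ i, Ideal.span (f '' groups i) = ⊤) :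
    IsPt (Uni.pt f hf ≫ toQ ≫ incl eqQ) (univ.map f).l (univ.map f).image :=
  exists_toQ.choose_spec.2 A f hf

end ERing

/-- The iterated blowup is parametrized by coordinates. -/
structure IsParam {Yt : Scheme.{0}} (ψ : Yt ⟶ Y) (q : ERing.U.toScheme ⟶ Yt) : Prop where
  isPt : ∀ {A : Type} [CommRing A] (f : ERing →+* A)
    (hf : ∀ i, Ideal.span (f '' ERing.groups i) = ⊤),
    IsPt ((Uni.pt f hf ≫ q) ≫ ψ ≫ incl eqY) (ERing.univ.map f).l (ERing.univ.map f).x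
  str : q ≫ ψ ≫ str eqY = ERing.U.ι ≫ Spec.map (CommRingCat.ofHom (algebraMap ℂ ERing))
  exists_section : ∀ y : Yt, ∃ (B : Type) (_ : CommRing B) (k : Spec (CommRingCat.of B) ⟶ Yt)
    (_ : IsOpenImmersion k), y ∈ Set.range k ∧ ∃ f hf, Uni.pt (V := ERing.groups) f hf ≫ q = k

theorem exists_isParam {Y' Y'' Yt : Scheme.{0}} {b₁ : Y' ⟶ Y} {b₂ : Y'' ⟶ Y'} {b₃ : Yt ⟶ Y''}
    (h₁ : IsBlowupAlong b₁ Y₁) (h₂ : IsBlowupAlong b₂ (properTransform b₁ Y₁ Y₂))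
    (h₃ : IsBlowupAlong b₃ (properTransform b₂ (properTransform b₁ Y₁ Y₂)
      (properTransform b₁ Y₁ Y₃))) :
    ∃ q, IsParam (b₃ ≫ b₂ ≫ b₁) q := by
  obtain ⟨q₁, hq₁⟩ := (h₁.universal _ _ isEffectiveCartier_comap_toY).exists
  have h₃' := isBlowup_third h₁ hq₁ h₂ h₃
  obtain ⟨q, hq⟩ := exists_param h₁ hq₁ h₂ h₃'
  refine ⟨q, fun {A} _ f hf => isPt_param hq₁ hq f hf, ?_, exists_section h₁ hq₁ h₂ h₃' hq⟩
  have := congrArg (· ≫ b₁ ≫ BiProj.str eqY) hq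
  simp only [Category.assoc] at this
  rw [reassoc_of% hq₁, HRing.toY_str, reassoc_of% ERing.toHU_ι, ← Spec.map_comp,
    ← CommRingCat.ofHom_comp] at this
  simp only [Category.assoc]
  refine this.trans ?_
  congr 3
  exact ERing.ofH.comp_algebraMap

theorem isIso_restrict_UY {Y' Y'' Yt : Scheme.{0}} {b₁ : Y' ⟶ Y} {b₂ : Y'' ⟶ Y'} {b₃ : Yt ⟶ Y''}
    (h₁ : IsBlowupAlong b₁ Y₁) (h₂ : IsBlowupAlong b₂ (properTransform b₁ Y₁ Y₂))
    (h₃ : IsBlowupAlong b₃ (properTransform b₂ (properTransform b₁ Y₁ Y₂)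
      (properTransform b₁ Y₁ Y₃))) : IsIso ((b₃ ≫ b₂ ≫ b₁) ∣_ UY) := by
  have hle : ∀ {B X : Scheme.{0}} (b : B ⟶ X) (Z W : Closeds X) (V : X.Opens),
      (∀ x ∈ V, x ∉ W) → ∀ x ∈ b ⁻¹ᵁ V, x ∉ properTransform b Z W := by
    intro B X b Z W V hV x hx hx'
    refine hV _ hx ?_
    exact closure_minimal (fun z hz => hz.1) (W.isClosed.preimage b.continuous) hx'
  have i₁ : IsIso (b₁ ∣_ UY) := IsBlowup.isIso_restrict h₁ fun x hx h => hx (Y₁_le h)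
  have i₂ : IsIso (b₂ ∣_ (b₁ ⁻¹ᵁ UY)) := IsBlowup.isIso_restrict h₂ fun x hx h =>
    hle b₁ Y₁ Y₂ UY (fun x hx h => hx (Y₂_le h)) x hx h
  have i₃ : IsIso (b₃ ∣_ (b₂ ⁻¹ᵁ (b₁ ⁻¹ᵁ UY))) := IsBlowup.isIso_restrict h₃ fun x hx h =>
    hle b₂ _ _ (b₁ ⁻¹ᵁ UY) (fun x hx h =>
      hle b₁ Y₁ Y₃ UY (fun x hx h => hx (Y₃_le h)) x hx h) x hx h
  have i₄ : IsIso ((b₂ ≫ b₁) ∣_ UY) := by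
    rw [morphismRestrict_comp]
    exact IsIso.comp_isIso' i₂ i₁
  rw [morphismRestrict_comp]
  exact IsIso.comp_isIso' i₃ i₄

namespace IsParam

variable {Yt : Scheme.{0}} {ψ : Yt ⟶ Y} {q : ERing.U.toScheme ⟶ Yt} (h : IsParam ψ q)

include h

theorem hom_ext {Z : Scheme.{0}} {g g' : Yt ⟶ Z} (e : q ≫ g = q ≫ g') : g = g' := by
  refine hom_ext_of_locally fun y => ?_
  obtain ⟨B, _, k, hk, hy, f, hf, rfl⟩ := h.exists_section y
  exact ⟨_, hy, comp_eq_comp_of_range (Uni.pt f hf ≫ q) (by simp only [Category.assoc, e])⟩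

theorem toQ_eq_toQ {A : Type} [CommRing A] {f f' : ERing →+* A}
    (hf : ∀ i, Ideal.span (f '' ERing.groups i) = ⊤)
    (hf' : ∀ i, Ideal.span (f' '' ERing.groups i) = ⊤)
    (e : Uni.pt f hf ≫ q = Uni.pt f' hf' ≫ q)
    (h2 : (ERing.univ.map f).l 2 ∈ nonZeroDivisors A) :
    Uni.pt f hf ≫ ERing.toQ = Uni.pt f' hf' ≫ ERing.toQ := by
  have hp := h.isPt f hf
  have hp' := h.isPt f' hf'
  rw [e] at hp
  have hm := hp.minors hp'
  rw [← cancel_mono (incl eqQ), Category.assoc, Category.assoc]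
  refine (ERing.isPt_toQ f hf).hom_ext (ERing.isPt_toQ f' hf') ?_ hm.1 ?_
  · have := congrArg (· ≫ ψ ≫ BiProj.str eqY) e
    simp only [Category.assoc, h.str] at this
    rw [← ERing.toQ_str] at this
    simpa only [BiProj.str, Category.assoc] using this
  · obtain ⟨c, hc⟩ := exists_eq_smul_of_minors hp'.span_left hm.1
    obtain ⟨d, hd⟩ := exists_eq_smul_of_minors hp'.span_right hm.2
    generalize ERing.univ.map f = e₀ at *
    generalize ERing.univ.map f' = e₁ at *
    have htr : e₀.t * e₀.r ∈ nonZeroDivisors A :=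
      mem_nonZeroDivisors_of_dvd h2 ⟨e₀.P, (mul_assoc _ _ _).symm⟩
    have hi : ∀ i, e₀.t * e₀.r * e₀.image i = c * d * (e₁.t * e₁.r * e₁.image i) := by
      intro i
      rw [← ETuple.phiCoord_eq, ← ETuple.phiCoord_eq, ← phiCoord_smul, ← funext hc, ← funext hd]
    intro i j
    rw [mem_nonZeroDivisors_iff_right] at htr
    rw [← sub_eq_zero]
    refine htr _ ?_
    linear_combination e₁.image j * hi i - e₁.image i * hi j

/-- The extension of `φ`. -/
theorem exists_lift : ∃ g : Yt ⟶ Q, q ≫ g = ERing.toQ := by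
  let P {A : Type} [CommRing A] (k : Spec (CommRingCat.of A) ⟶ Yt)
      (v : Spec (CommRingCat.of A) ⟶ Q) : Prop :=
    ∃ f hf, Uni.pt (V := ERing.groups) f hf ≫ q = k ∧ Uni.pt f hf ≫ ERing.toQ = v
  have hnat : ∀ {A B : Type} [CommRing A] [CommRing B] (k : Spec (CommRingCat.of A) ⟶ Yt)
      (v : Spec (CommRingCat.of A) ⟶ Q) (φ : A →+* B), P k v →
      P (Spec.map (CommRingCat.ofHom φ) ≫ k) (Spec.map (CommRingCat.ofHom φ) ≫ v) := by
    rintro A B _ _ k v φ ⟨f, hf, rfl, rfl⟩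
    refine ⟨φ.comp f, Uni.span_image_comp hf φ, ?_, ?_⟩
    · rw [← Uni.specMap_pt f hf, Category.assoc]
    · rw [← Uni.specMap_pt f hf, Category.assoc]
  have huniq : ∀ {A : Type} [CommRing A] (k : Spec (CommRingCat.of A) ⟶ Yt)
      (v w : Spec (CommRingCat.of A) ⟶ Q), IsOpenImmersion k → P k v → P k w → v = w := by
    rintro A _ k v w hk ⟨f, hf, rfl, rfl⟩ ⟨f', hf', e, rfl⟩
    exact h.toQ_eq_toQ hf hf' e.symm (lam_two_mem_of_section h.isPt hf)
  have hex : ∀ y : Yt, ∃ (B : Type) (_ : CommRing B) (k : Spec (CommRingCat.of B) ⟶ Yt)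
      (_ : IsOpenImmersion k), y ∈ Set.range k ∧ ∃ v, P k v := by
    intro y
    obtain ⟨B, _, k, hk, hy, f, hf, e⟩ := h.exists_section y
    exact ⟨B, inferInstance, k, hk, hy, _, f, hf, e, rfl⟩
  obtain ⟨g, hg⟩ := Charts.exists_hom_of_charts (T := Yt) (Z := Q) P
    (fun k v φ _ _ => hnat k v φ) huniq hex
  refine ⟨g, hom_ext_of_locally fun y => ?_⟩
  obtain ⟨v, -, hu, ho, hy⟩ := Uni.exists_chart y
  refine ⟨_, hy, comp_eq_comp_of_range _ (Charts.spec_hom_ext_of_locally fun z => ?_)⟩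
  obtain ⟨B, _, k, hk, hz, f, hf, e⟩ := h.exists_section ((Uni.pt _ hu ≫ q) z)
  obtain ⟨a, ha, φ, hφ⟩ := Charts.exists_away_factor (Uni.pt _ hu ≫ q) z k hz
  refine ⟨a, ha, ?_⟩
  have e1 : Spec.map (CommRingCat.ofHom (algebraMap _ (Localization.Away a))) ≫ Uni.pt _ hu ≫ q ≫ g
      = Spec.map (CommRingCat.ofHom φ) ≫ Uni.pt f hf ≫ ERing.toQ := by
    have := congrArg (· ≫ g) hφ
    simp only [Category.assoc] at this
    rw [this, hg _ k _ hk ⟨f, hf, e, rfl⟩]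
  rw [e1]
  rw [← e] at hφ
  rw [← Category.assoc, ← Category.assoc,
    Uni.specMap_pt f hf φ (Uni.span_image_comp hf φ),
    Uni.specMap_pt _ hu _ (Uni.span_image_comp hu (algebraMap _ (Localization.Away a)))]
  refine (h.toQ_eq_toQ _ _ ?_ ?_).symm
  · rw [← Uni.specMap_pt f hf φ, ← Uni.specMap_pt _ hu _, Category.assoc, Category.assoc, hφ]
  · have := map_mem_nonZeroDivisors_away (ERing.lam_two_mem hu) a
    refine (congrArg (· ∈ nonZeroDivisors (Localization.Away a)) ?_).mpr this
    exact congrFun (ETuple.map_l (ERing.univ.map (algebraMap ERing (Localization.Away (∏ i, v i))))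
      (algebraMap _ (Localization.Away a))) 2

theorem lift_str {g : Yt ⟶ Q} (hg : q ≫ g = ERing.toQ) : g ≫ BiProj.str eqQ = ψ ≫ BiProj.str eqY :=
  h.hom_ext (by rw [h.str, reassoc_of% hg, ERing.toQ_str])

theorem lift_compat {g : Yt ⟶ Q} (hg : q ≫ g = ERing.toQ) {φ : domainPhi.toScheme ⟶ Q}
    (hs : φ ≫ BiProj.str eqQ = domainPhi.ι ≫ BiProj.str eqY)
    (hφ : ∀ {A : Type} [CommRing A] (p : Spec (CommRingCat.of A) ⟶ domainPhi.toScheme)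
      (l : Fin 3 → A) (x : Fin 4 → A), IsPt (p ≫ domainPhi.ι ≫ incl eqY) l x →
      IsPt (p ≫ φ ≫ incl eqQ) l (phiCoord l x)) :
    (ψ ⁻¹ᵁ domainPhi).ι ≫ g = (ψ ∣_ domainPhi) ≫ φ := by
  refine hom_ext_of_locally fun y => ?_
  obtain ⟨B, _, k, hk, ⟨z, hz⟩, f, hf, e⟩ := h.exists_section y.1
  obtain ⟨a, ha, j, hj⟩ := Charts.exists_away_lift k z (ψ ⁻¹ᵁ domainPhi).ι (by
    rw [hz, Scheme.Opens.range_ι]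
    exact y.2)
  have ho : IsOpenImmersion j := by
    have : IsOpenImmersion (j ≫ (ψ ⁻¹ᵁ domainPhi).ι) := by
      rw [← hj]
      infer_instance
    exact IsOpenImmersion.of_comp _ (ψ ⁻¹ᵁ domainPhi).ι
  obtain ⟨z', hz'⟩ := (Charts.range_specMap_away a).ge ha
  refine ⟨j.opensRange, ⟨z', (ψ ⁻¹ᵁ domainPhi).ι.injective ?_⟩, comp_eq_comp_of_range j ?_⟩
  · rw [← Scheme.Hom.comp_apply, ← hj, Scheme.Hom.comp_apply, hz', hz]
    rfl
  rw [← e, ← Category.assoc, Uni.specMap_pt _ hf _ (Uni.span_image_comp hf _)] at hj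
  have hp := h.isPt _ (Uni.span_image_comp hf (algebraMap B (Localization.Away a)))
  have hi := ERing.isPt_toQ _ (Uni.span_image_comp hf (algebraMap B (Localization.Away a)))
  rw [← hg, ← Category.assoc, ← Category.assoc, hj] at hi
  rw [hj] at hp
  have hp' : IsPt ((j ≫ (ψ ∣_ domainPhi)) ≫ domainPhi.ι ≫ incl eqY)
      (ERing.univ.map ((algebraMap B (Localization.Away a)).comp f)).l
      (ERing.univ.map ((algebraMap B (Localization.Away a)).comp f)).x := by
    have : (j ≫ (ψ ∣_ domainPhi)) ≫ domainPhi.ι ≫ incl eqY =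
        (j ≫ (ψ ⁻¹ᵁ domainPhi).ι) ≫ ψ ≫ incl eqY := by simp
    rw [this]
    exact hp
  have hi' := hφ _ _ _ hp'
  rw [← cancel_mono (incl eqQ)]
  simp only [Category.assoc] at hi hi' ⊢
  refine hi.hom_ext hi' ?_ (fun _ _ => mul_comm _ _) fun i j => ?_
  · have e1 := h.lift_str hg
    simp only [BiProj.str] at e1 hs
    simp [e1, hs]
  · rw [ETuple.phiCoord_eq, ETuple.phiCoord_eq]
    ring

theorem dense_UY : Dense ((ψ ⁻¹ᵁ UY : Yt.Opens) : Set Yt) := by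
  rw [dense_iff_inter_open]
  rintro O hO ⟨y, hy⟩
  obtain ⟨B, _, k, hk, ⟨z, rfl⟩, f, hf, e⟩ := h.exists_section y
  have hn : (ERing.univ.map f).l 2 ∈ nonZeroDivisors B := by
    subst e
    exact lam_two_mem_of_section h.isPt hf
  obtain ⟨_, ⟨a, rfl⟩, hza, haO⟩ := PrimeSpectrum.isTopologicalBasis_basic_opens.exists_subset_of_mem_open
    (show (z : PrimeSpectrum B) ∈ k ⁻¹' O from hy) (hO.preimage k.continuous)
  have hna : ¬ IsNilpotent ((ERing.univ.map f).l 2 * a) := by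
    rintro ⟨n, hn'⟩
    rw [mul_pow, mul_comm] at hn'
    have := (mem_nonZeroDivisors_iff_right.1 (pow_mem hn n)) _ hn'
    refine hza ?_
    exact z.2.mem_of_pow_mem n (this ▸ z.asIdeal.zero_mem)
  obtain ⟨w, hw⟩ : ∃ w : PrimeSpectrum B, (ERing.univ.map f).l 2 * a ∉ w.asIdeal := by
    by_contra! hcon
    exact hna ((nilpotent_iff_mem_prime).2 fun J hJ => hcon ⟨J, hJ⟩)
  refine ⟨k w, haO (fun hm => hw (Ideal.mul_mem_left _ _ hm)), ?_⟩
  have hp := h.isPt f hf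
  rw [e, ← Category.assoc] at hp
  exact (mem_UY_iff hp w).2 fun hm => hw (Ideal.mul_mem_right _ _ hm)

end IsParam

end Example

/-! ### Rational curves on the iterated blowup -/

namespace Example

open BiProj Blow ZeroCycle Polynomial

namespace ETuple

variable {A : Type} [CommRing A]

/-- The action of the torus. -/
def scale (e : ETuple A) (u₁ u₂ u₃ u₄ : A) : ETuple A where
  l0 := u₁ * u₃ * u₄ * e.l0
  l1 := u₁ * u₃ * u₄ * e.l1
  x0 := u₂ * u₃ * e.x0
  x1 := u₂ * u₃ * e.x1
  t := u₃ * e.t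
  a := u₂ * e.a
  b := u₂ * e.b
  r := u₄ * e.r
  P := u₁ * e.P
  c := u₁ * u₂ * u₃ * e.c
  d := u₁ * u₂ * u₃ * e.d
  r1 := by linear_combination u₁ * u₂ * u₃ * u₄ * e.r1
  r2 := by linear_combination u₁ * u₂ * u₃ * u₄ * e.r2
  r3 := by linear_combination u₁ ^ 2 * u₂ ^ 2 * u₃ ^ 3 * u₄ * e.r3

theorem scale_l (e : ETuple A) (u₁ u₂ u₃ u₄ : A) (i : Fin 3) :
    (e.scale u₁ u₂ u₃ u₄).l i = u₁ * u₃ * u₄ * e.l i := by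
  fin_cases i
  · rfl
  · rfl
  · change u₃ * e.t * (u₄ * e.r * (u₁ * e.P)) = u₁ * u₃ * u₄ * (e.t * (e.r * e.P))
    ring

theorem scale_x (e : ETuple A) (u₁ u₂ u₃ u₄ : A) (i : Fin 4) :
    (e.scale u₁ u₂ u₃ u₄).x i = u₂ * u₃ * e.x i := by
  fin_cases i
  · rfl
  · rfl
  · change u₃ * e.t * (u₂ * e.a) = u₂ * u₃ * (e.t * e.a)
    ring
  · change u₃ * e.t * (u₂ * e.b) = u₂ * u₃ * (e.t * e.b)
    ring

theorem scale_image (e : ETuple A) (u₁ u₂ u₃ u₄ : A) (i : Fin 6) :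
    (e.scale u₁ u₂ u₃ u₄).image i = u₁ * u₂ * u₃ * e.image i := by
  fin_cases i <;> simp [image, scale] <;> ring

variable {L : Type} [Field L]

theorem span_eq_top_iff {n : ℕ} {v : Fin n → L} :
    Ideal.span (Set.range v) = ⊤ ↔ ∃ i, v i ≠ 0 := by
  constructor
  · intro h
    by_contra! hcon
    have : v = 0 := funext hcon
    subst this
    have h1 : (1 : L) ∈ Ideal.span (Set.range (0 : Fin n → L)) := h.ge trivial
    obtain ⟨α, hα⟩ := Ideal.mem_span_range_iff_exists_fun.1 h1
    simp at hα
  · rintro ⟨i, hi⟩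
    exact Ideal.eq_top_of_isUnit_mem _ (Ideal.subset_span ⟨i, rfl⟩) (isUnit_iff_ne_zero.2 hi)

theorem isUni_iff {e : ETuple L} : e.IsUni ↔
    (e.l0 ≠ 0 ∨ e.l1 ≠ 0 ∨ e.t * (e.r * e.P) ≠ 0) ∧
    (e.x0 ≠ 0 ∨ e.x1 ≠ 0 ∨ e.t * e.a ≠ 0 ∨ e.t * e.b ≠ 0) ∧
    (e.r * e.P ≠ 0 ∨ e.a ≠ 0 ∨ e.b ≠ 0) ∧ (e.P ≠ 0 ∨ e.c ≠ 0 ∨ e.d ≠ 0) := by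
  have h3 : ∀ {v : Fin 3 → L}, (∃ i, v i ≠ 0) ↔ v 0 ≠ 0 ∨ v 1 ≠ 0 ∨ v 2 ≠ 0 := by
    intro v
    rw [Fin.exists_fin_succ, Fin.exists_fin_two]
    rfl
  have h4 : ∀ {v : Fin 4 → L}, (∃ i, v i ≠ 0) ↔ v 0 ≠ 0 ∨ v 1 ≠ 0 ∨ v 2 ≠ 0 ∨ v 3 ≠ 0 := by
    intro v
    rw [Fin.exists_fin_succ, Fin.exists_fin_succ, Fin.exists_fin_two]
    rfl
  constructor
  · rintro ⟨⟨hl, hx, hw⟩, hz⟩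
    exact ⟨h3.1 (span_eq_top_iff.1 hl), h4.1 (span_eq_top_iff.1 hx), h3.1 (span_eq_top_iff.1 hw),
      h3.1 (span_eq_top_iff.1 hz)⟩
  · rintro ⟨hl, hx, hw, hz⟩
    exact ⟨⟨span_eq_top_iff.2 (h3.2 hl), span_eq_top_iff.2 (h4.2 hx), span_eq_top_iff.2 (h3.2 hw)⟩,
      span_eq_top_iff.2 (h3.2 hz)⟩

theorem IsUni.scale {e : ETuple L} (he : e.IsUni) {u₁ u₂ u₃ u₄ : L} (h₁ : u₁ ≠ 0) (h₂ : u₂ ≠ 0)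
    (h₃ : u₃ ≠ 0) (h₄ : u₄ ≠ 0) : (e.scale u₁ u₂ u₃ u₄).IsUni := by
  rw [isUni_iff] at he ⊢
  simpa [ETuple.scale, h₁, h₂, h₃, h₄] using he

/-- A polynomial vector that does not vanish at `0` and `1` generates an ideal containing a
polynomial that does not vanish at `0` and `1`. -/
theorem exists_mem_span {n : ℕ} {v : Fin n → L[X]}
    (h₀ : Ideal.span (Set.range (evalRingHom 0 ∘ v)) = ⊤)
    (h₁ : Ideal.span (Set.range (evalRingHom 1 ∘ v)) = ⊤) :
    ∃ g ∈ Ideal.span (Set.range v), g.eval 0 ≠ 0 ∧ g.eval 1 ≠ 0 := by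
  obtain ⟨i, hi⟩ := span_eq_top_iff.1 h₀
  obtain ⟨j, hj⟩ := span_eq_top_iff.1 h₁
  refine ⟨(1 - X) * v i + X * v j, Ideal.add_mem _ (Ideal.mul_mem_left _ _ (Ideal.subset_span
    ⟨i, rfl⟩)) (Ideal.mul_mem_left _ _ (Ideal.subset_span ⟨j, rfl⟩)), ?_, ?_⟩
  · simpa using hi
  · simpa using hj

theorem span_map_away {n : ℕ} {v : Fin n → L[X]} {g : L[X]} (φ : L[X] →+* A) (hφ : IsUnit (φ g))
    {g' : L[X]} (hg' : g' ∣ g) (h : g' ∈ Ideal.span (Set.range v)) :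
    Ideal.span (Set.range (φ ∘ v)) = ⊤ := by
  obtain ⟨k, rfl⟩ := hg'
  rw [Set.range_comp, ← Ideal.map_span]
  refine Ideal.eq_top_of_isUnit_mem _ (Ideal.mem_map_of_mem φ h) ?_
  rw [map_mul] at hφ
  exact isUnit_of_mul_isUnit_left hφ

theorem exists_isUni_away {E : ETuple L[X]} (h₀ : (E.map (evalRingHom 0)).IsUni)
    (h₁ : (E.map (evalRingHom 1)).IsUni) : ∃ g : L[X], g.eval 0 ≠ 0 ∧ g.eval 1 ≠ 0 ∧
      (E.map (algebraMap L[X] (Localization.Away g))).IsUni := by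
  have hl₀ := h₀.toH.hl
  have hl₁ := h₁.toH.hl
  have hx₀ := h₀.toH.hx
  have hx₁ := h₁.toH.hx
  have hw₀ := h₀.toH.hw
  have hw₁ := h₁.toH.hw
  have hz₀ := h₀.hz
  have hz₁ := h₁.hz
  rw [toH_map, HTuple.map_l] at hl₀ hl₁
  rw [toH_map, HTuple.map_x] at hx₀ hx₁
  rw [toH_map, HTuple.map_w] at hw₀ hw₁
  rw [map_z] at hz₀ hz₁
  obtain ⟨gl, hgl, gl₀, gl₁⟩ := exists_mem_span hl₀ hl₁
  obtain ⟨gx, hgx, gx₀, gx₁⟩ := exists_mem_span hx₀ hx₁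
  obtain ⟨gw, hgw, gw₀, gw₁⟩ := exists_mem_span hw₀ hw₁
  obtain ⟨gz, hgz, gz₀, gz₁⟩ := exists_mem_span hz₀ hz₁
  refine ⟨gl * (gx * (gw * gz)), ?_, ?_, ?_⟩
  · simp [*]
  · simp [*]
  · have hu := IsLocalization.Away.algebraMap_isUnit
      (S := Localization.Away (gl * (gx * (gw * gz)))) (gl * (gx * (gw * gz)))
    refine ⟨⟨?_, ?_, ?_⟩, ?_⟩
    · rw [toH_map, HTuple.map_l]
      exact span_map_away _ hu ⟨_, rfl⟩ hgl
    · rw [toH_map, HTuple.map_x]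
      exact span_map_away _ hu ⟨gl * (gw * gz), by ring⟩ hgx
    · rw [toH_map, HTuple.map_w]
      exact span_map_away _ hu ⟨gl * (gx * gz), by ring⟩ hgw
    · rw [map_z]
      exact span_map_away _ hu ⟨gl * (gx * gw), by ring⟩ hgz

theorem IsUni.map {B : Type} [CommRing B] {e : ETuple A} (h : e.IsUni) (φ : A →+* B) :
    (e.map φ).IsUni := by
  have key : ∀ {n : ℕ} {v : Fin n → A}, Ideal.span (Set.range v) = ⊤ →
      Ideal.span (Set.range (φ ∘ v)) = ⊤ := by
    intro n v hv
    rw [Set.range_comp, ← Ideal.map_span, hv, Ideal.map_top]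
  refine ⟨⟨?_, ?_, ?_⟩, ?_⟩
  · rw [toH_map, HTuple.map_l]
    exact key h.toH.hl
  · rw [toH_map, HTuple.map_x]
    exact key h.toH.hx
  · rw [toH_map, HTuple.map_w]
    exact key h.toH.hw
  · rw [map_z]
    exact key h.hz

end ETuple

namespace ERing

variable {A B : Type} [CommRing A] [Algebra ℂ A] [CommRing B] [Algebra ℂ B]

theorem span_of_isUni {e : ETuple A} (he : e.IsUni) (i : Fin 4) :
    Ideal.span ((hom e).toRingHom '' groups i) = ⊤ :=
  (forall_span_iff _).2 ((univ_map_hom e).symm ▸ he) i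

/-- The point with given coordinates. -/
def point (e : ETuple A) (he : e.IsUni) : Spec (CommRingCat.of A) ⟶ U.toScheme :=
  Uni.pt (hom e).toRingHom (span_of_isUni he)

theorem point_ι (e : ETuple A) (he : e.IsUni) :
    point e he ≫ U.ι = Spec.map (CommRingCat.ofHom (hom e).toRingHom) := Uni.pt_ι _ _

theorem point_str (e : ETuple A) (he : e.IsUni) :
    point e he ≫ U.ι ≫ Spec.map (CommRingCat.ofHom (algebraMap ℂ ERing)) =
      Spec.map (CommRingCat.ofHom (algebraMap ℂ A)) := by
  rw [← Category.assoc, point_ι, ← Spec.map_comp, ← CommRingCat.ofHom_comp]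
  congr 2
  exact (hom e).comp_algebraMap

theorem specMap_point (e : ETuple A) (he : e.IsUni) (φ : A →+* B)
    (hφ : φ.comp (algebraMap ℂ A) = algebraMap ℂ B) {e' : ETuple B} (h : e.map φ = e')
    (he' : e'.IsUni) : Spec.map (CommRingCat.ofHom φ) ≫ point e he = point e' he' := by
  subst h
  rw [← cancel_mono U.ι, Category.assoc, point_ι, point_ι, ← Spec.map_comp,
    ← CommRingCat.ofHom_comp]
  congr 2
  let φ' : A →ₐ[ℂ] B := { φ with commutes' := fun c => DFunLike.congr_fun hφ c }
  have : φ'.comp (hom e) = hom (e.map φ) := by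
    refine algHom_ext ?_
    rw [univ_map_hom]
    conv_rhs => rw [← univ_map_hom e]
    rfl
  exact congrArg AlgHom.toRingHom this

end ERing

/-- The morphism `F` is determined by `λ` and the homogeneous coordinates `v`. -/
structure IsCoord {Yt Z : Scheme.{0}} (q : ERing.U.toScheme ⟶ Yt) (F : Yt ⟶ Z) {n : ℕ}
    (v : ∀ {A : Type} [CommRing A], ETuple A → Fin n → A) : Prop where
  map : ∀ {A B : Type} [CommRing A] [CommRing B] (e : ETuple A) (φ : A →+* B),
    v (e.map φ) = φ ∘ v e
  scale : ∀ {A : Type} [CommRing A] (e : ETuple A) (u₁ u₂ u₃ u₄ : A),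
    ∃ c, ∀ i, v (e.scale u₁ u₂ u₃ u₄) i = c * v e i
  hom_ext : ∀ {A : Type} [CommRing A] [Algebra ℂ A] {e e' : ETuple A} (he : e.IsUni)
    (he' : e'.IsUni), (∀ i j, e.l i * e'.l j = e.l j * e'.l i) →
    (∀ i j, v e i * v e' j = v e j * v e' i) →
    ERing.point e he ≫ q ≫ F = ERing.point e' he' ≫ q ≫ F

section Conn

variable {Yt Z : Scheme.{0}} {q : ERing.U.toScheme ⟶ Yt} {F : Yt ⟶ Z} {n : ℕ}
  {v : ∀ {A : Type} [CommRing A], ETuple A → Fin n → A} {L : Type} [Field L] [Algebra ℂ L]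

variable (q F) in
/-- Two points are connected by a chain of rational curves in a fibre of `F`. -/
def Conn (e e' : ETuple L) : Prop :=
  ∀ he he', Relation.EqvGen (Linked F) (ERing.point e he ≫ q) (ERing.point e' he' ≫ q)

theorem Conn.symm {e e' : ETuple L} (h : Conn q F e e') : Conn q F e' e :=
  fun he he' => (h he' he).symm

theorem Conn.trans {e e' e'' : ETuple L} (h : Conn q F e e') (he' : e'.IsUni)
    (h' : Conn q F e' e'') : Conn q F e e'' :=
  fun he he'' => (h he he').trans _ _ _ (h' he' he'')

theorem IsCoord.conn_of_path (hF : IsCoord q F v) (E : ETuple L[X]) {e e' : ETuple L}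
    (h₀ : E.map (evalRingHom 0) = e) (h₁ : E.map (evalRingHom 1) = e')
    (hl : ∃ c, ∀ i, E.l i = c * C (e.l i)) (hv : ∃ c, ∀ i, v E i = c * C (v e i)) :
    Conn q F e e' := by
  intro he he'
  refine Relation.EqvGen.rel _ _ ?_
  obtain ⟨g, hg₀, hg₁, hE⟩ := ETuple.exists_isUni_away (E := E) (h₀ ▸ he) (h₁ ▸ he')
  have hA : (algebraMap L[X] (Localization.Away g)).comp (algebraMap ℂ L[X]) =
      algebraMap ℂ (Localization.Away g) := (IsScalarTower.algebraMap_eq _ _ _).symm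
  have hCL : (C : L →+* L[X]).comp (algebraMap ℂ L) = algebraMap ℂ L[X] := rfl
  have key : ∀ (s : L) (hs : g.eval s ≠ 0), ∃ φ : Localization.Away g →+* L,
      φ.comp (algebraMap L[X] _) = evalRingHom s ∧
      φ.comp (algebraMap ℂ (Localization.Away g)) = algebraMap ℂ L := by
    intro s hs
    have hu : IsUnit (evalRingHom s g) := isUnit_iff_ne_zero.2 hs
    refine ⟨IsLocalization.Away.lift g hu, IsLocalization.Away.lift_comp g hu, ?_⟩
    rw [← hA, ← RingHom.comp_assoc, IsLocalization.Away.lift_comp, ← hCL]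
    ext
    simp
  obtain ⟨φ₀, hφ₀, hφ₀'⟩ := key 0 hg₀
  obtain ⟨φ₁, hφ₁, hφ₁'⟩ := key 1 hg₁
  refine ⟨g, ERing.point _ hE ≫ q, φ₀, φ₁, hφ₀, hφ₁, ?_, ?_, ?_⟩
  · rw [← Category.assoc, ERing.specMap_point _ hE φ₀ hφ₀' (e' := e) ?_ he]
    rw [← h₀, ← hφ₀]
    rfl
  · rw [← Category.assoc, ERing.specMap_point _ hE φ₁ hφ₁' (e' := e') ?_ he']
    rw [← h₁, ← hφ₁]
    rfl
  · have h3 : ((algebraMap L[X] (Localization.Away g)).comp C).comp (algebraMap ℂ L) =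
        algebraMap ℂ (Localization.Away g) := by
      rw [RingHom.comp_assoc, hCL, hA]
    rw [Category.assoc, Category.assoc, ← Category.assoc (Spec.map _),
      ERing.specMap_point e he _ h3 rfl (he.map _)]
    refine hF.hom_ext _ _ ?_ ?_
    · obtain ⟨c, hc⟩ := hl
      intro i j
      simp only [ETuple.map_l, Function.comp_apply, hc, RingHom.comp_apply, map_mul]
      ring
    · obtain ⟨c, hc⟩ := hv
      intro i j
      simp only [hF.map, Function.comp_apply, hc, RingHom.comp_apply, map_mul]
      ring

theorem IsCoord.conn_scale (hF : IsCoord q F v) (e : ETuple L) (u₁ u₂ u₃ u₄ : L) :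
    Conn q F e (e.scale u₁ u₂ u₃ u₄) := by
  let p (u : L) : L[X] := 1 - X + X * C u
  have hp₀ : ∀ u, (p u).eval 0 = 1 := fun u => by simp [p]
  have hp₁ : ∀ u, (p u).eval 1 = u := fun u => by simp [p]
  refine hF.conn_of_path ((e.map C).scale (p u₁) (p u₂) (p u₃) (p u₄)) ?_ ?_ ?_ ?_
  · ext <;> simp [ETuple.map, ETuple.scale, hp₀]
  · ext <;> simp [ETuple.map, ETuple.scale, hp₁]
  · exact ⟨_, fun i => by rw [ETuple.scale_l, ETuple.map_l]; rfl⟩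
  · obtain ⟨c, hc⟩ := hF.scale (e.map C) (p u₁) (p u₂) (p u₃) (p u₄)
    exact ⟨c, fun i => by rw [hc, hF.map]; rfl⟩

end Conn

namespace IsParam

variable {Yt : Scheme.{0}} {ψ : Yt ⟶ Y} {q : ERing.U.toScheme ⟶ Yt} (h : IsParam ψ q)

include h

theorem exists_eq_point {L : Type} [Field L] [Algebra ℂ L] (p : Spec (CommRingCat.of L) ⟶ Yt)
    (hp : p ≫ ψ ≫ BiProj.str eqY = Spec.map (CommRingCat.ofHom (algebraMap ℂ L))) :
    ∃ e he, p = ERing.point e he ≫ q := by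
  let y : PrimeSpectrum L := ⊥
  obtain ⟨B, _, k, hk, hy, f, hf, e⟩ := h.exists_section (p y)
  have hr : Set.range p ⊆ Set.range k := by
    rintro _ ⟨z, rfl⟩
    obtain rfl : z = y := Subsingleton.elim (α := PrimeSpectrum L) _ _
    exact hy
  obtain ⟨φ, hφ⟩ := Charts.exists_specMap (IsOpenImmersion.lift k p hr)
  have hfac : p = Spec.map (CommRingCat.ofHom φ) ≫ k := by
    rw [← hφ, IsOpenImmersion.lift_fac]
  have hfac' : p = Uni.pt (φ.comp f) (Uni.span_image_comp hf φ) ≫ q := by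
    rw [hfac, ← e, ← Category.assoc, Uni.specMap_pt f hf φ]
  have hstr : (φ.comp f).comp (algebraMap ℂ ERing) = algebraMap ℂ L := by
    have := hp
    rw [hfac', Category.assoc, h.str, ← Category.assoc, Uni.pt_ι, ← Spec.map_comp,
      ← CommRingCat.ofHom_comp] at this
    exact congrArg CommRingCat.Hom.hom (Spec.map_injective this)
  let f' : ERing →ₐ[ℂ] L := { φ.comp f with commutes' := fun c => DFunLike.congr_fun hstr c }
  have hu := (ERing.forall_span_iff _).1 (Uni.span_image_comp hf φ)
  refine ⟨ERing.univ.map (φ.comp f), hu, ?_⟩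
  have he : ERing.hom (ERing.univ.map (φ.comp f)) = f' := by
    refine ERing.algHom_ext ?_
    rw [ERing.univ_map_hom]
  rw [hfac']
  congr 1
  rw [← cancel_mono ERing.U.ι, Uni.pt_ι, ERing.point_ι, he]

theorem isPt_point {A : Type} [CommRing A] [Algebra ℂ A] (e : ETuple A) (he : e.IsUni) :
    IsPt ((ERing.point e he ≫ q ≫ ψ) ≫ incl eqY) e.l e.x := by
  have := h.isPt _ (ERing.span_of_isUni he)
  rw [ERing.univ_map_hom] at this
  simp only [Category.assoc] at this ⊢
  exact this

theorem isCoord : IsCoord q ψ (fun e => e.x) where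
  map e φ := e.map_x φ
  scale e u₁ u₂ u₃ u₄ := ⟨_, e.scale_x u₁ u₂ u₃ u₄⟩
  hom_ext he he' hl hx := by
    rw [← cancel_mono (incl eqY)]
    refine (h.isPt_point _ he).hom_ext (h.isPt_point _ he') ?_ hl hx
    have e1 := ERing.point_str _ he
    rw [← ERing.point_str _ he', ← h.str] at e1
    simpa only [BiProj.str, Category.assoc] using e1

variable {g : Yt ⟶ Q} (hg : q ≫ g = ERing.toQ)

include hg

omit h in
theorem isPt_point_lift {A : Type} [CommRing A] [Algebra ℂ A] (e : ETuple A) (he : e.IsUni) :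
    IsPt ((ERing.point e he ≫ q ≫ g) ≫ incl eqQ) e.l e.image := by
  have := ERing.isPt_toQ _ (ERing.span_of_isUni he)
  rw [ERing.univ_map_hom, ← hg] at this
  simp only [Category.assoc] at this ⊢
  exact this

theorem isCoord_lift : IsCoord q g (fun e => e.image) where
  map e φ := e.map_image φ
  scale e u₁ u₂ u₃ u₄ := ⟨_, e.scale_image u₁ u₂ u₃ u₄⟩
  hom_ext he he' hl hx := by
    rw [← cancel_mono (incl eqQ)]
    refine (isPt_point_lift hg _ he).hom_ext (isPt_point_lift hg _ he') ?_ hl hx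
    have e1 := ERing.point_str _ he
    rw [← ERing.point_str _ he', ← h.str, ← h.lift_str hg] at e1
    simpa only [BiProj.str, Category.assoc] using e1

end IsParam

end Example

/-! ### Points in the fibres of `ψ` and of the extension of `φ` -/

namespace Example

open BiProj Blow ZeroCycle Polynomial

namespace ETuple

variable {L : Type} [Field L]

theorem exists_l_x {l : Fin 3 → L} {x : Fin 4 → L} (hl : ∃ i, l i ≠ 0) (hx : ∃ i, x i ≠ 0)
    (h : yEq l x = 0) : ∃ e : ETuple L, e.IsUni ∧ e.l = l ∧ e.x = x := by
  have hext : ∀ e : ETuple L, e.l0 = l 0 → e.l1 = l 1 → e.t * (e.r * e.P) = l 2 → e.x0 = x 0 →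
      e.x1 = x 1 → e.t * e.a = x 2 → e.t * e.b = x 3 → (e.r * e.P ≠ 0 ∨ e.a ≠ 0 ∨ e.b ≠ 0) →
      (e.P ≠ 0 ∨ e.c ≠ 0 ∨ e.d ≠ 0) → ∃ e : ETuple L, e.IsUni ∧ e.l = l ∧ e.x = x := by
    intro e h0 h1 h2 k0 k1 k2 k3 hw hz
    have el : e.l = l := by
      ext i; fin_cases i
      exacts [h0, h1, h2]
    have ex : e.x = x := by
      ext i; fin_cases i
      exacts [k0, k1, k2, k3]
    refine ⟨e, ⟨⟨?_, ?_, ?_⟩, ?_⟩, el, ex⟩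
    · exact span_eq_top_iff.2 (el.symm ▸ hl : ∃ i, e.l i ≠ 0)
    · exact span_eq_top_iff.2 (ex.symm ▸ hx : ∃ i, e.x i ≠ 0)
    · rcases hw with hw | hw | hw
      exacts [span_eq_top_iff.2 ⟨0, hw⟩, span_eq_top_iff.2 ⟨1, hw⟩, span_eq_top_iff.2 ⟨2, hw⟩]
    · rcases hz with hz | hz | hz
      exacts [span_eq_top_iff.2 ⟨0, hz⟩, span_eq_top_iff.2 ⟨1, hz⟩, span_eq_top_iff.2 ⟨2, hz⟩]
  rw [yEq] at h
  by_cases hw : l 2 ≠ 0 ∨ x 2 ≠ 0 ∨ x 3 ≠ 0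
  · by_cases hz : l 2 ≠ 0 ∨ l 1 * x 2 ≠ 0 ∨ (l 0 - l 1) * x 3 ≠ 0
    · refine hext ⟨l 0, l 1, x 0, x 1, 1, x 2, x 3, 1, l 2, l 1 * x 2, (l 0 - l 1) * x 3, by ring,
        by ring, by linear_combination h⟩ rfl rfl ?_ rfl rfl ?_ ?_ ?_ hz
      · simp
      · simp
      · simp
      · simpa using hw
    · push Not at hz
      obtain ⟨h2, h3, h4⟩ := hz
      refine hext ⟨l 0, l 1, x 0, x 1, 1, x 2, x 3, 0, 0, 0, 1, by rw [h3]; ring,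
        by rw [h4]; ring, by linear_combination h4⟩ rfl rfl ?_ rfl rfl ?_ ?_ ?_ ?_
      · simp [h2]
      · simp
      · simp
      · simpa [h2] using hw
      · simp
  · push Not at hw
    obtain ⟨h2, h3, h4⟩ := hw
    by_cases h1 : l 1 = 0
    · refine hext ⟨l 0, l 1, x 0, x 1, 0, 1, 0, 0, 0, 1, 0, by rw [h1], by ring, by ring⟩
        rfl rfl ?_ rfl rfl ?_ ?_ ?_ ?_ <;> simp [*]
    · refine hext ⟨l 0, l 1, x 0, x 1, 0, 1, 0, 1, 0, l 1, 0, by ring, by ring, by ring⟩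
        rfl rfl ?_ rfl rfl ?_ ?_ ?_ ?_ <;> simp [*]

/-- Solutions of `λ₁ a = r c` and `(λ₀ - λ₁) b = r d`. -/
theorem exists_abr (l0 l1 c d : L) : ∃ a b r : L, l1 * a = r * c ∧ (l0 - l1) * b = r * d ∧
    (r ≠ 0 ∨ a ≠ 0 ∨ b ≠ 0) ∧ (c ≠ 0 ∨ d ≠ 0 → a ≠ 0 ∨ b ≠ 0) := by
  by_cases h1 : l1 = 0
  · exact ⟨1, 0, 0, by simp [h1], by simp, by simp, by simp⟩
  by_cases h2 : l0 - l1 = 0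
  · exact ⟨0, 1, 0, by simp, by simp [h2], by simp, by simp⟩
  refine ⟨c / l1, d / (l0 - l1), 1, by field_simp, by field_simp, by simp, ?_⟩
  simp [h1, h2]

theorem exists_l_image {l : Fin 3 → L} {z : Fin 6 → L} (hl : ∃ i, l i ≠ 0) (hz : ∃ i, z i ≠ 0)
    (h : (l 0 - l 1) * z 3 = l 2 * z 5 ∧ l 1 * z 2 = l 2 * z 4 ∧ qEq l z = 0) :
    ∃ e : ETuple L, e.IsUni ∧ e.l = l ∧ e.image = z := by
  have hext : ∀ e : ETuple L, e.l0 = l 0 → e.l1 = l 1 → e.t * (e.r * e.P) = l 2 →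
      e.P * e.x0 = z 0 → e.P * e.x1 = z 1 → e.P * (e.t * e.a) = z 2 → e.P * (e.t * e.b) = z 3 →
      e.c = z 4 → e.d = z 5 →
      (e.x0 ≠ 0 ∨ e.x1 ≠ 0 ∨ e.t * e.a ≠ 0 ∨ e.t * e.b ≠ 0) →
      (e.r * e.P ≠ 0 ∨ e.a ≠ 0 ∨ e.b ≠ 0) → (e.P ≠ 0 ∨ e.c ≠ 0 ∨ e.d ≠ 0) →
      ∃ e : ETuple L, e.IsUni ∧ e.l = l ∧ e.image = z := by
    intro e h0 h1 h2 k0 k1 k2 k3 k4 k5 hx hw hz'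
    have el : e.l = l := by
      ext i; fin_cases i
      exacts [h0, h1, h2]
    refine ⟨e, isUni_iff.2 ⟨?_, hx, hw, hz'⟩, el, ?_⟩
    · rw [h0, h1, h2]
      obtain ⟨i, hi⟩ := hl
      fin_cases i
      exacts [Or.inl hi, Or.inr (Or.inl hi), Or.inr (Or.inr hi)]
    · ext i; fin_cases i
      exacts [k0, k1, k2, k3, k4, k5]
  obtain ⟨e1, e2, e3⟩ := h
  rw [qEq] at e3
  by_cases hP : z 0 ≠ 0 ∨ z 1 ≠ 0 ∨ z 2 ≠ 0 ∨ z 3 ≠ 0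
  · by_cases hw : l 2 ≠ 0 ∨ z 2 ≠ 0 ∨ z 3 ≠ 0
    · refine hext ⟨l 0, l 1, z 0, z 1, 1, z 2, z 3, l 2, 1, z 4, z 5, e2, e1,
        by linear_combination e3 + z 5 * e1⟩ rfl rfl ?_ ?_ ?_ ?_ ?_ rfl rfl ?_ ?_ ?_
      all_goals first | simp; done | skip
      · simpa using hP
      · simpa using hw
    · push Not at hw
      obtain ⟨h2, h3, h4⟩ := hw
      obtain ⟨a, b, r, ha, hb, hab, -⟩ := exists_abr (l 0) (l 1) (z 4) (z 5)
      refine hext ⟨l 0, l 1, z 0, z 1, 0, a, b, r, 1, z 4, z 5, ha, hb, ?_⟩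
        rfl rfl ?_ ?_ ?_ ?_ ?_ rfl rfl ?_ ?_ ?_
      · rw [h2, h3, h4] at e3
        linear_combination e3
      all_goals first | (simp [h2, h3, h4]; done) | skip
      · simpa [h3, h4] using hP
      · simpa using hab
  · push Not at hP
    obtain ⟨h0, h1, h2, h3⟩ := hP
    have hcd : z 4 ≠ 0 ∨ z 5 ≠ 0 := by
      obtain ⟨i, hi⟩ := hz
      fin_cases i
      exacts [(hi h0).elim, (hi h1).elim, (hi h2).elim, (hi h3).elim, Or.inl hi, Or.inr hi]
    have hl2 : l 2 = 0 := by
      rw [h3, mul_zero] at e1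
      rw [h2, mul_zero] at e2
      rcases hcd with h | h
      · exact (mul_eq_zero.1 e2.symm).resolve_right h
      · exact (mul_eq_zero.1 e1.symm).resolve_right h
    obtain ⟨a, b, r, ha, hb, -, hab⟩ := exists_abr (l 0) (l 1) (z 4) (z 5)
    refine hext ⟨l 0, l 1, 1, 0, 0, a, b, r, 0, z 4, z 5, ha, hb, by ring⟩
      rfl rfl ?_ ?_ ?_ ?_ ?_ rfl rfl ?_ ?_ ?_
    all_goals simp [*]

end ETuple

section Links

variable {Yt Z : Scheme.{0}} {q : ERing.U.toScheme ⟶ Yt} {F : Yt ⟶ Z} {L : Type} [Field L]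
  [Algebra ℂ L]

section Psi

variable (hF : IsCoord q F fun e => e.x)

include hF

/-- A chain of rational curves in a fibre of `ψ` along which only `z` moves. -/
theorem conn_of_z {e e' : ETuple L} (h0 : e.l0 = e'.l0) (h1 : e.l1 = e'.l1) (hx0 : e.x0 = e'.x0)
    (hx1 : e.x1 = e'.x1) (ht : e.t = e'.t) (ha : e.a = e'.a) (hb : e.b = e'.b) (hr : e.r = 0)
    (hr' : e'.r = 0) : Conn q F e e' := by
  let f := e.map C
  let f' := e'.map C
  have hr : f.r = 0 := by simp [f, ETuple.map, hr]
  have hr' : f'.r = 0 := by simp [f', ETuple.map, hr']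
  have g0 : f.l0 = f'.l0 := congrArg C h0
  have g1 : f.l1 = f'.l1 := congrArg C h1
  have gx0 : f.x0 = f'.x0 := congrArg C hx0
  have gx1 : f.x1 = f'.x1 := congrArg C hx1
  have gt : f.t = f'.t := congrArg C ht
  have ga : f.a = f'.a := congrArg C ha
  have gb : f.b = f'.b := congrArg C hb
  have r1 := f.r1
  have r2 := f.r2
  have r3 := f.r3
  have r3' := f'.r3
  rw [hr] at r1 r2 r3
  rw [hr', ← g0, ← g1, ← gx0, ← gx1, ← gt, ← ga, ← gb] at r3'
  let E : ETuple L[X] :=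
    { l0 := f.l0, l1 := f.l1, x0 := f.x0, x1 := f.x1, t := f.t, a := f.a, b := f.b, r := 0
      P := (1 - X) * f.P + X * f'.P, c := (1 - X) * f.c + X * f'.c
      d := (1 - X) * f.d + X * f'.d
      r1 := by linear_combination r1
      r2 := by linear_combination r2
      r3 := by linear_combination (1 - X) * r3 + X * r3' }
  refine hF.conn_of_path E ?_ ?_ ⟨1, fun i => ?_⟩ ⟨1, fun i => ?_⟩
  · ext <;> simp [E, f, f', ETuple.map, *]
  · ext <;> simp [E, f, f', ETuple.map, *]
  · fin_cases i <;> simp [E, f, f', ETuple.map, ETuple.l, ETuple.toH, HTuple.l, *]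
  · fin_cases i <;> simp [E, f, f', ETuple.map, ETuple.x, ETuple.toH, HTuple.x, *]

/-- A chain of rational curves in a fibre of `ψ` along which only `w` and `z` move. -/
theorem conn_of_w {e e' : ETuple L} (h0 : e.l0 = e'.l0) (h1 : e.l1 = e'.l1) (hx0 : e.x0 = e'.x0)
    (hx1 : e.x1 = e'.x1) (ht : e.t = 0) (ht' : e'.t = 0) (hr : e.r = 1)
    (hr' : e'.r = 1) : Conn q F e e' := by
  let f := e.map C
  let f' := e'.map C
  have hr : f.r = 1 := by simp [f, ETuple.map, hr]
  have hr' : f'.r = 1 := by simp [f', ETuple.map, hr']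
  have ht : f.t = 0 := by simp [f, ETuple.map, ht]
  have ht' : f'.t = 0 := by simp [f', ETuple.map, ht']
  have g0 : f.l0 = f'.l0 := congrArg C h0
  have g1 : f.l1 = f'.l1 := congrArg C h1
  have gx0 : f.x0 = f'.x0 := congrArg C hx0
  have gx1 : f.x1 = f'.x1 := congrArg C hx1
  have r1 := f.r1
  have r2 := f.r2
  have r3 := f.r3
  have r1' := f'.r1
  have r2' := f'.r2
  have r3' := f'.r3
  rw [hr] at r1 r2 r3
  rw [ht] at r3
  rw [hr', ← g1] at r1'
  rw [hr', ← g0, ← g1] at r2'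
  rw [hr', ht', ← g0, ← g1, ← gx0, ← gx1] at r3'
  let E : ETuple L[X] :=
    { l0 := f.l0, l1 := f.l1, x0 := f.x0, x1 := f.x1, t := 0, r := 1
      a := (1 - X) * f.a + X * f'.a, b := (1 - X) * f.b + X * f'.b
      P := (1 - X) * f.P + X * f'.P, c := (1 - X) * f.c + X * f'.c
      d := (1 - X) * f.d + X * f'.d
      r1 := by linear_combination (1 - X) * r1 + X * r1'
      r2 := by linear_combination (1 - X) * r2 + X * r2'
      r3 := by linear_combination (1 - X) * r3 + X * r3' }
  refine hF.conn_of_path E ?_ ?_ ⟨1, fun i => ?_⟩ ⟨1, fun i => ?_⟩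
  · ext <;> simp [E, f, f', ETuple.map, *]
  · ext <;> simp [E, f, f', ETuple.map, *]
  · fin_cases i <;> simp [E, f, f', ETuple.map, ETuple.l, ETuple.toH, HTuple.l, *]
  · fin_cases i <;> simp [E, f, f', ETuple.map, ETuple.x, ETuple.toH, HTuple.x, *]

/-- A rational curve in a fibre of `ψ` along which `a`, `b` and `r` move. -/
theorem conn_of_kernel {e e' : ETuple L} (h0 : e.l0 = e'.l0) (h1 : e.l1 = e'.l1)
    (hx0 : e.x0 = e'.x0) (hx1 : e.x1 = e'.x1) (ht : e.t = 0) (ht' : e'.t = 0) (hP : e.P = e'.P)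
    (hc : e.c = e'.c) (hd : e.d = e'.d) (hr' : e'.r = 0) : Conn q F e e' := by
  let f := e.map C
  let f' := e'.map C
  have hr' : f'.r = 0 := by simp [f', ETuple.map, hr']
  have ht : f.t = 0 := by simp [f, ETuple.map, ht]
  have ht' : f'.t = 0 := by simp [f', ETuple.map, ht']
  have g0 : f.l0 = f'.l0 := congrArg C h0
  have g1 : f.l1 = f'.l1 := congrArg C h1
  have r1 := f.r1
  have r2 := f.r2
  have r3 := f.r3
  have r1' := f'.r1
  have r2' := f'.r2
  rw [ht] at r3
  rw [hr', ← g1] at r1'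
  rw [hr', ← g0, ← g1] at r2'
  let E : ETuple L[X] :=
    { l0 := f.l0, l1 := f.l1, x0 := f.x0, x1 := f.x1, t := 0, r := (1 - X) * f.r
      a := (1 - X) * f.a + X * f'.a, b := (1 - X) * f.b + X * f'.b
      P := f.P, c := f.c, d := f.d
      r1 := by linear_combination (1 - X) * r1 + X * r1'
      r2 := by linear_combination (1 - X) * r2 + X * r2'
      r3 := by linear_combination r3 }
  refine hF.conn_of_path E ?_ ?_ ⟨1, fun i => ?_⟩ ⟨1, fun i => ?_⟩
  · ext <;> simp [E, f, f', ETuple.map, *]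
  · ext <;> simp [E, f, f', ETuple.map, *]
  · fin_cases i <;> simp [E, f, f', ETuple.map, ETuple.l, ETuple.toH, HTuple.l, *]
  · fin_cases i <;> simp [E, f, f', ETuple.map, ETuple.x, ETuple.toH, HTuple.x, *]

/-- Points of a fibre of `ψ` with equal `t ≠ 0` are connected. -/
theorem conn_of_t_eq {e e' : ETuple L} (he : e.IsUni) (he' : e'.IsUni) (h0 : e.l0 = e'.l0)
    (h1 : e.l1 = e'.l1) (hx0 : e.x0 = e'.x0) (hx1 : e.x1 = e'.x1) (ht : e.t = e'.t)
    (ha : e.a = e'.a) (hb : e.b = e'.b) (hP : e.r * e.P = e'.r * e'.P) : Conn q F e e' := by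
  obtain ⟨-, -, -, hz⟩ := ETuple.isUni_iff.1 he
  obtain ⟨-, -, -, hz'⟩ := ETuple.isUni_iff.1 he'
  have hc : e.r * e.c = e'.r * e'.c := by rw [← e.r1, ← e'.r1, h1, ha]
  have hd : e.r * e.d = e'.r * e'.d := by rw [← e.r2, ← e'.r2, h0, h1, hb]
  by_cases hr : e.r = 0
  · have hr' : e'.r = 0 := by
      rw [hr, zero_mul] at hP hc hd
      rcases hz' with h | h | h
      exacts [(mul_eq_zero.1 hP.symm).resolve_right h, (mul_eq_zero.1 hc.symm).resolve_right h,
        (mul_eq_zero.1 hd.symm).resolve_right h]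
    exact conn_of_z hF h0 h1 hx0 hx1 ht ha hb hr hr'
  · have hr' : e'.r ≠ 0 := by
      intro hr'
      rw [hr', zero_mul] at hP hc hd
      rcases hz with h | h | h
      exacts [hr ((mul_eq_zero.1 hP).resolve_right h), hr ((mul_eq_zero.1 hc).resolve_right h),
        hr ((mul_eq_zero.1 hd).resolve_right h)]
    have key : e = e'.scale (e'.r / e.r) 1 1 (e.r / e'.r) := by
      have hu : e'.r / e.r * (e.r / e'.r) = 1 := by field_simp
      ext <;> simp only [ETuple.scale, mul_one, one_mul, hu]
      · exact h0
      · exact h1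
      · exact hx0
      · exact hx1
      · exact ht
      · exact ha
      · exact hb
      · field_simp
      · field_simp; linear_combination hP
      · field_simp; linear_combination hc
      · field_simp; linear_combination hd
    rw [key]
    exact (hF.conn_scale e' _ _ _ _).symm

/-- Points of a fibre of `ψ` with `t = 0` are connected. -/
theorem conn_of_t_eq_zero {e e' : ETuple L} (he : e.IsUni) (he' : e'.IsUni) (h0 : e.l0 = e'.l0)
    (h1 : e.l1 = e'.l1) (hx0 : e.x0 = e'.x0) (hx1 : e.x1 = e'.x1) (ht : e.t = 0)
    (ht' : e'.t = 0) : Conn q F e e' := by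
  have hu := ETuple.isUni_iff.1 he
  have hu' := ETuple.isUni_iff.1 he'
  by_cases hker : ∃ a b : L, e.l1 * a = 0 ∧ (e.l0 - e.l1) * b = 0 ∧ (a ≠ 0 ∨ b ≠ 0)
  · obtain ⟨a, b, ha, hb, hab⟩ := hker
    have key : ∀ f : ETuple L, f.IsUni → f.l0 = e.l0 → f.l1 = e.l1 → f.t = 0 →
        ∃ g : ETuple L, g.IsUni ∧ Conn q F f g ∧ g.l0 = f.l0 ∧ g.l1 = f.l1 ∧ g.x0 = f.x0 ∧
          g.x1 = f.x1 ∧ g.t = 0 ∧ g.a = a ∧ g.b = b ∧ g.r = 0 := by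
      intro f hf f0 f1 ft
      have hf' := ETuple.isUni_iff.1 hf
      have r3 := f.r3
      rw [ft] at r3 hf'
      let g : ETuple L := ⟨f.l0, f.l1, f.x0, f.x1, 0, a, b, 0, f.P, f.c, f.d, by rw [f1, ha]; ring,
        by rw [f0, f1, hb]; ring, by linear_combination r3⟩
      refine ⟨g, ETuple.isUni_iff.2 ?_, conn_of_kernel hF rfl rfl rfl rfl ft rfl rfl rfl rfl rfl,
        rfl, rfl, rfl, rfl, rfl, rfl, rfl, rfl⟩
      simp only [zero_mul, ne_eq, not_true_eq_false, or_false] at hf'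
      simpa [g, hab] using ⟨hf'.1, hf'.2.1, hf'.2.2.2⟩
    obtain ⟨g, hg, hc, g0, g1, gx0, gx1, gt, ga, gb, gr⟩ := key e he rfl rfl ht
    obtain ⟨g', hg', hc', g0', g1', gx0', gx1', gt', ga', gb', gr'⟩ :=
      key e' he' h0.symm h1.symm ht'
    refine (hc.trans hg (conn_of_z hF ?_ ?_ ?_ ?_ ?_ ?_ ?_ gr gr')).trans hg' hc'.symm
    · rw [g0, g0', h0]
    · rw [g1, g1', h1]
    · rw [gx0, gx0', hx0]
    · rw [gx1, gx1', hx1]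
    · rw [gt, gt']
    · rw [ga, ga']
    · rw [gb, gb']
  · have hl1 : e.l1 ≠ 0 := fun h => hker ⟨1, 0, by simp [h], by simp, by simp⟩
    have hmu : e.l0 - e.l1 ≠ 0 := fun h => hker ⟨0, 1, by simp, by simp [h], by simp⟩
    have key : ∀ f : ETuple L, f.IsUni → f.l0 = e.l0 → f.l1 = e.l1 → f.r ≠ 0 := by
      intro f hf f0 f1 hr
      have r1 := f.r1
      have r2 := f.r2
      rw [hr, zero_mul, f1] at r1
      rw [hr, zero_mul, f0, f1] at r2
      have ha := (mul_eq_zero.1 r1).resolve_left hl1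
      have hb := (mul_eq_zero.1 r2).resolve_left hmu
      obtain ⟨-, -, hw, -⟩ := ETuple.isUni_iff.1 hf
      simp [hr, ha, hb] at hw
    have hr := key e he rfl rfl
    have hr' := key e' he' h0.symm h1.symm
    refine (hF.conn_scale e e.r 1 1 e.r⁻¹).trans (he.scale hr one_ne_zero one_ne_zero
      (inv_ne_zero hr)) (Conn.trans ?_ (he'.scale hr' one_ne_zero one_ne_zero
      (inv_ne_zero hr')) (hF.conn_scale e' e'.r 1 1 e'.r⁻¹).symm)
    refine conn_of_w hF ?_ ?_ ?_ ?_ ?_ ?_ ?_ ?_ <;> simp [ETuple.scale, *]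

theorem conn_psi {e e' : ETuple L} (he : e.IsUni) (he' : e'.IsUni) (hl : e.l = e'.l)
    (hx : e.x = e'.x) : Conn q F e e' := by
  have h0 : e.l0 = e'.l0 := congrFun hl 0
  have h1 : e.l1 = e'.l1 := congrFun hl 1
  have h2 : e.t * (e.r * e.P) = e'.t * (e'.r * e'.P) := congrFun hl 2
  have hx0 : e.x0 = e'.x0 := congrFun hx 0
  have hx1 : e.x1 = e'.x1 := congrFun hx 1
  have hx2 : e.t * e.a = e'.t * e'.a := congrFun hx 2
  have hx3 : e.t * e.b = e'.t * e'.b := congrFun hx 3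
  obtain ⟨-, -, hw, -⟩ := ETuple.isUni_iff.1 he
  obtain ⟨-, -, hw', -⟩ := ETuple.isUni_iff.1 he'
  by_cases ht : e.t = 0
  · have ht' : e'.t = 0 := by
      rw [ht, zero_mul] at h2 hx2 hx3
      rcases hw' with h | h | h
      exacts [(mul_eq_zero.1 h2.symm).resolve_right h, (mul_eq_zero.1 hx2.symm).resolve_right h,
        (mul_eq_zero.1 hx3.symm).resolve_right h]
    exact conn_of_t_eq_zero hF he he' h0 h1 hx0 hx1 ht ht'
  · have ht' : e'.t ≠ 0 := by
      intro ht'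
      rw [ht', zero_mul] at h2 hx2 hx3
      rcases hw with h | h | h
      exacts [ht ((mul_eq_zero.1 h2).resolve_right h), ht ((mul_eq_zero.1 hx2).resolve_right h),
        ht ((mul_eq_zero.1 hx3).resolve_right h)]
    have hu : e'.t / e.t ≠ 0 := div_ne_zero ht' ht
    have hs := he'.scale hu hu (div_ne_zero ht ht') one_ne_zero
    refine (conn_of_t_eq hF he hs ?_ ?_ ?_ ?_ ?_ ?_ ?_ ?_).trans hs (hF.conn_scale e' _ _ _ _).symm
    all_goals simp only [ETuple.scale]
    all_goals field_simp
    · exact h0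
    · exact h1
    · exact hx0
    · exact hx1
    · linear_combination hx2
    · linear_combination hx3
    · linear_combination h2

end Psi

section Phi

variable (hF : IsCoord q F fun e => e.image)

include hF

/-- A rational curve in a fibre of the extension of `φ` along which `a`, `b` and `r` move. -/
theorem conn_of_abr {e e' : ETuple L} (h0 : e.l0 = e'.l0) (h1 : e.l1 = e'.l1)
    (hx0 : e.x0 = e'.x0) (hx1 : e.x1 = e'.x1) (ht : e.t = 0) (ht' : e'.t = 0) (hP : e.P = e'.P)
    (hc : e.c = e'.c) (hd : e.d = e'.d) : Conn q F e e' := by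
  let f := e.map C
  let f' := e'.map C
  have ht : f.t = 0 := by simp [f, ETuple.map, ht]
  have ht' : f'.t = 0 := by simp [f', ETuple.map, ht']
  have g0 : f.l0 = f'.l0 := congrArg C h0
  have g1 : f.l1 = f'.l1 := congrArg C h1
  have gc : f.c = f'.c := congrArg C hc
  have gd : f.d = f'.d := congrArg C hd
  have r1 := f.r1
  have r2 := f.r2
  have r3 := f.r3
  have r1' := f'.r1
  have r2' := f'.r2
  rw [ht] at r3
  rw [← g1, ← gc] at r1'
  rw [← g0, ← g1, ← gd] at r2'
  let E : ETuple L[X] :=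
    { l0 := f.l0, l1 := f.l1, x0 := f.x0, x1 := f.x1, t := 0, r := (1 - X) * f.r + X * f'.r
      a := (1 - X) * f.a + X * f'.a, b := (1 - X) * f.b + X * f'.b
      P := f.P, c := f.c, d := f.d
      r1 := by linear_combination (1 - X) * r1 + X * r1'
      r2 := by linear_combination (1 - X) * r2 + X * r2'
      r3 := by linear_combination r3 }
  refine hF.conn_of_path E ?_ ?_ ⟨1, fun i => ?_⟩ ⟨1, fun i => ?_⟩
  · ext <;> simp [E, f, f', ETuple.map, *]
  · ext <;> simp [E, f, f', ETuple.map, *]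
  · fin_cases i <;> simp [E, f, f', ETuple.map, ETuple.l, ETuple.toH, HTuple.l, *]
  · fin_cases i <;> simp [E, f, f', ETuple.map, ETuple.image, *]

/-- A rational curve in a fibre of the extension of `φ` along which `x` moves. -/
theorem conn_of_x {e e' : ETuple L} (h0 : e.l0 = e'.l0) (h1 : e.l1 = e'.l1)
    (hx0 : e'.x0 = 1) (hx1 : e'.x1 = 0) (ht' : e'.t = 0) (ha : e.a = e'.a) (hb : e.b = e'.b)
    (hr : e.r = e'.r) (hP : e.P = 0) (hP' : e'.P = 0) (hc : e.c = e'.c) (hd : e.d = e'.d) :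
    Conn q F e e' := by
  let f := e.map C
  have hP : f.P = 0 := by simp [f, ETuple.map, hP]
  have r3 := f.r3
  rw [hP] at r3
  let E : ETuple L[X] :=
    { l0 := f.l0, l1 := f.l1, x0 := (1 - X) * f.x0 + X, x1 := (1 - X) * f.x1, t := (1 - X) * f.t
      r := f.r, a := f.a, b := f.b, P := 0, c := f.c, d := f.d
      r1 := f.r1
      r2 := f.r2
      r3 := by linear_combination (1 - X) * r3 }
  refine hF.conn_of_path E ?_ ?_ ⟨1, fun i => ?_⟩ ⟨1, fun i => ?_⟩
  · ext <;> simp [E, f, ETuple.map, *]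
  · ext <;> simp [E, f, ETuple.map, *]
  · fin_cases i <;> simp [E, f, ETuple.map, ETuple.l, ETuple.toH, HTuple.l, *]
  · fin_cases i <;> simp [E, f, ETuple.map, ETuple.image, *]

theorem conn_of_P_eq {e e' : ETuple L} (he : e.IsUni) (he' : e'.IsUni) (h0 : e.l0 = e'.l0)
    (h1 : e.l1 = e'.l1) (hx0 : e.x0 = e'.x0) (hx1 : e.x1 = e'.x1) (hr : e.t * e.r = e'.t * e'.r)
    (ha : e.t * e.a = e'.t * e'.a) (hb : e.t * e.b = e'.t * e'.b) (hP : e.P = e'.P)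
    (hc : e.c = e'.c) (hd : e.d = e'.d) : Conn q F e e' := by
  have hw : ∀ f : ETuple L, f.IsUni → f.r ≠ 0 ∨ f.a ≠ 0 ∨ f.b ≠ 0 := fun f hf =>
    (ETuple.isUni_iff.1 hf).2.2.1.imp_left left_ne_zero_of_mul
  by_cases ht : e.t = 0
  · have ht' : e'.t = 0 := by
      rw [ht, zero_mul] at hr ha hb
      rcases hw e' he' with h | h | h
      exacts [(mul_eq_zero.1 hr.symm).resolve_right h, (mul_eq_zero.1 ha.symm).resolve_right h,
        (mul_eq_zero.1 hb.symm).resolve_right h]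
    exact conn_of_abr hF h0 h1 hx0 hx1 ht ht' hP hc hd
  · have ht' : e'.t ≠ 0 := by
      intro ht'
      rw [ht', zero_mul] at hr ha hb
      rcases hw e he with h | h | h
      exacts [ht ((mul_eq_zero.1 hr).resolve_right h), ht ((mul_eq_zero.1 ha).resolve_right h),
        ht ((mul_eq_zero.1 hb).resolve_right h)]
    have key : e = e'.scale 1 (e'.t / e.t) (e.t / e'.t) (e'.t / e.t) := by
      have hu : e.t / e'.t * (e'.t / e.t) = 1 := by field_simp
      have hu' : e'.t / e.t * (e.t / e'.t) = 1 := by field_simp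
      ext <;> simp only [ETuple.scale, one_mul, hu, hu']
      · exact h0
      · exact h1
      · exact hx0
      · exact hx1
      · field_simp
      · field_simp; linear_combination ha
      · field_simp; linear_combination hb
      · field_simp; linear_combination hr
      · exact hP
      · exact hc
      · exact hd
    rw [key]
    exact (hF.conn_scale e' _ _ _ _).symm

theorem conn_of_P_eq_zero {e e' : ETuple L} (he : e.IsUni) (he' : e'.IsUni) (h0 : e.l0 = e'.l0)
    (h1 : e.l1 = e'.l1) (hP : e.P = 0) (hP' : e'.P = 0) (hc : e.c = e'.c) (hd : e.d = e'.d) :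
    Conn q F e e' := by
  have key : ∀ f : ETuple L, f.IsUni → f.P = 0 → ∃ g : ETuple L, g.IsUni ∧ Conn q F f g ∧
      g.l0 = f.l0 ∧ g.l1 = f.l1 ∧ g.x0 = 1 ∧ g.x1 = 0 ∧ g.t = 0 ∧ g.P = 0 ∧ g.c = f.c ∧
      g.d = f.d := by
    intro f hf fP
    have hf' := ETuple.isUni_iff.1 hf
    let g : ETuple L := ⟨f.l0, f.l1, 1, 0, 0, f.a, f.b, f.r, 0, f.c, f.d, f.r1, f.r2, by ring⟩
    refine ⟨g, ETuple.isUni_iff.2 ?_, conn_of_x hF rfl rfl rfl rfl rfl rfl rfl rfl fP rfl rfl rfl,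
      rfl, rfl, rfl, rfl, rfl, rfl, rfl, rfl⟩
    simp only [fP, mul_zero, ne_eq, not_true_eq_false, or_false, false_or] at hf'
    simpa [g] using ⟨hf'.1, hf'.2.2⟩
  obtain ⟨g, hg, k, g0, g1, gx0, gx1, gt, gP, gc, gd⟩ := key e he hP
  obtain ⟨g', hg', k', g0', g1', gx0', gx1', gt', gP', gc', gd'⟩ := key e' he' hP'
  refine (k.trans hg (conn_of_abr hF ?_ ?_ ?_ ?_ gt gt' ?_ ?_ ?_)).trans hg' k'.symm
  · rw [g0, g0', h0]
  · rw [g1, g1', h1]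
  · rw [gx0, gx0']
  · rw [gx1, gx1']
  · rw [gP, gP']
  · rw [gc, gc', hc]
  · rw [gd, gd', hd]

theorem conn_phi {e e' : ETuple L} (he : e.IsUni) (he' : e'.IsUni) (hl : e.l = e'.l)
    (hi : e.image = e'.image) : Conn q F e e' := by
  have h0 : e.l0 = e'.l0 := congrFun hl 0
  have h1 : e.l1 = e'.l1 := congrFun hl 1
  have h2 : e.t * (e.r * e.P) = e'.t * (e'.r * e'.P) := congrFun hl 2
  have hx0 : e.P * e.x0 = e'.P * e'.x0 := congrFun hi 0
  have hx1 : e.P * e.x1 = e'.P * e'.x1 := congrFun hi 1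
  have hx2 : e.P * (e.t * e.a) = e'.P * (e'.t * e'.a) := congrFun hi 2
  have hx3 : e.P * (e.t * e.b) = e'.P * (e'.t * e'.b) := congrFun hi 3
  have hc : e.c = e'.c := congrFun hi 4
  have hd : e.d = e'.d := congrFun hi 5
  obtain ⟨-, hx, -, -⟩ := ETuple.isUni_iff.1 he
  obtain ⟨-, hx', -, -⟩ := ETuple.isUni_iff.1 he'
  by_cases hP : e.P = 0
  · have hP' : e'.P = 0 := by
      rw [hP, zero_mul] at hx0 hx1 hx2 hx3
      rcases hx' with h | h | h | h
      exacts [(mul_eq_zero.1 hx0.symm).resolve_right h, (mul_eq_zero.1 hx1.symm).resolve_right h,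
        (mul_eq_zero.1 hx2.symm).resolve_right h, (mul_eq_zero.1 hx3.symm).resolve_right h]
    exact conn_of_P_eq_zero hF he he' h0 h1 hP hP' hc hd
  · have hP' : e'.P ≠ 0 := by
      intro hP'
      rw [hP', zero_mul] at hx0 hx1 hx2 hx3
      rcases hx with h | h | h | h
      exacts [hP ((mul_eq_zero.1 hx0).resolve_right h), hP ((mul_eq_zero.1 hx1).resolve_right h),
        hP ((mul_eq_zero.1 hx2).resolve_right h), hP ((mul_eq_zero.1 hx3).resolve_right h)]
    have hu : e'.P / e.P ≠ 0 := div_ne_zero hP' hP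
    have hs := he'.scale (div_ne_zero hP hP') hu one_ne_zero hu
    refine (conn_of_P_eq hF he hs ?_ ?_ ?_ ?_ ?_ ?_ ?_ ?_ ?_ ?_).trans hs
      (hF.conn_scale e' _ _ _ _).symm
    all_goals simp only [ETuple.scale]
    all_goals field_simp
    · exact h0
    · exact h1
    · linear_combination hx0
    · linear_combination hx1
    · linear_combination h2
    · linear_combination hx2
    · linear_combination hx3
    · exact hc
    · exact hd

end Phi

end Links

end Example

/-! ### The main result -/

namespace Example

open BiProj Blow ZeroCycle

theorem exists_scalar {L : Type} [Field L] {n : ℕ} {v w : Fin n → L}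
    (hv : Ideal.span (Set.range v) = ⊤) (hw : Ideal.span (Set.range w) = ⊤)
    (h : ∀ i j, v i * w j = v j * w i) : ∃ c ≠ 0, ∀ i, v i = c * w i := by
  obtain ⟨c, hc⟩ := exists_eq_smul_of_minors hw h
  refine ⟨c, ?_, hc⟩
  rintro rfl
  obtain ⟨i, hi⟩ := ETuple.span_eq_top_iff.1 hv
  exact hi (by rw [hc, zero_mul])

namespace IsParam

variable {Yt : Scheme.{0}} {ψ : Yt ⟶ Y} {q : ERing.U.toScheme ⟶ Yt} (h : IsParam ψ q)

include h

theorem exists_lift_psi (L : Type) [Field L] (p : Spec (CommRingCat.of L) ⟶ Y) :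
    ∃ p', p' ≫ ψ = p := by
  let := algebraOfHom (p ≫ BiProj.str eqY)
  obtain ⟨l, x, hp⟩ := exists_isPt_of_field p
  obtain ⟨e, he, rfl, rfl⟩ := ETuple.exists_l_x (ETuple.span_eq_top_iff.1 hp.span_left)
    (ETuple.span_eq_top_iff.1 hp.span_right) (yEq_eq_zero hp)
  refine ⟨ERing.point e he ≫ q, ?_⟩
  rw [← cancel_mono (incl eqY), Category.assoc]
  refine (h.isPt_point e he).hom_ext' hp ?_
  have h1 := ERing.point_str e he
  rw [← h.str, specMap_algebraOfHom] at h1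
  simpa only [BiProj.str, Category.assoc] using h1

theorem eqvGen_psi (L : Type) [Field L] (p p' : Spec (CommRingCat.of L) ⟶ Yt)
    (hp : p ≫ ψ = p' ≫ ψ) : Relation.EqvGen (Linked ψ) p p' := by
  obtain ⟨inst, hinst⟩ : ∃ inst : Algebra ℂ L,
      Spec.map (CommRingCat.ofHom (@algebraMap ℂ L _ _ inst)) = p ≫ ψ ≫ BiProj.str eqY :=
    ⟨algebraOfHom _, specMap_algebraOfHom _⟩
  obtain ⟨e, he, hpe⟩ := h.exists_eq_point p hinst.symm
  obtain ⟨e', he', rfl⟩ := h.exists_eq_point p' (by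
    rw [hinst, ← Category.assoc, ← hp, Category.assoc])
  subst hpe
  have h1 := h.isPt_point e he
  have h2 := h.isPt_point e' he'
  rw [Category.assoc, Category.assoc] at hp
  rw [hp] at h1
  obtain ⟨c, hc, hl⟩ := exists_scalar h1.span_left h2.span_left (h1.minors h2).1
  obtain ⟨d, hd, hx⟩ := exists_scalar h1.span_right h2.span_right (h1.minors h2).2
  have hs := he'.scale hc hd one_ne_zero one_ne_zero
  refine (conn_psi h.isCoord he hs ?_ ?_).trans hs (h.isCoord.conn_scale e' _ _ _ _).symm he he'
  · ext i
    rw [ETuple.scale_l, hl]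
    ring
  · ext i
    rw [ETuple.scale_x, hx]
    ring

variable {g : Yt ⟶ Q} (hg : q ≫ g = ERing.toQ)

include hg

theorem exists_lift_phi (L : Type) [Field L] (p : Spec (CommRingCat.of L) ⟶ Q) :
    ∃ p', p' ≫ g = p := by
  let := algebraOfHom (p ≫ BiProj.str eqQ)
  obtain ⟨l, x, hp⟩ := exists_isPt_of_field p
  obtain ⟨e, he, rfl, rfl⟩ := ETuple.exists_l_image (ETuple.span_eq_top_iff.1 hp.span_left)
    (ETuple.span_eq_top_iff.1 hp.span_right) (qEq_eq_zero hp)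
  refine ⟨ERing.point e he ≫ q, ?_⟩
  rw [← cancel_mono (incl eqQ), Category.assoc]
  refine (isPt_point_lift hg e he).hom_ext' hp ?_
  have h1 := ERing.point_str e he
  rw [← h.str, ← h.lift_str hg, specMap_algebraOfHom] at h1
  simpa only [BiProj.str, Category.assoc] using h1

theorem eqvGen_phi (L : Type) [Field L] (p p' : Spec (CommRingCat.of L) ⟶ Yt)
    (hp : p ≫ g = p' ≫ g) : Relation.EqvGen (Linked g) p p' := by
  obtain ⟨inst, hinst⟩ : ∃ inst : Algebra ℂ L,
      Spec.map (CommRingCat.ofHom (@algebraMap ℂ L _ _ inst)) = p ≫ ψ ≫ BiProj.str eqY :=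
    ⟨algebraOfHom _, specMap_algebraOfHom _⟩
  obtain ⟨e, he, hpe⟩ := h.exists_eq_point p hinst.symm
  obtain ⟨e', he', rfl⟩ := h.exists_eq_point p' (by
    rw [hinst, ← h.lift_str hg, ← Category.assoc, ← hp, Category.assoc])
  subst hpe
  have h1 := isPt_point_lift hg e he
  have h2 := isPt_point_lift hg e' he'
  rw [Category.assoc, Category.assoc] at hp
  rw [hp] at h1
  obtain ⟨c, hc, hl⟩ := exists_scalar h1.span_left h2.span_left (h1.minors h2).1
  obtain ⟨d, hd, hx⟩ := exists_scalar h1.span_right h2.span_right (h1.minors h2).2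
  have hs := he'.scale hc (div_ne_zero hd hc) one_ne_zero one_ne_zero
  refine (conn_phi (h.isCoord_lift hg) he hs ?_ ?_).trans hs
    ((h.isCoord_lift hg).conn_scale e' _ _ _ _).symm he he'
  · ext i
    rw [ETuple.scale_l, hl]
    ring
  · ext i
    rw [ETuple.scale_image, hx]
    field_simp

end IsParam

theorem surjective_of_exists_lift {X Z : Scheme.{0}} (f : X ⟶ Z)
    (h : ∀ (L : Type) [Field L] (p : Spec (CommRingCat.of L) ⟶ Z), ∃ p', p' ≫ f = p) :
    Function.Surjective f := by
  intro z
  obtain ⟨p, hp⟩ := h (Z.residueField z) (Z.fromSpecResidueField z)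
  have hz : z ∈ Set.range (Z.fromSpecResidueField z) := by
    rw [Scheme.range_fromSpecResidueField]
    rfl
  obtain ⟨y, hy⟩ := hz
  refine ⟨p y, ?_⟩
  rw [← Scheme.Hom.comp_apply, hp]
  exact hy

end Example

open Example BiProj Blow in
theorem exists_iterated_blowup : ∃ (Y' Y'' Yt : Scheme.{0})
    (b₁ : Y' ⟶ Y) (b₂ : Y'' ⟶ Y') (b₃ : Yt ⟶ Y''), IsProper b₁ ∧ IsProper b₂ ∧ IsProper b₃ ∧
    IsBlowupAlong b₁ Y₁ ∧ IsBlowupAlong b₂ (properTransform b₁ Y₁ Y₂) ∧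
    IsBlowupAlong b₃ (properTransform b₂ (properTransform b₁ Y₁ Y₂)
      (properTransform b₁ Y₁ Y₃)) := by
  have : IsLocallyNoetherian Y := LocallyOfFiniteType.isLocallyNoetherian (str eqY)
  obtain ⟨Y', b₁, h₁, p₁⟩ := exists_isBlowup (Scheme.IdealSheafData.vanishingIdeal Y₁)
  have : IsLocallyNoetherian Y' := LocallyOfFiniteType.isLocallyNoetherian b₁
  obtain ⟨Y'', b₂, h₂, p₂⟩ := exists_isBlowup
    (Scheme.IdealSheafData.vanishingIdeal (properTransform b₁ Y₁ Y₂))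
  have : IsLocallyNoetherian Y'' := LocallyOfFiniteType.isLocallyNoetherian b₂
  obtain ⟨Yt, b₃, h₃, p₃⟩ := exists_isBlowup (Scheme.IdealSheafData.vanishingIdeal
    (properTransform b₂ (properTransform b₁ Y₁ Y₂) (properTransform b₁ Y₁ Y₃)))
  exact ⟨Y', Y'', Yt, b₁, b₂, b₃, p₁, p₂, p₃, h₁, h₂, h₃⟩

theorem proposition3p2 :
    ∃ φ : Example.Y.PartialMap Example.Q,
      Example.IsPhi φ ∧ Blow.IsBirational φ.toRationalMap ∧
      ∃ (Y' Y'' Yt : AlgebraicGeometry.Scheme.{0})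
        (b₁ : Y' ⟶ Example.Y) (b₂ : Y'' ⟶ Y') (b₃ : Yt ⟶ Y''),
        -- successive blowups of `Y₁`, of the proper transform of `Y₂`
        -- and of the proper transform of `Y₃`
        Blow.IsBlowupAlong b₁ Example.Y₁ ∧
        Blow.IsBlowupAlong b₂ (Blow.properTransform b₁ Example.Y₁ Example.Y₂) ∧
        Blow.IsBlowupAlong b₃
          (Blow.properTransform b₂ (Blow.properTransform b₁ Example.Y₁ Example.Y₂)
            (Blow.properTransform b₁ Example.Y₁ Example.Y₃)) ∧
        ∃ (ψ : Yt ⟶ Example.Y) (φt : Yt ⟶ Example.Q),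
          ψ = b₃ ≫ b₂ ≫ b₁ ∧
          -- both are morphisms over `ℂ`, and `φt` extends `φ`
          φt ≫ BiProj.str Example.eqQ = ψ ≫ BiProj.str Example.eqY ∧
          (ψ ⁻¹ᵁ φ.domain).ι ≫ φt = (ψ ∣_ φ.domain) ≫ φ.hom ∧
          Blow.IsBirational ψ.toRationalMap ∧
          Blow.IsBirational φt.toRationalMap ∧
          ZeroCycle.IsUniversallyCH0Trivial (BiProj.str Example.eqY) ψ ∧
          ZeroCycle.IsUniversallyCH0Trivial (BiProj.str Example.eqQ) φt := by
  obtain ⟨Y', Y'', Yt, b₁, b₂, b₃, p₁, p₂, p₃, h₁, h₂, h₃⟩ := exists_iterated_blowup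
  obtain ⟨q, h⟩ := Example.exists_isParam h₁ h₂ h₃
  have hiso := Example.isIso_restrict_UY h₁ h₂ h₃
  have hprop : IsProper (b₃ ≫ b₂ ≫ b₁) := inferInstance
  obtain ⟨φt, hφt⟩ := h.exists_lift
  have hstr := h.lift_str hφt
  have hsurj := Example.surjective_of_exists_lift _ h.exists_lift_psi
  have hsurj' := Example.surjective_of_exists_lift _ (h.exists_lift_phi hφt)
  obtain ⟨f, hf, hf'⟩ := Example.exists_phi
  obtain ⟨e, he⟩ := Example.exists_iso hf hf'
  have hcompat := h.lift_compat hφt hf hf'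
  generalize hψ : b₃ ≫ b₂ ≫ b₁ = ψ at *
  have hd := h.dense_UY
  have hdY : Dense (Example.UY : Set Example.Y) :=
    (hsurj.denseRange.dense_image ψ.continuous hd).mono (by rintro _ ⟨y, hy, rfl⟩; exact hy)
  have hle : ψ ⁻¹ᵁ Example.UY ≤ ψ ⁻¹ᵁ Example.domainPhi := fun y hy => Example.UY_le hy
  have hres : (ψ ⁻¹ᵁ Example.UY).ι ≫ φt = (ψ ∣_ Example.UY) ≫ e.hom ≫ Example.UQ.ι := by
    have h1 : Yt.homOfLE hle ≫ (ψ ∣_ Example.domainPhi) =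
        (ψ ∣_ Example.UY) ≫ Example.Y.homOfLE Example.UY_le := by
      rw [← cancel_mono Example.domainPhi.ι]
      simp
    rw [he, ← reassoc_of% h1, ← hcompat]
    simp
  have hdQ : Dense (Example.UQ : Set Example.Q) := by
    refine (hsurj'.denseRange.dense_image φt.continuous hd).mono ?_
    rintro _ ⟨y, hy, rfl⟩
    have := congrArg (fun k => k ⟨y, hy⟩) hres
    change φt y = _ at this
    rw [this]
    exact ((((ψ ∣_ Example.UY) ≫ e.hom) ⟨y, hy⟩)).2
  have hproper : IsProper φt := by
    have : IsProper (φt ≫ BiProj.str Example.eqQ) := by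
      rw [hstr]
      infer_instance
    exact IsProper.of_comp φt (BiProj.str Example.eqQ)
  refine ⟨⟨Example.domainPhi, hdY.mono Example.UY_le, f⟩, ⟨rfl, ?_⟩, ?_, Y', Y'', Yt, b₁, b₂, b₃,
    h₁, h₂, h₃, ψ, φt, ?_, hstr, hcompat, ?_, ?_, ?_, ?_⟩
  · intro A _ _ l x hl hx p hp
    have h1 := hf' p l x ⟨_, hl, hx, hp⟩
    refine ⟨h1.span_right, h1.eq_bipt ?_⟩
    have h2 := congrArg (p ≫ ·) hf
    have h3 := congrArg (· ≫ BiProj.PPP.str 2 3) hp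
    simp only [Category.assoc, BiProj.bipt_str] at h3
    simp only [BiProj.str] at h2
    simp only [Category.assoc]
    exact h2.trans h3
  · exact Blow.isBirational_of_iso _ hdY hdQ Example.UY_le e he
  · exact hψ.symm
  · exact Blow.isBirational_toRationalMap ψ hd hdY (asIso (ψ ∣_ Example.UY)) (by simp)
  · exact Blow.isBirational_toRationalMap φt hd hdQ (asIso (ψ ∣_ Example.UY) ≪≫ e) (by
      rw [hres]
      simp)
  · exact ZeroCycle.isUniversallyCH0Trivial_of _ h.exists_lift_psi h.eqvGen_psi
  · exact ZeroCycle.isUniversallyCH0Trivial_of _ (h.exists_lift_phi hφt) (h.eqvGen_phi hφt)
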